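/- For $a,b\in\mathbb R^3$ let $(a\otimes b)_{ij}=a_ib_j$, for a matrix field $F$ let $(\nabla\cdot F)_j=\sum_i\partial_iF_{ij}$, and let $\|f\|_{L^{s,\infty}}=\sup_{l>0} l\,|\{|f|>l\}|^{1/s}$. For every $0<\eta<1$ there are $\varepsilon_0=\varepsilon_0(\eta)>0$ and $C=C(\eta)>0$ such that the following holds. Let $\varepsilon\le\varepsilon_0$ and let $U,\tilde U,w_0:\mathbb R^3\to\mathbb R^3$ be measurable vector fields with $$\sup_x |x|\,\bigl(|U(x)|+|\tilde U(x)|+|w_0(x)|\bigr)\le\varepsilon ,\qquad \operatorname{div} w_0=0 \text{ (in the sense of distributions)}.$$ Consider on $(0,\infty)\times\mathbb R^3$ the system $$\partial_t w-\Delta w+\nabla\cdot(w\otimes w+U\otimes w+w\otimes\tilde U)+\nabla p=0,\qquad \operatorname{div} w=0,\qquad w(0)=w_0 .$$ A solution $w$ is a field in $L^2_{loc}([0,\infty)\times\mathbb R^3)$ with $\operatorname{div}w(t)=0$ in the sense of distributions for a.e. $t>0$ such that, for all smooth compactly supported $\varphi$ on $\mathbb R\times\mathbb R^3$ with $\operatorname{div}\varphi(t,\cdot)=0$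 for all $t$, $$-\int_0^\infty\!\!\int_{\mathbb R^3}\bigl[w\cdot(\partial_t\varphi+\Delta\varphi)+(w\otimes w+U\otimes w+w\otimes\tilde U):\nabla\varphi\bigr]\,dx\,dt=\int_{\mathbb R^3} w_0\cdot\varphi(0,x)\,dx,$$ where $(a\otimes b):\nabla\varphi=\sum_{i,j}a_ib_j\partial_i\varphi_j$. (1) There is a solution $w$ such that, for all $t>0$ and $x\neq0$, $$|w(t,x)|\le C\varepsilon\,(|x|+\sqrt t)^{-1+\eta}|x|^{-\eta},$$ and $\int w(t,x)\cdot\varphi(x)\,dx\to\int w_0\cdot\varphi\,dx$ as $t\to0^+$ for every continuous compactly supported $\varphi$. It is unique: every solution $w'$ with $|w'(t,x)|\le C\varepsilon_0(|x|+\sqrt t)^{-1+\eta}|x|^{-\eta}$ for all $t>0$, $x\ne0$ (in particular, every solution satisfying the bound with $C\varepsilon$) equals $w$ almost everywhere on $(0,\infty)\times\mathbb R^3$. (2) There is a locally integrable pressure $p$ on $(0,\infty)\times\mathbb R^3$ with which the momentum equation holds in the sense of distributions on $(0,\infty)\times\mathbb R^3$, and $$\|p(t)\|_{L^{s,\infty}(\mathbb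 R^3)}\le C\varepsilon^2\,t^{-1+\frac3{2s}}\qquad\text{for all } t>0,\ \tfrac32\le s\le\tfrac3{1+\eta}.$$ (3) If furthermore the distributional gradients of $U,\tilde U,w_0$ are locally integrable functions with $\sup_x|x|^2\bigl(|\nabla U(x)|+|\nabla\tilde U(x)|+|\nabla w_0(x)|\bigr)\le\varepsilon$, then for all $t>0$ and $x\ne0$ the field $w(t,\cdot)$ is differentiable at $x$ and $$|\nabla w(t,x)|\le C\varepsilon\,(|x|+\sqrt t)^{-1+\eta}|x|^{-1-\eta}.$$ -/

import Mathlib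

open MeasureTheory Set Filter Topology
open scoped ENNReal NNReal ContDiff RealInnerProductSpace

namespace PerturbedNS

/-- Physical space `ℝ³` with the Euclidean norm. -/
abbrev E3 : Type := EuclideanSpace ℝ (Fin 3)

/-- The open space-time domain `(0,∞) × ℝ³`. -/
def posTime : Set (ℝ × E3) := Ioi (0 : ℝ) ×ˢ univ

/-- Divergence of a (classically differentiable) vector field. -/
noncomputable def divergence (v : E3 → E3) (x : E3) : ℝ :=
  ∑ i : Fin 3, (fderiv ℝ v x (EuclideanSpace.single i 1)) i

/-- `div v = 0` in the sense of distributions on `ℝ³`. -/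
def WeaklyDivFree (v : E3 → E3) : Prop :=
  ∀ ψ : E3 → ℝ, ContDiff ℝ ∞ ψ → HasCompactSupport ψ →
    ∫ x, fderiv ℝ ψ x (v x) = 0

/-- `G` is the distributional gradient of the vector field `v` on `ℝ³`. -/
structure IsWeakGradient (v : E3 → E3) (G : E3 → E3 →L[ℝ] E3) : Prop where
  locInt : LocallyIntegrable v
  locInt_grad : LocallyIntegrable G
  eq : ∀ ψ : E3 → ℝ, ContDiff ℝ ∞ ψ → HasCompactSupport ψ → ∀ e : E3,
    ∫ x, (fderiv ℝ ψ x e) • v x = - ∫ x, ψ x • G x e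

/-- Space-time test vector fields: smooth and compactly supported on `ℝ × ℝ³`. -/
structure IsTestField (φ : ℝ × E3 → E3) : Prop where
  smooth : ContDiff ℝ ∞ φ
  compact : HasCompactSupport φ

/-- The density
`w · (∂ₜφ + Δφ) + (w ⊗ w + U ⊗ w + w ⊗ V) : ∇φ` at the point `z = (t, x)`,
where `(a ⊗ b) : ∇φ = ∑ i j, a i * b j * ∂ᵢ φ j = ⟪b, Dφ a⟫`, so that `∇ · F` is the vector field
with components `(∇ · F) j = ∑ i, ∂ᵢ F i j`. -/
noncomputable def momentumDensity (U V : E3 → E3) (w : ℝ → E3 → E3) (φ : ℝ × E3 → E3)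
    (z : ℝ × E3) : ℝ :=
  ⟪w z.1 z.2,
    deriv (fun s => φ (s, z.2)) z.1 + Laplacian.laplacian (fun y => φ (z.1, y)) z.2⟫
  + ⟪w z.1 z.2, fderiv ℝ (fun y => φ (z.1, y)) z.2 (w z.1 z.2)⟫
  + ⟪w z.1 z.2, fderiv ℝ (fun y => φ (z.1, y)) z.2 (U z.2)⟫
  + ⟪V z.2, fderiv ℝ (fun y => φ (z.1, y)) z.2 (w z.1 z.2)⟫

/-- `w` is a (very weak) solution on `(0,∞) × ℝ³` of
`∂ₜ w - Δ w + ∇ · (w ⊗ w + U ⊗ w + w ⊗ V) + ∇ p = 0`, `div w = 0`, `w(0) = w₀`: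
it is locally square integrable up to `t = 0`, divergence free, and satisfies the momentum equation
tested against divergence free fields, which may be nonzero at `t = 0`. -/
structure IsSolution (U V w₀ : E3 → E3) (w : ℝ → E3 → E3) : Prop where
  aesm : AEStronglyMeasurable (fun z : ℝ × E3 => w z.1 z.2) (volume.restrict posTime)
  locSq : LocallyIntegrableOn (fun z : ℝ × E3 => ‖w z.1 z.2‖ ^ 2) (Ici (0 : ℝ) ×ˢ univ)
    (volume.restrict posTime)
  divFree : ∀ᵐ t ∂(volume.restrict (Ioi (0 : ℝ))), WeaklyDivFree (w t)
  momentum : ∀ φ : ℝ × E3 → E3, IsTestField φ →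
    (∀ t x, divergence (fun y => φ (t, y)) x = 0) →
    - ∫ z in posTime, momentumDensity U V w φ z = ∫ x, ⟪w₀ x, φ (0, x)⟫

/-- `p` is a pressure for `w`: the momentum equation with the term `∇ p` holds in the sense of
distributions on `(0,∞) × ℝ³`. -/
structure IsPressure (U V : E3 → E3) (w : ℝ → E3 → E3) (p : ℝ → E3 → ℝ) : Prop where
  locInt : LocallyIntegrableOn (fun z : ℝ × E3 => p z.1 z.2) posTime
  momentum : ∀ φ : ℝ × E3 → E3, IsTestField φ → tsupport φ ⊆ posTime →
    ∫ z in posTime, (momentumDensity U V w φ z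
      + p z.1 z.2 * divergence (fun y => φ (z.1, y)) z.2) = 0

/-- `|w(t,x)| ≤ M (|x| + √t)^(-1+η) |x|^(-η)` for all `t > 0` and `x ≠ 0`, with the weight
on the left (so that nothing is asserted at `x = 0`). -/
def PointwiseBound (η M : ℝ) (w : ℝ → E3 → E3) : Prop :=
  ∀ t : ℝ, 0 < t → ∀ x : E3, (‖x‖ + √t) ^ (1 - η) * ‖x‖ ^ η * ‖w t x‖ ≤ M

/-- The quasi-norm of weak `L^s(ℝ³) = L^{s,∞}(ℝ³)`: `sup_{l ≥ 0} l |{|f| > l}|^{1/s}`. -/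
noncomputable def weakLpNorm (s : ℝ) (f : E3 → ℝ) : ℝ≥0∞ :=
  ⨆ l : ℝ≥0, (l : ℝ≥0∞) * (volume {x : E3 | (l : ℝ) < |f x|}) ^ (1 / s)

end PerturbedNS

/-!
The equation is solved in mild form: with the Oseen kernel `oseenK` of `exp(tΔ) P ∇·`, a solution is a fixed
point `w = exp(tΔ)w₀ - bil w` (`mildMap`). All kernels are `O((|z| + √τ)^(-k))` with their derivatives (`IsKer`,
`pk`), and one integral estimate (`exists_lintegral_pk_wtF`) shows that those of order `4` map the weight `wtF` of
the quadratic terms to the weight `wt` of the solution. For small data the Picard iteration therefore contracts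
(`exists_mild`). The weak formulation follows by integrating by parts in the kernels, with Fubini's theorem and a
truncation near the diagonal (`IsMild.tendsto_weak`, `IsMild.isSolution`).

Uniqueness. A weak solution plus its Duhamel term solves the heat equation with a pressure and initial value `w₀`
(`solution_add_bil`). The difference of two such fields is divergence free and `O(|x|⁻¹)`, and vanishes by duality:
`pot χ` solves `Δ(∂ₜ + Δ) pot χ = χ` backward in time and decays well enough for spatial cutoffs
(`ae_eq_zero_of_heat`). So both solutions are mild, and the contraction estimate identifies them
(`exists_uniqueness`).

Pressure. It is `∂ᵢ∂ⱼ(-Δ)⁻¹ Fᵢⱼ` with `|F| ≲ t^((a-2)/2) |x|^(-a)` for `1 + η ≤ a ≤ 2`. The kernels regularized by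
`exp(τΔ)` are uniformly Calderón–Zygmund (`exists_isCZ_rieszK`). A stopping time argument with the `L²` bound gives
weak `L⁴` bounds on bounded functions (`IsCZ.exists_weak_four`), which sum over dyadic shells to a weak `L^(3/a)`
bound on functions `O(|y|^(-a))` (`IsCZ.exists_weak_bound`). The limit `τ → 0` exists in a weighted `L¹` space
(`exists_riesz_limit`).

Gradient. The data have representatives that are Lipschitz at the scale of `|x|` (`exists_lipschitz_rep`). Then `w` is
Hölder continuous of exponent `1/2` at this scale (`exists_duh_holder`), which compensates half an order of the
singularity of the differentiated kernels (`IsKer.exists_abs_cnv_dk_le`, `exists_gradient_bound`).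
-/

namespace PerturbedNS
open ENNReal (ofReal ofReal_le_ofReal ofReal_mul ofReal_ne_top ofReal_add ofReal_one tsum_le_tsum ofReal_pow)
open Real (exp rpow_add rpow_le_rpow_of_nonpos norm_eq_abs sqrt_nonneg rpow_neg rpow_mul rpow_natCast mul_rpow exp_pos
  zero_rpow sqrt_eq_rpow rpow_one rpow_le_rpow_of_exponent_le rpow_le_rpow rpow_neg_one div_rpow rpow_nonneg exp_neg
  norm_of_nonneg sq_sqrt one_rpow)
open Metric (ball closedBall ball_mem_nhds)
open Finset (sum_congr sum_le_sum sum_mul mul_sum sum_nonneg sum_add_distrib sum_sub_distrib sum_const card_univ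
  sum_comm abs_sum_le_sum_abs single_le_sum sum_eq_zero sum_pos)
open ContinuousLinearMap (integral_apply lsmul opNorm_le_bound inr snd mul_apply')
/-- Space-time. -/
notation "E4" => ℝ × E3
variable {A B C D M R a b c k l m m' p r s t ε η κ σ τ : ℝ}
  {f g h u v β : E3 → ℝ} {x y z : E3} {K : ℝ → E3 → ℝ} {n : ℕ} {φ : Fin 3 → E4 → ℝ} {χ ψ : E4 → ℝ}
  {w : E4 → E3} {U V w₀ : E3 → E3} {DU : E3 → E3 →L[ℝ] E3}
/-- Lebesgue measure on the space-time domain `t > 0`. -/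
notation "μ₊" => (volume.restrict posTime : Measure E4)

/-! ### Power integrals on `ℝ³` -/

lemma div_rpow_neg (hR : 0 ≤ R) (hc : 0 < c) (k : ℝ) : (R / c) ^ (-k) = c ^ k * R ^ (-k) := by
  rw [div_rpow hR hc.le, rpow_neg hc.le, div_inv_eq_mul, mul_comm]

lemma sqrt_rpow (ht : 0 ≤ t) (c : ℝ) : √t ^ c = t ^ (c / 2) := by
  rw [sqrt_eq_rpow, ← rpow_mul ht]; congr 1; ring

lemma integral_ext {α : Type*} [MeasurableSpace α] {μ : Measure α} {f g : α → ℝ} (h : ∀ x, f x = g x) :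
    ∫ x, f x ∂μ = ∫ x, g x ∂μ := by simp_rw [h]

/-- To prove `|S.indicator f y| ≤ c` it suffices to prove the bound on `S`. -/
lemma abs_indicator_le {S : Set E3} (hc : 0 ≤ c) (h : y ∈ S → |f y| ≤ c) :
    |S.indicator f y| ≤ c := by
  by_cases hy : y ∈ S
  · rw [indicator_of_mem hy]; exact h hy
  · simpa [hy]

/-- A family of densities that is homogeneous under dilations has integrals given by a power. -/
lemma exists_lintegral_of_homogeneous {f : ℝ → E3 → ℝ} (h0 : ∀ y, 0 ≤ f 1 y) (hi : Integrable (f 1))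
    (hf : ∀ r, 0 < r → ∀ y, f r (r • y) = r ^ (-b) * f 1 y) :
    ∃ C : ℝ, 0 < C ∧ ∀ r : ℝ, 0 < r → ∫⁻ y, ofReal (f r y) ≤ ofReal (C * r ^ (3 - b)) := by
  refine ⟨(∫ y, f 1 y) + 1, by linarith [show 0 ≤ ∫ y, f 1 y from integral_nonneg h0], fun r hr => ?_⟩
  have h1 : (volume : Measure E3) = ofReal (r ^ 3) • Measure.map (r • ·) volume := by
    rw [Measure.map_addHaar_smul _ hr.ne', smul_smul, ← ofReal_mul (by positivity)]
    simp [abs_of_pos hr, hr.ne']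
  have h2 := (Homeomorph.smulOfNeZero (α := E3) r hr.ne').measurableEmbedding.lintegral_map (μ := volume)
    fun y => ofReal (f r y)
  simp_rw [Homeomorph.smulOfNeZero_apply, hf r hr, ofReal_mul (show 0 ≤ r ^ (-b) by positivity)] at h2
  conv_lhs => rw [h1, lintegral_smul_measure]
  erw [h2]
  rw [lintegral_const_mul' _ _ ofReal_ne_top, ← ofReal_integral_eq_lintegral_ofReal hi (ae_of_all _ h0), smul_eq_mul,
    ← ofReal_mul (by positivity), ← ofReal_mul (by positivity), ← mul_assoc, ← rpow_natCast, ← rpow_add hr, mul_comm,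
    show ((3 : ℕ) : ℝ) + -b = 3 - b by norm_num [sub_eq_add_neg]]
  gcongr; linarith

lemma exists_lintegral_ball_rpow (hb : b < 3) : ∃ C : ℝ, 0 < C ∧ ∀ r : ℝ, 0 < r →
    ∫⁻ y in ball (0 : E3) r, ofReal (‖y‖ ^ (-b)) ≤ ofReal (C * r ^ (3 - b)) := by
  have hi : IntegrableOn (fun y : E3 => ‖y‖ ^ (-b)) (ball 0 1) := by
    rw [integrableOn_fun_norm_addHaar volume (f := fun s : ℝ => s ^ (-b))]
    refine ((intervalIntegral.integrableOn_Ioo_rpow_iff (s := 2 - b) one_pos).2 (by linarith)).congr_fun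
      (fun y hy => ?_) measurableSet_Ioo
    simp only [smul_eq_mul]; rw [← rpow_natCast, ← rpow_add hy.1]; norm_num [sub_eq_add_neg]
  obtain ⟨C, hC, H⟩ := exists_lintegral_of_homogeneous (b := b)
    (f := fun r => (ball (0 : E3) r).indicator fun y => ‖y‖ ^ (-b))
    (fun y => indicator_nonneg (fun y _ => by positivity) y) (hi.integrable_indicator measurableSet_ball) fun r hr y => by
      have h : r • y ∈ ball (0 : E3) r ↔ y ∈ ball (0 : E3) 1 := by
        rw [mem_ball_zero_iff, mem_ball_zero_iff, norm_smul, Real.norm_of_nonneg hr.le, mul_lt_iff_lt_one_right hr]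
      by_cases hy : y ∈ ball (0 : E3) 1
      · rw [indicator_of_mem hy, indicator_of_mem (h.2 hy), norm_smul, Real.norm_of_nonneg hr.le,
          mul_rpow hr.le (norm_nonneg y)]
      · rw [indicator_of_notMem hy, indicator_of_notMem (hy ∘ h.1), mul_zero]
  refine ⟨C, hC, fun r hr => (H r hr).trans' ?_⟩; rw [← lintegral_indicator measurableSet_ball]
  exact lintegral_mono fun y => by by_cases h : ‖y‖ < r <;> simp [h]

lemma exists_lintegral_add_norm_rpow (hk : 3 < k) : ∃ C : ℝ, 0 < C ∧ ∀ r : ℝ, 0 < r →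
    ∫⁻ y : E3, ofReal ((‖y‖ + r) ^ (-k)) ≤ ofReal (C * r ^ (3 - k)) :=
  exists_lintegral_of_homogeneous (f := fun r y => (‖y‖ + r) ^ (-k)) (fun y => by positivity)
    (by simpa [add_comm] using integrable_one_add_norm (E := E3) (μ := volume) (r := k) (by simpa using hk))
    fun r hr y => by rw [norm_smul, Real.norm_of_nonneg hr.le, ← mul_add_one, mul_rpow hr.le (by positivity)]

lemma exists_lintegral_compl_ball_rpow (hb : 3 < b) : ∃ C : ℝ, 0 < C ∧ ∀ r : ℝ, 0 < r →
    ∫⁻ y in {y : E3 | r ≤ ‖y‖}, ofReal (‖y‖ ^ (-b)) ≤ ofReal (C * r ^ (3 - b)) := by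
  obtain ⟨C, hC, H⟩ := exists_lintegral_add_norm_rpow hb
  refine ⟨2 ^ b * C, by positivity, fun r hr => ?_⟩; rw [mul_assoc, ofReal_mul (by positivity)]
  refine le_trans ?_ (mul_le_mul_right (H r hr) _); rw [← lintegral_const_mul' _ _ ofReal_ne_top]
  refine (setLIntegral_mono (by fun_prop) fun y hy => ?_).trans (setLIntegral_le_lintegral _ _)
  rw [← ofReal_mul (by positivity), ← div_rpow_neg (by positivity) two_pos]; have := hr.trans_le hy
  exact ofReal_le_ofReal (rpow_le_rpow_of_nonpos (by positivity) (by linarith [mem_ofPred_eq ▸ hy]) (by linarith))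

/-- Convolution of the parabolic kernel `(|z| + √τ)^(-k)`, `k > 3`, with `|y|^(-b)`, where `ρ = √τ`:
away from the origin `|y|^(-b)` is comparable to its value at scale `|x| + ρ`, and near the origin
the kernel is. -/
lemma exists_lintegral_kernel_rpow (hk : 3 < k) (hb0 : 0 ≤ b) (hb : b < 3) :
    ∃ C : ℝ, 0 < C ∧ ∀ r : ℝ, 0 < r → ∀ x : E3,
    ∫⁻ y : E3, ofReal ((‖x - y‖ + r) ^ (-k) * ‖y‖ ^ (-b))
    ≤ ofReal (C * (r ^ (3 - k) * (‖x‖ + r) ^ (-b))) := by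
  obtain ⟨C1, h1, H1⟩ := exists_lintegral_ball_rpow hb
  obtain ⟨C2, h2, H2⟩ := exists_lintegral_add_norm_rpow hk
  refine ⟨4 ^ b * C2 + 2 ^ k * C1, by positivity, fun r hr x => ?_⟩; set R := ‖x‖ + r with hR
  have hR0 : 0 < R := by positivity
  have hpt : ∀ y, ofReal ((‖x - y‖ + r) ^ (-k) * ‖y‖ ^ (-b)) ≤
      ofReal (4 ^ b * R ^ (-b)) * ofReal ((‖x - y‖ + r) ^ (-k))
      + (ball (0 : E3) R).indicator
        (fun y => ofReal (2 ^ k * R ^ (-k)) * ofReal (‖y‖ ^ (-b))) y := fun y => by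
    by_cases h : R / 4 ≤ ‖y‖
    · refine le_trans ?_ le_self_add
      rw [← ofReal_mul (by positivity)]; apply ofReal_le_ofReal; rw [mul_comm]; gcongr
      calc ‖y‖ ^ (-b) ≤ (R / 4) ^ (-b) :=
          rpow_le_rpow_of_nonpos (by positivity) h (by linarith)
        _ = _ := div_rpow_neg hR0.le (by simp) b
    · push Not at h
      refine le_trans ?_ le_add_self
      rw [indicator_of_mem (by simp; linarith), ← ofReal_mul (by positivity)]; gcongr
      have hx := norm_le_norm_sub_add x y
      calc (‖x - y‖ + r) ^ (-k) ≤ (R / 2) ^ (-k) :=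
          rpow_le_rpow_of_nonpos (by positivity) (by linarith) (by linarith)
        _ = _ := div_rpow_neg hR0.le (by simp) k
  refine (lintegral_mono hpt).trans ?_
  rw [lintegral_add_left (by fun_prop), lintegral_const_mul' _ _ ofReal_ne_top,
    lintegral_indicator Metric.isOpen_ball.measurableSet,
    lintegral_const_mul' _ _ ofReal_ne_top,
    lintegral_sub_left_eq_self (fun y => ofReal ((‖y‖ + r) ^ (-k))) x]
  refine (add_le_add (mul_le_mul_right (H2 r hr) _) (mul_le_mul_right (H1 R hR0) _)).trans ?_
  rw [← ofReal_mul (by positivity), ← ofReal_mul (by positivity),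
    ← ofReal_add (by positivity) (by positivity)]
  gcongr
  have e1 : 2 ^ k * R ^ (-k) * (C1 * R ^ (3 - b)) = 2 ^ k * C1 * (R ^ (3 - k) * R ^ (-b)) := by
    have : R ^ (-k) * R ^ (3 - b) = R ^ (3 - k) * R ^ (-b) := by rw [← rpow_add hR0, ← rpow_add hR0]; ring_nf
    linear_combination (2 ^ k * C1) * this
  have e2 : R ^ (3 - k) ≤ r ^ (3 - k) := rpow_le_rpow_of_nonpos hr (by rw [hR]; bound) (by linarith)
  rw [e1, add_mul]; gcongr ?_ + 2 ^ k * C1 * (?_ * _); apply le_of_eq; ring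

/-! ### Space-time weights and their convolution with parabolic kernels -/

/-- The weight `(|x| + √t)^(-1+η) |x|^(-η)` of the solution; it vanishes at `x = 0` by the junk value
of `Real.rpow`. -/
noncomputable def wt (η t : ℝ) (x : E3) : ℝ := (‖x‖ + √t) ^ (-1 + η) * ‖x‖ ^ (-η)

/-- The weight `(|x| + √t)^(-1+η) |x|^(-1-η)` of the quadratic terms. -/
noncomputable def wtF (η t : ℝ) (x : E3) : ℝ := (‖x‖ + √t) ^ (-1 + η) * ‖x‖ ^ (-1 - η)

/-- The parabolic kernel `(|z| + √τ)^(-k)`, extended by zero to `τ ≤ 0`. -/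
noncomputable def pk (k τ : ℝ) (z : E3) : ℝ := if 0 < τ then (‖z‖ + √τ) ^ (-k) else 0

lemma wt_nonneg (η t : ℝ) (x : E3) : 0 ≤ wt η t x := by unfold wt; positivity
lemma wtF_nonneg (η t : ℝ) (x : E3) : 0 ≤ wtF η t x := by unfold wtF; positivity
lemma pk_nonneg (k t : ℝ) (x : E3) : 0 ≤ pk k t x := by unfold pk; split_ifs <;> positivity

@[fun_prop]
lemma measurable_wtF (η : ℝ) : Measurable (fun z : E4 => wtF η z.1 z.2) := by unfold wtF; fun_prop
@[fun_prop]
lemma measurable_pk (k : ℝ) : Measurable (fun z : E4 => pk k z.1 z.2) :=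
  Measurable.ite (measurableSet_lt measurable_const measurable_fst) (by fun_prop)
    measurable_const

lemma volume_restrict_posTime : μ₊
      = (volume.restrict (Ioi (0 : ℝ))).prod (volume : Measure E3) := by
  rw [posTime, Measure.volume_eq_prod, ← Measure.prod_restrict, Measure.restrict_univ]

lemma measurableSet_posTime : MeasurableSet posTime := measurableSet_Ioi.prod .univ

/-- `∫₀^∞ τ^(-p) (a + √τ)^(-c) dτ ≤ C a^(2-2p-c)`. -/
lemma exists_lintegral_time_rpow (hp : p < 1) (hc : 0 ≤ c) (hpc : 1 < p + c / 2) :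
    ∃ C : ℝ, 0 < C ∧ ∀ a : ℝ, 0 < a →
    ∫⁻ τ in Ioi (0 : ℝ), ofReal (τ ^ (-p) * (a + √τ) ^ (-c)) ≤ ofReal (C * a ^ (2 - 2 * p - c)) := by
  refine ⟨1 / (1 - p) + 1 / (p + c / 2 - 1), by
    have h1 := sub_pos.2 hp; have h2 := sub_pos.2 hpc; positivity, fun a ha => ?_⟩
  have ha2 : 0 < a ^ 2 := by positivity
  have e : ∀ q : ℝ, (a ^ 2) ^ q = a ^ (2 * q) := fun q => by rw [← rpow_natCast, ← rpow_mul ha.le]; norm_num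
  have i1 : IntegrableOn (fun τ => τ ^ (-p) * a ^ (-c)) (Ioc 0 (a ^ 2)) :=
    (intervalIntegral.intervalIntegrable_rpow' (a := 0) (b := a ^ 2) (r := -p) (by linarith)).1.mul_const _
  have i2 : IntegrableOn (fun τ => τ ^ (-(p + c / 2))) (Ioi (a ^ 2)) :=
    integrableOn_Ioi_rpow_of_lt (by linarith) ha2
  have h1p := sub_pos.2 hp; have h2p := sub_pos.2 hpc
  rw [← Ioc_union_Ioi_eq_Ioi ha2.le, add_mul, ofReal_add (by positivity) (by positivity)]
  refine (lintegral_union_le _ _ _).trans (add_le_add ?_ ?_)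
  · calc _ ≤ ∫⁻ τ in Ioc 0 (a ^ 2), ofReal (τ ^ (-p) * a ^ (-c)) :=
        setLIntegral_mono (by fun_prop) fun τ hτ => ofReal_le_ofReal <| mul_le_mul_of_nonneg_left
          (rpow_le_rpow_of_nonpos ha (by bound) (by linarith)) (rpow_nonneg hτ.1.le _)
      _ = ofReal (∫ τ in Ioc 0 (a ^ 2), τ ^ (-p) * a ^ (-c)) :=
        (ofReal_integral_eq_lintegral_ofReal i1 ((ae_restrict_mem measurableSet_Ioc).mono fun τ hτ =>
          mul_nonneg (rpow_nonneg hτ.1.le _) (by positivity))).symm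
      _ = _ := by
        rw [integral_mul_const, ← intervalIntegral.integral_of_le ha2.le, integral_rpow (Or.inl (by linarith)),
          zero_rpow (by linarith), sub_zero, e, show 2 - 2 * p - c = 2 * (-p + 1) + -c by ring, rpow_add ha,
          neg_add_eq_sub]
        congr 1; ring
  · calc _ ≤ ∫⁻ τ in Ioi (a ^ 2), ofReal (τ ^ (-(p + c / 2))) :=
        setLIntegral_mono (by fun_prop) fun τ hτ => by
          have hτ0 := ha2.trans hτ; rw [neg_add, rpow_add hτ0, ← neg_div, ← sqrt_rpow hτ0.le]
          gcongr ofReal (_ * ?_)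
          exact rpow_le_rpow_of_nonpos (Real.sqrt_pos.2 hτ0) (by linarith) (by linarith)
      _ = ofReal (∫ τ in Ioi (a ^ 2), τ ^ (-(p + c / 2))) :=
        (ofReal_integral_eq_lintegral_ofReal i2 ((ae_restrict_mem measurableSet_Ioi).mono fun τ hτ =>
          rpow_nonneg (ha2.trans hτ).le _)).symm
      _ = _ := by
        rw [integral_Ioi_rpow_of_lt (by linarith) ha2, e,
          show 2 * (-(p + c / 2) + 1) = 2 - 2 * p - c by ring,
          show -(p + c / 2) + 1 = -(p + c / 2 - 1) by ring, div_neg, neg_div, neg_neg]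
        congr 1; ring

lemma lintegral_time_sub_rpow (hp : p < 1) (ht : 0 < t) :
    ∫⁻ s in Ioo (0 : ℝ) t, ofReal ((t - s) ^ (-p)) = ofReal (t ^ (1 - p) / (1 - p)) := by
  have hi : IntegrableOn (fun τ => (t - τ) ^ (-p)) (Ioc 0 t) := by
    have := ((intervalIntegral.intervalIntegrable_rpow' (a := t) (b := 0) (r := -p)
      (by linarith)).comp_sub_left (c := t)).1
    simpa using this
  rw [restrict_Ioo_eq_restrict_Ioc,
    ← ofReal_integral_eq_lintegral_ofReal hi, ← intervalIntegral.integral_of_le ht.le,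
    intervalIntegral.integral_comp_sub_left (fun x => x ^ (-p)) t,
    integral_rpow (Or.inl (by linarith))]
  · rw [sub_self, sub_zero, zero_rpow (by linarith)]
    have : -p + 1 = 1 - p := by ring
    rw [this, sub_zero]
  · filter_upwards [ae_restrict_mem measurableSet_Ioc] with τ hτ
    exact rpow_nonneg (by linarith [hτ.2]) _

lemma wtF_le_rpow (hη0 : 0 < η) (hη1 : η < 1) (t : ℝ) (x : E3) : wtF η t x ≤ ‖x‖ ^ (-2 : ℝ) := by
  unfold wtF; rcases (norm_nonneg x).eq_or_lt with h | h
  · rw [← h, zero_rpow (show -1 - η ≠ 0 by linarith), mul_zero]; positivity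
  · calc _ ≤ ‖x‖ ^ (-1 + η) * ‖x‖ ^ (-1 - η) := by refine mul_le_mul_of_nonneg_right (rpow_le_rpow_of_nonpos h
        (by linarith [sqrt_nonneg t]) (by linarith)) (by positivity)
      _ = _ := by rw [← rpow_add h]; congr 1; ring

lemma wt_le_rpow (hη0 : 0 < η) (hη1 : η < 1) (t : ℝ) (x : E3) : wt η t x ≤ ‖x‖ ^ (-1 : ℝ) := by
  unfold wt; rcases (norm_nonneg x).eq_or_lt with h | h
  · rw [← h, zero_rpow (show -η ≠ 0 by linarith), mul_zero]; positivity
  · calc _ ≤ ‖x‖ ^ (-1 + η) * ‖x‖ ^ (-η) := by refine mul_le_mul_of_nonneg_right (rpow_le_rpow_of_nonpos h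
        (by linarith [sqrt_nonneg t]) (by linarith)) (by positivity)
      _ = _ := by rw [← rpow_add h]; congr 1; ring

lemma wtF_le_time_rpow (hη1 : η < 1) (ht : 0 < t) (x : E3) :
    wtF η t x ≤ t ^ ((-1 + η) / 2) * ‖x‖ ^ (-(1 + η)) := by
  unfold wtF; rw [← sqrt_rpow ht.le, show -1 - η = -(1 + η) by ring]
  refine mul_le_mul_of_nonneg_right (rpow_le_rpow_of_nonpos (Real.sqrt_pos.2 ht)
    (by bound) (by linarith)) (by positivity)

lemma exists_lintegral_pk_rpow (hk : 3 < k) (hb0 : 0 ≤ b) (hb : b < 3) :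
    ∃ C : ℝ, 0 < C ∧ ∀ τ : ℝ, 0 < τ → ∀ x : E3, ∫⁻ y : E3, ofReal (pk k τ (x - y) * ‖y‖ ^ (-b))
    ≤ ofReal (C * (τ ^ ((3 - k) / 2) * (‖x‖ + √τ) ^ (-b))) := by
  obtain ⟨C, hC, H⟩ := exists_lintegral_kernel_rpow hk hb0 hb; refine ⟨C, hC, fun τ hτ x => ?_⟩
  have := H (√τ) (Real.sqrt_pos.2 hτ) x; rw [sqrt_rpow hτ.le] at this; simpa [pk, hτ] using this

lemma exists_lintegral_pk_wtF_space (hk : 3 < k) (hη0 : 0 < η) (hη1 : η < 1) :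
    ∃ C : ℝ, 0 < C ∧ ∀ τ : ℝ, 0 < τ → ∀ s : ℝ, 0 < s → ∀ x : E3,
    ∫⁻ y : E3, ofReal (pk k τ (x - y) * wtF η s y)
    ≤ ofReal (C * (τ ^ ((3 - k) / 2) * (‖x‖ + √τ) ^ (-2 : ℝ))) ∧
    ∫⁻ y : E3, ofReal (pk k τ (x - y) * wtF η s y) ≤ ofReal (C * (s ^ ((-1 + η) / 2) *
    (τ ^ ((3 - k) / 2) * (‖x‖ + √τ) ^ (-(1 + η))))) := by
  obtain ⟨C1, hC1, H1⟩ := exists_lintegral_pk_rpow (b := 2) hk (by simp) (by norm_num)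
  obtain ⟨C2, hC2, H2⟩ := exists_lintegral_pk_rpow (b := 1 + η) hk (by linarith) (by linarith)
  refine ⟨C1 + C2, by positivity, fun τ hτ s hs x => ⟨?_, ?_⟩⟩
  · refine le_trans (lintegral_mono fun y => ?_) ((H1 τ hτ x).trans ?_)
    · exact ofReal_le_ofReal (mul_le_mul_of_nonneg_left (wtF_le_rpow hη0 hη1 s y) (pk_nonneg _ _ _))
    · exact ofReal_le_ofReal (by gcongr; linarith)
  · calc _ ≤ ∫⁻ y, ofReal (s ^ ((-1 + η) / 2)) * ofReal (pk k τ (x - y) * ‖y‖ ^ (-(1 + η))) := by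
          refine lintegral_mono fun y => ?_; rw [← ofReal_mul (by positivity)]
          apply ofReal_le_ofReal; rw [mul_left_comm]
          exact mul_le_mul_of_nonneg_left (wtF_le_time_rpow hη1 hs y) (pk_nonneg _ _ _)
      _ ≤ _ := by
        rw [lintegral_const_mul' _ _ ofReal_ne_top]
        refine (mul_le_mul_right (H2 τ hτ x) _).trans ?_; rw [← ofReal_mul (by positivity)]
        apply ofReal_le_ofReal; rw [mul_left_comm]; gcongr; linarith

lemma lintegral_pk_posTime_eq (x : E3) :
    ∫⁻ z in posTime, ofReal (pk k (t - z.1) (x - z.2) * wtF η z.1 z.2)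
    = ∫⁻ s in Ioo 0 t, ∫⁻ y : E3, ofReal (pk k (t - s) (x - y) * wtF η s y) := by
  rw [volume_restrict_posTime, lintegral_prod _ (by
    have h1 := (measurable_pk k).comp (f := fun z : E4 => (t - z.1, x - z.2)) (by fun_prop)
    exact (ENNReal.measurable_ofReal.comp (h1.mul (measurable_wtF η))).aemeasurable),
    ← Ioi_inter_Iio, inter_comm, ← setLIntegral_indicator measurableSet_Iio]
  refine lintegral_congr fun s => ?_
  by_cases h : s < t
  · simp [h]
  · have : ¬ 0 < t - s := by linarith
    simp [h, pk]

/-- The basic space-time estimate: parabolic kernels of order `k ∈ [4, 5)` map the weight of the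
quadratic terms to the weight of the solution (with `k - 4` further powers of `|x|⁻¹`), and gain
a power of time. -/
lemma exists_lintegral_pk_wtF (hk : 4 ≤ k) (hk5 : k < 5) (hη0 : 0 < η) (hη1 : η < 1) :
    ∃ C : ℝ, 0 < C ∧ ∀ t : ℝ, 0 < t → ∀ x : E3, x ≠ 0 →
    ∫⁻ z in posTime, ofReal (pk k (t - z.1) (x - z.2) * wtF η z.1 z.2)
    ≤ ofReal (C * ((‖x‖ + √t) ^ (-1 + η) * ‖x‖ ^ (-η - (k - 4)))) ∧
    ∫⁻ z in posTime, ofReal (pk k (t - z.1) (x - z.2) * wtF η z.1 z.2)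
    ≤ ofReal (C * (t ^ ((5 - k) / 2) * ‖x‖ ^ (-2 : ℝ))) := by
  obtain ⟨C1, hC1, H1⟩ := exists_lintegral_pk_wtF_space (k := k) (by linarith) hη0 hη1
  obtain ⟨C2, hC2, H2⟩ := exists_lintegral_time_rpow (p := (k - 3) / 2) (c := 1 + η)
    (by linarith) (by linarith) (by linarith)
  have h5 : 0 < 1 - (k - 3) / 2 := by linarith
  refine ⟨C1 * (2 ^ (1 - η) * C2 + 1 / (1 - (k - 3) / 2)), by positivity, fun t ht x hx => ?_⟩
  have hx0 := norm_pos_iff.2 hx; have ep : (3 - k) / 2 = -((k - 3) / 2) := by ring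
  rw [lintegral_pk_posTime_eq]
  constructor
  · set R := ‖x‖ + √t
    have hR : 0 < R := by positivity
    calc _ ≤ ∫⁻ s in Ioo 0 t, ofReal (C1 * (R / 2) ^ (-(1 - η))) *
        (Ioi (0:ℝ)).indicator (fun τ => ofReal (τ ^ (-((k - 3) / 2)) * (‖x‖ + √τ) ^ (-(1 + η)))) (t - s) := by
          refine setLIntegral_mono (.const_mul
            ((Measurable.indicator (by fun_prop) measurableSet_Ioi).comp (by fun_prop)) _) fun s hs => ?_
          have hτ : 0 < t - s := sub_pos.2 hs.2; have hq : 0 < ‖x‖ + √(t - s) := by positivity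
          rw [indicator_of_mem (show t - s ∈ Ioi 0 from hτ), ← ofReal_mul (by positivity), ← ep]
        -- either the kernel or the weight lives at scale `|x| + √t`
          by_cases h : R / 2 ≤ ‖x‖ + √(t - s)
          · refine (H1 (t - s) hτ s hs.1 x).1.trans (ofReal_le_ofReal ?_)
            rw [show (-2 : ℝ) = -(1 - η) + -(1 + η) by ring, rpow_add hq, mul_left_comm _ (_ ^ (-(1 - η))), mul_assoc C1]
            gcongr C1 * (?_ * _); exact rpow_le_rpow_of_nonpos (by positivity) h (by linarith)
          · refine (H1 (t - s) hτ s hs.1 x).2.trans (ofReal_le_ofReal ?_)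
            have h1 : √t ≤ √s + √(t - s) := Real.sqrt_le_iff.2 ⟨by positivity, by
              nlinarith [Real.sq_sqrt hs.1.le, Real.sq_sqrt hτ.le, mul_nonneg (sqrt_nonneg s) (sqrt_nonneg (t - s))]⟩
            rw [mul_assoc C1, ← sqrt_rpow hs.1.le, show -1 + η = -(1 - η) by ring]
            gcongr C1 * (?_ * _)
            exact rpow_le_rpow_of_nonpos (by positivity) (by linarith) (by linarith)
      _ ≤ ofReal (C1 * (R / 2) ^ (-(1 - η))) * ofReal (C2 * ‖x‖ ^ (2 - 2 * ((k - 3) / 2) - (1 + η))) := by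
        rw [lintegral_const_mul' _ _ ofReal_ne_top]
        refine mul_le_mul_right ((setLIntegral_le_lintegral _ _).trans ?_) _
        rw [lintegral_sub_left_eq_self (fun τ => (Ioi (0:ℝ)).indicator _ τ) t, lintegral_indicator measurableSet_Ioi]
        exact H2 ‖x‖ hx0
      _ ≤ _ := by
        rw [← ofReal_mul (by positivity), div_rpow_neg hR.le two_pos, neg_sub, sub_eq_neg_add η,
          show 2 - 2 * ((k - 3) / 2) - (1 + η) = -η - (k - 4) by ring]
        refine ofReal_le_ofReal ?_
        have : 0 ≤ C1 * (1 / (1 - (k - 3) / 2)) * (R ^ (-1 + η) * ‖x‖ ^ (-η - (k - 4))) := by positivity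
        linarith
  · calc _ ≤ ∫⁻ s in Ioo 0 t, ofReal (C1 * ‖x‖ ^ (-2 : ℝ)) * ofReal ((t - s) ^ (-((k - 3) / 2))) := by
          refine setLIntegral_mono (by fun_prop) fun s hs => (H1 (t - s) (sub_pos.2 hs.2) s hs.1 x).1.trans ?_
          have : 0 ≤ (t - s) ^ (-((k - 3) / 2)) := rpow_nonneg (by linarith [hs.2]) _
          rw [← ofReal_mul (by positivity), ep, mul_assoc, mul_comm ((t - s) ^ _)]
          gcongr ofReal (C1 * (?_ * _)); exact rpow_le_rpow_of_nonpos hx0 (by bound) (by simp)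
      _ ≤ _ := by
        rw [lintegral_const_mul' _ _ ofReal_ne_top, lintegral_time_sub_rpow (by linarith) ht,
          ← ofReal_mul (by positivity), show (5 - k) / 2 = 1 - (k - 3) / 2 by ring]
        refine ofReal_le_ofReal ?_
        have : 0 ≤ C1 * (2 ^ (1 - η) * C2) * (t ^ (1 - (k - 3) / 2) * ‖x‖ ^ (-2 : ℝ)) := by positivity
        linear_combination this

/-! ### Parabolic kernels -/

/-- `s^(-k) exp(-|z|²/4s)`, extended by zero to `s ≤ 0`. -/
noncomputable def ek (k s : ℝ) (z : E3) : ℝ :=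
  if 0 < s then s ^ (-k) * exp (-‖z‖ ^ 2 / (4 * s)) else 0

/-- `∫ₜ^∞ s^(-k) exp(-|z|²/4s) ds`, extended by zero to `t ≤ 0`. -/
noncomputable def gk (k t : ℝ) (z : E3) : ℝ :=
  if 0 < t then ∫ s in Ioi t, ek k s z else 0

/-- `IsKer n m K`: the kernel `K τ z` is `n` times differentiable in space and its derivatives of
order `j ≤ n` are `O((|z| + √τ)^(-m-j))`; it vanishes for `τ ≤ 0`. -/
def IsKer : ℕ → ℝ → (ℝ → E3 → ℝ) → Prop
  | 0, m, K => Measurable (fun p : E4 => K p.1 p.2) ∧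
      ∃ C : ℝ, 0 ≤ C ∧ ∀ τ z, |K τ z| ≤ C * pk m τ z
  | n + 1, m, K => (Measurable (fun p : E4 => K p.1 p.2) ∧
      ∃ C : ℝ, 0 ≤ C ∧ ∀ τ z, |K τ z| ≤ C * pk m τ z) ∧
      (∀ τ, Differentiable ℝ (K τ)) ∧ ∀ v, IsKer n (m + 1) (fun τ z => fderiv ℝ (K τ) z v)

/-- The derivative of a kernel in the spatial direction `v`. -/
noncomputable def dk (v : E3) (K : ℝ → E3 → ℝ) : ℝ → E3 → ℝ := fun τ z => fderiv ℝ (K τ) z v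

namespace IsKer
variable {n : ℕ} {m : ℝ} {K L : ℝ → E3 → ℝ}

lemma base (h : IsKer n m K) : Measurable (fun p : E4 => K p.1 p.2) ∧
      ∃ C : ℝ, 0 ≤ C ∧ ∀ τ z, |K τ z| ≤ C * pk m τ z := by
  cases n with
  | zero => exact h
  | succ n => exact h.1

lemma measurable (h : IsKer n m K) : Measurable (fun p : E4 => K p.1 p.2) := h.base.1

lemma bound (h : IsKer n m K) : ∃ C : ℝ, 0 ≤ C ∧ ∀ τ z, |K τ z| ≤ C * pk m τ z := h.base.2

lemma eq_zero (h : IsKer n m K) (hτ : τ ≤ 0) (z : E3) : K τ z = 0 := by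
  obtain ⟨C, -, hC⟩ := h.bound; have := hC τ z; rw [pk, if_neg hτ.not_gt, mul_zero] at this
  exact abs_nonpos_iff.1 this

lemma differentiable (h : IsKer (n + 1) m K) (τ : ℝ) : Differentiable ℝ (K τ) := h.2.1 τ

protected lemma dk (h : IsKer (n + 1) m K) (v : E3) : IsKer n (m + 1) (dk v K) := h.2.2 v

lemma of_succ (h : IsKer (n + 1) m K) : IsKer n m K := by
  induction n generalizing m K with
  | zero => exact h.1
  | succ n ih => exact ⟨h.1, h.2.1, fun v => ih (h.2.2 v)⟩

lemma lin (hK : IsKer n m K) (hL : IsKer n m L) (a b : ℝ) : IsKer n m (fun τ z => a * K τ z + b * L τ z) := by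
  have hb : ∀ {m : ℝ} {K L : ℝ → E3 → ℝ}, IsKer 0 m K → IsKer 0 m L → IsKer 0 m (fun τ z => a * K τ z + b * L τ z) := by
    intro m K L ⟨hK, C, hC, h1⟩ ⟨hL, D, hD, h2⟩
    refine ⟨(hK.const_mul a).add (hL.const_mul b), |a| * C + |b| * D, by positivity, fun τ z => (abs_add_le _ _).trans ?_⟩
    rw [abs_mul, abs_mul, add_mul, mul_assoc, mul_assoc]; gcongr; exacts [h1 τ z, h2 τ z]
  induction n generalizing m K L with
  | zero => exact hb hK hL
  | succ n ih =>
    have h := fun τ z => ((hK.differentiable τ z).hasFDerivAt.const_mul a).add ((hL.differentiable τ z).hasFDerivAt.const_mul b)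
    refine ⟨hb hK.base hL.base, fun τ z => (h τ z).differentiableAt, fun v => ?_⟩
    convert ih (hK.2.2 v) (hL.2.2 v) using 3 with τ z
    exact congrArg (· v) (h τ z).fderiv

lemma add (hK : IsKer n m K) (hL : IsKer n m L) : IsKer n m (fun τ z => K τ z + L τ z) := by
  simpa using hK.lin hL 1 1

lemma const_mul (hK : IsKer n m K) (c : ℝ) : IsKer n m (fun τ z => c * K τ z) := by
  simpa using hK.lin hK c 0

lemma mul_inner (hK : IsKer n m K) (a : E3) : IsKer n (m - 1) (fun τ z => ⟪a, z⟫ * K τ z) := by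
  have hb : ∀ {m : ℝ} {K : ℝ → E3 → ℝ}, IsKer 0 m K → IsKer 0 (m - 1) (fun τ z => ⟪a, z⟫ * K τ z) := by
    intro m K ⟨hK, C, hC, h1⟩
    refine ⟨Measurable.mul (by fun_prop) hK, ‖a‖ * C, by positivity, fun τ z => ?_⟩
    have h2 := h1 τ z; rw [abs_mul]; rw [pk] at h2 ⊢; split_ifs at h2 ⊢ with hτ
    · calc _ ≤ (‖a‖ * (‖z‖ + √τ)) * (C * (‖z‖ + √τ) ^ (-m)) := by
            gcongr; exact (abs_real_inner_le_norm a z).trans (by gcongr; linarith [sqrt_nonneg τ])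
        _ = _ := by
          have := Real.sqrt_pos.2 hτ; rw [neg_sub, sub_eq_add_neg, rpow_add (by positivity), rpow_one]; ring
    · rw [mul_zero] at h2 ⊢; rw [h2.antisymm (abs_nonneg _), mul_zero]
  induction n generalizing m K with
  | zero => exact hb hK
  | succ n ih =>
    have h := fun τ z => (innerSL ℝ a).hasFDerivAt.mul (hK.differentiable τ z).hasFDerivAt
    refine ⟨hb hK.base, fun τ z => (h τ z).differentiableAt, fun v => ?_⟩
    have h2 := (ih (hK.2.2 v)).lin (m := m + 1 - 1) (L := K) (by simpa using hK.of_succ) 1 ⟪a, v⟫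
    convert h2 using 3 with τ z
    · ring
    · rw [one_mul, mul_comm _ (K τ z)]; exact congrArg (· v) (h τ z).fderiv

lemma contDiff (h : IsKer (n + 1) m K) (τ : ℝ) : ContDiff ℝ n (K τ) := by
  induction n generalizing m K with
  | zero => exact contDiff_zero.2 (h.differentiable τ).continuous
  | succ n ih =>
    push_cast; rw [contDiff_succ_iff_fderiv_apply]
    exact ⟨h.differentiable τ, by simp, fun v => ih (h.2.2 v)⟩

lemma continuous (h : IsKer (n + 1) m K) (τ : ℝ) : Continuous (K τ) := (h.differentiable τ).continuous

end IsKer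

lemma ek_nonneg (k s : ℝ) (z : E3) : 0 ≤ ek k s z := by unfold ek; split_ifs <;> positivity

lemma ek_le_rpow (k s : ℝ) (z : E3) (hs : 0 < s) : ek k s z ≤ s ^ (-k) := by
  rw [ek, if_pos hs]; refine mul_le_of_le_one_right (by positivity) (Real.exp_le_one_iff.2 ?_)
  rw [neg_div]; have : 0 ≤ ‖z‖ ^ 2 / (4 * s) := by positivity
  linarith

@[fun_prop]
lemma measurable_ek (k : ℝ) : Measurable (fun p : E4 => ek k p.1 p.2) :=
  Measurable.ite (measurableSet_lt measurable_const measurable_fst) (by fun_prop)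
    measurable_const

lemma exists_ek_le (hk : 0 ≤ k) :
    ∃ C : ℝ, 0 ≤ C ∧ ∀ s z, |ek k s z| ≤ C * pk (2 * k) s z := by
  obtain ⟨N, hN⟩ := exists_nat_ge k; set M : ℝ := N + 1; have hM : 0 < M := by positivity
  refine ⟨2 ^ k * (4 * M) ^ M, by positivity, fun s z => ?_⟩
  rw [abs_of_nonneg (ek_nonneg _ _ _), ek, pk]; split_ifs with hs
  swap; · simp
  set v := ‖z‖ ^ 2 / s with hv; have hv0 : 0 ≤ v := by positivity
  have h1 : ((1 : ℝ) + v) ^ k ≤ (4 * M) ^ M * exp (v / 4) := by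
    calc ((1 : ℝ) + v) ^ k ≤ (1 + v) ^ M :=
        rpow_le_rpow_of_exponent_le (by linarith) (by linarith)
      _ ≤ (4 * M * exp (v / (4 * M))) ^ M := by
        gcongr; have := Real.add_one_le_exp (v / (4 * M))
        calc 1 + v ≤ 4 * M * (v / (4 * M) + 1) := by field_simp; nlinarith
          _ ≤ _ := by gcongr
      _ = _ := by rw [mul_rpow (by positivity) (by positivity), ← Real.exp_mul]; congr 2; field_simp
  have h2 : (‖z‖ + √s) ^ 2 ≤ 2 * (s * (1 + v)) := by
    have : s * (1 + v) = s + ‖z‖ ^ 2 := by rw [hv]; field_simp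
    rw [this]; linarith [sq_nonneg (‖z‖ - √s), sq_sqrt hs.le]
  have h3 : (‖z‖ + √s) ^ (2 * k) ≤ 2 ^ k * (s ^ k * (1 + v) ^ k) := by
    rw [← mul_rpow hs.le (by positivity), ← mul_rpow (by simp) (by positivity),
      rpow_mul (by positivity), Real.rpow_ofNat]
    gcongr
  rw [rpow_neg (x := ‖z‖ + √s) (by positivity), ← div_eq_mul_inv, le_div_iff₀ (by positivity)]
  calc s ^ (-k) * exp (-‖z‖ ^ 2 / (4 * s)) * (‖z‖ + √s) ^ (2 * k)
      ≤ s ^ (-k) * exp (-‖z‖ ^ 2 / (4 * s)) *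
        (2 ^ k * (s ^ k * ((4 * M) ^ M * exp (v / 4)))) := by gcongr; exact h3.trans (by gcongr)
    _ = 2 ^ k * (4 * M) ^ M * (s ^ (-k) * s ^ k) *
      (exp (-‖z‖ ^ 2 / (4 * s)) * exp (v / 4)) := by ring
    _ = _ := by
      rw [← rpow_add hs, ← Real.exp_add, hv]
      have : -‖z‖ ^ 2 / (4 * s) + ‖z‖ ^ 2 / s / 4 = 0 := by field_simp; ring
      rw [this]; simp

lemma hasFDerivAt_ek (k s : ℝ) (z : E3) :
    HasFDerivAt (ek k s) ((-(1 / 2) * ek (k + 1) s z) • innerSL ℝ z) z := by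
  unfold ek; by_cases hs : 0 < s <;> simp only [hs, if_true, if_false]
  · have h1 := (hasStrictFDerivAt_norm_sq z).hasFDerivAt.neg.mul_const (4 * s)⁻¹
    refine (h1.exp.const_mul (s ^ (-k))).congr_fderiv ?_; ext v
    simp [show -(k + 1) = -k - 1 by ring, Real.rpow_sub_one hs.ne', div_eq_mul_inv]; ring
  · simpa using hasFDerivAt_const (0 : ℝ) z

/-- Kernels which differ by a shift of the parameter from their own derivatives. -/
lemma isKer_of_shift {F : ℝ → ℝ → E3 → ℝ} {k₀ d : ℝ} (n : ℕ) (hk : k₀ < k)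
    (hF : ∀ k, k₀ < k → IsKer 0 (2 * k - d) (F k))
    (h : ∀ k, k₀ < k → ∀ t z, HasFDerivAt (F k t) ((-(1 / 2) * F (k + 1) t z) • innerSL ℝ z) z) :
    IsKer n (2 * k - d) (F k) := by
  induction n generalizing k with
  | zero => exact hF k hk
  | succ n ih =>
    refine ⟨hF k hk, fun τ z => (h k hk τ z).differentiableAt, fun v => ?_⟩
    convert ((ih (k := k + 1) (by linarith)).mul_inner v).const_mul (-(1 / 2)) using 1
    · ring
    · ext τ z; rw [(h k hk τ z).fderiv]; simp [real_inner_comm]; ring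

lemma isKer_ek (n : ℕ) (hk : 0 < k) : IsKer n (2 * k) (ek k) := by
  simpa using isKer_of_shift (d := 0) n hk (fun k hk => ⟨measurable_ek k, by simpa using exists_ek_le hk.le⟩)
    fun k _ => hasFDerivAt_ek k

@[fun_prop]
lemma measurable_ek_left (k : ℝ) (z : E3) : Measurable fun s => ek k s z :=
  (measurable_ek k).comp (f := fun s => (s, z)) (by fun_prop)

lemma integrableOn_ek (hk : 1 < k) (ht : 0 < t) (z : E3) :
    IntegrableOn (fun s => ek k s z) (Ioi t) := by
  refine (integrableOn_Ioi_rpow_of_lt (a := -k) (by linarith) ht).mono' (by fun_prop) ?_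
  filter_upwards [ae_restrict_mem measurableSet_Ioi] with s hs
  rw [norm_of_nonneg (ek_nonneg _ _ _)]; exact ek_le_rpow k s z (ht.trans hs)

lemma gk_nonneg (k s : ℝ) (z : E3) : 0 ≤ gk k s z := by
  unfold gk; split_ifs
  · exact integral_nonneg fun _ => ek_nonneg _ _ _
  · exact le_rfl

@[fun_prop]
lemma measurable_gk (k : ℝ) : Measurable (fun p : E4 => gk k p.1 p.2) := by
  refine Measurable.ite (measurableSet_lt measurable_const measurable_fst) ?_ measurable_const
  simp_rw [← integral_indicator measurableSet_Ioi]
  refine (StronglyMeasurable.integral_prod_right (Measurable.stronglyMeasurable ?_)).measurable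
  exact ((measurable_ek k).comp (f := fun q : E4 × ℝ => (q.2, q.1.2)) (by fun_prop)).indicator
    (measurableSet_lt (f := fun q : E4 × ℝ => q.1.1) (g := fun q => q.2) (by fun_prop) (by fun_prop))

lemma exists_gk_le (hk : 1 < k) :
    ∃ C : ℝ, 0 ≤ C ∧ ∀ s z, |gk k s z| ≤ C * pk (2 * k - 2) s z := by
  obtain ⟨C, hC, H⟩ := exists_ek_le (by linarith); have hk1 : 0 < k - 1 := by linarith
  refine ⟨C * (2 ^ (k - 1) / (k - 1)), by positivity, fun t z => ?_⟩
  rw [abs_of_nonneg (gk_nonneg _ _ _), gk, pk]; split_ifs with ht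
  swap; · simp
  set q := ‖z‖ ^ 2; have hq : 0 ≤ q := by positivity
  have hi : IntegrableOn (fun s => (s + q) ^ (-k)) (Ioi t) :=
    integrableOn_add_rpow_Ioi_of_lt (by linarith) (by linarith)
  have hval : ∫ s in Ioi t, (s + q) ^ (-k) = (t + q) ^ (1 - k) / (k - 1) := by
    have := (measurePreserving_add_right volume q).setIntegral_preimage_emb (measurableEmbedding_addRight q)
      (· ^ (-k)) (Ioi (t + q))
    rw [preimage_add_const_Ioi, add_sub_cancel_right] at this
    rw [this, integral_Ioi_rpow_of_lt (by linarith) (by positivity), ← neg_div_neg_eq, neg_neg]; congr 2 <;> ring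
  calc ∫ s in Ioi t, ek k s z ≤ ∫ s in Ioi t, C * (s + q) ^ (-k) := by
        refine setIntegral_mono_on (integrableOn_ek hk ht z) (hi.const_mul C) measurableSet_Ioi
          fun s hs => ?_
        have hs0 := ht.trans hs; refine (le_abs_self _).trans ((H s z).trans ?_)
        rw [pk, if_pos hs0]; gcongr
        rw [show -(2 * k) = 2 * -k by ring, rpow_mul (by positivity), Real.rpow_ofNat]
        refine rpow_le_rpow_of_nonpos (by positivity) ?_ (by linarith); have := sqrt_nonneg s
        nlinarith [sq_sqrt hs0.le, norm_nonneg z]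
    _ = C * ((t + q) ^ (1 - k) / (k - 1)) := by rw [integral_const_mul, hval]
    _ ≤ _ := by
        rw [mul_assoc]; gcongr; rw [div_mul_eq_mul_div]; gcongr
        rw [show -(2 * k - 2) = 2 * (-(k - 1)) by ring, rpow_mul (by positivity),
          Real.rpow_ofNat, ← div_rpow_neg (by positivity) (by simp), show 1 - k = -(k - 1) by ring]
        refine rpow_le_rpow_of_nonpos (by positivity) ?_ (by linarith)
        linarith [sq_sqrt ht.le, sq_nonneg (‖z‖ - √t)]

lemma hasFDerivAt_gk (hk : 1 < k) (t : ℝ) (z : E3) :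
    HasFDerivAt (gk k t) ((-(1 / 2) * gk (k + 1) t z) • innerSL ℝ z) z := by
  by_cases ht : 0 < t
  · have e : gk k t = fun z => ∫ s in Ioi t, ek k s z := by ext z; rw [gk, if_pos ht]
    rw [e]; have key := hasFDerivAt_integral_of_dominated_of_fderiv_le
      (F' := fun z s => (-(1 / 2) * ek (k + 1) s z) • innerSL ℝ z)
      (bound := fun s => s ^ (-(k + 1)) * (‖z‖ + 1)) (ball_mem_nhds z one_pos)
      (.of_forall fun x => (measurable_ek_left k x).aestronglyMeasurable) (integrableOn_ek hk ht z)
      (((measurable_ek_left _ z).const_mul _).smul_const _).aestronglyMeasurable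
      (by
        filter_upwards [ae_restrict_mem measurableSet_Ioi] with s hs x hx
        rw [norm_smul, innerSL_apply_norm, norm_mul, norm_of_nonneg (ek_nonneg _ _ _)]
        have h2 : ‖x‖ ≤ ‖z‖ + 1 := by
          have := norm_le_norm_add_norm_sub' x z; rw [mem_ball_iff_norm] at hx; linarith
        refine mul_le_mul ((mul_le_of_le_one_left (ek_nonneg _ _ _) ?_).trans (ek_le_rpow _ s x (ht.trans hs))) h2
          (norm_nonneg _) (rpow_nonneg (ht.trans hs).le _)
        norm_num)
      ((integrableOn_Ioi_rpow_of_lt (by linarith) ht).mul_const _) (.of_forall fun s x _ => hasFDerivAt_ek k s x)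
    refine key.congr_fderiv ?_; rw [integral_smul_const, integral_const_mul, gk, if_pos ht]
  · unfold gk; simpa [ht] using hasFDerivAt_const (0 : ℝ) z

lemma isKer_gk (n : ℕ) (hk : 1 < k) : IsKer n (2 * k - 2) (gk k) :=
  isKer_of_shift n hk (fun k hk => ⟨measurable_gk k, exists_gk_le hk⟩) fun _ hk => hasFDerivAt_gk hk

lemma hasDerivAt_ek (k : ℝ) (hs : 0 < s) (z : E3) :
    HasDerivAt (fun s => ek k s z) (-k * ek (k + 1) s z + ‖z‖ ^ 2 / 4 * ek (k + 2) s z) s := by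
  have e : (fun s => ek k s z) =ᶠ[𝓝 s] fun s => s ^ (-k) * exp (-‖z‖ ^ 2 / 4 * s⁻¹) := by
    filter_upwards [lt_mem_nhds hs] with s hs; rw [ek, if_pos hs]; congr 2; field_simp
  refine HasDerivAt.congr_of_eventuallyEq ?_ e
  have h1 := (Real.hasDerivAt_rpow_const (p := -k) (Or.inl hs.ne')).mul
    (((hasDerivAt_inv hs.ne').const_mul (-‖z‖ ^ 2 / 4)).exp)
  refine h1.congr_deriv ?_; simp only [ek, if_pos hs]
  rw [show -‖z‖ ^ 2 / 4 * s⁻¹ = -‖z‖ ^ 2 / (4 * s) by field_simp,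
    show -(k + 1) = -k - 1 by ring, show -(k + 2) = -k - (2 : ℕ) by push_cast; ring,
    Real.rpow_sub_natCast hs.ne']
  ring

lemma gk_recurrence (hk : 0 < k) (ht : 0 < t) (z : E3) :
    ek k t z = k * gk (k + 1) t z - ‖z‖ ^ 2 / 4 * gk (k + 2) t z := by
  have hi1 := (integrableOn_ek (k := k + 1) (by linarith) ht z).const_mul (-k)
  have hi2 := (integrableOn_ek (k := k + 2) (by linarith) ht z).const_mul (‖z‖ ^ 2 / 4)
  have hlim : Tendsto (fun s => ek k s z) atTop (𝓝 0) := by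
    refine squeeze_zero' (Eventually.of_forall fun s => ek_nonneg _ _ _) ?_ (tendsto_rpow_neg_atTop hk)
    filter_upwards [eventually_gt_atTop 0] with s hs using ek_le_rpow k s z hs
  have := integral_Ioi_of_hasDerivAt_of_tendsto'
    (fun s (hs : s ∈ Ici t) => hasDerivAt_ek k (ht.trans_le hs) z) (hi1.add hi2) hlim
  have h2 : ∫ s in Ioi t, (-k * ek (k + 1) s z + ‖z‖ ^ 2 / 4 * ek (k + 2) s z)
      = -k * gk (k + 1) t z + ‖z‖ ^ 2 / 4 * gk (k + 2) t z := by
    rw [integral_add hi1 hi2, integral_const_mul, integral_const_mul, gk, gk, if_pos ht, if_pos ht]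
  rw [h2] at this; linarith

lemma hasDerivAt_gk (hk : 1 < k) (ht : 0 < t) (z : E3) :
    HasDerivAt (fun t => gk k t z) (-ek k t z) t := by
  have h0 : 0 < t / 2 := by linarith
  have hi := integrableOn_ek hk h0 z
  have e : (fun t => gk k t z) =ᶠ[𝓝 t]
      fun t' => (∫ s in Ioi (t / 2), ek k s z) - ∫ s in (t / 2)..t', ek k s z := by
    filter_upwards [lt_mem_nhds (show t / 2 < t by linarith)] with t' ht'
    rw [gk, if_pos (h0.trans ht'), intervalIntegral.integral_of_le ht'.le,
      ← Ioc_union_Ioi_eq_Ioi ht'.le, setIntegral_union (Ioc_disjoint_Ioi le_rfl) measurableSet_Ioi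
        (hi.mono_set Ioc_subset_Ioi_self) (hi.mono_set (Ioi_subset_Ioi ht'.le))]
    ring
  refine HasDerivAt.congr_of_eventuallyEq ?_ e
  refine HasDerivAt.const_sub _ (intervalIntegral.integral_hasDerivAt_right ?_ ?_ ?_)
  · rw [intervalIntegrable_iff_integrableOn_Ioc_of_le (by linarith)]
    exact hi.mono_set Ioc_subset_Ioi_self
  · exact (measurable_ek_left k z).stronglyMeasurable.stronglyMeasurableAtFilter
  · exact (hasDerivAt_ek k ht z).continuousAt

/-! ### The heat kernel, the Newtonian tail and the Oseen kernel -/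

/-- The normalization `(4π)^(-3/2)` of the heat kernel. -/
noncomputable def c0 : ℝ := (4 * Real.pi) ^ (-(3 / 2) : ℝ)

/-- The heat kernel. -/
noncomputable def heatK : ℝ → E3 → ℝ := fun t z => c0 * ek (3 / 2) t z

/-- `∫ₜ^∞` of the heat kernel, that is, the kernel of `(-Δ)⁻¹ exp(tΔ)`. -/
noncomputable def newtK : ℝ → E3 → ℝ := fun t z => c0 * gk (3 / 2) t z

/-- The kernel `∂ₐ∂_b (-Δ)⁻¹ exp(tΔ)`. -/
noncomputable def rieszK (a b : E3) : ℝ → E3 → ℝ := dk a (dk b newtK)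

/-- The `c`-component of the kernel of `exp(tΔ) P ∇·` applied to `a ⊗ b`, `P` being the projection
onto divergence free fields. -/
noncomputable def oseenK (a b c : E3) : ℝ → E3 → ℝ :=
  fun t z => ⟪b, c⟫ * dk a heatK t z + dk c (rieszK a b) t z

lemma c0_pos : 0 < c0 := by unfold c0; positivity

lemma isKer_heatK (n : ℕ) : IsKer n 3 heatK := by
  have := (isKer_ek n (k := 3 / 2) (by norm_num)).const_mul c0
  rwa [show (2 * (3 / 2) : ℝ) = 3 by norm_num] at this

lemma isKer_newtK (n : ℕ) : IsKer n 1 newtK := by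
  have := (isKer_gk n (k := 3 / 2) (by norm_num)).const_mul c0
  rwa [show (2 * (3 / 2) - 2 : ℝ) = 1 by norm_num] at this

lemma isKer_rieszK (n : ℕ) (a b : E3) : IsKer n 3 (rieszK a b) := by
  have := ((isKer_newtK (n + 2)).dk b).dk a; rwa [show (1 + 1 + 1 : ℝ) = 3 by norm_num] at this

lemma isKer_oseenK (n : ℕ) (a b c : E3) : IsKer n 4 (oseenK a b c) := by
  have h1 := ((isKer_heatK (n + 1)).dk a).const_mul ⟪b, c⟫
  have h2 := (isKer_rieszK (n + 1) a b).dk c; rw [show (3 + 1 : ℝ) = 4 by norm_num] at h1 h2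
  exact h1.add h2

lemma heatK_nonneg (t : ℝ) (z : E3) : 0 ≤ heatK t z := mul_nonneg c0_pos.le (ek_nonneg _ _ _)

lemma heatK_neg (t : ℝ) (z : E3) : heatK t (-z) = heatK t z := by simp [heatK, ek]

lemma integral_heatK (ht : 0 < t) : ∫ z, heatK t z = 1 := by
  simp only [heatK, ek, if_pos ht]; rw [integral_const_mul, integral_const_mul]
  have : ∀ z : E3, -‖z‖ ^ 2 / (4 * t) = -(1 / (4 * t)) * ‖z‖ ^ 2 := fun z => by ring
  simp_rw [this]; rw [GaussianFourier.integral_rexp_neg_mul_sq_norm (by positivity), c0]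
  have h3 : (Module.finrank ℝ E3 : ℝ) / 2 = 3 / 2 := by simp
  rw [h3, show Real.pi / (1 / (4 * t)) = (4 * Real.pi) * t by field_simp,
    mul_rpow (by positivity) ht.le]
  have e1 : (4 * Real.pi) ^ (-(3 / 2) : ℝ) * (4 * Real.pi) ^ (3 / 2 : ℝ) = 1 := by
    rw [← rpow_add (by positivity)]; norm_num
  have e2 : t ^ (-(3 / 2) : ℝ) * t ^ (3 / 2 : ℝ) = 1 := by rw [← rpow_add ht]; norm_num
  linear_combination (t ^ (-(3 / 2) : ℝ) * t ^ (3 / 2 : ℝ)) * e1 + e2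

lemma sum_inner_single_sq (z : E3) :
    ∑ i : Fin 3, (⟪EuclideanSpace.single i (1 : ℝ), z⟫ : ℝ) ^ 2 = ‖z‖ ^ 2 := by
  rw [EuclideanSpace.norm_sq_eq]; simp [EuclideanSpace.inner_single_left]

/-- The Laplacian of a radial kernel whose derivatives shift the parameter, as for `ek` and `gk`. -/
lemma sum_dk_dk_of_shift {F : ℝ → ℝ → E3 → ℝ} (c : ℝ)
    (h : ∀ j, k ≤ j → ∀ z, HasFDerivAt (F j t) ((-(1 / 2) * F (j + 1) t z) • innerSL ℝ z) z) (z : E3) :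
    ∑ i : Fin 3, dk (EuclideanSpace.single i 1) (dk (EuclideanSpace.single i 1)
    (fun t z => c * F k t z)) t z
    = c * (-(3 / 2) * F (k + 1) t z + ‖z‖ ^ 2 / 4 * F (k + 2) t z) := by
  have h1 : ∀ v, dk v (dk v (fun t z => c * F k t z)) t z
      = c * (-(1 / 2) * ‖v‖ ^ 2 * F (k + 1) t z + 1 / 4 * ⟪v, z⟫ ^ 2 * F (k + 2) t z) := fun v => by
    have e : (fun z => dk v (fun t z => c * F k t z) t z) = fun z => -(c / 2) * (⟪v, z⟫ * F (k + 1) t z) := by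
      ext z; unfold dk; rw [((h k le_rfl z).const_mul c).fderiv]; simp [real_inner_comm]; ring
    have h2 := (((innerSL ℝ v).hasFDerivAt (x := z)).mul (h (k + 1) (by linarith) z)).const_mul (-(c / 2))
    have e2 : dk v (dk v (fun t z => c * F k t z)) t z = fderiv ℝ (fun z => dk v (fun t z => c * F k t z) t z) z v := rfl
    rw [e2, e]; refine (congrArg (· v) h2.fderiv).trans ?_
    simp [real_inner_comm, show k + 1 + 1 = k + 2 by ring]; ring
  simp_rw [h1]
  rw [← mul_sum, sum_add_distrib, ← sum_mul, ← sum_mul, ← mul_sum, ← mul_sum, sum_inner_single_sq]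
  congr 1; simp; ring

/-- The heat equation for the heat kernel. -/
lemma hasDerivAt_heatK (ht : 0 < t) (z : E3) : HasDerivAt (fun t => heatK t z)
    (∑ i : Fin 3, dk (EuclideanSpace.single i 1) (dk (EuclideanSpace.single i 1) heatK) t z) t := by
  refine ((hasDerivAt_ek (3 / 2) ht z).const_mul c0).congr_deriv ?_; unfold heatK
  rw [sum_dk_dk_of_shift c0 fun j _ => hasFDerivAt_ek j t]

lemma sum_rieszK (ht : 0 < t) (z : E3) :
    ∑ i : Fin 3, rieszK (EuclideanSpace.single i 1) (EuclideanSpace.single i 1) t z = -heatK t z := by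
  unfold rieszK newtK heatK
  rw [sum_dk_dk_of_shift (F := gk) c0 (fun j hj => hasFDerivAt_gk (by linarith) t), gk_recurrence (by simp) ht]
  ring

lemma hasDerivAt_newtK (ht : 0 < t) (z : E3) :
    HasDerivAt (fun t => newtK t z) (-heatK t z) t :=
  ((hasDerivAt_gk (by norm_num) ht z).const_mul c0).congr_deriv (by simp [heatK])

lemma dk_comm (h : IsKer 3 m K) (a b : E3) :
    dk a (dk b K) = dk b (dk a K) := by
  ext τ z; have hc := h.contDiff τ
  have hd := (hc.fderiv_right (m := 1) (by norm_num)).differentiable (by simp) z; unfold dk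
  rw [fderiv_clm_apply hd (differentiableAt_const _), fderiv_clm_apply hd (differentiableAt_const _)]
  simpa using (hc.contDiffAt.isSymmSndFDerivAt (by simp)) a b

/-! ### Convolution operators and their bounds -/

lemma integrable_of_lintegral_le {α : Type*} [MeasurableSpace α] {μ : Measure α} {F g : α → ℝ}
    (hF : AEStronglyMeasurable F μ) (hD : 0 ≤ D) (hB : 0 ≤ B)
    (hFg : ∀ᵐ a ∂μ, |F a| ≤ D * g a) (hg : ∫⁻ a, ofReal (g a) ∂μ ≤ ofReal B) :
    Integrable F μ ∧ ∫ a, |F a| ∂μ ≤ D * B := by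
  have h1 : ∫⁻ a, ‖F a‖ₑ ∂μ ≤ ofReal (D * B) := by
    calc ∫⁻ a, ‖F a‖ₑ ∂μ ≤ ∫⁻ a, ofReal D * ofReal (g a) ∂μ := by
          refine lintegral_mono_ae ?_; filter_upwards [hFg] with a ha
          rw [← ofReal_mul hD, ← ofReal_norm]; gcongr; exact ha
      _ ≤ _ := by rw [lintegral_const_mul' _ _ ofReal_ne_top, ofReal_mul hD]; gcongr
  refine ⟨⟨hF, h1.trans_lt ENNReal.ofReal_lt_top⟩, ?_⟩
  have h2 : ∫ a, |F a| ∂μ = ∫ a, ‖F a‖ ∂μ := rfl; rw [h2, integral_norm_eq_lintegral_enorm hF]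
  exact ENNReal.toReal_le_of_le_ofReal (by positivity) h1

/-- The space-time convolution `∫₀^∞ ∫ K (t - s, x - y) f (s, y) dy ds` of a kernel vanishing for
negative times. -/
noncomputable def duh (K : ℝ → E3 → ℝ) (f : E4 → ℝ) (t : ℝ) (x : E3) : ℝ :=
  ∫ z in posTime, K (t - z.1) (x - z.2) * f z

/-- The convolution `∫ K (τ, x - y) f (y) dy` at a fixed time. -/
noncomputable def cnv (K : ℝ → E3 → ℝ) (f : E3 → ℝ) (τ : ℝ) (x : E3) : ℝ :=
  ∫ y, K τ (x - y) * f y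

lemma IsKer.measurable_sub (hK : IsKer n m K) (τ : ℝ) (x : E3) :
    Measurable fun y => K τ (x - y) :=
  hK.measurable.comp (f := fun y : E3 => (τ, x - y)) (by fun_prop)

lemma IsKer.measurable_sub_prod (hK : IsKer n m K) (t : ℝ) (x : E3) :
    Measurable fun z : E4 => K (t - z.1) (x - z.2) :=
  hK.measurable.comp (f := fun z : E4 => (t - z.1, x - z.2)) (by fun_prop)

lemma measurable_duh (hK : IsKer n m K) {f : E4 → ℝ}
    (hf : Measurable f) : Measurable fun p : E4 => duh K f p.1 p.2 := by
  refine StronglyMeasurable.measurable (StronglyMeasurable.integral_prod_right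

    ?_)
  apply Measurable.stronglyMeasurable
  exact (hK.measurable.comp (f := fun q : E4 × E4 => (q.1.1 - q.2.1, q.1.2 - q.2.2))
    (by fun_prop)).mul (hf.comp measurable_snd)

lemma measurable_cnv (hK : IsKer n m K) {f : ℝ → E3 → ℝ}
    (hf : Measurable fun p : E4 => f p.1 p.2) (g : ℝ → ℝ) (hg : Measurable g) :
    Measurable fun p : E4 => cnv K (f p.1) (g p.1) p.2 := by
  refine StronglyMeasurable.measurable (StronglyMeasurable.integral_prod_right ?_)
  apply Measurable.stronglyMeasurable
  exact (hK.measurable.comp (f := fun q : E4 × E3 => (g q.1.1, q.1.2 - q.2))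
    (by fun_prop)).mul (hf.comp (f := fun q : E4 × E3 => (q.1.1, q.2)) (by fun_prop))

/-- Parabolic kernels of order `m > 3` act on functions `O(|y|^(-b))`, at a fixed time. -/
lemma exists_cnv_bound (hK : IsKer 0 m K) (hm : 3 < m) (hb0 : 0 ≤ b) (hb : b < 3) :
    ∃ C : ℝ, 0 < C ∧ ∀ (M : ℝ) (f : E3 → ℝ), 0 ≤ M → Measurable f →
    (∀ᵐ y, |f y| ≤ M * ‖y‖ ^ (-b)) → ∀ τ : ℝ, 0 < τ → ∀ x : E3,
    Integrable (fun y => K τ (x - y) * f y) ∧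
    ∫ y, |K τ (x - y) * f y| ≤ C * M * (τ ^ ((3 - m) / 2) * (‖x‖ + √τ) ^ (-b)) := by
  obtain ⟨C, hC, H⟩ := exists_lintegral_pk_rpow hm hb0 hb; obtain ⟨D, hD, HK⟩ := hK.bound
  refine ⟨(D + 1) * C, by positivity, fun M f hM hf hfb τ hτ x => ?_⟩
  have := integrable_of_lintegral_le (D := (D + 1) * M)
    (F := fun y => K τ (x - y) * f y) ((hK.measurable_sub τ x).mul hf).aestronglyMeasurable
    (by positivity) (by positivity) ?_ (H τ hτ x)
  · refine ⟨this.1, this.2.trans_eq (by ring)⟩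
  · filter_upwards [hfb] with y hy
    rw [abs_mul]
    calc _ ≤ (D * pk m τ (x - y)) * (M * ‖y‖ ^ (-b)) :=
        mul_le_mul (HK τ _) hy (abs_nonneg _) (mul_nonneg hD (pk_nonneg _ _ _))
      _ = D * M * (pk m τ (x - y) * ‖y‖ ^ (-b)) := by ring
      _ ≤ _ := by have := pk_nonneg m τ (x - y); gcongr; linarith

/-- The estimate `exists_lintegral_pk_wtF` for kernels acting on sources bounded by `wtF`. -/
lemma exists_duh_bound (hK : IsKer 0 k K) (hk : 4 ≤ k) (hk5 : k < 5) (hη0 : 0 < η) (hη1 : η < 1) :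
    ∃ C : ℝ, 0 < C ∧ ∀ (M : ℝ) (f : E4 → ℝ), 0 ≤ M → Measurable f →
    (∀ᵐ z ∂μ₊, |f z| ≤ M * wtF η z.1 z.2) →
    ∀ t : ℝ, 0 < t → ∀ x : E3, x ≠ 0 → Integrable (fun z => K (t - z.1) (x - z.2) * f z) μ₊ ∧
    ∫ z in posTime, |K (t - z.1) (x - z.2) * f z|
    ≤ C * M * ((‖x‖ + √t) ^ (-1 + η) * ‖x‖ ^ (-η - (k - 4))) ∧
    ∫ z in posTime, |K (t - z.1) (x - z.2) * f z|
    ≤ C * M * (t ^ ((5 - k) / 2) * ‖x‖ ^ (-2 : ℝ)) := by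
  obtain ⟨C, hC, H⟩ := exists_lintegral_pk_wtF hk hk5 hη0 hη1; obtain ⟨D, hD, HK⟩ := hK.bound
  refine ⟨(D + 1) * C, by positivity, fun M f hM hf hfb t ht x hx => ?_⟩
  have hae : ∀ᵐ z ∂μ₊, |K (t - z.1) (x - z.2) * f z| ≤
      ((D + 1) * M) * (pk k (t - z.1) (x - z.2) * wtF η z.1 z.2) := by
    filter_upwards [hfb] with z hz; rw [abs_mul]
    calc _ ≤ (D * pk k (t - z.1) (x - z.2)) * (M * wtF η z.1 z.2) :=
        mul_le_mul (HK _ _) hz (abs_nonneg _) (mul_nonneg hD (pk_nonneg _ _ _))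
      _ = D * M * (pk k (t - z.1) (x - z.2) * wtF η z.1 z.2) := by ring
      _ ≤ _ := by
        have := pk_nonneg k (t - z.1) (x - z.2); have := wtF_nonneg η z.1 z.2; gcongr; linarith
  have hm := ((hK.measurable_sub_prod t x).mul hf).aestronglyMeasurable (μ := μ₊)
  have h1 := integrable_of_lintegral_le hm (by positivity) (by positivity) hae (H t ht x hx).1
  have h2 := integrable_of_lintegral_le hm (by positivity) (by positivity) hae (H t ht x hx).2
  exact ⟨h1.1, h1.2.trans_eq (by ring), h2.2.trans_eq (by ring)⟩

/-- The heat semigroup is `√t` times an operator with a kernel of order `4`. -/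
lemma heatK_eq_sqrt_mul (t : ℝ) (z : E3) : heatK t z = √t * (c0 * ek 2 t z) := by
  unfold heatK ek; split_ifs with ht
  · have : √t * t ^ (-2 : ℝ) = t ^ (-(3 / 2) : ℝ) := by rw [sqrt_eq_rpow, ← rpow_add ht]; norm_num
    linear_combination (-c0 * exp (-‖z‖ ^ 2 / (4 * t))) * this
  · simp

lemma isKer_ek_two (n : ℕ) : IsKer n 4 (fun t z => c0 * ek 2 t z) := by
  have := (isKer_ek n (k := 2) (by simp)).const_mul c0
  rwa [show (2 * 2 : ℝ) = 4 by norm_num] at this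

lemma cnv_heatK_eq (f : E3 → ℝ) (t : ℝ) (x : E3) :
    cnv heatK f t x = √t * cnv (fun t z => c0 * ek 2 t z) f t x := by
  unfold cnv; rw [← integral_const_mul]; refine integral_ext fun y => ?_
  simp only [heatK_eq_sqrt_mul t]; ring

lemma exists_heat_bound (hb0 : 0 ≤ b) (hb : b < 3) :
    ∃ C : ℝ, 0 < C ∧ ∀ (M : ℝ) (f : E3 → ℝ), 0 ≤ M → Measurable f →
    (∀ᵐ y, |f y| ≤ M * ‖y‖ ^ (-b)) → ∀ t : ℝ, 0 < t → ∀ x : E3,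
    Integrable (fun y => heatK t (x - y) * f y) ∧
    ∫ y, |heatK t (x - y) * f y| ≤ C * M * (‖x‖ + √t) ^ (-b) := by
  obtain ⟨C, hC, H⟩ := exists_cnv_bound (isKer_ek_two 0) (by norm_num) hb0 hb
  refine ⟨C, hC, fun M f hM hf hfb t ht x => ?_⟩; obtain ⟨h1, h2⟩ := H M f hM hf hfb t ht x
  have e : (fun y => heatK t (x - y) * f y)
    = fun y => √t * (c0 * ek 2 t (x - y) * f y) := by ext y; rw [heatK_eq_sqrt_mul]; ring
  refine ⟨by rw [e]; exact h1.const_mul _, ?_⟩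
  have e2 : (fun y => |heatK t (x - y) * f y|) = fun y => √t * |c0 * ek 2 t (x - y) * f y| := by
    ext y; rw [heatK_eq_sqrt_mul, mul_assoc, abs_mul, abs_of_nonneg (sqrt_nonneg t)]
  rw [e2, integral_const_mul]
  calc _ ≤ √t * (C * M * (t ^ ((3 - 4) / 2 : ℝ) * (‖x‖ + √t) ^ (-b))) := by gcongr
    _ = C * M * (‖x‖ + √t) ^ (-b) * (√t * t ^ ((3 - 4) / 2 : ℝ)) := by ring
    _ = _ := by rw [sqrt_eq_rpow, ← rpow_add ht]; norm_num

lemma rpow_neg_one_le_wt (hη0 : 0 < η) (hx : x ≠ 0) : (‖x‖ + √t) ^ (-1 : ℝ) ≤ wt η t x := by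
  calc (‖x‖ + √t) ^ (-1 : ℝ) = (‖x‖ + √t) ^ (-1 + η) * (‖x‖ + √t) ^ (-η) := by
        rw [← rpow_add (by positivity)]; congr 1; ring
    _ ≤ _ := mul_le_mul_of_nonneg_left
      (rpow_le_rpow_of_nonpos (norm_pos_iff.2 hx) (by bound) (by linarith)) (by positivity)

/-! ### Scalar test functions on space-time -/

/-- Smooth compactly supported scalar functions on `ℝ × ℝ³`. -/
structure TF (ψ : E4 → ℝ) : Prop where
  smooth : ContDiff ℝ ∞ ψ
  compact : HasCompactSupport ψ

/-- Directional derivative on space-time. -/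
noncomputable def dd (v : E4) (ψ : E4 → ℝ) : E4 → ℝ := fun z => fderiv ℝ ψ z v

/-- The standard basis vectors of `ℝ³`. -/
noncomputable abbrev ei (i : Fin 3) : E3 := EuclideanSpace.single i 1

/-- The adjoint heat operator `∂ₜ + Δ` on space-time. -/
noncomputable def Lop (ψ : E4 → ℝ) : E4 → ℝ :=
  fun z => dd (1, 0) ψ z + ∑ i : Fin 3, dd (0, ei i) (dd (0, ei i) ψ) z

namespace TF
variable {ψ χ : E4 → ℝ}

protected lemma dd (h : TF ψ) (v : E4) : TF (dd v ψ) :=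
  ⟨(h.smooth.fderiv_right (m := ∞) le_rfl).clm_apply contDiff_const, h.compact.fderiv_apply (𝕜 := ℝ) v⟩

lemma add (h : TF ψ) (h' : TF χ) : TF (fun z => ψ z + χ z) :=
  ⟨h.smooth.add h'.smooth, h.compact.add h'.compact⟩

lemma const_mul (h : TF ψ) (c : ℝ) : TF (fun z => c * ψ z) :=
  ⟨contDiff_const.mul h.smooth, h.compact.mul_left⟩

lemma zero : TF (fun _ => 0) := ⟨contDiff_const, HasCompactSupport.zero⟩

lemma sum {ι : Type*} {s : Finset ι} {f : ι → E4 → ℝ} (h : ∀ i ∈ s, TF (f i)) :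
    TF (fun z => ∑ i ∈ s, f i z) := by
  classical
  induction s using Finset.induction_on with
  | empty => simpa using zero
  | insert i s hi ih =>
    simp only [Finset.sum_insert hi]; exact (h i (by simp)).add (ih fun j hj => h j (by simp [hj]))

protected lemma Lop (h : TF ψ) : TF (Lop ψ) := (h.dd _).add (TF.sum fun _ _ => (h.dd _).dd _)

lemma differentiable (h : TF ψ) : Differentiable ℝ ψ := h.smooth.differentiable (by simp)

lemma continuous (h : TF ψ) : Continuous ψ := h.smooth.continuous

lemma exists_bound (h : TF ψ) : ∃ B : ℝ, 0 ≤ B ∧ ∀ z, |ψ z| ≤ B := by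
  obtain ⟨B, hB⟩ := h.compact.exists_bound_of_continuous h.continuous
  exact ⟨B, (norm_nonneg _).trans (hB 0), hB⟩

/-- A test function vanishes outside some `[-R, R] × B_R`. -/
lemma exists_radius (h : TF ψ) : ∃ R : ℝ, 0 < R ∧ ∀ t x, R ≤ |t| ∨ R ≤ ‖x‖ → ψ (t, x) = 0 := by
  obtain ⟨R, hR0, hR⟩ := h.compact.isCompact.isBounded.subset_ball_lt 0 0
  refine ⟨R, hR0, fun t x htx => ?_⟩; by_contra hne; have := hR (subset_tsupport _ hne)
  rw [mem_ball_zero_iff, Prod.norm_mk, max_lt_iff] at this; rcases htx with h | h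
  · exact absurd this.1 (by simpa using h)
  · exact absurd this.2 (by simpa using h)

lemma dd_comm (h : TF ψ) (u v : E4) : dd u (dd v ψ) = dd v (dd u ψ) := by
  ext z; have hd := (h.smooth.fderiv_right (m := ∞) le_rfl).differentiable (by simp) z; unfold dd
  rw [fderiv_clm_apply hd (differentiableAt_const _), fderiv_clm_apply hd (differentiableAt_const _)]
  simpa using ((contDiff_infty.1 h.smooth 2).contDiffAt.isSymmSndFDerivAt (by simp)) u v

lemma dd_add (h : TF ψ) (h' : TF χ) (v : E4) : dd v (fun z => ψ z + χ z)
    = fun z => dd v ψ z + dd v χ z := by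
  ext z; unfold dd; rw [fderiv_fun_add (h.differentiable z) (h'.differentiable z)]; rfl

lemma dd_sum {ι : Type*} {s : Finset ι} {f : ι → E4 → ℝ} (h : ∀ i ∈ s, TF (f i)) (v : E4) :
    dd v (fun z => ∑ i ∈ s, f i z) = fun z => ∑ i ∈ s, dd v (f i) z := by
  ext z; unfold dd; rw [fderiv_fun_sum fun i hi => (h i hi).differentiable z]; simp

lemma dd_Lop (h : TF ψ) (v : E4) : dd v (Lop ψ) = Lop (dd v ψ) := by
  unfold Lop
  rw [dd_add (h.dd _) (TF.sum fun _ _ => (h.dd _).dd _), dd_sum fun _ _ => (h.dd _).dd _, h.dd_comm]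
  ext z; congr 1; refine sum_congr rfl fun i _ => ?_; rw [(h.dd _).dd_comm, h.dd_comm]

lemma Lop_sum {ι : Type*} {s : Finset ι} {f : ι → E4 → ℝ} (h : ∀ i ∈ s, TF (f i)) :
    Lop (fun z => ∑ i ∈ s, f i z) = fun z => ∑ i ∈ s, Lop (f i) z := by
  unfold Lop; ext z; rw [dd_sum h]; simp_rw [dd_sum h]
  simp_rw [fun i => dd_sum (f := fun j => dd (0, ei i) (f j)) (fun j hj => (h j hj).dd _) (0, ei i)]
  rw [sum_comm, ← sum_add_distrib]

lemma hasFDerivAt_slice (h : TF ψ) (t : ℝ) (x : E3) :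
    HasFDerivAt (fun y => ψ (t, y)) ((fderiv ℝ ψ (t, x)).comp (inr ℝ ℝ E3)) x :=
  (h.differentiable (t, x)).hasFDerivAt.comp x (hasFDerivAt_prodMk_right t x)

lemma hasDerivAt_time (h : TF ψ) (t : ℝ) (x : E3) :
    HasDerivAt (fun s => ψ (s, x)) (dd (1, 0) ψ (t, x)) t :=
  (h.differentiable (t, x)).hasFDerivAt.comp_hasDerivAt t
    ((hasDerivAt_id t).prodMk (hasDerivAt_const t x))

end TF

/-! ### Kernels tested against smooth functions -/

/-- The kernel `K` tested against `ψ` at time lag `σ`: `∫ K (σ, x - y) ψ (s + σ, x) dx`. -/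
noncomputable def pair (K : ℝ → E3 → ℝ) (ψ : E4 → ℝ) (σ s : ℝ) (y : E3) : ℝ :=
  ∫ x, K σ (x - y) * ψ (s + σ, x)

/-- `∫_ε^∞ ∫ K (σ, x - y) ψ (s + σ, x) dx dσ`. -/
noncomputable def pairInt (K : ℝ → E3 → ℝ) (ψ : E4 → ℝ) (ε s : ℝ) (y : E3) : ℝ :=
  ∫ σ in Ioi ε, pair K ψ σ s y

section
variable {n : ℕ} {m : ℝ} {K : ℝ → E3 → ℝ} {ψ : E4 → ℝ}

lemma TF.slice_compact (h : TF ψ) (t : ℝ) : HasCompactSupport fun x => ψ (t, x) := by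
  obtain ⟨R, -, hR⟩ := h.exists_radius
  refine HasCompactSupport.intro (isCompact_closedBall (0 : E3) R) fun x hx => hR t x (Or.inr ?_)
  simp at hx; exact hx.le

lemma TF.slice_continuous (h : TF ψ) (t : ℝ) : Continuous fun x => ψ (t, x) :=
  h.continuous.comp (by fun_prop)

lemma IsKer.continuous_sub (hK : IsKer (n + 1) m K) (σ : ℝ) (y : E3) :
    Continuous fun x => K σ (x - y) := (hK.continuous σ).comp (by fun_prop)

lemma IsKer.integrable_pair (hK : IsKer (n + 1) m K) (h : TF ψ) (σ t : ℝ) (y : E3) :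
    Integrable fun x => K σ (x - y) * ψ (t, x) :=
  ((hK.continuous_sub σ y).mul (h.slice_continuous t)).integrable_of_hasCompactSupport
    (h.slice_compact t).mul_left

lemma IsKer.hasFDerivAt_sub (hK : IsKer (n + 1) m K) (σ : ℝ) (x y : E3) :
    HasFDerivAt (fun x => K σ (x - y)) (fderiv ℝ (K σ) (x - y)) x := by
  have h2 : HasFDerivAt (fun x => K σ (x - y))
      ((fderiv ℝ (K σ) (x - y)).comp (ContinuousLinearMap.id ℝ E3)) x :=
    HasFDerivAt.comp x (hK.differentiable σ (x - y)).hasFDerivAt ((hasFDerivAt_id x).sub_const y)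
  simpa using h2

lemma integral_fderiv_mul {k φ : E3 → ℝ} (hk : ContDiff ℝ 1 k) (hφ : ContDiff ℝ 1 φ) (hc : HasCompactSupport φ)
    (v : E3) : ∫ x, fderiv ℝ k x v * φ x = -∫ x, k x * fderiv ℝ φ x v := by
  have h1 : ∀ {f : E3 → ℝ}, ContDiff ℝ 1 f → Continuous fun x => fderiv ℝ f x v := fun hf =>
    (hf.continuous_fderiv one_ne_zero).clm_apply continuous_const
  rw [integral_mul_fderiv_eq_neg_fderiv_mul_of_integrable
    (((h1 hk).mul hφ.continuous).integrable_of_hasCompactSupport hc.mul_left)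
    ((hk.continuous.mul (h1 hφ)).integrable_of_hasCompactSupport (hc.fderiv_apply ℝ v).mul_left)
    ((hk.continuous.mul hφ.continuous).integrable_of_hasCompactSupport hc.mul_left)
    (fun x _ => hk.differentiable one_ne_zero x) fun x _ => hφ.differentiable one_ne_zero x, neg_neg]

/-- Integration by parts moves a spatial derivative from the kernel to the test function. -/
lemma pair_dk (hK : IsKer (n + 2) m K) (h : TF ψ) (v : E3) (σ s : ℝ) (y : E3) :
    pair (dk v K) ψ σ s y = -pair K (dd (0, v) ψ) σ s y := by
  have := integral_fderiv_mul (k := fun x => K σ (x - y)) (φ := fun x => ψ (s + σ, x))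
    (((hK.contDiff σ).of_le (by norm_num)).comp (by fun_prop))
    ((h.smooth.of_le (by simp)).comp (by fun_prop)) (h.slice_compact _) v
  simp only [(hK.hasFDerivAt_sub σ _ y).fderiv, (h.hasFDerivAt_slice _ _).fderiv] at this
  exact this

lemma pk_le_rpow (hm : 0 ≤ m) (hε : 0 < ε) (hσ : ε ≤ σ) (z : E3) : pk m σ z ≤ √ε ^ (-m) := by
  rw [pk, if_pos (hε.trans_le hσ)]
  refine rpow_le_rpow_of_nonpos (Real.sqrt_pos.2 hε) ?_ (by linarith)
  linarith [norm_nonneg z, Real.sqrt_le_sqrt hσ]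

/-- Away from `σ = 0` the kernel is bounded, so it is integrable against test functions. -/
lemma IsKer.integrable_prod (hK : IsKer n m K) (hm : 0 ≤ m) (h : TF ψ) (hε : 0 < ε) (s : ℝ)
    (y : E3) : Integrable (fun z : E4 => K z.1 (z.2 - y) * ψ (s + z.1, z.2))
    ((volume.restrict (Ioi ε)).prod volume) := by
  obtain ⟨C, hC, H⟩ := hK.bound
  have hψ : Integrable (fun z : E4 => ψ (s + z.1, z.2)) := by
    have h1 := (h.continuous.comp (Homeomorph.addLeft ((s, 0) : E4)).continuous).integrable_of_hasCompactSupport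
      (μ := volume) (h.compact.comp_homeomorph (Homeomorph.addLeft ((s, 0) : E4)))
    exact h1.congr (ae_of_all _ fun z => by simp [Prod.add_def])
  have hle : (volume.restrict (Ioi ε)).prod (volume : Measure E3) ≤ (volume : Measure E4) := by
    rw [Measure.volume_eq_prod, ← Measure.restrict_univ (μ := (volume : Measure E3)),
      Measure.prod_restrict]
    simpa using Measure.restrict_le_self
  refine (hψ.mono_measure hle).bdd_mul (c := C * √ε ^ (-m)) ?_ ?_
  · exact (hK.measurable.comp (f := fun z : E4 => (z.1, z.2 - y)) (by fun_prop)).aestronglyMeasurable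
  · have : ∀ᵐ z ∂((volume.restrict (Ioi ε)).prod (volume : Measure E3)), z.1 ∈ Ioi ε :=
      Measure.quasiMeasurePreserving_fst.ae (ae_restrict_mem measurableSet_Ioi)
    filter_upwards [this] with z hz; exact (H _ _).trans (by gcongr; exact pk_le_rpow hm hε hz.le _)

lemma IsKer.integrableOn_pair (hK : IsKer n m K) (hm : 0 ≤ m) (h : TF ψ) (hε : 0 < ε) (s : ℝ)
    (y : E3) : IntegrableOn (fun σ => pair K ψ σ s y) (Ioi ε) :=
  (hK.integrable_prod hm h hε s y).integral_prod_left

lemma pairInt_dk (hK : IsKer (n + 2) m K) (h : TF ψ) (v : E3) (ε s : ℝ) (y : E3) :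
    pairInt (dk v K) ψ ε s y = -pairInt K (dd (0, v) ψ) ε s y := by
  unfold pairInt; rw [← integral_neg]; exact integral_ext fun σ => pair_dk hK h v σ s y

/-- A kernel solving the heat equation, tested against `(∂ₜ + Δ)ψ`: only the boundary term at
`σ = ε` remains. -/
lemma pairInt_Lop (hK : IsKer 3 m K) (hm : 0 ≤ m)
    (hheat : ∀ σ, 0 < σ → ∀ z, HasDerivAt (fun σ => K σ z)
    (∑ i : Fin 3, dk (ei i) (dk (ei i) K) σ z) σ)
    (h : TF ψ) (hε : 0 < ε) (s : ℝ) (y : E3) :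
    pairInt K (Lop ψ) ε s y = -pair K ψ ε s y := by
  set D := fun σ z => ∑ i, dk (ei i) (dk (ei i) K) σ z with hD
  have hDi : ∀ i, IsKer 1 (m + 1 + 1) (dk (ei i) (dk (ei i) K)) := fun i => (hK.dk _).dk _
  have iD : ∀ i, Integrable (fun z => dk (ei i) (dk (ei i) K) z.1 (z.2 - y) * ψ (s + z.1, z.2))
    ((volume.restrict (Ioi ε)).prod volume) := fun i => (hDi i).integrable_prod (by linarith) h hε s y
  have iDs : Integrable (fun z => D z.1 (z.2 - y) * ψ (s + z.1, z.2))
      ((volume.restrict (Ioi ε)).prod volume) := by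
    simp only [hD, sum_mul]; exact integrable_finsetSum _ fun i _ => iD i
  have it := hK.integrable_prod hm (h.dd (1, 0)) hε s y
  -- the boundary by integrating the `σ`-derivative of the product first in `σ`
  have iS : Integrable (fun z => D z.1 (z.2 - y) * ψ (s + z.1, z.2)
      + K z.1 (z.2 - y) * dd (1, 0) ψ (s + z.1, z.2)) ((volume.restrict (Ioi ε)).prod volume) :=
    iDs.add it
  have hFTC : ∀ᵐ x, ∫ σ in Ioi ε, (D σ (x - y) * ψ (s + σ, x) + K σ (x - y) * dd (1, 0) ψ (s + σ, x))
      = -(K ε (x - y) * ψ (s + ε, x)) := by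
    filter_upwards [iS.prod_left_ae] with x hx; obtain ⟨R, hR0, hR⟩ := h.exists_radius
    have hlim : Tendsto (fun σ => K σ (x - y) * ψ (s + σ, x)) atTop (𝓝 0) := by
      refine tendsto_const_nhds.congr' ?_; filter_upwards [eventually_ge_atTop (R - s)] with σ hσ
      rw [hR _ _ (Or.inl ((by linarith : R ≤ s + σ).trans (le_abs_self _))), mul_zero]
    rw [integral_Ioi_of_hasDerivAt_of_tendsto' ?_ hx hlim, zero_sub]; intro σ hσ
    exact (hheat σ (hε.trans_le hσ) (x - y)).mul ((h.hasDerivAt_time (s + σ) x).comp_const_add s σ)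
  have h1 : ∫ z, (D z.1 (z.2 - y) * ψ (s + z.1, z.2) + K z.1 (z.2 - y) * dd (1, 0) ψ (s + z.1, z.2))
      ∂((volume.restrict (Ioi ε)).prod volume) = -pair K ψ ε s y := by
    rw [integral_prod_symm _ iS, integral_congr_ae hFTC, integral_neg]; rfl
  rw [integral_add iDs it, integral_prod _ iDs, integral_prod _ it] at h1
  have h2 : ∀ σ, ∫ x, D σ (x - y) * ψ (s + σ, x) = ∑ i, pair K (dd (0, ei i) (dd (0, ei i) ψ)) σ s y := fun σ => by
    simp only [hD, sum_mul]
    rw [integral_finsetSum _ fun i _ => (hDi i).integrable_pair h σ (s + σ) y]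
    refine sum_congr rfl fun i _ => ?_; have e1 := pair_dk (hK.dk (ei i)) h (ei i) σ s y
    rw [(pair_dk hK (h.dd (0, ei i)) (ei i) σ s y), neg_neg] at e1; exact e1
  have h3 : ∀ σ, pair K (Lop ψ) σ s y = (∫ x, D σ (x - y) * ψ (s + σ, x)) + pair K (dd (1, 0) ψ) σ s y := fun σ => by
    rw [h2]; unfold pair Lop; simp only [mul_add, mul_sum]
    rw [integral_add, integral_finsetSum, add_comm]
    · exact fun i _ => hK.integrable_pair ((h.dd _).dd _) σ (s + σ) y
    · exact hK.integrable_pair (h.dd _) σ (s + σ) y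
    · exact integrable_finsetSum _ fun i _ => hK.integrable_pair ((h.dd _).dd _) σ (s + σ) y
  unfold pairInt; simp_rw [h3]
  exact (integral_add iDs.integral_prod_left it.integral_prod_left).trans h1

lemma pairInt_heatK_Lop (h : TF ψ) (hε : 0 < ε) (s : ℝ) (y : E3) :
    pairInt heatK (Lop ψ) ε s y = -pair heatK ψ ε s y :=
  pairInt_Lop (isKer_heatK 3) (by norm_num) (fun _ hσ z => hasDerivAt_heatK hσ z) h hε s y

lemma pairInt_newtK_Lop (h : TF ψ) (hε : 0 < ε) (s : ℝ) (y : E3) :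
    pairInt newtK (Lop ψ) ε s y = -pair newtK ψ ε s y := pairInt_Lop (isKer_newtK 3) (by simp) (fun σ hσ z =>
      (hasDerivAt_newtK hσ z).congr_deriv (sum_rieszK hσ z).symm) h hε s y

lemma pair_rieszK (h : TF ψ) (a b : E3) (σ s : ℝ) (y : E3) :
    pair (rieszK a b) ψ σ s y = pair newtK (dd (0, b) (dd (0, a) ψ)) σ s y := by
  rw [rieszK, pair_dk ((isKer_newtK 3).dk b) h, pair_dk (isKer_newtK 3) (h.dd _), neg_neg]

lemma pair_oseenK (h : TF ψ) (a b c : E3) (σ s : ℝ) (y : E3) : pair (oseenK a b c) ψ σ s y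
    = -⟪b, c⟫ * pair heatK (dd (0, a) ψ) σ s y - pair newtK (dd (0, b) (dd (0, a) (dd (0, c) ψ))) σ s y := by
  have h1 : pair (oseenK a b c) ψ σ s y = ⟪b, c⟫ * pair (dk a heatK) ψ σ s y + pair (dk c (rieszK a b)) ψ σ s y := by
    simp only [pair, oseenK]
    rw [← integral_const_mul, ← integral_add ((((isKer_heatK 2).dk a).integrable_pair h _ _ _).const_mul _)
      (((isKer_rieszK 2 a b).dk c).integrable_pair h _ _ _)]
    exact integral_ext fun x => by ring
  rw [h1, pair_dk (isKer_heatK 2) h, pair_dk (isKer_rieszK 2 a b) h, pair_rieszK (h.dd _)]; ring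

/-- The Oseen kernel tested against `(∂ₜ + Δ)φ`: a heat term, which tends to `∂ₐφ · b` as `ε → 0`,
and a pressure term, which vanishes when `φ` is divergence free. -/
lemma sum_pairInt_oseenK (h : ∀ c, TF (φ c)) (a : E3) (j : Fin 3)  (hε : 0 < ε) (s : ℝ) (y : E3) :
    ∑ c : Fin 3, pairInt (oseenK a (ei j) (ei c)) (Lop (φ c)) ε s y
    = pair heatK (dd (0, a) (φ j)) ε s y
    + pair (rieszK a (ei j)) (fun z => ∑ c : Fin 3, dd (0, ei c) (φ c) z) ε s y := by
  have h1 : ∀ c, pairInt (oseenK a (ei j) (ei c)) (Lop (φ c)) ε s y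
      = ⟪ei j, ei c⟫ * pair heatK (dd (0, a) (φ c)) ε s y + pair (rieszK a (ei j)) (dd (0, ei c) (φ c)) ε s y := fun c => by
    have i1 := (isKer_heatK 0).integrableOn_pair (by simp) ((h c).dd (0, a)).Lop hε s y
    have hT := ((h c).dd (0, ei c)).dd (0, a)
    have i2 := (isKer_newtK 0).integrableOn_pair (by simp) (hT.dd (0, ei j)).Lop hε s y
    have e1 := pairInt_heatK_Lop ((h c).dd (0, a)) hε s y
    have e2 := pairInt_newtK_Lop (hT.dd (0, ei j)) hε s y; unfold pairInt at e1 e2 ⊢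
    simp_rw [pair_oseenK (h c).Lop, (h c).dd_Lop, ((h c).dd _).dd_Lop, hT.dd_Lop]
    rw [integral_sub (i1.const_mul _) i2, integral_const_mul, e1, e2, pair_rieszK ((h c).dd _)]
    ring
  simp_rw [h1, sum_add_distrib]; congr 1
  · simp [EuclideanSpace.inner_single_left]
  · unfold pair
    rw [← integral_finsetSum _ fun c _ => (isKer_rieszK 1 _ _).integrable_pair ((h c).dd _) _ _ _]
    simp only [mul_sum]

/-- The Oseen kernel maps into divergence free fields: its pairing with a gradient vanishes. -/
lemma sum_pair_oseenK_gradient (h : TF ψ) (a : E3) (j : Fin 3) (hσ : 0 < σ) (s : ℝ) (y : E3) :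
    ∑ c : Fin 3, pair (oseenK a (ei j) (ei c)) (dd (0, ei c) ψ) σ s y = 0 := by
  have hT := (h.dd (0, a)).dd (0, ei j)
  have e2 : ∀ c, dd (0, ei j) (dd (0, a) (dd (0, ei c) (dd (0, ei c) ψ)))
      = dd (0, ei c) (dd (0, ei c) (dd (0, ei j) (dd (0, a) ψ))) := fun c => by
    rw [((h.dd _).dd_comm (0, a) (0, ei c)), h.dd_comm (0, a) (0, ei c), ((h.dd _).dd _).dd_comm (0, ei j),
      (h.dd _).dd_comm (0, ei j)]
  have e3 : ∑ c, pair newtK (dd (0, ei c) (dd (0, ei c) (dd (0, ei j) (dd (0, a) ψ)))) σ s y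
      = -pair heatK (dd (0, ei j) (dd (0, a) ψ)) σ s y := by
    simp_rw [← pair_rieszK hT]; unfold pair
    rw [← integral_finsetSum _ fun c _ => (isKer_rieszK 1 _ _).integrable_pair hT _ _ _, ← integral_neg]
    exact integral_ext fun x => by rw [← sum_mul, sum_rieszK hσ, neg_mul]
  simp_rw [fun c => pair_oseenK (h.dd (0, ei c)) a (ei j) (ei c) σ s y, e2, sum_sub_distrib, e3]
  simp [EuclideanSpace.inner_single_left, h.dd_comm (0, a)]

end

/-! ### Weak formulations -/

lemma heatK_scaling (hε : 0 < ε) (y : E3) (G : E3 → ℝ) :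
    ∫ x, heatK ε (x - y) * G x = ∫ ξ, heatK 1 ξ * G (y + √ε • ξ) := by
  have h1 := integral_sub_right_eq_self (μ := (volume : Measure E3))
    (fun z => heatK ε z * G (z + y)) y
  simp at h1; rw [h1]
  have h2 := Measure.integral_comp_smul (volume : Measure E3) (fun z => heatK ε z * G (z + y)) (√ε)
  have hd : Module.finrank ℝ E3 = 3 := by simp
  rw [hd, abs_of_nonneg (by positivity), smul_eq_mul] at h2
  have h3 : ∀ ξ, heatK ε (√ε • ξ) = (√ε ^ 3)⁻¹ * heatK 1 ξ := fun ξ => by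
    simp only [heatK, ek, if_pos hε, if_pos one_pos, norm_smul, norm_eq_abs, abs_of_pos (Real.sqrt_pos.2 hε)]
    have e1 : ε ^ (-(3 / 2) : ℝ) = (√ε ^ 3)⁻¹ := by
      rw [rpow_neg hε.le, sqrt_eq_rpow, ← rpow_natCast, ← rpow_mul hε.le]; norm_num
    have e2 : -(√ε * ‖ξ‖) ^ 2 / (4 * ε) = -‖ξ‖ ^ 2 / (4 * 1) := by rw [mul_pow, sq_sqrt hε.le]; field_simp
    rw [e1, e2, one_rpow]; ring
  have h4 : (√ε ^ 3)⁻¹ ≠ 0 := by positivity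
  apply mul_left_cancel₀ h4; rw [← h2, ← integral_const_mul]
  refine integral_ext fun ξ => ?_; simp only [h3, add_comm y]; ring

lemma integrable_heatK (ht : 0 < t) : Integrable (heatK t) := by
  by_contra h; have := integral_heatK ht; rw [integral_undef h] at this; exact zero_ne_one this

/-- The heat kernel is an approximate identity, also with a time shift in the test function. -/
lemma tendsto_heatK_pair {g : E4 → ℝ} (hg : Continuous g) (hB : ∀ z, |g z| ≤ B) (s : ℝ) (y : E3) :
    Tendsto (fun ε => ∫ x, heatK ε (x - y) * g (s + ε, x)) (𝓝[>] 0) (𝓝 (g (s, y))) := by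
  have e : (fun ε => ∫ x, heatK ε (x - y) * g (s + ε, x)) =ᶠ[𝓝[>] 0]
      fun ε => ∫ ξ, heatK 1 ξ * g (s + ε, y + √ε • ξ) := by
    filter_upwards [self_mem_nhdsWithin] with ε hε; exact heatK_scaling hε y fun x => g (s + ε, x)
  refine Tendsto.congr' e.symm ?_
  have hlim : ∫ ξ, heatK 1 ξ * g (s, y) = g (s, y) := by
    rw [integral_mul_const, integral_heatK one_pos, one_mul]
  rw [← hlim]
  refine tendsto_integral_filter_of_dominated_convergence (fun ξ => heatK 1 ξ * B) ?_ ?_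
    ((integrable_heatK one_pos).mul_const B) ?_
  · refine .of_forall fun ε => ?_
    exact (((isKer_heatK 1).continuous 1).mul (hg.comp (by fun_prop))).aestronglyMeasurable
  · refine .of_forall fun ε => ae_of_all _ fun ξ => ?_
    rw [norm_mul, norm_eq_abs, abs_of_nonneg (heatK_nonneg _ _)]
    exact mul_le_mul_of_nonneg_left (hB _) (heatK_nonneg _ _)
  · refine ae_of_all _ fun ξ => Tendsto.const_mul _ ?_
    have hc : Continuous fun ε => g (s + ε, y + √ε • ξ) := hg.comp (by fun_prop)
    have := (hc.tendsto 0).mono_left (nhdsWithin_le_nhds (s := Ioi 0)); simpa using this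

lemma integrable_rpow_indicator (hb : b < 3) (hR : 0 < R) :
    IntegrableOn (fun x : E3 => ‖x‖ ^ (-b)) (ball 0 R) := by
  obtain ⟨C, hC, H⟩ := exists_lintegral_ball_rpow hb
  have := integrable_of_lintegral_le (F := fun x => ‖x‖ ^ (-b)) (g := fun x => ‖x‖ ^ (-b))
    (Measurable.aestronglyMeasurable (by fun_prop)) zero_le_one (by positivity)
    (ae_of_all _ fun x => by rw [one_mul, abs_of_nonneg (by positivity)]) (H R hR)
  exact this.1

lemma integrable_rpow_mul_of_bdd (hb : b < 3) {g : E4 → ℝ} (hg : Measurable g)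
    (hR : 0 < R) (hB : ∀ z, |g z| ≤ B) (hsupp : ∀ t x, R ≤ |t| ∨ R ≤ ‖x‖ → g (t, x) = 0) :
    Integrable (fun p : E4 => ‖p.2‖ ^ (-b) * g p) := by
  have h1 : Integrable ((Icc (-R) R).indicator fun _ => B) := by
    rw [integrable_indicator_iff measurableSet_Icc]; exact integrable_const B
  have h2 := (integrable_rpow_indicator hb hR).integrable_indicator Metric.isOpen_ball.measurableSet
  refine (h1.mul_prod h2).mono' (Measurable.aestronglyMeasurable (by fun_prop)) (ae_of_all _ fun p => ?_)
  by_cases hp : R ≤ |p.1| ∨ R ≤ ‖p.2‖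
  · rw [show g p = 0 from hsupp p.1 p.2 hp, mul_zero, norm_zero]
    exact mul_nonneg (indicator_nonneg (fun _ _ => ((abs_nonneg _).trans (hB p))) _)
      (indicator_nonneg (fun _ _ => by positivity) _)
  · push Not at hp
    rw [indicator_of_mem (show p.1 ∈ Icc (-R) R from abs_le.1 hp.1.le), indicator_of_mem (by simpa using hp.2), norm_mul,
      norm_eq_abs, norm_eq_abs, abs_of_nonneg (by positivity), mul_comm]
    gcongr; exact hB p

lemma TF.integrable_rpow_mul (h : TF ψ) (hb : b < 3) :
    Integrable (fun p : E4 => ‖p.2‖ ^ (-b) * ψ p) := by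
  obtain ⟨B, -, hB⟩ := h.exists_bound; obtain ⟨R, hR, hs⟩ := h.exists_radius
  exact integrable_rpow_mul_of_bdd hb h.continuous.measurable hR hB hs

section
variable {α : Type*} {s : α → ℝ} {y : α → E3} {f : α → ℝ}
  {n : ℕ} {m : ℝ} {K : ℝ → E3 → ℝ} {ψ : E4 → ℝ}

/-- Shifting the time variable by `s a` turns the truncated pairing into `pairInt`. -/
lemma integral_indicator_eq_pairInt (hK : IsKer n m K) (hm : 0 ≤ m) (h : TF ψ) (hε : 0 < ε)
    {a : α} (ha : 0 ≤ s a) :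
    ∫ p in posTime, {q : E4 × α | ε < q.1.1 - s q.2}.indicator
    (fun q => K (q.1.1 - s q.2) (q.1.2 - y q.2) * f q.2 * ψ q.1) (p, a)
    = f a * pairInt K ψ ε (s a) (y a) := by
  have h1 : ∀ p, {q : E4 × α | ε < q.1.1 - s q.2}.indicator
      (fun q => K (q.1.1 - s q.2) (q.1.2 - y q.2) * f q.2 * ψ q.1) (p, a)
      = f a * {p : E4 | ε < p.1 - s a}.indicator (fun p => K (p.1 - s a) (p.2 - y a) * ψ p) p := fun p => by
    by_cases hp : ε < p.1 - s a <;> simp [hp]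
    ring
  simp_rw [h1]; rw [integral_const_mul]; congr 1
  have hset : {p : E4 | ε < p.1 - s a} = Ioi (s a + ε) ×ˢ univ := by ext p; simp [lt_sub_iff_add_lt']
  rw [hset, setIntegral_indicator (measurableSet_Ioi.prod .univ)]
  have hset2 : posTime ∩ Ioi (s a + ε) ×ˢ univ = Ioi (s a + ε) ×ˢ univ := by
    rw [inter_eq_right]; exact prod_mono (Ioi_subset_Ioi (by linarith)) le_rfl
  have hr : (volume.restrict (Ioi (s a + ε) ×ˢ univ) : Measure E4)
      = (volume.restrict (Ioi (s a + ε))).prod volume := by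
    rw [Measure.volume_eq_prod, ← Measure.prod_restrict, Measure.restrict_univ]
  have e1 : pairInt K ψ ε (s a) (y a)
      = ∫ z, K z.1 (z.2 - y a) * ψ (s a + z.1, z.2) ∂((volume.restrict (Ioi ε)).prod volume) := by
    rw [integral_prod _ (hK.integrable_prod hm h hε (s a) (y a))]; rfl
  have hmp : MeasurePreserving (fun z : E4 => (s a + z.1, z.2))
      ((volume.restrict (Ioi ε)).prod volume) ((volume.restrict (Ioi (s a + ε))).prod volume) := by
    refine MeasurePreserving.prod ?_ (MeasurePreserving.id _)
    have := (measurePreserving_add_left (volume : Measure ℝ) (s a)).restrict_preimage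
      (s := Ioi (s a + ε)) measurableSet_Ioi
    simpa using this
  have hemb :=
    (MeasurableEquiv.prodCongr (MeasurableEquiv.addLeft (s a)) (MeasurableEquiv.refl E3)).measurableEmbedding
  rw [hset2, hr, e1, ← hmp.integral_comp hemb]; simp

variable [MeasurableSpace α] {μ : Measure α}

lemma measurableSet_lag (hs : Measurable s) (ε : ℝ) :
    MeasurableSet {q : E4 × α | ε < q.1.1 - s q.2} :=
  measurableSet_lt measurable_const ((measurable_fst.comp measurable_fst).sub (hs.comp measurable_snd))

variable [SFinite μ]

lemma integrable_mul_pairInt (hs : Measurable s) (hs0 : ∀ᵐ a ∂μ, 0 ≤ s a)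
    (hK : IsKer n m K) (hm : 0 ≤ m) (h : TF ψ)
    (hF : Integrable (fun q : E4 × α => K (q.1.1 - s q.2) (q.1.2 - y q.2) * f q.2 * ψ q.1)
    (μ₊.prod μ)) (hε : 0 < ε) :
    Integrable (fun a => f a * pairInt K ψ ε (s a) (y a)) μ := by
  refine (hF.indicator (measurableSet_lag hs ε)).integral_prod_right.congr ?_
  filter_upwards [hs0] with a ha; exact integral_indicator_eq_pairInt hK hm h hε ha

/-- Fubini for a kernel acting on sources `f a` placed at the points `(s a, y a)`, with the diagonal
`t ≤ s a + ε` removed and `ε → 0`. -/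
lemma tendsto_integral_pairInt (hs : Measurable s) (hs0 : ∀ᵐ a ∂μ, 0 ≤ s a)
    (hK : IsKer n m K) (hm : 0 ≤ m) (h : TF ψ)
    (hF : Integrable (fun q : E4 × α => K (q.1.1 - s q.2) (q.1.2 - y q.2) * f q.2 * ψ q.1)
      (μ₊.prod μ)) :
    Tendsto (fun ε => ∫ a, f a * pairInt K ψ ε (s a) (y a) ∂μ) (𝓝[>] 0)
      (𝓝 (∫ p in posTime, (∫ a, K (p.1 - s a) (p.2 - y a) * f a ∂μ) * ψ p)) := by
  set F : E4 × α → ℝ := fun q => K (q.1.1 - s q.2) (q.1.2 - y q.2) * f q.2 * ψ q.1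
  have hlimit : ∫ p in posTime, (∫ a, K (p.1 - s a) (p.2 - y a) * f a ∂μ) * ψ p
      = ∫ q, F q ∂(μ₊.prod μ) := by
    rw [integral_prod _ hF]; refine integral_ext fun p => ?_; simp only [F, integral_mul_const]
  have heps : (fun ε => ∫ a, f a * pairInt K ψ ε (s a) (y a) ∂μ) =ᶠ[𝓝[>] 0] fun ε =>
      ∫ q, {q : E4 × α | ε < q.1.1 - s q.2}.indicator F q ∂(μ₊.prod μ) := by
    filter_upwards [self_mem_nhdsWithin] with ε hε
    rw [integral_prod_symm _ (hF.indicator (measurableSet_lag hs ε))]; refine integral_congr_ae ?_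
    filter_upwards [hs0] with a ha; exact (integral_indicator_eq_pairInt hK hm h hε ha).symm
  refine Tendsto.congr' heps.symm ?_; rw [hlimit]
  refine tendsto_integral_filter_of_dominated_convergence (fun q => ‖F q‖) ?_ ?_ hF.norm ?_
  · exact .of_forall fun ε => (hF.indicator (measurableSet_lag hs ε)).aestronglyMeasurable
  · exact .of_forall fun ε => ae_of_all _ fun q => norm_indicator_le_norm_self _ _
  · refine ae_of_all _ fun q => ?_
    by_cases hq : 0 < q.1.1 - s q.2
    · refine tendsto_const_nhds.congr' ?_
      filter_upwards [Ioo_mem_nhdsGT hq] with ε hε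
      rw [indicator_of_mem (show q ∈ {q : E4 × α | ε < q.1.1 - s q.2} from hε.2)]
    · have : F q = 0 := by simp only [F]; rw [hK.eq_zero (not_lt.1 hq)]; simp
      rw [this]; refine tendsto_const_nhds.congr fun ε => ?_
      rw [indicator_apply_eq_zero.2 fun _ => this]

end

/-- Absolute integrability of a double integral from a pointwise bound on the inner one. -/
lemma integrable_prod_of_bound {α β : Type*} [MeasurableSpace α] [MeasurableSpace β] {μ : Measure α}
    {ν : Measure β} [SFinite μ] [SFinite ν] {F : β → α → ℝ} {G H : β → ℝ}
    (hF : AEStronglyMeasurable (fun q : β × α => F q.1 q.2) (ν.prod μ))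
    (hG : AEStronglyMeasurable G ν)
    (hb : ∀ᵐ p ∂ν, Integrable (F p) μ ∧ ∫ a, |F p a| ∂μ ≤ C * H p)
    (hi : Integrable (fun p => H p * G p) ν) :
    Integrable (fun q : β × α => F q.1 q.2 * G q.1) (ν.prod μ) := by
  have hm := hF.mul (hG.comp_quasiMeasurePreserving (Measure.quasiMeasurePreserving_fst))
  refine (integrable_prod_iff hm).2 ⟨?_, ?_⟩
  · filter_upwards [hb] with p hp using hp.1.mul_const (G p)
  · refine (hi.const_mul C).mono hm.norm.integral_prod_right' ?_
    filter_upwards [hb] with p hp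
    have e : ∫ a, ‖F p a * G p‖ ∂μ = (∫ a, |F p a| ∂μ) * |G p| := by simp_rw [norm_mul, integral_mul_const]; rfl
    change ‖∫ a, ‖F p a * G p‖ ∂μ‖ ≤ _
    rw [e, ← mul_assoc, norm_mul, norm_mul, norm_of_nonneg (integral_nonneg fun _ => abs_nonneg _), norm_eq_abs, abs_abs]
    exact mul_le_mul_of_nonneg_right (hp.2.trans (le_abs_self _)) (abs_nonneg _)

lemma ae_ne_zero : ∀ᵐ x : E3, x ≠ 0 := compl_mem_ae_iff.2 (measure_singleton (0 : E3))

lemma ae_posTime : ∀ᵐ p ∂μ₊, 0 < p.1 ∧ p.2 ≠ 0 := by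
  filter_upwards [ae_restrict_mem measurableSet_posTime,
    ae_restrict_of_ae (Measure.quasiMeasurePreserving_snd.ae ae_ne_zero)] with p hp hp2
  exact ⟨hp.1, hp2⟩

lemma integrable_rpow_mul_min (ha : a < 3) (ha2 : 1 / 2 < a) :
    Integrable (fun y : E3 => ‖y‖ ^ (-a) * min 1 (‖y‖ ^ (-(5 / 2) : ℝ))) := by
  obtain ⟨C, hC, H⟩ := exists_lintegral_compl_ball_rpow (b := a + 5 / 2) (by linarith)
  have h1 := integrable_rpow_indicator ha one_pos
  have h2 := (integrable_of_lintegral_le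
    (F := fun x => ‖x‖ ^ (-(a + 5 / 2))) (g := fun x => ‖x‖ ^ (-(a + 5 / 2)))
    (Measurable.aestronglyMeasurable (by fun_prop)) zero_le_one (by positivity)
    (ae_of_all _ fun x => by rw [one_mul, abs_of_nonneg (by positivity)]) (H 1 one_pos)).1
  refine ((h1.integrable_indicator Metric.isOpen_ball.measurableSet).add (IntegrableOn.integrable_indicator h2
      (measurableSet_le measurable_const measurable_norm))).mono'
    (Measurable.aestronglyMeasurable (by fun_prop)) (ae_of_all _ fun y => ?_)
  rw [norm_eq_abs, abs_of_nonneg (by positivity), Pi.add_apply]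
  by_cases hy : ‖y‖ < 1
  · rw [indicator_of_mem (by simpa using hy), indicator_of_notMem (by simpa using hy), add_zero]
    exact mul_le_of_le_one_right (by positivity) (min_le_left _ _)
  · rw [indicator_of_notMem (by simpa using hy), indicator_of_mem (by simpa using hy), zero_add,
      neg_add, rpow_add (by linarith)]
    gcongr; exact min_le_right _ _

/-- Heat averages of a bounded function supported in a ball decay, uniformly in time. -/
lemma exists_heatK_pairing_bound (hb0 : 0 ≤ b) (hb : b < 3) :
    ∃ C : ℝ, 0 < C ∧ ∀ (B R : ℝ) (φ : E3 → ℝ), 0 ≤ B → 0 < R → Measurable φ → (∀ x, |φ x| ≤ B) →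
    (∀ x, R ≤ ‖x‖ → φ x = 0) → ∀ ε : ℝ, 0 < ε → ∀ y : E3, y ≠ 0 →
    |∫ x, heatK ε (x - y) * φ x| ≤ C * (B * R ^ b) * ‖y‖ ^ (-b) := by
  obtain ⟨C, hC, H⟩ := exists_heat_bound hb0 hb
  refine ⟨C, hC, fun B R φ hB hR hφ hφB hφR ε hε y hy => ?_⟩
  have := H (B * R ^ b) φ (by positivity) hφ ?_ ε hε y
  · have e : ∀ x, heatK ε (x - y) = heatK ε (y - x) := fun x => by rw [← heatK_neg, neg_sub]
    simp_rw [e]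
    exact (abs_integral_le_integral_abs).trans (this.2.trans
        (mul_le_mul_of_nonneg_left (rpow_le_rpow_of_nonpos (norm_pos_iff.2 hy) (by bound)
      (by linarith)) (by positivity)))
  · filter_upwards [ae_ne_zero] with x hx
    have hx0 := norm_pos_iff.2 hx
    by_cases hxR : R ≤ ‖x‖
    · rw [hφR x hxR, abs_zero]; positivity
    · have : 1 ≤ R ^ b * ‖x‖ ^ (-b) := by
        rw [rpow_neg hx0.le, ← div_eq_mul_inv, one_le_div (by positivity)]
        exact rpow_le_rpow hx0.le (not_le.1 hxR).le hb0
      calc |φ x| ≤ B := hφB x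
        _ ≤ B * (R ^ b * ‖x‖ ^ (-b)) := le_mul_of_one_le_right hB this
        _ = _ := by ring

/-- The decay is integrable at infinity against `|y|^(-a)`, for every `a > 1/2`. -/
lemma exists_heatK_pairing_min (hB : 0 ≤ B) (hR : 0 < R) :
    ∃ C : ℝ, 0 < C ∧ ∀ (φ : E3 → ℝ), Measurable φ → (∀ x, |φ x| ≤ B) →
    (∀ x, R ≤ ‖x‖ → φ x = 0) → ∀ ε : ℝ, 0 < ε → ∀ y : E3, y ≠ 0 →
    |∫ x, heatK ε (x - y) * φ x| ≤ C * min 1 (‖y‖ ^ (-(5 / 2) : ℝ)) := by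
  obtain ⟨C1, hC1, H1⟩ := exists_heatK_pairing_bound le_rfl (by simp)
  obtain ⟨C2, hC2, H2⟩ := exists_heatK_pairing_bound (b := 5 / 2) (by norm_num) (by norm_num)
  refine ⟨C1 * (B + 1) + C2 * ((B + 1) * R ^ (5 / 2 : ℝ)), by positivity,
    fun φ hφ hφB hφR ε hε y hy => ?_⟩
  have h1 := H1 B R φ hB hR hφ hφB hφR ε hε y hy; simp at h1
  have hR0 : (0 : ℝ) ≤ R ^ (5 / 2 : ℝ) := by positivity
  rcases min_cases 1 (‖y‖ ^ (-(5 / 2) : ℝ)) with ⟨h, -⟩ | ⟨h, -⟩ <;> rw [h]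
  · refine h1.trans ?_
    have : 0 ≤ C2 * ((B + 1) * R ^ (5 / 2 : ℝ)) := by positivity
    nlinarith
  · refine (H2 B R φ hB hR hφ hφB hφR ε hε y hy).trans (mul_le_mul_of_nonneg_right ?_ (by positivity))
    have : 0 ≤ C1 * (B + 1) := by positivity
    linarith [mul_nonneg hC2.le hR0]

/-- Heat averages of a continuous function, integrated against sources `f a` placed at `(s a, y a)`. -/
lemma tendsto_integral_mul_pair_heatK {α : Type*} [MeasurableSpace α] {μ : Measure α} {s : α → ℝ} {y : α → E3}
    {f D : α → ℝ} (hs : Measurable s) (hy : Measurable y) (hf : Measurable f) {g : E4 → ℝ} (hg : Continuous g)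
    (hR : 0 < R) (hB : ∀ z, |g z| ≤ B) (hgR : ∀ t x, R ≤ ‖x‖ → g (t, x) = 0) (hD : Integrable D μ)
    (h : ∀ᵐ a ∂μ, y a ≠ 0 ∧ (|f a| * min 1 (‖y a‖ ^ (-(5 / 2) : ℝ)) ≤ D a ∨ ∀ t x, s a < t → g (t, x) = 0)) :
    (∀ ε, 0 < ε → Integrable (fun a => f a * pair heatK g ε (s a) (y a)) μ) ∧
    Tendsto (fun ε => ∫ a, f a * pair heatK g ε (s a) (y a) ∂μ) (𝓝[>] 0) (𝓝 (∫ a, f a * g (s a, y a) ∂μ)) := by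
  obtain ⟨C, hC, HC⟩ := exists_heatK_pairing_min ((abs_nonneg _).trans (hB 0)) hR
  have hm : ∀ ε, AEStronglyMeasurable (fun a => f a * pair heatK g ε (s a) (y a)) μ := fun ε => by
    refine (hf.mul (StronglyMeasurable.integral_prod_right (Measurable.stronglyMeasurable ?_)).measurable).aestronglyMeasurable
    exact ((isKer_heatK 0).measurable.comp (f := fun q : α × E3 => (ε, q.2 - y q.1)) (by fun_prop)).mul
      (hg.measurable.comp (by fun_prop))
  have hb : ∀ ε, 0 < ε → ∀ᵐ a ∂μ, ‖f a * pair heatK g ε (s a) (y a)‖ ≤ C * |D a| := fun ε hε => by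
    filter_upwards [h] with a ⟨h0, h1⟩; rw [norm_mul, norm_eq_abs, norm_eq_abs]; unfold pair
    rcases h1 with h1 | h1
    · calc _ ≤ |f a| * (C * min 1 (‖y a‖ ^ (-(5 / 2) : ℝ))) := by
            gcongr; exact HC _ (hg.comp (by fun_prop)).measurable (fun x => hB _) (fun x => hgR _ x) ε hε _ h0
        _ = C * (|f a| * min 1 (‖y a‖ ^ (-(5 / 2) : ℝ))) := by ring
        _ ≤ _ := by gcongr; exact h1.trans (le_abs_self _)
    · simp [h1 _ _ (lt_add_of_pos_right (s a) hε)]; positivity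
  refine ⟨fun ε hε => (hD.abs.const_mul C).mono' (hm ε) (hb ε hε), ?_⟩
  refine tendsto_integral_filter_of_dominated_convergence _ (.of_forall hm) ?_ (hD.abs.const_mul C) ?_
  · filter_upwards [self_mem_nhdsWithin] with ε hε using hb ε hε
  · exact ae_of_all _ fun a => (tendsto_heatK_pair hg hB (s a) (y a)).const_mul _

/-- The heat extension of `v`, tested against `(∂ₜ + Δ)ψ`. -/
lemma integral_cnv_heatK_mul_Lop (hM : 0 ≤ M) (hv : Measurable v)
    (hvM : ∀ᵐ y, |v y| ≤ M * ‖y‖ ^ (-1 : ℝ)) (h : TF ψ) :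
    Integrable (fun p : E4 => cnv heatK v p.1 p.2 * Lop ψ p) μ₊ ∧
    ∫ p in posTime, cnv heatK v p.1 p.2 * Lop ψ p = -∫ y, v y * ψ (0, y) := by
  obtain ⟨C, hC, H⟩ := exists_heat_bound zero_le_one (by simp)
  have hF : Integrable (fun q : E4 × E3 => heatK (q.1.1 - 0) (q.1.2 - q.2) * v q.2 * Lop ψ q.1)
      (μ₊.prod volume) := by
    refine integrable_prod_of_bound (F := fun (p : E4) y => heatK (p.1 - 0) (p.2 - y) * v y) (C := C * M) ?_
      h.Lop.continuous.aestronglyMeasurable ?_ (h.Lop.integrable_rpow_mul (b := 1) (by simp)).integrableOn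
    · exact (((isKer_heatK 0).measurable.comp (f := fun q : E4 × E3 => (q.1.1 - 0, q.1.2 - q.2))
        (by fun_prop)).mul (hv.comp measurable_snd)).aestronglyMeasurable
    · filter_upwards [ae_posTime] with p hp; have h1 := H M v hM hv hvM p.1 hp.1 p.2; rw [sub_zero]
      exact ⟨h1.1, h1.2.trans (mul_le_mul_of_nonneg_left
        (rpow_le_rpow_of_nonpos (norm_pos_iff.2 hp.2) (by bound) (by simp)) (by positivity))⟩
  have hlim := tendsto_integral_pairInt (s := fun _ => (0 : ℝ)) (y := id)
    measurable_const (ae_of_all _ fun _ => le_rfl) (isKer_heatK 0) (by simp) h.Lop hF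
  refine ⟨?_, ?_⟩
  · refine hF.integral_prod_left.congr (ae_of_all _ fun p => ?_)
    simp only [sub_zero, integral_mul_const]; rfl
  obtain ⟨B, hB0, hB⟩ := h.exists_bound; obtain ⟨R, hR, hRs⟩ := h.exists_radius
  have h2 := (tendsto_integral_mul_pair_heatK (s := fun _ => 0) (y := id) measurable_const measurable_id hv h.continuous
    hR hB (fun t x hx => hRs t x (Or.inr hx)) ((integrable_rpow_mul_min (a := 1) (by simp) (by norm_num)).const_mul M) (by
      filter_upwards [hvM, ae_ne_zero] with y hy hy0
      rw [← mul_assoc]; exact ⟨hy0, Or.inl (mul_le_mul_of_nonneg_right hy (by positivity))⟩)).2.neg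
  have e := tendsto_nhds_unique hlim (h2.congr' ?_)
  · simp only [sub_zero, id] at e; exact e
  · filter_upwards [self_mem_nhdsWithin] with ε hε; simp_rw [pairInt_heatK_Lop h hε, mul_neg, integral_neg]

/-! ### The Duhamel term and the heat flow as distributions -/

/-- Order `4`: the first bound closes the fixed point argument, the second one tends to `0` with `t`. -/
lemma exists_duh_bound_four (hK : IsKer 0 4 K) (hη0 : 0 < η) (hη1 : η < 1) :
    ∃ C : ℝ, 0 < C ∧ ∀ (M : ℝ) (f : E4 → ℝ), 0 ≤ M → Measurable f →
    (∀ᵐ z ∂μ₊, |f z| ≤ M * wtF η z.1 z.2) →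
    ∀ t : ℝ, 0 < t → ∀ x : E3, x ≠ 0 → Integrable (fun z => K (t - z.1) (x - z.2) * f z) μ₊ ∧
    ∫ z in posTime, |K (t - z.1) (x - z.2) * f z| ≤ C * M * wt η t x ∧
    ∫ z in posTime, |K (t - z.1) (x - z.2) * f z| ≤ C * M * (√t * ‖x‖ ^ (-2 : ℝ)) := by
  obtain ⟨C, hC, H⟩ := exists_duh_bound hK le_rfl (by norm_num) hη0 hη1
  refine ⟨C, hC, fun M f hM hf hfb t ht x hx => ?_⟩; have := H M f hM hf hfb t ht x hx
  rw [show -η - (4 - 4) = -η by ring, show ((5 : ℝ) - 4) / 2 = 1 / 2 by norm_num,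
    ← sqrt_eq_rpow] at this
  exact this

lemma integrable_rpow_mul_slice (hb : b < 3) (hg : Continuous g)
    (hgc : HasCompactSupport g) : Integrable (fun x : E3 => ‖x‖ ^ (-b) * g x) := by
  obtain ⟨B, hB⟩ := hgc.exists_bound_of_continuous hg
  obtain ⟨R, hR0, hR⟩ := hgc.isCompact.isBounded.subset_ball_lt 0 0
  refine (((integrable_rpow_indicator hb hR0).integrable_indicator
      Metric.isOpen_ball.measurableSet).const_mul B).mono'
    (Measurable.aestronglyMeasurable (by fun_prop)) (ae_of_all _ fun x => ?_)
  by_cases hx : x ∈ ball (0 : E3) R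
  · rw [indicator_of_mem hx, norm_mul, norm_eq_abs, abs_of_nonneg (by positivity), mul_comm]
    gcongr; exact hB x
  · rw [indicator_of_notMem hx, image_eq_zero_of_notMem_tsupport fun h => hx (hR h)]
    simp

section duhamel
variable {η M : ℝ} {f : E4 → ℝ}

lemma integrable_duh_test (hK : IsKer 0 4 K) (hη0 : 0 < η) (hη1 : η < 1) (hM : 0 ≤ M)
    (hf : Measurable f) (hfb : ∀ᵐ z ∂μ₊, |f z| ≤ M * wtF η z.1 z.2)
    (h : TF ψ) :
    Integrable (fun q : E4 × E4 => K (q.1.1 - q.2.1) (q.1.2 - q.2.2) * f q.2 * ψ q.1)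
    (μ₊.prod μ₊) := by
  obtain ⟨C, hC, H⟩ := exists_duh_bound_four hK hη0 hη1
  refine integrable_prod_of_bound (F := fun (p z : E4) => K (p.1 - z.1) (p.2 - z.2) * f z)
    (C := C * M) ?_ h.continuous.aestronglyMeasurable ?_ (h.integrable_rpow_mul (b := 1) (by simp)).integrableOn
  · exact ((hK.measurable.comp (f := fun q : E4 × E4 => (q.1.1 - q.2.1, q.1.2 - q.2.2))
      (by fun_prop)).mul (hf.comp measurable_snd)).aestronglyMeasurable
  · filter_upwards [ae_posTime] with p hp
    obtain ⟨h1, h2, -⟩ := H M f hM hf hfb p.1 hp.1 p.2 hp.2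
    exact ⟨h1, h2.trans (by gcongr; exact wt_le_rpow hη0 hη1 _ _)⟩

lemma integrable_duh_slice (hK : IsKer 0 4 K) (hη0 : 0 < η) (hη1 : η < 1)
    (hM : 0 ≤ M) (hf : Measurable f)
    (hfb : ∀ᵐ z ∂μ₊, |f z| ≤ M * wtF η z.1 z.2)
    (hg : Continuous g) (hgc : HasCompactSupport g) (ht : 0 < t) :
    Integrable (fun q : E3 × E4 => K (t - q.2.1) (q.1 - q.2.2) * f q.2 * g q.1)
    (volume.prod μ₊) := by
  obtain ⟨C, hC, H⟩ := exists_duh_bound_four hK hη0 hη1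
  refine integrable_prod_of_bound (F := fun (x : E3) (z : E4) => K (t - z.1) (x - z.2) * f z)
    (C := C * M) ?_ hg.aestronglyMeasurable ?_ (integrable_rpow_mul_slice (b := 1) (by simp) hg hgc)
  · exact ((hK.measurable.comp (f := fun q : E3 × E4 => (t - q.2.1, q.1 - q.2.2))
      (by fun_prop)).mul (hf.comp measurable_snd)).aestronglyMeasurable
  · filter_upwards [ae_ne_zero] with x hx
    obtain ⟨h1, h2, -⟩ := H M f hM hf hfb t ht x hx
    exact ⟨h1, h2.trans (by gcongr; exact wt_le_rpow hη0 hη1 _ _)⟩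

lemma integrable_mul_pair_heatK (hη0 : 0 < η) (hη1 : η < 1) (hM : 0 ≤ M)
    (hf : Measurable f) (hfb : ∀ᵐ z ∂μ₊, |f z| ≤ M * wtF η z.1 z.2)
    (h : TF ψ) :
    (∀ ε : ℝ, 0 < ε → Integrable (fun z => f z * pair heatK ψ ε z.1 z.2) μ₊) ∧
    Tendsto (fun ε => ∫ z in posTime, f z * pair heatK ψ ε z.1 z.2) (𝓝[>] 0)
    (𝓝 (∫ z in posTime, f z * ψ z)) := by
  obtain ⟨B, hB0, hB⟩ := h.exists_bound; obtain ⟨R, hR, hRs⟩ := h.exists_radius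
  refine tendsto_integral_mul_pair_heatK (D := fun z => M * ((Icc 0 R).indicator (fun _ => (1 : ℝ)) z.1
    * (‖z.2‖ ^ (-2 : ℝ) * min 1 (‖z.2‖ ^ (-(5 / 2) : ℝ))))) measurable_fst measurable_snd hf h.continuous hR hB
    (fun t x hx => hRs t x (Or.inr hx)) ?_ ?_
  · refine Integrable.integrableOn (Integrable.const_mul (Integrable.mul_prod ?_
      (integrable_rpow_mul_min (by norm_num) (by norm_num))) _)
    rw [integrable_indicator_iff measurableSet_Icc]; exact integrable_const 1
  · filter_upwards [hfb, ae_posTime] with z hz hz0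
    have hfz := hz.trans (mul_le_mul_of_nonneg_left (wtF_le_rpow hη0 hη1 _ _) hM)
    refine ⟨hz0.2, (le_or_gt z.1 R).imp (fun hzR => ?_) fun hzR t x ht =>
      hRs _ _ (Or.inl ((hzR.trans ht).le.trans (le_abs_self _)))⟩
    rw [indicator_of_mem (show z.1 ∈ Icc 0 R from ⟨hz0.1.le, hzR⟩), one_mul, ← mul_assoc]; gcongr

/-- The Duhamel term with the Oseen kernel, tested against `(∂ₜ + Δ)φ`: up to the source term, it is
the limit of the source tested against smooth approximations of the pressure operator applied to
`div φ`. -/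
lemma tendsto_integral_rieszK (hη0 : 0 < η) (hη1 : η < 1) (hM : 0 ≤ M)
    (hf : Measurable f) (hfb : ∀ᵐ z ∂μ₊, |f z| ≤ M * wtF η z.1 z.2)
    (h : ∀ c, TF (φ c)) (i j : Fin 3) :
    (∀ c, Integrable (fun p => duh (oseenK (ei i) (ei j) (ei c)) f p.1 p.2 * Lop (φ c) p) μ₊) ∧
    Tendsto (fun ε => ∫ z in posTime, f z * pair (rieszK (ei i) (ei j))
    (fun z => ∑ c : Fin 3, dd (0, ei c) (φ c) z) ε z.1 z.2) (𝓝[>] 0)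
    (𝓝 ((∑ c : Fin 3, ∫ p in posTime, duh (oseenK (ei i) (ei j) (ei c)) f p.1 p.2 * Lop (φ c) p)
    - ∫ z in posTime, f z * dd (0, ei i) (φ j) z)) := by
  have hK : ∀ c, IsKer 0 4 (oseenK (ei i) (ei j) (ei c)) := fun c => isKer_oseenK 0 _ _ _
  have hF := fun c => integrable_duh_test (hK c) hη0 hη1 hM hf hfb (h c).Lop
  have hs0 : ∀ᵐ z ∂μ₊, 0 ≤ z.1 := by filter_upwards [ae_posTime] with z hz using hz.1.le
  refine ⟨fun c => ?_, ?_⟩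
  · refine (hF c).integral_prod_left.congr (ae_of_all _ fun p => ?_)
    simp only [integral_mul_const]; rfl
  have h1 := fun c => tendsto_integral_pairInt measurable_fst hs0 (hK c) (by simp) (h c).Lop (hF c)
  obtain ⟨g1, g2⟩ := integrable_mul_pair_heatK hη0 hη1 hM hf hfb ((h j).dd (0, ei i))
  refine ((tendsto_finsetSum Finset.univ fun c _ => h1 c).sub g2).congr' ?_
  filter_upwards [self_mem_nhdsWithin] with ε hε
  have hi := fun c => integrable_mul_pairInt measurable_fst hs0 (hK c) (by simp) (h c).Lop (hF c) hε
  rw [← integral_finsetSum _ fun c _ => hi c, ← integral_sub (integrable_finsetSum _ fun c _ => hi c)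
    (g1 ε hε)]
  refine integral_ext fun z => ?_; rw [← mul_sum, sum_pairInt_oseenK h (ei i) j hε]; ring

/-- The Duhamel term with the Oseen kernel is divergence free. -/
lemma sum_integral_duh_gradient (hη0 : 0 < η) (hη1 : η < 1) (hM : 0 ≤ M)
    (hf : Measurable f) (hfb : ∀ᵐ z ∂μ₊, |f z| ≤ M * wtF η z.1 z.2)
    (h : TF ψ) (i j : Fin 3) (ht : 0 < t) :
    ∑ c : Fin 3, ∫ x, duh (oseenK (ei i) (ei j) (ei c)) f t x * dd (0, ei c) ψ (t, x) = 0 := by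
  have hF := fun c => integrable_duh_slice (isKer_oseenK 0 (ei i) (ei j) (ei c)) hη0 hη1 hM hf hfb
    ((h.dd (0, ei c)).slice_continuous t) ((h.dd (0, ei c)).slice_compact t) ht
  have h1 : ∀ c, ∫ x, duh (oseenK (ei i) (ei j) (ei c)) f t x * dd (0, ei c) ψ (t, x)
      = ∫ z in posTime, f z * pair (oseenK (ei i) (ei j) (ei c)) (dd (0, ei c) ψ) (t - z.1) z.1 z.2 := fun c => by
    have e1 : ∀ x, duh (oseenK (ei i) (ei j) (ei c)) f t x * dd (0, ei c) ψ (t, x)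
      = ∫ z in posTime, oseenK (ei i) (ei j) (ei c) (t - z.1) (x - z.2) * f z
        * dd (0, ei c) ψ (t, x) := fun x => by rw [integral_mul_const]; rfl
    simp_rw [e1]; rw [integral_integral_swap (hF c)]
    refine integral_ext fun z => ?_; simp only [pair]; rw [← integral_const_mul]
    refine integral_ext fun x => ?_; simp; ring
  have h2 : ∀ c, Integrable (fun z => f z * pair (oseenK (ei i) (ei j) (ei c))
      (dd (0, ei c) ψ) (t - z.1) z.1 z.2) μ₊ := fun c => by
    refine (hF c).integral_prod_right.congr (ae_of_all _ fun z => ?_); simp only [pair]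
    rw [← integral_const_mul]; refine integral_ext fun x => ?_; simp; ring
  simp_rw [h1]; rw [← integral_finsetSum _ fun c _ => h2 c]
  refine integral_eq_zero_of_ae (ae_of_all _ fun z => ?_); simp only [← mul_sum]
  rcases le_or_gt (t - z.1) 0 with hz | hz
  · have : ∀ c, pair (oseenK (ei i) (ei j) (ei c)) (dd (0, ei c) ψ) (t - z.1) z.1 z.2 = 0 := fun c => by
      unfold pair; simp [(isKer_oseenK 0 (ei i) (ei j) (ei c)).eq_zero hz]
    simp [this]
  · rw [sum_pair_oseenK_gradient h (ei i) j hz]; simp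

lemma integrable_duh_mul (hK : IsKer 0 4 K) (hη0 : 0 < η) (hη1 : η < 1)
    (hM : 0 ≤ M) (hf : Measurable f)
    (hfb : ∀ᵐ z ∂μ₊, |f z| ≤ M * wtF η z.1 z.2)
    (hg : Continuous g) (hgc : HasCompactSupport g) (ht : 0 < t) :
    Integrable (fun x => duh K f t x * g x) := by
  refine (integrable_duh_slice hK hη0 hη1 hM hf hfb hg hgc ht).integral_prod_left.congr
    (ae_of_all _ fun x => ?_)
  simp only [integral_mul_const]; rfl

lemma tendsto_integral_duh (hK : IsKer 0 4 K) (hη0 : 0 < η) (hη1 : η < 1)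
    (hM : 0 ≤ M) (hf : Measurable f)
    (hfb : ∀ᵐ z ∂μ₊, |f z| ≤ M * wtF η z.1 z.2)
    (hg : Continuous g) (hgc : HasCompactSupport g) :
    Tendsto (fun t => ∫ x, duh K f t x * g x) (𝓝[>] 0) (𝓝 0) := by
  obtain ⟨C, hC, H⟩ := exists_duh_bound_four hK hη0 hη1
  have hlim : Tendsto (fun t => C * M * √t * ∫ x, |‖x‖ ^ (-2 : ℝ) * g x|) (𝓝[>] 0) (𝓝 0) := by
    have : Continuous fun t => C * M * √t * ∫ x, |‖x‖ ^ (-2 : ℝ) * g x| := by fun_prop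
    have := (this.tendsto 0).mono_left (nhdsWithin_le_nhds (s := Ioi 0)); simpa using this
  refine squeeze_zero_norm' ?_ hlim; filter_upwards [self_mem_nhdsWithin] with t ht
  rw [← integral_const_mul]
  refine norm_integral_le_of_norm_le ((integrable_rpow_mul_slice (b := 2) (by norm_num) hg hgc).abs.const_mul _) ?_
  filter_upwards [ae_ne_zero] with x hx
  rw [norm_mul, abs_mul, abs_of_nonneg (by positivity : 0 ≤ ‖x‖ ^ (-2 : ℝ))]
  have h2 := abs_integral_le_integral_abs.trans ((H M f hM hf hfb t ht x hx).2.2)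
  calc _ ≤ (C * M * (√t * ‖x‖ ^ (-2 : ℝ))) * |g x| := mul_le_mul_of_nonneg_right h2 (abs_nonneg _)
    _ = _ := by ring

end duhamel

section heat
variable {M : ℝ} {v : E3 → ℝ}

lemma integrable_heat_slice (hM : 0 ≤ M) (hv : Measurable v) (hvM : ∀ᵐ y, |v y| ≤ M * ‖y‖ ^ (-1 : ℝ))
    (hg : Continuous g) (hgc : HasCompactSupport g) (ht : 0 < t) :
    Integrable (fun q : E3 × E3 => heatK t (q.1 - q.2) * v q.2 * g q.1) (volume.prod volume) := by
  obtain ⟨C, hC, H⟩ := exists_heat_bound zero_le_one (by simp)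
  refine integrable_prod_of_bound (F := fun (x y : E3) => heatK t (x - y) * v y)
    (C := C * M) ?_ hg.aestronglyMeasurable ?_ (integrable_rpow_mul_slice (b := 1) (by simp) hg hgc)
  · exact (((isKer_heatK 0).measurable.comp (f := fun q : E3 × E3 => (t, q.1 - q.2))
      (by fun_prop)).mul (hv.comp measurable_snd)).aestronglyMeasurable
  · filter_upwards [ae_ne_zero] with x hx
    obtain ⟨h1, h2⟩ := H M v hM hv hvM t ht x
    exact ⟨h1, h2.trans (mul_le_mul_of_nonneg_left
      (rpow_le_rpow_of_nonpos (norm_pos_iff.2 hx) (by bound)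
      (by simp)) (by positivity))⟩

lemma integrable_cnv_heatK_mul (hM : 0 ≤ M) (hv : Measurable v)
    (hvM : ∀ᵐ y, |v y| ≤ M * ‖y‖ ^ (-1 : ℝ)) (hg : Continuous g)
    (hgc : HasCompactSupport g) (ht : 0 < t) :
    Integrable (fun x => cnv heatK v t x * g x) := by
  refine (integrable_heat_slice hM hv hvM hg hgc ht).integral_prod_left.congr
    (ae_of_all _ fun x => ?_)
  simp only [integral_mul_const]; rfl

lemma tendsto_integral_cnv_heatK (hM : 0 ≤ M) (hv : Measurable v)
    (hvM : ∀ᵐ y, |v y| ≤ M * ‖y‖ ^ (-1 : ℝ)) (hg : Continuous g)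
    (hgc : HasCompactSupport g) :
    Tendsto (fun t => ∫ x, cnv heatK v t x * g x) (𝓝[>] 0) (𝓝 (∫ x, v x * g x)) := by
  obtain ⟨B, hB⟩ := hgc.exists_bound_of_continuous hg
  obtain ⟨R, hR0, hR⟩ := hgc.isCompact.isBounded.subset_ball_lt 0 0
  refine ((tendsto_integral_mul_pair_heatK (s := fun _ => 0) (y := id) (g := fun z => g z.2) measurable_const measurable_id
    hv (hg.comp continuous_snd) hR0 (fun z => hB _) (fun t x hx => image_eq_zero_of_notMem_tsupport fun h => ?_)
    ((integrable_rpow_mul_min (a := 1) (by simp) (by norm_num)).const_mul M) ?_).2).congr' ?_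
  · have := hR h; rw [mem_ball_zero_iff] at this; exact hx.not_gt this
  · filter_upwards [hvM, ae_ne_zero] with y hy hy0
    rw [← mul_assoc]; exact ⟨hy0, Or.inl (mul_le_mul_of_nonneg_right hy (by positivity))⟩
  · filter_upwards [self_mem_nhdsWithin] with t ht; simp_rw [cnv, ← integral_mul_const]
    rw [integral_integral_swap (integrable_heat_slice hM hv hvM hg hgc ht)]
    refine integral_ext fun y => ?_; rw [pair, ← integral_const_mul]; exact integral_ext fun x => by simp; ring

end heat

/-- A test function on space is the time slice of a test function on space-time. -/
lemma exists_TF_slice {ψ : E3 → ℝ} (hψ : ContDiff ℝ ∞ ψ) (hc : HasCompactSupport ψ) (t : ℝ) :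
    ∃ χ : E4 → ℝ, TF χ ∧ (∀ x, χ (t, x) = ψ x) ∧ ∀ x v, dd (0, v) χ (t, x) = fderiv ℝ ψ x v := by
  let b : ContDiffBump t := ⟨1, 2, one_pos, by simp⟩
  have hT : TF fun z => b z.1 * ψ z.2 := by
    refine ⟨(b.contDiff.comp contDiff_fst).mul (hψ.comp contDiff_snd), ?_⟩
    refine HasCompactSupport.intro (b.hasCompactSupport.isCompact.prod hc.isCompact) fun z hz => ?_
    by_cases h1 : z.1 ∈ tsupport b
    · have h2 := fun h2 => hz ⟨h1, h2⟩
      rw [image_eq_zero_of_notMem_tsupport h2, mul_zero]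
    · rw [image_eq_zero_of_notMem_tsupport h1, zero_mul]
  have h1 : ∀ x, b t * ψ x = ψ x := fun x => by
    rw [b.one_of_mem_closedBall (Metric.mem_closedBall_self b.rIn_pos.le), one_mul]
  refine ⟨_, hT, h1, fun x v => ?_⟩; have h2 := hT.hasFDerivAt_slice t x; simp_rw [h1] at h2
  rw [h2.fderiv]; simp [dd]

lemma fderiv_apply_eq_sum (ψ : E3 → ℝ) (x v : E3) :
    fderiv ℝ ψ x v = ∑ c : Fin 3, v c * fderiv ℝ ψ x (ei c) := by
  have : v = ∑ c, v c • ei c := by ext k; simp [Pi.single_apply]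
  conv_lhs => rw [this]
  simp

/-- The heat flow preserves the divergence condition: a convolution is an average of translates. -/
lemma sum_integral_cnv_heatK_gradient {v : E3 → E3} (hM : 0 ≤ M) (hv : Measurable v)
    (hvM : ∀ᵐ y, ‖v y‖ ≤ M * ‖y‖ ^ (-1 : ℝ)) (hdiv : WeaklyDivFree v) {ψ : E3 → ℝ}
    (hψ : ContDiff ℝ ∞ ψ) (hc : HasCompactSupport ψ) (ht : 0 < t) :
    ∑ c : Fin 3, ∫ x, cnv heatK (fun y => v y c) t x * fderiv ℝ ψ x (ei c) = 0 := by
  have hvc : ∀ c, Measurable fun y => v y c := fun c =>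
    (EuclideanSpace.proj c).continuous.measurable.comp hv
  have hvcM : ∀ c, ∀ᵐ y, |v y c| ≤ M * ‖y‖ ^ (-1 : ℝ) := fun c => by
    filter_upwards [hvM] with y hy using (PiLp.norm_apply_le (v y) c).trans hy
  have hgC : ∀ c, Continuous fun x => fderiv ℝ ψ x (ei c) := fun c =>
    (hψ.continuous_fderiv (by simp)).clm_apply continuous_const
  have hgS : ∀ c, HasCompactSupport fun x => fderiv ℝ ψ x (ei c) := fun c => hc.fderiv_apply (𝕜 := ℝ) _
  have hF : Integrable (fun q : E3 × E3 => heatK t q.2 * fderiv ℝ ψ q.1 (v (q.1 - q.2))) (volume.prod volume) := by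
    have hmp : MeasurePreserving (fun q : E3 × E3 => (q.1, q.1 - q.2)) (volume.prod volume) (volume.prod volume) :=
      (MeasurePreserving.id _).skew_product (by fun_prop)
        (ae_of_all _ fun x => (Measure.measurePreserving_sub_left volume x).map_eq)
    have := integrable_finsetSum Finset.univ fun c _ => integrable_heat_slice hM (hvc c) (hvcM c) (hgC c) (hgS c) ht
    refine ((hmp.integrable_comp this.aestronglyMeasurable).2 this).congr (ae_of_all _ fun q => ?_)
    simp only [Function.comp, sub_sub_cancel, fderiv_apply_eq_sum ψ q.1 (v _), mul_sum, mul_assoc]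
  calc _ = ∫ x, ∫ z, heatK t z * fderiv ℝ ψ x (v (x - z)) := by
        rw [← integral_finsetSum _ fun c _ => integrable_cnv_heatK_mul hM (hvc c) (hvcM c) (hgC c) (hgS c) ht]
        refine integral_congr_ae ?_; filter_upwards [ae_ne_zero] with x hx
        rw [← integral_sub_left_eq_self _ volume x]
        simp only [sub_sub_cancel, fderiv_apply_eq_sum ψ x (v _), mul_sum, ← mul_assoc]
        obtain ⟨_, _, H⟩ := exists_heat_bound zero_le_one (by simp)
        rw [integral_finsetSum _ fun c _ => (H M _ hM (hvc c) (hvcM c) t ht x).1.mul_const _]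
        simp_rw [integral_mul_const]; rfl
    _ = ∫ z, ∫ x, heatK t z * fderiv ℝ ψ x (v (x - z)) := integral_integral_swap hF
    _ = 0 := by
        refine integral_eq_zero_of_ae (ae_of_all _ fun z => ?_); simp only
        rw [integral_const_mul, ← integral_add_right_eq_self _ z]
        have := hdiv (fun y => ψ (y + z)) (hψ.comp (by fun_prop)) (hc.comp_homeomorph (Homeomorph.addRight z))
        simp only [fderiv_comp_add_right] at this; simp [this]

/-! ### The momentum density in coordinates -/

/-- The components `wᵢwⱼ + Uᵢwⱼ + wᵢVⱼ` of the quadratic term. -/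
noncomputable def Fq (U V : E3 → E3) (w : E4 → E3) (i j : Fin 3) (z : E4) : ℝ :=
  w z i * w z j + U z.2 i * w z j + w z i * V z.2 j

lemma fderiv_apply_coord {g : E3 → E3} (hg : DifferentiableAt ℝ g x) (v : E3) (c : Fin 3) :
    (fderiv ℝ g x v) c = fderiv ℝ (fun y => g y c) x v := by
  have := (EuclideanSpace.proj c : E3 →L[ℝ] ℝ).hasFDerivAt.comp x hg.hasFDerivAt
  have e : (fun y => g y c) = (EuclideanSpace.proj c : E3 →L[ℝ] ℝ) ∘ g := rfl
  rw [e, this.fderiv]; rfl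

namespace IsTestField
variable {φ : E4 → E3}

lemma TF (h : IsTestField φ) (c : Fin 3) : TF fun z => φ z c :=
  ⟨(EuclideanSpace.proj (𝕜 := ℝ) c : E3 →L[ℝ] ℝ).contDiff.comp h.smooth,
    h.compact.comp_left (g := fun v : E3 => v c) rfl⟩

lemma contDiff_slice (h : IsTestField φ) (t : ℝ) : ContDiff ℝ ∞ fun y => φ (t, y) :=
  h.smooth.comp (by fun_prop)

lemma fderiv_slice (h : IsTestField φ) (t : ℝ) (x v : E3) (c : Fin 3) :
    (fderiv ℝ (fun y => φ (t, y)) x v) c = dd (0, v) (fun z => φ z c) (t, x) := by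
  rw [fderiv_apply_coord ((h.contDiff_slice t).differentiable (by simp) x),
    ((h.TF c).hasFDerivAt_slice t x).fderiv]
  simp [dd]

lemma divergence_slice (h : IsTestField φ) (t : ℝ) (x : E3) :
    divergence (fun y => φ (t, y)) x = ∑ c : Fin 3, dd (0, ei c) (fun z => φ z c) (t, x) :=
  sum_congr rfl fun c _ => h.fderiv_slice t x _ c

lemma laplacian_slice (h : IsTestField φ) (t : ℝ) (x : E3) (c : Fin 3) :
    (Laplacian.laplacian (fun y => φ (t, y)) x) c
      = ∑ i : Fin 3, dd (0, ei i) (dd (0, ei i) (fun z => φ z c)) (t, x) := by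
  rw [InnerProductSpace.laplacian_eq_iteratedFDeriv_orthonormalBasis _
    (EuclideanSpace.basisFun (Fin 3) ℝ)]
  simp; refine sum_congr rfl fun i _ => ?_; rw [iteratedFDeriv_two_apply]; simp
  have hd := ((h.contDiff_slice t).fderiv_right (m := ∞) le_rfl).differentiable (by simp)
  have e1 : fderiv ℝ (fderiv ℝ fun y => φ (t, y)) x (ei i) (ei i)
      = fderiv ℝ (fun y => fderiv ℝ (fun y => φ (t, y)) y (ei i)) x (ei i) := by
    rw [fderiv_clm_apply (hd x) (differentiableAt_const _)]; simp
  rw [e1, fderiv_apply_coord ((hd x).clm_apply (differentiableAt_const _))]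
  simp_rw [h.fderiv_slice]; rw [(((h.TF c).dd (0, ei i)).hasFDerivAt_slice t x).fderiv]; simp [dd]

lemma deriv_time (h : IsTestField φ) (t : ℝ) (x : E3) (c : Fin 3) :
    (deriv (fun s => φ (s, x)) t) c = dd (1, 0) (fun z => φ z c) (t, x) := by
  have h1 : HasDerivAt (fun s => φ (s, x)) (fderiv ℝ φ (t, x) (1, 0)) t :=
    (h.smooth.differentiable (by simp) (t, x)).hasFDerivAt.comp_hasDerivAt t
      ((hasDerivAt_id t).prodMk (hasDerivAt_const t x))
  have h2 := (EuclideanSpace.proj c : E3 →L[ℝ] ℝ).hasFDerivAt.comp_hasDerivAt t h1; rw [h1.deriv]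
  exact h2.unique ((h.TF c).hasDerivAt_time t x)

end IsTestField

lemma inner_eq_sum (a b : E3) : (⟪a, b⟫ : ℝ) = ∑ c : Fin 3, a c * b c := by simp [PiLp.inner_apply, mul_comm]

lemma momentumDensity_eq {φ : E4 → E3} (h : IsTestField φ) (U V : E3 → E3) (w : E4 → E3) (z : E4) :
    momentumDensity U V (fun t x => w (t, x)) φ z = (∑ c : Fin 3, w z c * Lop (fun z => φ z c) z)
        + ∑ i : Fin 3, ∑ j : Fin 3, Fq U V w i j z * dd (0, ei i) (fun z => φ z j) z := by
  obtain ⟨t, x⟩ := z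
  have hlin : ∀ v, ∀ c, (fderiv ℝ (fun y => φ (t, y)) x v) c
      = ∑ i, v i * dd (0, ei i) (fun z => φ z c) (t, x) := fun v c => by
    rw [fderiv_apply_coord ((h.contDiff_slice t).differentiable (by simp) x), fderiv_apply_eq_sum]
    refine sum_congr rfl fun i _ => ?_; rw [((h.TF c).hasFDerivAt_slice t x).fderiv]; simp [dd]
  unfold momentumDensity
  simp only [inner_eq_sum, hlin, WithLp.ofLp_add, Pi.add_apply, h.deriv_time, h.laplacian_slice]
  simp only [Lop, Fq, Fin.sum_univ_three]; ring

/-! ### The fixed point -/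

lemma wt_mul_rpow (hη0 : 0 < η) (t : ℝ) (x : E3) : wt η t x * ‖x‖ ^ (-1 : ℝ) = wtF η t x := by
  unfold wt wtF; rcases (norm_nonneg x).eq_or_lt with h | h
  · rw [← h, zero_rpow (show (-1 : ℝ) ≠ 0 by simp), zero_rpow (show -1 - η ≠ 0 by linarith)]; simp
  · rw [mul_assoc, ← rpow_add h]; ring_nf

lemma wt_mul_wt_le (hη0 : 0 < η) (hη1 : η < 1) (t : ℝ) (x : E3) :
    wt η t x * wt η t x ≤ wtF η t x := by
  rw [← wt_mul_rpow hη0]; exact mul_le_mul_of_nonneg_left (wt_le_rpow hη0 hη1 t x) (wt_nonneg _ _ _)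

lemma abs_coord_le (v : E3) (c : Fin 3) : |v c| ≤ ‖v‖ := PiLp.norm_apply_le v c

lemma norm_le_sum_coord (v : E3) : ‖v‖ ≤ ∑ c : Fin 3, |v c| := by
  rw [EuclideanSpace.norm_eq]; refine Real.sqrt_le_iff.2 ⟨by positivity, ?_⟩
  simp only [Fin.sum_univ_three, norm_eq_abs]
  linarith [abs_nonneg (v 0), abs_nonneg (v 1), abs_nonneg (v 2),
    mul_nonneg (abs_nonneg (v 0)) (abs_nonneg (v 1)), mul_nonneg (abs_nonneg (v 0)) (abs_nonneg (v 2)),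
    mul_nonneg (abs_nonneg (v 1)) (abs_nonneg (v 2))]

/-- Data of size `ε`: measurable fields bounded by `ε / |x|`. -/
structure IsData (η ε : ℝ) (U V w₀ : E3 → E3) : Prop where
  hη0 : 0 < η
  hη1 : η < 1
  hε : 0 ≤ ε
  mU : Measurable U
  mV : Measurable V
  mw₀ : Measurable w₀
  hU : ∀ x, ‖U x‖ ≤ ε * ‖x‖ ^ (-1 : ℝ)
  hV : ∀ x, ‖V x‖ ≤ ε * ‖x‖ ^ (-1 : ℝ)
  hw₀ : ∀ x, ‖w₀ x‖ ≤ ε * ‖x‖ ^ (-1 : ℝ)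

/-- The ball of radius `A` in the weighted space, for almost every positive time. -/
structure IsBdd (η A : ℝ) (w : E4 → E3) : Prop where
  hA : 0 ≤ A
  mw : Measurable w
  hw : ∀ᵐ z ∂μ₊, ‖w z‖ ≤ A * wt η z.1 z.2

lemma measurable_coord {α : Type*} [MeasurableSpace α] {w : α → E3} (hw : Measurable w) (c : Fin 3) :
    Measurable fun z => w z c :=
  (EuclideanSpace.proj (𝕜 := ℝ) c).continuous.measurable.comp hw

lemma measurable_Fq (hU : Measurable U) (hV : Measurable V) (hw : Measurable w)
    (i j : Fin 3) : Measurable (Fq U V w i j) := by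
  have h1 := fun c => measurable_coord hw c
  have h2 := fun c => measurable_coord (hU.comp (measurable_snd (α := ℝ))) c
  have h3 := fun c => measurable_coord (hV.comp (measurable_snd (α := ℝ))) c
  exact (((h1 i).mul (h1 j)).add ((h2 i).mul (h1 j))).add ((h1 i).mul (h3 j))

lemma abs_coord_mul_le {u v : E3} (hu : ‖u‖ ≤ a) (hv : ‖v‖ ≤ b) (i j : Fin 3) : |u i * v j| ≤ a * b :=
  abs_mul (u i) _ ▸ mul_le_mul ((abs_coord_le _ _).trans hu) ((abs_coord_le _ _).trans hv) (abs_nonneg _)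
    ((norm_nonneg _).trans hu)

namespace IsData
variable {w' : E4 → E3} {A' : ℝ}

/-- Pointwise Lipschitz estimate for the quadratic term. -/
lemma abs_Fq_sub_le (d : IsData η ε U V w₀) (hA : 0 ≤ A) (hA' : 0 ≤ A') (hD : 0 ≤ D) {z : E4}
    (hw : ‖w z‖ ≤ A * wt η z.1 z.2) (hw' : ‖w' z‖ ≤ A' * wt η z.1 z.2)
    (hww : ‖w z - w' z‖ ≤ D * wt η z.1 z.2) (i j : Fin 3) :
    |Fq U V w i j z - Fq U V w' i j z| ≤ (A + A' + 2 * ε) * D * wtF η z.1 z.2 := by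
  have e : Fq U V w i j z - Fq U V w' i j z = (w z - w' z) i * w z j + w' z i * (w z - w' z) j
    + U z.2 i * (w z - w' z) j + (w z - w' z) i * V z.2 j := by simp only [Fq, PiLp.sub_apply]; ring
  have h1 := wt_mul_wt_le d.hη0 d.hη1 z.1 z.2; have := d.hε; rw [e]
  calc _ ≤ _ := (abs_add_le _ _).trans (add_le_add ((abs_add_le _ _).trans (add_le_add
      ((abs_add_le _ _).trans (add_le_add (abs_coord_mul_le hww hw i j) (abs_coord_mul_le hw' hww i j)))
      (abs_coord_mul_le (d.hU z.2) hww i j))) (abs_coord_mul_le hww (d.hV z.2) i j))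
    _ = (A + A') * D * (wt η z.1 z.2 * wt η z.1 z.2)
      + 2 * ε * D * (wt η z.1 z.2 * ‖z.2‖ ^ (-1 : ℝ)) := by ring
    _ ≤ (A + A') * D * wtF η z.1 z.2 + 2 * ε * D * wtF η z.1 z.2 := by
      rw [(wt_mul_rpow d.hη0 z.1 z.2)]; gcongr
    _ = _ := by ring

lemma abs_Fq_le (d : IsData η ε U V w₀) (hA : 0 ≤ A) {z : E4} (hw : ‖w z‖ ≤ A * wt η z.1 z.2)
    (i j : Fin 3) : |Fq U V w i j z| ≤ (A + 2 * ε) * A * wtF η z.1 z.2 := by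
  simpa [Fq] using d.abs_Fq_sub_le (w' := fun _ => 0) hA le_rfl hA hw (by simp) (by simpa using hw) i j

lemma mFq (d : IsData η ε U V w₀) (b : IsBdd η A w) (i j : Fin 3) : Measurable (Fq U V w i j) :=
  measurable_Fq d.mU d.mV b.mw i j

lemma hFq (d : IsData η ε U V w₀) (b : IsBdd η A w) (i j : Fin 3) :
    ∀ᵐ z ∂μ₊, |Fq U V w i j z| ≤ (A + 2 * ε) * A * wtF η z.1 z.2 :=
  b.hw.mono fun _ h => d.abs_Fq_le b.hA h i j

lemma const_nonneg (d : IsData η ε U V w₀) (b : IsBdd η A w) : 0 ≤ (A + 2 * ε) * A := by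
  have := d.hε; have := b.hA; positivity

end IsData

/-- The bilinear Duhamel term, `∫₀ᵗ exp((t-s)Δ) P ∇·F(w)(s) ds`. -/
noncomputable def bil (U V : E3 → E3) (w : E4 → E3) (c : Fin 3) (p : E4) : ℝ :=
  ∑ i : Fin 3, ∑ j : Fin 3, duh (oseenK (ei i) (ei j) (ei c)) (Fq U V w i j) p.1 p.2

lemma measurable_bil (hU : Measurable U) (hV : Measurable V) (hw : Measurable w)
    (c : Fin 3) : Measurable (bil U V w c) :=
  Finset.measurable_fun_sum _ fun i _ => Finset.measurable_fun_sum _ fun j _ =>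
    measurable_duh (isKer_oseenK 0 _ _ _) (measurable_Fq hU hV hw i j)

/-- The Duhamel term is Lipschitz on balls of the weighted space, with a constant of their size. -/
lemma exists_bil_sub_bound (hη0 : 0 < η) (hη1 : η < 1) :
    ∃ K : ℝ, 0 < K ∧ ∀ {ε A A' D : ℝ} {U V w₀ : E3 → E3} {w w' : E4 → E3}, IsData η ε U V w₀ →
      IsBdd η A w → IsBdd η A' w' → 0 ≤ D → (∀ᵐ z ∂μ₊, ‖w z - w' z‖ ≤ D * wt η z.1 z.2) →
      ∀ t : ℝ, 0 < t → ∀ x : E3, x ≠ 0 → ∑ c : Fin 3, |bil U V w c (t, x) - bil U V w' c (t, x)|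
          ≤ K * ((A + A' + 2 * ε) * D) * wt η t x := by
  choose C hC H using fun q : Fin 3 × Fin 3 × Fin 3 =>
    exists_duh_bound_four (isKer_oseenK 0 (ei q.1) (ei q.2.1) (ei q.2.2)) hη0 hη1
  refine ⟨∑ c, ∑ i, ∑ j, C (i, j, c), sum_pos (fun c _ => sum_pos (fun i _ => sum_pos
    (fun j _ => hC _) ⟨0, by simp⟩) ⟨0, by simp⟩) ⟨0, by simp⟩, ?_⟩
  intro ε A A' D U V w₀ w w' d b b' hD hwD t ht x hx
  simp only [sum_mul]; refine sum_le_sum fun c _ => ?_; unfold bil; rw [← sum_sub_distrib]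
  refine (abs_sum_le_sum_abs _ _).trans (sum_le_sum fun i _ => ?_); rw [← sum_sub_distrib]
  refine (abs_sum_le_sum_abs _ _).trans (sum_le_sum fun j _ => ?_)
  have i1 := (H (i, j, c) _ _ (d.const_nonneg b) (d.mFq b i j) (d.hFq b i j) t ht x hx).1
  have i2 := (H (i, j, c) _ _ (d.const_nonneg b') (d.mFq b' i j) (d.hFq b' i j) t ht x hx).1
  have i3 := H (i, j, c) ((A + A' + 2 * ε) * D) (fun z => Fq U V w i j z - Fq U V w' i j z)
    (by have := d.hε; have := b.hA; have := b'.hA; positivity) ((d.mFq b i j).sub (d.mFq b' i j))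
    (by filter_upwards [b.hw, b'.hw, hwD] with z h1 h2 h3
      using d.abs_Fq_sub_le b.hA b'.hA hD h1 h2 h3 i j) t ht x hx
  simp only [duh, ← integral_sub i1 i2, ← mul_sub]; exact abs_integral_le_integral_abs.trans i3.2.1

lemma bil_zero (c : Fin 3) (p : E4) : bil U V (fun _ => 0) c p = 0 := by simp [bil, duh, Fq]

/-- The mild formulation: the right-hand side of the integral equation, set to zero for `t ≤ 0`
and for `x = 0`. -/
noncomputable def mildMap (U V w₀ : E3 → E3) (w : E4 → E3) (p : E4) : E3 :=
  if 0 < p.1 ∧ p.2 ≠ 0 then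
    WithLp.toLp 2 fun c => cnv heatK (fun y => w₀ y c) p.1 p.2 - bil U V w c p
  else 0

lemma measurable_cnv_heatK (hv : Measurable v) :
    Measurable fun p : E4 => cnv heatK v p.1 p.2 :=
  measurable_cnv (isKer_heatK 0) (f := fun _ => v) (hv.comp measurable_snd) id measurable_id

lemma measurable_mildMap (hU : Measurable U) (hV : Measurable V)
    (hw₀ : Measurable w₀) (hw : Measurable w) : Measurable (mildMap U V w₀ w) := by
  refine Measurable.ite ?_ ?_ measurable_const
  · exact (measurableSet_lt measurable_const measurable_fst).inter
      ((measurableSet_singleton (0 : E3)).compl.preimage measurable_snd)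
  · refine (WithLp.measurable_toLp 2 _).comp (measurable_pi_lambda _ fun c => ?_)
    exact (measurable_cnv_heatK (measurable_coord hw₀ c)).sub (measurable_bil hU hV hw c)

/-- The two ingredients of the contraction: the size of the heat flow and the Lipschitz bound. -/
lemma exists_mildMap_bound (hη0 : 0 < η) (hη1 : η < 1) :
    ∃ C K : ℝ, 0 < C ∧ 0 < K ∧ ∀ {ε : ℝ} {U V w₀ : E3 → E3}, IsData η ε U V w₀ →
      (∀ p, ‖mildMap U V w₀ (fun _ => 0) p‖ ≤ C * ε * wt η p.1 p.2) ∧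
      ∀ {w w' : E4 → E3} {A A' D : ℝ}, IsBdd η A w → IsBdd η A' w' → 0 ≤ D →
        (∀ z, ‖w z - w' z‖ ≤ D * wt η z.1 z.2) → ∀ p,
        ‖mildMap U V w₀ w p - mildMap U V w₀ w' p‖ ≤ K * ((A + A' + 2 * ε) * D) * wt η p.1 p.2 := by
  obtain ⟨K, hK, HK⟩ := exists_bil_sub_bound hη0 hη1
  obtain ⟨C, hC, HC⟩ := exists_heat_bound zero_le_one (by simp)
  refine ⟨3 * C, K, by positivity, hK, fun {ε U V w₀} d => ⟨fun p => ?_, fun {w w' A A' D} b b' hD h p => ?_⟩⟩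
  all_goals have := wt_nonneg η p.1 p.2; have := d.hε; unfold mildMap; split_ifs with hp
  · refine (norm_le_sum_coord _).trans ?_
    have : ∀ c, |cnv heatK (fun y => w₀ y c) p.1 p.2| ≤ C * ε * wt η p.1 p.2 := fun c => by
      have := (HC ε (fun y => w₀ y c) d.hε (measurable_coord d.mw₀ c)
        (ae_of_all _ fun y => (abs_coord_le _ _).trans (d.hw₀ y)) p.1 hp.1 p.2).2
      refine (abs_integral_le_integral_abs.trans this).trans ?_
      gcongr; exact rpow_neg_one_le_wt hη0 hp.2
    simp only [bil_zero, sub_zero, Fin.sum_univ_three]; linarith [this 0, this 1, this 2]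
  · simp; positivity
  · refine (norm_le_sum_coord _).trans ((sum_le_sum fun c _ => ?_).trans
      (HK d b b' hD (ae_of_all _ h) p.1 hp.1 p.2 hp.2))
    simp only [PiLp.sub_apply]; rw [sub_sub_sub_cancel_left, abs_sub_comm]
  · have := b.hA; have := b'.hA; simp; positivity

/-- Data of size `ε`, with a fixed point `w` of `mildMap` in the ball of radius `A`. -/
structure IsMild (η ε A : ℝ) (U V w₀ : E3 → E3) (w : E4 → E3) : Prop extends IsData η ε U V w₀ where
  hA : 0 ≤ A
  mw : Measurable w
  hw : ∀ z, ‖w z‖ ≤ A * wt η z.1 z.2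
  eq : ∀ p, mildMap U V w₀ w p = w p

lemma tendsto_half_pow_mul (a b : ℝ) : Tendsto (fun n : ℕ => a * (1 / 2 : ℝ) ^ n * b) atTop (𝓝 0) := by
  simpa using ((tendsto_pow_atTop_nhds_zero_of_lt_one (r := (1 / 2 : ℝ)) (by simp)
    (by norm_num)).const_mul a).mul_const b

/-- Picard iteration for small data, in the ball of radius twice the size of the heat flow. -/
lemma exists_mild (hη0 : 0 < η) (hη1 : η < 1) : ∃ K : ℝ, 0 < K ∧ ∀ {ε : ℝ} {U V w₀ : E3 → E3},
    IsData η ε U V w₀ → K * ε ≤ 1 → ∃ w, IsMild η ε (K * ε) U V w₀ w := by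
  obtain ⟨C, K, hC, hK, H⟩ := exists_mildMap_bound hη0 hη1
  refine ⟨2 * C + K * (8 * C + 4), by positivity, fun {ε U V w₀} d hKε => ?_⟩
  obtain ⟨H1, H2⟩ := H d; have hε := d.hε; have hp : 0 ≤ 2 * C * ε := by positivity
  have hq : 0 ≤ K * (8 * C + 4) * ε := by positivity
  set A := 2 * C * ε with hA
  -- the iterates, starting from zero
  set W := fun n => (mildMap U V w₀)^[n] fun _ => 0
  have hWs : ∀ n, W (n + 1) = mildMap U V w₀ (W n) := fun n => Function.iterate_succ_apply' _ _ _
  -- the Lipschitz constant on the ball of radius `A` is at most `1/2`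
  have hcontr : ∀ A' D, A' ≤ A → 0 ≤ D → K * ((A + A' + 2 * ε) * D) ≤ D / 2 := fun A' D hA' hD => by
    have := mul_le_mul_of_nonneg_right (show K * (8 * C + 4) * ε ≤ 1 by linarith) hD
    have : K * ((A + A' + 2 * ε) * D) ≤ K * ((A + A + 2 * ε) * D) := by gcongr
    rw [hA] at this; bound
  have hb : ∀ n, Measurable (W n) ∧ ∀ z, ‖W n z‖ ≤ A * wt η z.1 z.2 := fun n => by
    induction n with
    | zero => exact ⟨measurable_const, fun z => by simpa [W] using mul_nonneg hp (wt_nonneg _ _ _)⟩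
    | succ n ih =>
      rw [hWs]; refine ⟨measurable_mildMap d.mU d.mV d.mw₀ ih.1, fun z => ?_⟩
      have h1 := H2 (w' := fun _ => 0) ⟨hp, ih.1, ae_of_all _ ih.2⟩ ⟨le_rfl, measurable_const, ae_of_all _ fun z => by simp⟩ hp
        (by simpa using ih.2) z
      have h2 := mul_le_mul_of_nonneg_right (hcontr 0 A hp hp) (wt_nonneg η z.1 z.2)
      have h3 := norm_le_norm_add_norm_sub' (mildMap U V w₀ (W n) z) (mildMap U V w₀ (fun _ => 0) z)
      linarith [H1 z]
  have hB : ∀ n, IsBdd η A (W n) := fun n => ⟨hp, (hb n).1, ae_of_all _ (hb n).2⟩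
  have hWd : ∀ n z, ‖W n z - W (n + 1) z‖ ≤ A * (1 / 2) ^ n * wt η z.1 z.2 := fun n => by
    induction n with
    | zero => intro z; simpa [W] using (hb 1).2 z
    | succ n ih =>
      intro z; rw [hWs n, hWs (n + 1)]; refine (H2 (hB n) (hB (n + 1)) (by positivity) ih z).trans
        (mul_le_mul_of_nonneg_right ((hcontr _ _ le_rfl (by positivity)).trans_eq ?_) (wt_nonneg _ _ _))
      rw [pow_succ]; ring
  have hgeo : ∀ z n, dist (W n z) (W (n + 1) z) ≤ A * wt η z.1 z.2 * (1 / 2) ^ n := fun z n => by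
    rw [dist_eq_norm]; exact (hWd n z).trans_eq (by ring)
  choose w hw using fun z =>
    cauchySeq_tendsto_of_complete (cauchySeq_of_le_geometric (1 / 2) _ (by norm_num) (hgeo z))
  have mw := measurable_of_tendsto_metrizable (fun n => (hb n).1) (tendsto_pi_nhds.2 hw)
  have hwA := fun z => le_of_tendsto (hw z).norm (.of_forall fun n => (hb n).2 z)
  have hwd : ∀ n z, ‖W n z - w z‖ ≤ 2 * A * (1 / 2) ^ n * wt η z.1 z.2 := fun n z => by
    have := dist_le_of_le_geometric_of_tendsto (1 / 2) _ (by norm_num) (hgeo z) (hw z) n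
    rw [dist_eq_norm] at this; exact this.trans_eq (by ring)
  refine ⟨w, { d with hA := by positivity, mw := mw, hw := fun z => (hwA z).trans ?_, eq := fun p => ?_ }⟩
  · gcongr; exacts [wt_nonneg _ _ _, by linarith]
  · refine tendsto_nhds_unique (tendsto_iff_norm_sub_tendsto_zero.2 ?_)
      ((tendsto_add_atTop_iff_nat 1).2 (hw p))
    refine squeeze_zero (fun _ => norm_nonneg _) (fun n => ?_) (tendsto_half_pow_mul A (wt η p.1 p.2))
    rw [hWs]
    refine (H2 (hB n) ⟨hp, mw, ae_of_all _ hwA⟩ (by positivity) (hwd n) p).trans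
      (mul_le_mul_of_nonneg_right ((hcontr _ _ le_rfl (by positivity)).trans_eq ?_) (wt_nonneg _ _ _))
    ring

lemma integrable_mul_TF (hb : b < 3) {f : E4 → ℝ} (hf : Measurable f)
    (hfb : ∀ᵐ z ∂μ₊, |f z| ≤ M * ‖z.2‖ ^ (-b)) (hψ : TF ψ) :
    Integrable (fun z => f z * ψ z) μ₊ := by
  refine Integrable.mono' ((hψ.integrable_rpow_mul hb).norm.const_mul M).integrableOn
    (hf.mul hψ.continuous.measurable).aestronglyMeasurable ?_
  filter_upwards [hfb] with z hz
  rw [norm_mul, norm_mul, ← mul_assoc, norm_eq_abs (‖z.2‖ ^ (-b)), abs_of_nonneg (by positivity)]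
  gcongr; exact hz

lemma integral_momentumDensity {φ : E4 → E3} (hφ : IsTestField φ)
    (i1 : ∀ c : Fin 3, Integrable (fun z => w z c * Lop (fun z => φ z c) z) μ₊)
    (i2 : ∀ i j : Fin 3, Integrable (fun z => Fq U V w i j z * dd (0, ei i) (fun z => φ z j) z)
    μ₊) :
    Integrable (momentumDensity U V (fun t x => w (t, x)) φ) μ₊ ∧
    ∫ z in posTime, momentumDensity U V (fun t x => w (t, x)) φ z
    = (∑ c : Fin 3, ∫ z in posTime, w z c * Lop (fun z => φ z c) z)
    + ∑ i : Fin 3, ∑ j : Fin 3, ∫ z in posTime,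
    Fq U V w i j z * dd (0, ei i) (fun z => φ z j) z := by
  have e : momentumDensity U V (fun t x => w (t, x)) φ = fun z =>
      (∑ c, w z c * Lop (fun z => φ z c) z)
        + ∑ i, ∑ j, Fq U V w i j z * dd (0, ei i) (fun z => φ z j) z :=
    funext fun z => momentumDensity_eq hφ U V w z
  have j1 := integrable_finsetSum Finset.univ fun c _ => i1 c
  have j2 := integrable_finsetSum Finset.univ fun i _ =>
    integrable_finsetSum Finset.univ fun j _ => i2 i j
  rw [e]; refine ⟨j1.add j2, ?_⟩
  rw [integral_add j1 j2, integral_finsetSum _ fun c _ => i1 c,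
    integral_finsetSum _ fun i _ => integrable_finsetSum _ fun j _ => i2 i j]
  congr 1; exact sum_congr rfl fun i _ => integral_finsetSum _ fun j _ => i2 i j

namespace IsData

lemma heat (d : IsData η ε U V w₀) (c : Fin 3) : ∀ᵐ y : E3, |w₀ y c| ≤ ε * ‖y‖ ^ (-1 : ℝ) :=
  ae_of_all _ fun y => (abs_coord_le _ _).trans (d.hw₀ y)

lemma integrable_initial_mul (d : IsData η ε U V w₀) (c : Fin 3) (hg : Continuous g)
    (hgc : HasCompactSupport g) : Integrable fun x => w₀ x c * g x := by
  refine ((integrable_rpow_mul_slice (b := 1) (by simp) hg hgc).norm.const_mul ε).mono'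
    ((measurable_coord d.mw₀ c).aestronglyMeasurable.mul hg.aestronglyMeasurable)
    (ae_of_all _ fun x => ?_)
  rw [norm_mul, norm_mul, ← mul_assoc, norm_eq_abs (‖x‖ ^ (-1 : ℝ)), abs_of_nonneg (by positivity)]
  gcongr; exact (abs_coord_le _ _).trans (d.hw₀ x)

lemma integrable_Fq_mul (d : IsData η ε U V w₀) (b : IsBdd η A w) (i j : Fin 3) (hψ : TF ψ) :
    Integrable (fun z => Fq U V w i j z * ψ z) μ₊ :=
  integrable_mul_TF (b := 2) (by norm_num) (d.mFq b i j) ((d.hFq b i j).mono fun _ h =>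
    h.trans (mul_le_mul_of_nonneg_left (wtF_le_rpow d.hη0 d.hη1 _ _) (d.const_nonneg b))) hψ

lemma abs_coord_le (d : IsData η ε U V w₀) (b : IsBdd η A w) (c : Fin 3) :
    ∀ᵐ z ∂μ₊, |w z c| ≤ A * ‖z.2‖ ^ (-1 : ℝ) := b.hw.mono fun _ h =>
  (PerturbedNS.abs_coord_le _ _).trans (h.trans (mul_le_mul_of_nonneg_left (wt_le_rpow d.hη0 d.hη1 _ _) b.hA))

lemma integrable_coord_mul (d : IsData η ε U V w₀) (b : IsBdd η A w) (c : Fin 3) (hψ : TF ψ) :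
    Integrable (fun z => w z c * ψ z) μ₊ :=
  integrable_mul_TF (b := 1) (by norm_num) (measurable_coord b.mw c) (d.abs_coord_le b c) hψ

lemma integrable_duh_mul (d : IsData η ε U V w₀) (b : IsBdd η A w) (i j c : Fin 3) (hψ : TF ψ) :
    Integrable (fun p => duh (oseenK (ei i) (ei j) (ei c)) (Fq U V w i j) p.1 p.2 * ψ p) μ₊ := by
  refine (integrable_duh_test (isKer_oseenK 0 (ei i) (ei j) (ei c)) d.hη0 d.hη1 (d.const_nonneg b)
    (d.mFq b i j) (d.hFq b i j) hψ).integral_prod_left.congr (ae_of_all _ fun p => ?_)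
  simp only [integral_mul_const]; rfl

lemma integral_bil_mul (d : IsData η ε U V w₀) (b : IsBdd η A w) (c : Fin 3) (hψ : TF ψ) :
    Integrable (fun p => bil U V w c p * ψ p) μ₊ ∧ ∫ p in posTime, bil U V w c p * ψ p = ∑ i, ∑ j,
      ∫ p in posTime, duh (oseenK (ei i) (ei j) (ei c)) (Fq U V w i j) p.1 p.2 * ψ p := by
  have h := fun i j => d.integrable_duh_mul b i j c hψ
  have h1 := fun i => integrable_finsetSum Finset.univ fun j _ => h i j
  simp_rw [← integral_finsetSum _ fun j _ => h _ j]
  rw [← integral_finsetSum _ fun i _ => h1 i]; simp only [bil, sum_mul]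
  exact ⟨integrable_finsetSum _ fun i _ => h1 i, trivial⟩

/-- Testing the Duhamel term: the pressure is a limit of smooth approximations. -/
lemma tendsto_bil (d : IsData η ε U V w₀) (b : IsBdd η A w) (hφ : ∀ c, TF (φ c)) :
    Tendsto (fun δ => ∑ i : Fin 3, ∑ j : Fin 3, ∫ z in posTime, Fq U V w i j z
      * pair (rieszK (ei i) (ei j)) (fun z => ∑ c : Fin 3, dd (0, ei c) (φ c) z) δ z.1 z.2) (𝓝[>] 0)
      (𝓝 ((∑ c : Fin 3, ∫ z in posTime, bil U V w c z * Lop (φ c) z)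
        - ∑ i : Fin 3, ∑ j : Fin 3, ∫ z in posTime, Fq U V w i j z * dd (0, ei i) (φ j) z)) := by
  have := tendsto_finsetSum Finset.univ fun i _ => tendsto_finsetSum Finset.univ fun j _ =>
    (tendsto_integral_rieszK d.hη0 d.hη1 (d.const_nonneg b) (d.mFq b i j) (d.hFq b i j) hφ i j).2
  convert this using 2
  simp_rw [fun c => (d.integral_bil_mul b c (hφ c).Lop).2]; simp only [Fin.sum_univ_three]; ring

end IsData

/-! ### The fixed point is a solution -/

namespace IsMild

lemma bdd (h : IsMild η ε A U V w₀ w) : IsBdd η A w := ⟨h.hA, h.mw, ae_of_all _ h.hw⟩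

lemma coord_eq (h : IsMild η ε A U V w₀ w) {p : E4} (hp : 0 < p.1 ∧ p.2 ≠ 0) (c : Fin 3) :
    w p c = cnv heatK (fun y => w₀ y c) p.1 p.2 - bil U V w c p := by
  conv_lhs => rw [← h.eq p, mildMap, if_pos hp]

lemma abs_Fq_le (h : IsMild η ε A U V w₀ w) (i j : Fin 3) (z : E4) :
    |Fq U V w i j z| ≤ (A + 2 * ε) * A * wtF η z.1 z.2 :=
  h.toIsData.abs_Fq_le h.hA (h.hw z) i j

/-- The weak form of the equation, with the pressure term as a limit of smooth approximations. -/
lemma tendsto_weak (h : IsMild η ε A U V w₀ w) (hφ : ∀ c, TF (φ c)) :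
    Tendsto (fun δ => ∑ i : Fin 3, ∑ j : Fin 3, ∫ z in posTime, Fq U V w i j z
    * pair (rieszK (ei i) (ei j)) (fun z => ∑ c : Fin 3, dd (0, ei c) (φ c) z) δ z.1 z.2) (𝓝[>] 0)
    (𝓝 (-(∑ c : Fin 3, ∫ z in posTime, w z c * Lop (φ c) z)
    - (∑ i : Fin 3, ∑ j : Fin 3, ∫ z in posTime, Fq U V w i j z * dd (0, ei i) (φ j) z)
    - ∑ c : Fin 3, ∫ x, w₀ x c * φ c (0, x))) := by
  have hheat := fun c => integral_cnv_heatK_mul_Lop h.hε (measurable_coord h.mw₀ c) (h.heat c) (hφ c)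
  have hw : ∀ c, ∫ z in posTime, w z c * Lop (φ c) z
      = -(∫ x, w₀ x c * φ c (0, x)) - ∫ z in posTime, bil U V w c z * Lop (φ c) z := fun c => by
    rw [← (hheat c).2, ← integral_sub (hheat c).1 (h.integral_bil_mul h.bdd c (hφ c).Lop).1]
    refine integral_congr_ae ?_; filter_upwards [ae_posTime] with p hp; rw [h.coord_eq hp, sub_mul]
  convert h.tendsto_bil h.bdd hφ using 2; simp_rw [hw]; simp only [Fin.sum_univ_three]; ring

lemma integrable_slice_mul (h : IsMild η ε A U V w₀ w) (ht : 0 < t)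
    (hg : Continuous g) (hgc : HasCompactSupport g) (c : Fin 3) :
    Integrable (fun x => w (t, x) c * g x) ∧
    ∫ x, w (t, x) c * g x = (∫ x, cnv heatK (fun y => w₀ y c) t x * g x)
    - ∑ i : Fin 3, ∑ j : Fin 3, ∫ x, duh (oseenK (ei i) (ei j) (ei c)) (Fq U V w i j) t x * g x := by
  have i1 := integrable_cnv_heatK_mul h.hε (measurable_coord h.mw₀ c) (h.heat c) hg hgc ht
  have i2 := fun i j => integrable_duh_mul (isKer_oseenK 0 (ei i) (ei j) (ei c)) h.hη0 h.hη1
    (h.const_nonneg h.bdd) (h.mFq h.bdd i j) (h.hFq h.bdd i j) hg hgc ht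
  have j2 := integrable_finsetSum Finset.univ fun i _ =>
    integrable_finsetSum Finset.univ fun j _ => i2 i j
  have e : (fun x => w (t, x) c * g x) =ᵐ[volume] fun x => cnv heatK (fun y => w₀ y c) t x * g x
      - ∑ i, ∑ j, duh (oseenK (ei i) (ei j) (ei c)) (Fq U V w i j) t x * g x := by
    filter_upwards [ae_ne_zero] with x hx; rw [h.coord_eq ⟨ht, hx⟩, bil]
    simp only [sub_mul, sum_mul]
  refine ⟨(i1.sub j2).congr e.symm, ?_⟩
  rw [integral_congr_ae e, integral_sub i1 j2,
    integral_finsetSum _ fun i _ => integrable_finsetSum _ fun j _ => i2 i j]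
  congr 1; exact sum_congr rfl fun i _ => integral_finsetSum _ fun j _ => i2 i j

lemma weaklyDivFree (h : IsMild η ε A U V w₀ w) (hdiv : WeaklyDivFree w₀) (ht : 0 < t) :
    WeaklyDivFree fun x => w (t, x) := fun ψ hψ hc => by
  have hgC : ∀ c, Continuous fun x => fderiv ℝ ψ x (ei c) := fun c =>
    (hψ.continuous_fderiv (by simp)).clm_apply continuous_const
  have hgS : ∀ c, HasCompactSupport fun x => fderiv ℝ ψ x (ei c) := fun c =>
    hc.fderiv_apply (𝕜 := ℝ) _
  have hi := fun c => h.integrable_slice_mul ht (hgC c) (hgS c) c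
  rw [integral_congr_ae (ae_of_all _ fun x => fderiv_apply_eq_sum ψ x (w (t, x))),
    integral_finsetSum _ fun c _ => (hi c).1]
  simp_rw [fun c => (hi c).2]
  rw [sum_sub_distrib, sum_integral_cnv_heatK_gradient h.hε h.mw₀
    (ae_of_all _ h.hw₀) hdiv hψ hc ht, zero_sub, neg_eq_zero, sum_comm]
  refine sum_eq_zero fun i _ => ?_
  rw [sum_comm]
  refine sum_eq_zero fun j _ => ?_
  obtain ⟨χ, hχ, -, hχd⟩ := exists_TF_slice hψ hc t
  simp_rw [← hχd]
  exact sum_integral_duh_gradient h.hη0 h.hη1 (h.const_nonneg h.bdd) (h.mFq h.bdd i j)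
    (h.hFq h.bdd i j) hχ i j ht

lemma tendsto_initial (h : IsMild η ε A U V w₀ w) {φ : E3 → E3} (hφ : Continuous φ)
    (hc : HasCompactSupport φ) :
    Tendsto (fun t : ℝ => ∫ x, ⟪w (t, x), φ x⟫) (𝓝[>] 0) (𝓝 (∫ x, ⟪w₀ x, φ x⟫)) := by
  have hgC : ∀ c, Continuous fun x => φ x c := fun c => by fun_prop
  have hgS : ∀ c, HasCompactSupport fun x => φ x c := fun c =>
    hc.comp_left (g := fun v : E3 => v c) rfl
  have hlim : ∫ x, ⟪w₀ x, φ x⟫ = ∑ c, ((∫ x, w₀ x c * φ x c)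
      - ∑ i : Fin 3, ∑ j : Fin 3, (0 : ℝ)) := by
    simp only [inner_eq_sum, Finset.sum_const_zero, sub_zero]
    exact integral_finsetSum _ fun c _ => h.integrable_initial_mul c (hgC c) (hgS c)
  rw [hlim]
  refine Tendsto.congr' ?_ (tendsto_finsetSum Finset.univ fun c _ =>
    (tendsto_integral_cnv_heatK h.hε (measurable_coord h.mw₀ c) (h.heat c) (hgC c) (hgS c)).sub
    (tendsto_finsetSum Finset.univ fun i _ => tendsto_finsetSum Finset.univ fun j _ =>
      tendsto_integral_duh (isKer_oseenK 0 (ei i) (ei j) (ei c)) h.hη0 h.hη1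
        (h.const_nonneg h.bdd) (h.mFq h.bdd i j) (h.hFq h.bdd i j) (hgC c) (hgS c)))
  filter_upwards [self_mem_nhdsWithin] with t ht
  have hi := fun c => h.integrable_slice_mul ht (hgC c) (hgS c) c; simp_rw [inner_eq_sum]
  rw [integral_finsetSum _ fun c _ => (hi c).1]; exact sum_congr rfl fun c _ => (hi c).2.symm

end IsMild

lemma locallyIntegrable_rpow (hb : b < 3) :
    LocallyIntegrable (fun z : E4 => ‖z.2‖ ^ (-b)) := fun z => by
  set R := ‖z‖ + 1; have hR : 0 < R := by positivity
  set S : Set E4 := ball 0 R; have hS : MeasurableSet S := Metric.isOpen_ball.measurableSet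
  refine ⟨S, Metric.isOpen_ball.mem_nhds (by simp [R]), ?_⟩
  have := integrable_rpow_mul_of_bdd hb (g := S.indicator fun _ => 1)
    (measurable_const.indicator hS) (B := 1) hR
    (fun z => by by_cases hz : z ∈ S <;> simp [hz])
    (fun t x htx => by
      refine indicator_of_notMem (fun hz => ?_) _
      simp only [S, mem_ball_zero_iff, Prod.norm_mk, max_lt_iff, norm_eq_abs] at hz
      rcases htx with h | h <;> linarith)
  rw [← integrable_indicator_iff hS]; refine this.congr (ae_of_all _ fun z => ?_)
  by_cases hz : z ∈ S <;> simp [hz]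

lemma IsMild.isSolution (h : IsMild η ε A U V w₀ w) (hdiv : WeaklyDivFree w₀) :
    IsSolution U V w₀ fun t x => w (t, x) where
  aesm := h.mw.aestronglyMeasurable
  locSq := by
    have h1 : LocallyIntegrable fun z => ‖w z‖ ^ 2 := by
      refine ((locallyIntegrable_rpow (b := 2) (by norm_num)).smul (A ^ 2)).mono
        (h.mw.norm.pow_const 2).aestronglyMeasurable (ae_of_all _ fun z => ?_)
      have h1 := (h.hw z).trans (mul_le_mul_of_nonneg_left (wt_le_rpow h.hη0 h.hη1 _ _) h.hA)
      have h2 : (‖z.2‖ ^ (-1 : ℝ)) ^ 2 = ‖z.2‖ ^ (-2 : ℝ) := by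
        rw [← rpow_natCast, ← rpow_mul (norm_nonneg _)]; norm_num
      have h3 : ‖w z‖ ^ 2 ≤ A ^ 2 * ‖z.2‖ ^ (-2 : ℝ) := by rw [← h2, ← mul_pow]; gcongr
      simpa [abs_of_nonneg (show (0 : ℝ) ≤ ‖z.2‖ ^ (-2 : ℝ) by positivity)] using h3
    exact fun z _ => ((h1 z).mono_measure Measure.restrict_le_self).filter_mono nhdsWithin_le_nhds
  divFree := by filter_upwards [ae_restrict_mem measurableSet_Ioi] with t ht using h.weaklyDivFree hdiv ht
  momentum := fun φ hφ hφd => by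
    have hz : (fun z => ∑ c, dd (0, ei c) (fun z => φ z c) z) = fun _ => 0 :=
      funext fun z => by rw [← hφ.divergence_slice z.1 z.2]; exact hφd _ _
    have h1 := h.tendsto_weak hφ.TF; rw [hz] at h1
    have h2 : ∀ (i j : Fin 3) (δ s : ℝ) (y : E3), pair (rieszK (ei i) (ei j)) (fun _ => 0) δ s y = 0 := by
      intro i j δ s y; simp [pair]
    simp only [h2, mul_zero, integral_zero, Finset.sum_const_zero] at h1
    have h3 := tendsto_nhds_unique h1 tendsto_const_nhds
    rw [(integral_momentumDensity hφ (fun c => h.integrable_coord_mul h.bdd c (hφ.TF c).Lop)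
      fun i j => h.integrable_Fq_mul h.bdd i j ((hφ.TF j).dd (0, ei i))).2]
    simp_rw [inner_eq_sum]; rw [integral_finsetSum _ fun c _ =>
      h.integrable_initial_mul c ((hφ.TF c).slice_continuous 0) ((hφ.TF c).slice_compact 0)]
    linarith

/-- `wt` is the reciprocal of the weight in `PointwiseBound`. -/
lemma mul_wt (t : ℝ) {x : E3} (hx : x ≠ 0) : (‖x‖ + √t) ^ (1 - η) * ‖x‖ ^ η * wt η t x = 1 := by
  have h1 := rpow_add (show 0 < ‖x‖ + √t by positivity) (1 - η) (-1 + η)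
  have h2 := rpow_add (norm_pos_iff.2 hx) η (-η)
  simp only [sub_add_add_cancel, add_neg_cancel, Real.rpow_zero] at h1 h2
  unfold wt; linear_combination -(‖x‖ ^ η * ‖x‖ ^ (-η)) * h1 - h2

lemma IsMild.pointwiseBound (h : IsMild η ε A U V w₀ w) : PointwiseBound η A fun t x => w (t, x) := fun t ht x => by
  rcases eq_or_ne x 0 with rfl | hx
  · rw [norm_zero, zero_rpow h.hη0.ne']; simpa using h.hA
  · calc _ ≤ (‖x‖ + √t) ^ (1 - η) * ‖x‖ ^ η * (A * wt η t x) :=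
          mul_le_mul_of_nonneg_left (h.hw (t, x)) (by positivity)
      _ = A := by linear_combination A * mul_wt t hx

/-! ### The potential of a test function -/

/-- The spatial Laplacian on space-time. -/
noncomputable def D2 (f : E4 → ℝ) (z : E4) : ℝ := ∑ i : Fin 3, dd (0, ei i) (dd (0, ei i) f) z

/-- The potential of `χ`: it solves `Δ (∂ₜ + Δ) pot χ = χ` backward in time. -/
noncomputable def pot (χ : E4 → ℝ) (p : E4) : ℝ :=
  ∫ z, newtK (z.1 - p.1) (z.2 - p.2) * χ z

protected lemma TF.D2 (h : TF χ) : TF (D2 χ) := TF.sum fun _ _ => (h.dd _).dd _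

lemma locallyIntegrable_newtK : LocallyIntegrable fun q : E4 => newtK (-q.1) (-q.2) := by
  obtain ⟨C, hC, H⟩ := (isKer_newtK 0).bound
  refine ((locallyIntegrable_rpow (b := 1) (by simp)).smul C).mono
    ((isKer_newtK 0).measurable.comp (f := fun q : E4 => (-q.1, -q.2))
      (by fun_prop)).aestronglyMeasurable ?_
  filter_upwards [(Measure.quasiMeasurePreserving_snd.ae ae_ne_zero)] with q hq
  rw [Pi.smul_apply, norm_smul, norm_eq_abs, norm_eq_abs, norm_eq_abs, abs_of_nonneg hC,
    abs_of_nonneg (by positivity : 0 ≤ ‖q.2‖ ^ (-1 : ℝ))]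
  refine (H _ _).trans (mul_le_mul_of_nonneg_left ?_ hC); unfold pk; split_ifs
  · rw [norm_neg]
    exact rpow_le_rpow_of_nonpos (norm_pos_iff.2 hq) (by bound) (by simp)
  · positivity

instance isAddHaarMeasure_spacetime : (volume : Measure E4).IsAddHaarMeasure :=
  inferInstanceAs ((volume : Measure ℝ).prod (volume : Measure E3)).IsAddHaarMeasure

/-- As a convolution with a locally integrable function, `pot χ` is smooth. -/
lemma pot_eq_convolution (χ : E4 → ℝ) :
    pot χ = convolution χ (fun q : E4 => newtK (-q.1) (-q.2)) (ContinuousLinearMap.mul ℝ ℝ) volume := by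
  ext p; refine integral_ext fun z => ?_; simp [mul_comm]

lemma contDiff_dd {f : E4 → ℝ} (hf : ContDiff ℝ ∞ f) (v : E4) : ContDiff ℝ ∞ (dd v f) :=
  (hf.fderiv_right (m := ∞) le_rfl).clm_apply contDiff_const

namespace TF
variable {χ χ' : E4 → ℝ}

lemma contDiff_pot (h : TF χ) : ContDiff ℝ ∞ (pot χ) := by
  rw [pot_eq_convolution]
  exact h.compact.contDiff_convolution_left _ h.smooth locallyIntegrable_newtK

lemma integrable_pot (h : TF χ) (p : E4) :
    Integrable fun z : E4 => newtK (z.1 - p.1) (z.2 - p.2) * χ z := by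
  have := h.compact.convolutionExists_left (ContinuousLinearMap.mul ℝ ℝ) h.continuous
    locallyIntegrable_newtK p
  refine Integrable.congr this (ae_of_all _ fun z => ?_); simp [mul_comm]

lemma dd_pot (h : TF χ) (v : E4) : dd v (pot χ) = pot (dd v χ) := by
  ext p
  have h1 := h.compact.hasFDerivAt_convolution_left (ContinuousLinearMap.mul ℝ ℝ)
    (h.smooth.of_le (by simp)) locallyIntegrable_newtK p
  rw [← pot_eq_convolution] at h1; unfold dd; rw [h1.fderiv, pot]
  have h2 : ConvolutionExistsAt (fderiv ℝ χ) (fun q => newtK (-q.1) (-q.2)) p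
      ((ContinuousLinearMap.mul ℝ ℝ).precompL E4) volume :=
    (h.compact.fderiv (𝕜 := ℝ)).convolutionExists_left _ (h.smooth.continuous_fderiv (by simp))
      locallyIntegrable_newtK p
  rw [convolution, integral_apply h2]; refine integral_ext fun z => ?_; simp [mul_comm]

lemma pot_add (h : TF χ) (h' : TF χ') (p : E4) :
    pot (fun z => χ z + χ' z) p = pot χ p + pot χ' p := by
  unfold pot; rw [← integral_add (h.integrable_pot p) (h'.integrable_pot p)]
  refine integral_ext fun z => ?_; ring

lemma pot_sum {ι : Type*} {s : Finset ι} {f : ι → E4 → ℝ} (h : ∀ i ∈ s, TF (f i)) (p : E4) :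
    pot (fun z => ∑ i ∈ s, f i z) p = ∑ i ∈ s, pot (f i) p := by
  unfold pot; rw [← integral_finsetSum _ fun i hi => (h i hi).integrable_pot p]
  refine integral_ext fun z => ?_; simp only [mul_sum]

lemma D2_pot (h : TF χ) : D2 (pot χ) = pot (D2 χ) := by
  ext p; unfold D2; rw [pot_sum fun _ _ => (h.dd _).dd _]
  refine sum_congr rfl fun i _ => ?_; rw [h.dd_pot, (h.dd _).dd_pot]

lemma Lop_pot (h : TF χ) : Lop (pot χ) = pot (Lop χ) := by
  ext p; have := congrFun h.D2_pot p; unfold D2 at this; unfold Lop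
  rw [pot_add (h.dd _) (TF.sum fun _ _ => (h.dd _).dd _), h.dd_pot, this]

lemma pot_eq_zero (h : TF χ) : ∃ R : ℝ, 0 < R ∧ ∀ s y, R ≤ s → pot χ (s, y) = 0 := by
  obtain ⟨R, hR, H⟩ := h.exists_radius
  refine ⟨R, hR, fun s y hs => integral_eq_zero_of_ae (ae_of_all _ fun z => ?_)⟩
  rcases le_or_gt (z.1 - s) 0 with hz | hz
  · simp [(isKer_newtK 0).eq_zero hz]
  · have := H z.1 z.2 (Or.inl ((by linarith : R ≤ z.1).trans (le_abs_self _)))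
    simp [this]

lemma tendsto_pairInt_newtK (h : TF χ) (hs : 0 ≤ s) (y : E3) :
    Tendsto (fun ε => pairInt newtK χ ε s y) (𝓝[>] 0) (𝓝 (pot χ (s, y))) := by
  have hi : Integrable (fun q : E4 × Unit => newtK (q.1.1 - s) (q.1.2 - y) * 1 * χ q.1)
      (μ₊.prod (Measure.dirac ())) := by
    have := ((h.integrable_pot (s, y)).integrableOn (s := posTime)).comp_fst (Measure.dirac ())
    simpa using this
  have := tendsto_integral_pairInt
    (y := fun _ => y) (f := fun _ => 1) measurable_const (ae_of_all _ fun _ => hs)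
    (isKer_newtK 0) zero_le_one h hi
  simp at this
  have e : ∫ p in posTime, newtK (p.1 - s) (p.2 - y) * χ p = pot χ (s, y) := by
    refine setIntegral_eq_integral_of_forall_compl_eq_zero fun z hz => ?_
    have hz0 : z.1 ≤ 0 := by simpa [posTime] using hz
    rw [(isKer_newtK 0).eq_zero (by linarith), zero_mul]
  rwa [e] at this

/-- The defining property of the potential, for nonnegative times. -/
lemma pot_Lop_D2 (h : TF χ) (hs : 0 ≤ s) (y : E3) : pot (Lop (D2 χ)) (s, y) = χ (s, y) := by
  obtain ⟨B, -, hB⟩ := h.exists_bound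
  refine tendsto_nhds_unique (h.D2.Lop.tendsto_pairInt_newtK hs y) ?_
  refine (tendsto_heatK_pair h.continuous hB s y).congr' ?_
  filter_upwards [self_mem_nhdsWithin] with ε hε; have hε0 := hε; rw [pairInt_newtK_Lop h.D2 hε0]
  have e1 : pair newtK (D2 χ) ε s y = ∑ i, pair (rieszK (ei i) (ei i)) χ ε s y := by
    simp_rw [pair_rieszK h]; unfold pair D2
    rw [← integral_finsetSum _ fun i _ => (isKer_newtK 1).integrable_pair ((h.dd _).dd _) _ _ _]
    refine integral_ext fun x => ?_; simp only [mul_sum]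
  rw [e1]; unfold pair
  rw [← integral_finsetSum _ fun i _ => (isKer_rieszK 1 _ _).integrable_pair h _ _ _, ← integral_neg]
  refine integral_ext fun x => ?_; simp only [← sum_mul]; rw [sum_rieszK hε0]; ring

end TF

/-- Pairings with a kernel of order `m < 3` decay like the kernel, uniformly in the truncation. -/
lemma exists_pairInt_bound (hK : IsKer 0 m K) (hm0 : 0 ≤ m) (hm : m < 3) {g : E4 → ℝ} (h : TF g) :
    ∃ C : ℝ, 0 ≤ C ∧ ∀ ε : ℝ, 0 < ε → ∀ s : ℝ, 0 ≤ s → ∀ y : E3,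
    |pairInt K g ε s y| ≤ C * (‖y‖ + 1) ^ (-m) := by
  obtain ⟨B, hB0, hB⟩ := h.exists_bound; obtain ⟨R, hR, hRs⟩ := h.exists_radius
  obtain ⟨D, hD, HD⟩ := hK.bound
  obtain ⟨C, hC, HC⟩ := exists_lintegral_kernel_rpow (k := 4) (by norm_num) hm0 hm
  set B' := B * (R + 1) ^ (4 : ℝ)
  have hg : ∀ t x, |g (t, x)| ≤ B' * (‖x‖ + 1) ^ (-4 : ℝ) := fun t x => by
    by_cases hx : R ≤ ‖x‖
    · rw [hRs t x (Or.inr hx), abs_zero]; positivity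
    · refine (hB _).trans ?_
      rw [mul_assoc]; refine le_mul_of_one_le_right hB0 ?_
      rw [rpow_neg (by positivity), ← div_eq_mul_inv, one_le_div (by positivity)]
      exact rpow_le_rpow (by positivity) (by linarith) (by simp)
  have hpair : ∀ σ s, ∀ y, |pair K g σ s y| ≤ D * B' * (C * (‖y‖ + 1) ^ (-m)) := fun σ s y => by
    have e : pair K g σ s y = ∫ ξ, K σ ξ * g (s + σ, ξ + y) := by
      unfold pair; rw [← integral_add_right_eq_self _ y]; simp
    rw [e]
    have := integrable_of_lintegral_le (F := fun ξ => K σ ξ * g (s + σ, ξ + y)) (D := D * B')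

      ((hK.measurable.comp (f := fun ξ => (σ, ξ)) (by fun_prop)).mul
        (h.continuous.measurable.comp (by fun_prop))).aestronglyMeasurable (by positivity)
      (by positivity) ?_ (HC 1 one_pos (-y))
    · refine abs_integral_le_integral_abs.trans (this.2.trans_eq ?_)
      rw [one_rpow, one_mul, norm_neg]
    · filter_upwards [ae_ne_zero] with ξ hξ
      rw [abs_mul]
      have h1 : |K σ ξ| ≤ D * ‖ξ‖ ^ (-m) := by
        refine (HD σ ξ).trans (mul_le_mul_of_nonneg_left ?_ hD); unfold pk; split_ifs
        · exact rpow_le_rpow_of_nonpos (norm_pos_iff.2 hξ) (by bound) (by linarith)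
        · positivity
      rw [show ‖-y - ξ‖ = ‖ξ + y‖ by rw [← norm_neg]; congr 1; abel]
      calc _ ≤ (D * ‖ξ‖ ^ (-m)) * (B' * (‖ξ + y‖ + 1) ^ (-4 : ℝ)) :=
          by gcongr; exact hg (s + σ) (ξ + y)
        _ = _ := by ring
  refine ⟨R * (D * B' * C), by positivity, fun ε hε s hs y => ?_⟩
  set Q := D * B' * (C * (‖y‖ + 1) ^ (-m)); have hQ : 0 ≤ Q := by positivity
  have hdom : Integrable ((Ioc 0 R).indicator fun _ => Q) := by
    rw [integrable_indicator_iff measurableSet_Ioc]; exact integrable_const Q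
  calc |pairInt K g ε s y| ≤ ∫ σ in Ioi ε, (Ioc 0 R).indicator (fun _ => Q) σ := by
        refine norm_integral_le_of_norm_le (f := fun σ => pair K g σ s y) hdom.integrableOn ?_
        filter_upwards [ae_restrict_mem measurableSet_Ioi] with σ hσ
        by_cases hσR : σ ≤ R
        · rw [indicator_of_mem (show σ ∈ Ioc 0 R from ⟨hε.trans hσ, hσR⟩)]
          exact hpair σ s y
        · have : pair K g σ s y = 0 := by
            unfold pair
            have : ∀ x, g (s + σ, x) = 0 := fun x =>
              hRs _ _ (Or.inl ((by linarith : R ≤ s + σ).trans (le_abs_self _)))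
            simp [this]
          rw [this, norm_zero]; exact indicator_nonneg (fun _ _ => hQ) _
    _ ≤ ∫ σ, (Ioc 0 R).indicator (fun _ => Q) σ :=
      setIntegral_le_integral hdom (ae_of_all _ fun σ => indicator_nonneg (fun _ _ => hQ) _)
    _ = R * Q := by rw [integral_indicator measurableSet_Ioc, setIntegral_const]; simp [hR.le]
    _ = _ := by simp only [Q]; ring

/-- `g` decays like `|y|^(-m)` for positive times and vanishes for large times. -/
def Dec (m : ℝ) (g : E4 → ℝ) : Prop :=
  ∃ C R : ℝ, 0 ≤ C ∧ 0 < R ∧ (∀ s, 0 ≤ s → ∀ y, |g (s, y)| ≤ C * (‖y‖ + 1) ^ (-m)) ∧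
    ∀ s y, R ≤ s → g (s, y) = 0

lemma TF.dec_pot (h : TF χ) : Dec 1 (pot χ) := by
  obtain ⟨C, hC, H⟩ := exists_pairInt_bound (isKer_newtK 0) zero_le_one (by simp) h
  obtain ⟨R, hR, HR⟩ := h.pot_eq_zero
  refine ⟨C, R, hC, hR, fun s hs y => le_of_tendsto (h.tendsto_pairInt_newtK hs y).abs ?_, HR⟩
  filter_upwards [self_mem_nhdsWithin] with ε hε using H ε hε s hs y

/-- A derivative of `χ` falls on the kernel, and gains one power of decay. -/
lemma TF.dec_pot_dd (h : TF χ) (v : E3) : Dec 2 (pot (dd (0, v) χ)) := by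
  have hk := (isKer_newtK 2).dk v; rw [show (1 + 1 : ℝ) = 2 by norm_num] at hk
  obtain ⟨C, hC, H⟩ := exists_pairInt_bound hk.of_succ (by simp) (by norm_num) h
  obtain ⟨R, hR, HR⟩ := (h.dd (0, v)).pot_eq_zero
  refine ⟨C, R, hC, hR, fun s hs y => le_of_tendsto ((h.dd (0, v)).tendsto_pairInt_newtK hs y).abs ?_, HR⟩
  filter_upwards [self_mem_nhdsWithin] with ε hε; have := H ε hε s hs y
  rwa [pairInt_dk (isKer_newtK 2) h, abs_neg] at this

/-! ### Cutoffs -/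

section calculus
variable {f g : E4 → ℝ}

lemma dd_mul_fun (hf : ContDiff ℝ ∞ f) (hg : ContDiff ℝ ∞ g) (v : E4) :
    dd v (fun z => f z * g z) = fun z => dd v f z * g z + f z * dd v g z := by
  ext z; unfold dd
  rw [fderiv_fun_mul (hf.differentiable (by simp) z) (hg.differentiable (by simp) z)]; simp; ring

lemma dd_add_fun (hf : ContDiff ℝ ∞ f) (hg : ContDiff ℝ ∞ g) (v : E4) :
    dd v (fun z => f z + g z) = fun z => dd v f z + dd v g z := by
  ext z; unfold dd
  rw [fderiv_fun_add (hf.differentiable (by simp) z) (hg.differentiable (by simp) z)]; rfl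

lemma dd_const_mul_fun (hf : ContDiff ℝ ∞ f) (c : ℝ) (v : E4) :
    dd v (fun z => c * f z) = fun z => c * dd v f z := by
  ext z; unfold dd; rw [fderiv_const_mul (hf.differentiable (by simp) z)]; rfl

lemma contDiff_D2 (hf : ContDiff ℝ ∞ f) : ContDiff ℝ ∞ (D2 f) :=
  ContDiff.sum fun _ _ => contDiff_dd (contDiff_dd hf _) _

lemma contDiff_Lop (hf : ContDiff ℝ ∞ f) : ContDiff ℝ ∞ (Lop f) :=
  (contDiff_dd hf _).add (contDiff_D2 hf)

lemma Lop_eq (f : E4 → ℝ) (z : E4) : Lop f z = dd (1, 0) f z + D2 f z := rfl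

lemma D2_mul (hf : ContDiff ℝ ∞ f) (hg : ContDiff ℝ ∞ g) (z : E4) : D2 (fun z => f z * g z) z
      = f z * D2 g z + 2 * (∑ i : Fin 3, dd (0, ei i) f z * dd (0, ei i) g z) + D2 f z * g z := by
  unfold D2; rw [mul_sum, mul_sum, sum_mul, ← sum_add_distrib, ← sum_add_distrib]
  refine sum_congr rfl fun i _ => ?_
  rw [dd_mul_fun hf hg, dd_add_fun ((contDiff_dd hf _).mul hg) (hf.mul (contDiff_dd hg _)),
    dd_mul_fun (contDiff_dd hf _) hg, dd_mul_fun hf (contDiff_dd hg _)]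
  ring

lemma D2_add (hf : ContDiff ℝ ∞ f) (hg : ContDiff ℝ ∞ g) (z : E4) :
    D2 (fun z => f z + g z) z = D2 f z + D2 g z := by
  unfold D2; rw [← sum_add_distrib]; refine sum_congr rfl fun i _ => ?_
  rw [dd_add_fun hf hg, dd_add_fun (contDiff_dd hf _) (contDiff_dd hg _)]

lemma D2_const_mul (hf : ContDiff ℝ ∞ f) (c : ℝ) (z : E4) :
    D2 (fun z => c * f z) z = c * D2 f z := by
  unfold D2; rw [mul_sum]; refine sum_congr rfl fun i _ => ?_
  rw [dd_const_mul_fun hf, dd_const_mul_fun (contDiff_dd hf _)]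

lemma D2_sum {ι : Type*} {s : Finset ι} {F : ι → E4 → ℝ} (h : ∀ i, ContDiff ℝ ∞ (F i))
    (z : E4) : D2 (fun z => ∑ i ∈ s, F i z) z = ∑ i ∈ s, D2 (F i) z := by
  classical
  induction s using Finset.induction_on with
  | empty => simp; unfold D2 dd; simp
  | insert i s hi ih =>
    simp only [Finset.sum_insert hi]; rw [D2_add (h i) (ContDiff.sum fun j _ => h j), ih]

lemma Lop_mul (hf : ContDiff ℝ ∞ f) (hg : ContDiff ℝ ∞ g) (ht : dd (1, 0) f = fun _ => 0) (z : E4) :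
    Lop (fun z => f z * g z) z
      = f z * Lop g z + 2 * (∑ i : Fin 3, dd (0, ei i) f z * dd (0, ei i) g z) + D2 f z * g z := by
  rw [Lop_eq, D2_mul hf hg, dd_mul_fun hf hg, ht, Lop_eq]; ring

lemma Lop_lin (hf : ContDiff ℝ ∞ f) (hg : ContDiff ℝ ∞ g) (a b : ℝ) (z : E4) :
    Lop (fun z => a * f z + b * g z) z = a * Lop f z + b * Lop g z := by
  rw [Lop_eq, D2_add (contDiff_const.mul hf) (contDiff_const.mul hg),
    dd_add_fun (contDiff_const.mul hf) (contDiff_const.mul hg), dd_const_mul_fun hf,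
    dd_const_mul_fun hg, D2_const_mul hf, D2_const_mul hg, Lop_eq, Lop_eq]; ring

/-- The bilaplacian-type operator `Δ (∂ₜ + Δ)` applied to a product with a function of `x`. -/
lemma D2_Lop_mul (hf : ContDiff ℝ ∞ f) (hg : ContDiff ℝ ∞ g) (ht : dd (1, 0) f = fun _ => 0)
    (z : E4) :
    D2 (Lop (fun z => f z * g z)) z = f z * D2 (Lop g) z
        + (2 * (∑ i : Fin 3, dd (0, ei i) f z * dd (0, ei i) (Lop g) z) + D2 f z * Lop g z
          + 2 * (∑ i : Fin 3, (dd (0, ei i) f z * D2 (dd (0, ei i) g) z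
            + 2 * (∑ k : Fin 3, dd (0, ei k) (dd (0, ei i) f) z * dd (0, ei k) (dd (0, ei i) g) z)
            + D2 (dd (0, ei i) f) z * dd (0, ei i) g z))
          + (D2 f z * D2 g z + 2 * (∑ i : Fin 3, dd (0, ei i) (D2 f) z * dd (0, ei i) g z)
            + D2 (D2 f) z * g z)) := by
  have e : Lop (fun z => f z * g z) = fun z => (f z * Lop g z
      + 2 * (∑ i, dd (0, ei i) f z * dd (0, ei i) g z)) + D2 f z * g z :=
    funext fun z => Lop_mul hf hg ht z
  have h1 := hf.mul (contDiff_Lop hg)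
  have h2 : ∀ i, ContDiff ℝ ∞ fun z => dd (0, ei i) f z * dd (0, ei i) g z := fun i =>
    (contDiff_dd hf _).mul (contDiff_dd hg _)
  have h2' : ContDiff ℝ ∞ fun z => ∑ i, dd (0, ei i) f z * dd (0, ei i) g z :=
    ContDiff.sum fun i _ => h2 i
  rw [e, D2_add (h1.add (contDiff_const.mul h2')) ((contDiff_D2 hf).mul hg), D2_add h1 (contDiff_const.mul h2'),
    D2_const_mul h2', D2_sum h2, D2_mul hf (contDiff_Lop hg), D2_mul (contDiff_D2 hf) hg]
  simp_rw [fun i => D2_mul (contDiff_dd hf (0, ei i)) (contDiff_dd hg (0, ei i)) z]; ring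

lemma dd_congr_on {O : Set E4} (hO : IsOpen O) (h : EqOn f g O) (v : E4) :
    EqOn (dd v f) (dd v g) O := fun z hz => by
  unfold dd
  rw [(h.eventuallyEq_of_mem (hO.mem_nhds hz)).fderiv_eq]

lemma D2_congr_on {O : Set E4} (hO : IsOpen O) (h : EqOn f g O) : EqOn (D2 f) (D2 g) O :=
  fun _ hz => sum_congr rfl fun _ _ => dd_congr_on hO (dd_congr_on hO h _) _ hz

lemma Lop_congr_on {O : Set E4} (hO : IsOpen O) (h : EqOn f g O) : EqOn (Lop f) (Lop g) O :=
  fun z hz => by rw [Lop_eq, Lop_eq, D2_congr_on hO h hz, dd_congr_on hO h _ hz]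

lemma TF.dd_D2 (h : TF f) (v : E4) : dd v (D2 f) = D2 (dd v f) := by
  unfold D2; rw [dd_sum fun _ _ => (h.dd _).dd _]; ext z
  refine sum_congr rfl fun i _ => ?_; rw [(h.dd _).dd_comm, h.dd_comm]

lemma TF.Lop_D2 (h : TF f) : Lop (D2 f) = D2 (Lop f) := by
  unfold D2; rw [Lop_sum fun _ _ => (h.dd _).dd _]; ext z
  refine sum_congr rfl fun i _ => ?_; rw [h.dd_Lop, (h.dd _).dd_Lop]

end calculus

/-- The rescaled cutoff `R^(-k) β (x / R)`. -/
noncomputable def sck (k : ℕ) (R : ℝ) (β : E3 → ℝ) (z : E4) : ℝ := R⁻¹ ^ k * β (R⁻¹ • z.2)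

/-- Partial derivatives of functions on space. -/
noncomputable def pd (i : Fin 3) (β : E3 → ℝ) (y : E3) : ℝ := fderiv ℝ β y (ei i)

/-- The Laplacian of functions on space. -/
noncomputable def lap (β : E3 → ℝ) (y : E3) : ℝ := ∑ i : Fin 3, pd i (pd i β) y

/-- Smooth compactly supported functions on space. -/
structure SC (β : E3 → ℝ) : Prop where
  smooth : ContDiff ℝ ∞ β
  compact : HasCompactSupport β

protected lemma SC.pd (h : SC β) (i : Fin 3) : SC (pd i β) :=
  ⟨(h.smooth.fderiv_right (m := ∞) le_rfl).clm_apply contDiff_const, h.compact.fderiv_apply (𝕜 := ℝ) _⟩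

lemma SC.lap (h : SC β) : SC (lap β) := by
  have h1 := fun i => (h.pd i).pd i; refine ⟨ContDiff.sum fun i _ => (h1 i).smooth, ?_⟩
  have : PerturbedNS.lap β = fun y => pd 0 (pd 0 β) y + pd 1 (pd 1 β) y + pd 2 (pd 2 β) y := by
    ext y; simp [PerturbedNS.lap, Fin.sum_univ_three]
  rw [this]; exact ((h1 0).compact.add (h1 1).compact).add (h1 2).compact

lemma contDiff_sck (h : SC β) (k : ℕ) (R : ℝ) : ContDiff ℝ ∞ (sck k R β) :=
  contDiff_const.mul (h.smooth.comp (contDiff_snd.const_smul R⁻¹))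

lemma fderiv_sck (h : SC β) (k : ℕ) (R : ℝ) (v : E4) (z : E4) :
    dd v (sck k R β) z = R⁻¹ ^ (k + 1) * fderiv ℝ β (R⁻¹ • z.2) v.2 := by
  have h1 : HasFDerivAt (fun z => R⁻¹ • z.2) (R⁻¹ • snd ℝ ℝ E3) z :=
    (snd ℝ ℝ E3).hasFDerivAt.const_smul R⁻¹
  unfold dd; have e : sck k R β = fun z => R⁻¹ ^ k * (β ∘ fun z => R⁻¹ • z.2) z := rfl
  rw [e, (((h.smooth.differentiable (by simp) (R⁻¹ • z.2)).hasFDerivAt.comp z h1).const_mul (R⁻¹ ^ k)).fderiv]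
  simp; ring

lemma dd_sck (h : SC β) (k : ℕ) (R : ℝ) (i : Fin 3) :
    dd (0, ei i) (sck k R β) = sck (k + 1) R (pd i β) := funext fun z => fderiv_sck h k R _ z

lemma dd_time_sck (h : SC β) (k : ℕ) (R : ℝ) : dd (1, 0) (sck k R β) = fun _ => 0 :=
  funext fun z => by rw [fderiv_sck h]; simp

lemma D2_sck (h : SC β) (k : ℕ) (R : ℝ) : D2 (sck k R β) = sck (k + 2) R (lap β) := by
  ext z; unfold D2; simp_rw [dd_sck h, dd_sck (h.pd _)]; simp [sck, lap, mul_sum]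

/-- Families of functions, indexed by `R`, that vanish pointwise as `R → ∞` and are dominated by
`|x|^(-3)`. -/
def Small (E : ℝ → E4 → ℝ) : Prop :=
  (∃ C : ℝ, 0 ≤ C ∧ ∀ R, 1 ≤ R → ∀ z : E4, 0 ≤ z.1 → |E R z| ≤ C * (‖z.2‖ + 1) ^ (-3 : ℝ)) ∧
  (∃ T : ℝ, 0 < T ∧ ∀ R z, T ≤ z.1 → E R z = 0) ∧
  ∀ z : E4, 0 ≤ z.1 → Tendsto (fun R => E R z) atTop (𝓝 0)

lemma Small.add {E F : ℝ → E4 → ℝ} (hE : Small E) (hF : Small F) :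
    Small fun R z => E R z + F R z := by
  obtain ⟨⟨C, hC, h1⟩, ⟨T, hT, h2⟩, h3⟩ := hE; obtain ⟨⟨C', hC', k1⟩, ⟨T', hT', k2⟩, k3⟩ := hF
  refine ⟨⟨C + C', by positivity, fun R hR z hz => ?_⟩, ⟨max T T', by positivity, fun R z hz => ?_⟩,
    fun z hz => by simpa using (h3 z hz).add (k3 z hz)⟩
  · rw [add_mul]
    exact (abs_add_le _ _).trans (add_le_add (h1 R hR z hz) (k1 R hR z hz))
  · simp only; rw [h2 R z ((le_max_left _ _).trans hz), k2 R z ((le_max_right _ _).trans hz), add_zero]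

lemma Small.const_mul {E : ℝ → E4 → ℝ} (hE : Small E) (c : ℝ) : Small fun R z => c * E R z := by
  obtain ⟨⟨C, hC, h1⟩, ⟨T, hT, h2⟩, h3⟩ := hE
  refine ⟨⟨|c| * C, by positivity, fun R hR z hz => ?_⟩, ⟨T, hT, fun R z hz => ?_⟩,
    fun z hz => by simpa using (h3 z hz).const_mul c⟩
  · rw [abs_mul, mul_assoc]
    gcongr; exact h1 R hR z hz
  · simp only; rw [h2 R z hz, mul_zero]

lemma Small.sum {F : Fin 3 → ℝ → E4 → ℝ} (h : ∀ i, Small (F i)) :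
    Small fun R z => ∑ i : Fin 3, F i R z := by
  simp only [Fin.sum_univ_three]; exact ((h 0).add (h 1)).add (h 2)

/-- `k` derivatives of a cutoff at scale `R` and decay of order `3 - k` give an error small in the
sense of `Small`. -/
lemma small_sck_mul {k : ℕ} (h : SC β) (hk : 1 ≤ k) {g : E4 → ℝ}
    (hg : Dec m g) (hkm : 3 ≤ k + m) : Small fun R z => sck k R β z * g z := by
  obtain ⟨C, T, hC, hT, hgC, hgT⟩ := hg
  obtain ⟨B, hB⟩ := h.compact.exists_bound_of_continuous h.smooth.continuous
  have hB0 := (norm_nonneg _).trans (hB 0)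
  obtain ⟨ρ, hρ0, hρ⟩ := h.compact.isCompact.isBounded.subset_ball_lt 0 0
  refine ⟨⟨B * (ρ + 1) ^ (k : ℝ) * C, by positivity, fun R hR z hz => ?_⟩, ⟨T, hT, fun R z hz => ?_⟩,
    fun z hz => ?_⟩
  · have hR0 : 0 < R := by linarith
    by_cases hb : R⁻¹ • z.2 ∈ ball (0 : E3) ρ
    · have hy0 : 0 < ‖z.2‖ + 1 := by positivity
      have h1 : ‖z.2‖ + 1 ≤ (ρ + 1) * R := by
        rw [mem_ball_zero_iff, norm_smul, norm_inv, norm_eq_abs, abs_of_pos hR0,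
          inv_mul_lt_iff₀ hR0] at hb
        bound
      have h2 : R⁻¹ ^ k ≤ (ρ + 1) ^ (k : ℝ) * (‖z.2‖ + 1) ^ (-(k : ℝ)) := by
        rw [rpow_neg hy0.le, rpow_natCast, rpow_natCast, ← inv_pow, ← mul_pow]
        refine pow_le_pow_left₀ (by positivity) ?_ k
        rw [← div_eq_mul_inv, le_div_iff₀ hy0, inv_mul_le_iff₀ hR0]; linarith
      rw [abs_mul, sck, abs_mul, abs_of_nonneg (by positivity : 0 ≤ R⁻¹ ^ k)]
      calc _ ≤ ((ρ + 1) ^ (k : ℝ) * (‖z.2‖ + 1) ^ (-(k : ℝ)) * B) * (C * (‖z.2‖ + 1) ^ (-m)) := by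
            refine mul_le_mul (by gcongr; exact hB _) (hgC _ hz _) (abs_nonneg _) (by positivity)
        _ = B * (ρ + 1) ^ (k : ℝ) * C * (‖z.2‖ + 1) ^ (-(k : ℝ) + -m) := by rw [rpow_add hy0]; ring
        _ ≤ _ := mul_le_mul_of_nonneg_left (rpow_le_rpow_of_exponent_le
          (by bound) (by linarith)) (by positivity)
    · have : sck k R β z = 0 := by rw [sck, image_eq_zero_of_notMem_tsupport fun h => hb (hρ h), mul_zero]
      simp only [this, zero_mul, abs_zero]; positivity
  · simp only; rw [show g z = 0 from hgT z.1 z.2 hz, mul_zero]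
  · have h0 : Tendsto (fun R => R⁻¹ ^ k * (B * |g z|)) atTop (𝓝 0) := by
      have := (tendsto_inv_atTop_zero (𝕜 := ℝ)).pow k; rw [zero_pow (by omega)] at this
      simpa using this.mul_const (B * |g z|)
    refine squeeze_zero_norm' ?_ h0; filter_upwards [eventually_ge_atTop 1] with R hR
    have : 0 ≤ R⁻¹ ^ k := by positivity
    rw [norm_mul, sck, norm_mul, norm_eq_abs (R⁻¹ ^ k), abs_of_nonneg this, mul_assoc]
    refine mul_le_mul_of_nonneg_left (mul_le_mul_of_nonneg_right (hB _) (abs_nonneg _)) this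

/-- Cutting off the potential of `χ` at radius `R` changes `Δ (∂ₜ + Δ) pot χ = χ` by a small error. -/
lemma TF.D2_Lop_cutoff (h : TF χ) (hβ : SC β) : ∃ E : ℝ → E4 → ℝ, Small E ∧ ∀ R, ∀ z : E4, 0 ≤ z.1 →
    D2 (Lop fun z => sck 0 R β z * pot χ z) z = sck 0 R β z * χ z + E R z := by
  have d2 := fun i => h.dec_pot_dd (ei i)
  have s1 := Small.sum fun i => small_sck_mul (hβ.pd i) le_rfl
    (h.Lop.dec_pot_dd (ei i)) (by norm_num)
  have s2 := small_sck_mul hβ.lap (k := 0 + 2) (by simp) h.Lop.dec_pot (by norm_num)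
  have s3 := fun i => small_sck_mul (hβ.pd i) le_rfl (h.D2.dec_pot_dd (ei i)) (by norm_num)
  have s4 := fun i => Small.sum fun k => small_sck_mul ((hβ.pd i).pd k)
    (k := 0 + 1 + 1) (by simp) ((h.dd (0, ei i)).dec_pot_dd (ei k)) (by norm_num)
  have s5 := fun i => small_sck_mul (hβ.pd i).lap (k := 0 + 1 + 2) (by simp) (d2 i) (by simp)
  have s6 := small_sck_mul hβ.lap (k := 0 + 2) (by simp) h.D2.dec_pot (by norm_num)
  have s7 := Small.sum fun i => small_sck_mul (hβ.lap.pd i) (k := 0 + 2 + 1) (by simp)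
    (d2 i) (by simp)
  have s8 := small_sck_mul hβ.lap.lap (k := 0 + 2 + 2) (by simp) h.dec_pot (by norm_num)
  refine ⟨_, (((s1.const_mul 2).add s2).add ((Small.sum fun i =>
    ((s3 i).add ((s4 i).const_mul 2)).add (s5 i)).const_mul 2)).add
    ((s6.add (s7.const_mul 2)).add s8), fun R z hz => ?_⟩
  have e := D2_Lop_mul (contDiff_sck hβ 0 R) h.contDiff_pot (dd_time_sck hβ 0 R) z
  simp only [h.Lop_pot, h.Lop.D2_pot, ← h.Lop_D2] at e; rw [h.pot_Lop_D2 hz] at e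
  simp only [D2_sck hβ, dd_sck hβ, dd_sck (hβ.pd _), D2_sck (hβ.pd _), D2_sck hβ.lap,
    dd_sck hβ.lap, h.dd_pot, (h.dd _).dd_pot, h.Lop.dd_pot, (h.dd _).D2_pot, ← h.dd_D2,
    h.D2_pot] at e
  exact e

/-! ### Uniqueness -/

section heatUnique
variable {h : Fin 3 → E4 → ℝ} {N : ℝ}

/-- Divergence free weak solutions of the heat equation with a pressure, with zero initial value, in
the class `O(|x|⁻¹)`. -/
structure HeatNull (h : Fin 3 → E4 → ℝ) (N : ℝ) : Prop where
  hm : ∀ c, Measurable (h c)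
  hN0 : 0 ≤ N
  hN : ∀ c, ∀ᵐ z ∂μ₊, |h c z| ≤ N * ‖z.2‖ ^ (-1 : ℝ)
  hdiv : ∀ g, TF g → ∑ c : Fin 3, ∫ z in posTime, h c z * dd (0, ei c) g z = 0
  hheat : ∀ φ : Fin 3 → E4 → ℝ, (∀ c, TF (φ c)) → (∀ z, ∑ c : Fin 3, dd (0, ei c) (φ c) z = 0) →
    ∑ c : Fin 3, ∫ z in posTime, h c z * Lop (φ c) z = 0

lemma HeatNull.integrable (hh : HeatNull h N) (c : Fin 3) {g : E4 → ℝ} (hg : TF g) :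
    Integrable (fun z => h c z * g z) μ₊ := integrable_mul_TF (by simp) (hh.hm c) (hh.hN c) hg

/-- `h` is tested with `Δ Ψ e_j - ∇ ∂_j Ψ`, whose second part is annihilated by `h`. -/
lemma integral_mul_D2_Lop_eq_zero (hh : HeatNull h N) (j : Fin 3) {Ψ : E4 → ℝ} (hΨ : TF Ψ) :
    ∫ z in posTime, h j z * D2 (Lop Ψ) z = 0 := by
  set δ : Fin 3 → ℝ := fun c => if c = j then 1 else 0
  -- the divergence free field `Δ Ψ e_j - ∇ ∂_j Ψ`
  have hφ : ∀ c, TF fun z => δ c * D2 Ψ z + (-1) * dd (0, ei c) (dd (0, ei j) Ψ) z := fun c =>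
    (hΨ.D2.const_mul _).add (((hΨ.dd _).dd _).const_mul _)
  have hφd : ∀ z, ∑ c, dd (0, ei c)
      (fun z => δ c * D2 Ψ z + (-1) * dd (0, ei c) (dd (0, ei j) Ψ) z) z = 0 := fun z => by
    have e : ∀ c, dd (0, ei c) (fun z => δ c * D2 Ψ z + (-1) * dd (0, ei c) (dd (0, ei j) Ψ) z) z
        = δ c * dd (0, ei c) (D2 Ψ) z - dd (0, ei c) (dd (0, ei c) (dd (0, ei j) Ψ)) z := fun c => by
      have s1 := hΨ.D2.smooth; have s2 := ((hΨ.dd (0, ei j)).dd (0, ei c)).smooth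
      rw [dd_add_fun (contDiff_const.mul s1) (contDiff_const.mul s2), dd_const_mul_fun s1,
        dd_const_mul_fun s2]
      ring
    simp_rw [e]; rw [sum_sub_distrib]; simp only [δ, ite_mul, one_mul, zero_mul]
    rw [Finset.sum_ite_eq' Finset.univ j, if_pos (Finset.mem_univ j), hΨ.dd_D2]; exact sub_self _
  have h1 := hh.hheat _ hφ hφd
  have e : ∀ c, ∫ z in posTime, h c z
      * Lop (fun z => δ c * D2 Ψ z + (-1) * dd (0, ei c) (dd (0, ei j) Ψ) z) z
      = δ c * (∫ z in posTime, h c z * D2 (Lop Ψ) z)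
        - ∫ z in posTime, h c z * dd (0, ei c) (Lop (dd (0, ei j) Ψ)) z := fun c => by
    rw [← integral_const_mul, ← integral_sub ((hh.integrable c hΨ.Lop.D2).const_mul _)
      (hh.integrable c ((hΨ.dd (0, ei j)).Lop.dd (0, ei c)))]
    refine integral_ext fun z => ?_
    rw [Lop_lin hΨ.D2.smooth ((hΨ.dd (0, ei j)).dd (0, ei c)).smooth, hΨ.Lop_D2,
      ← (hΨ.dd (0, ei j)).dd_Lop]
    ring
  simp_rw [e] at h1; rw [sum_sub_distrib, hh.hdiv _ (hΨ.dd (0, ei j)).Lop, sub_zero] at h1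
  simpa [δ] using h1

/-- Uniqueness for the heat equation with a pressure, in the class `O(|x|⁻¹)`. -/
lemma ae_eq_zero_of_heat (hh : HeatNull h N) (j : Fin 3) : ∀ᵐ z ∂μ₊, h j z = 0 := by
  have key : ∀ χ, TF χ → ∫ z in posTime, h j z * χ z = 0 := fun χ hχ => by
    let b : ContDiffBump (0 : E3) := ⟨1, 2, one_pos, by simp⟩
    have hb : SC b := ⟨b.contDiff, b.hasCompactSupport⟩; obtain ⟨T, hT, hpot⟩ := hχ.pot_eq_zero
    let θ : ContDiffBump (0 : ℝ) := ⟨T + 1, T + 2, by positivity, by linarith⟩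
    obtain ⟨E, ⟨⟨C, hC, hE⟩, ⟨T', hT', hE'⟩, hE0⟩, hcut⟩ := hχ.D2_Lop_cutoff hb
    -- the compactly supported approximations of the potential
    have hΨ : ∀ R, 0 < R → TF fun z => θ z.1 * (sck 0 R b z * pot χ z) := fun R hR => by
      refine ⟨(θ.contDiff.comp contDiff_fst).mul ((contDiff_sck hb 0 R).mul hχ.contDiff_pot), ?_⟩
      refine HasCompactSupport.intro (θ.hasCompactSupport.isCompact.prod
        (isCompact_closedBall (0 : E3) (2 * R))) fun z hz => ?_
      by_cases h1 : z.1 ∈ tsupport θ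
      · have h2 : z.2 ∉ closedBall (0 : E3) (2 * R) := fun h2 => hz ⟨h1, h2⟩
        have : b (R⁻¹ • z.2) = 0 := by
          refine b.zero_of_le_dist ?_; rw [mem_closedBall_zero_iff, not_le] at h2
          rw [dist_zero_right, norm_smul, norm_inv, norm_eq_abs, abs_of_pos hR, le_inv_mul_iff₀ hR]
          linarith
        simp [sck, this]
      · simp [image_eq_zero_of_notMem_tsupport h1]
    have hO : IsOpen {z : E4 | -(T + 1) < z.1} := isOpen_lt continuous_const continuous_fst
    have heq : ∀ R, EqOn (fun z => θ z.1 * (sck 0 R b z * pot χ z))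
        (fun z => sck 0 R b z * pot χ z) {z : E4 | -(T + 1) < z.1} := fun R z hz => by
      rcases le_or_gt T z.1 with h1 | h1
      · simp only
        rw [show pot χ z = 0 from hpot z.1 z.2 h1]; simp
      · have : θ z.1 = 1 := by
          refine θ.one_of_mem_closedBall ?_; rw [mem_closedBall_zero_iff, norm_eq_abs]
          exact abs_le.2 ⟨hz.le, by change z.1 ≤ T + 1; linarith⟩
        simp [this]
    have hR : ∀ R, 1 ≤ R → ∫ z in posTime, h j z * (sck 0 R b z * χ z + E R z) = 0 := fun R hR1 => by
      rw [← integral_mul_D2_Lop_eq_zero hh j (hΨ R (by linarith))]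
      refine setIntegral_congr_fun measurableSet_posTime fun z hz => ?_; have hz0 : 0 < z.1 := hz.1
      rw [← hcut R z hz0.le]; congr 1
      exact (D2_congr_on hO (Lop_congr_on hO (heq R)) (by change -(T + 1) < z.1; linarith)).symm
    have hlim : Tendsto (fun R => ∫ z in posTime, h j z * (sck 0 R b z * χ z + E R z)) atTop
        (𝓝 (∫ z in posTime, h j z * χ z)) := by
      have hi := hh.integrable j hχ; have hN0 := hh.hN0
      set D := fun z => |h j z * χ z| + N * C * ((Icc 0 T').indicator (fun _ => (1 : ℝ)) z.1
        * (‖z.2‖ ^ (-1 : ℝ) * min 1 (‖z.2‖ ^ (-(5 / 2) : ℝ))))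
      have hD : Integrable D μ₊ := by
        refine hi.abs.add (Integrable.integrableOn (Integrable.const_mul (Integrable.mul_prod ?_
          (integrable_rpow_mul_min (by simp) (by norm_num))) _))
        rw [integrable_indicator_iff measurableSet_Icc]; exact integrable_const 1
      refine tendsto_integral_filter_of_dominated_convergence D ?_ ?_ hD ?_
      · filter_upwards [eventually_ge_atTop 1] with R hR1
        refine (hh.hm j).aestronglyMeasurable.mul ?_
        -- `E R` is smooth on positive times by its defining identity
        have hc :=
          (contDiff_D2 (contDiff_Lop ((contDiff_sck hb 0 R).mul hχ.contDiff_pot))).continuous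
        refine hc.aestronglyMeasurable.congr ?_
        filter_upwards [ae_posTime] with z hz using hcut R z hz.1.le
      · filter_upwards [eventually_ge_atTop 1] with R hR1
        filter_upwards [ae_posTime, hh.hN j] with z hz hzN; rw [norm_mul, norm_eq_abs, norm_eq_abs]
        have h1 : |h j z| * |sck 0 R b z * χ z| ≤ |h j z * χ z| := by
          rw [abs_mul, abs_mul]
          gcongr; exact mul_le_of_le_one_left (abs_nonneg _)
            (by rw [sck, pow_zero, one_mul, abs_of_nonneg b.nonneg]; exact b.le_one)
        have h2 : |h j z| * |E R z| ≤ N * C * ((Icc 0 T').indicator (fun _ => (1 : ℝ)) z.1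
            * (‖z.2‖ ^ (-1 : ℝ) * min 1 (‖z.2‖ ^ (-(5 / 2) : ℝ)))) := by
          by_cases hzT : z.1 ≤ T'
          · rw [indicator_of_mem (show z.1 ∈ Icc 0 T' from ⟨hz.1.le, hzT⟩), one_mul]
            have hy0 := norm_pos_iff.2 hz.2
            have h3 : (‖z.2‖ + 1) ^ (-3 : ℝ) ≤ min 1 (‖z.2‖ ^ (-(5 / 2) : ℝ)) := by
              refine le_min (Real.rpow_le_one_of_one_le_of_nonpos (by linarith) (by simp)) ?_
              calc (‖z.2‖ + 1) ^ (-3 : ℝ) ≤ (‖z.2‖ + 1) ^ (-(5 / 2) : ℝ) :=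
                  rpow_le_rpow_of_exponent_le (by linarith) (by norm_num)
                _ ≤ _ := rpow_le_rpow_of_nonpos hy0 (by linarith) (by norm_num)
            calc _ ≤ (N * ‖z.2‖ ^ (-1 : ℝ)) * (C * min 1 (‖z.2‖ ^ (-(5 / 2) : ℝ))) :=
                by gcongr; exact (hE R hR1 z hz.1.le).trans (by gcongr)
              _ = _ := by ring
          · rw [hE' R z (not_le.1 hzT).le, abs_zero, mul_zero,
              indicator_of_notMem (show z.1 ∉ Icc 0 T' from fun h => hzT h.2)]
            simp
        calc _ ≤ |h j z| * (|sck 0 R b z * χ z| + |E R z|) :=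
            by gcongr; exact abs_add_le _ _
          _ = |h j z| * |sck 0 R b z * χ z| + |h j z| * |E R z| := by ring
          _ ≤ _ := add_le_add h1 h2
      · filter_upwards [ae_posTime] with z hz
        have h1 : Tendsto (fun R => sck 0 R b z * χ z) atTop (𝓝 (χ z)) := by
          refine tendsto_const_nhds.congr' ?_
          filter_upwards [eventually_gt_atTop 0, eventually_ge_atTop ‖z.2‖] with R hR0 hRz
          have : b (R⁻¹ • z.2) = 1 := by
            refine b.one_of_mem_closedBall ?_
            rw [mem_closedBall_zero_iff, norm_smul, norm_inv, norm_eq_abs, abs_of_pos hR0,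
              inv_mul_le_iff₀ hR0]
            linarith
          simp [sck, this]
        simpa using ((h1.add (hE0 z hz.1.le)).const_mul (h j z))
    refine tendsto_nhds_unique hlim (tendsto_const_nhds.congr' ?_)
    filter_upwards [eventually_ge_atTop 1] with R hR1 using (hR R hR1).symm
  have hloc : LocallyIntegrable (posTime.indicator (h j)) := by
    refine ((locallyIntegrable_rpow (b := 1) (by simp)).smul N).mono
      ((hh.hm j).indicator measurableSet_posTime).aestronglyMeasurable ?_
    filter_upwards [(ae_restrict_iff' measurableSet_posTime).1 (hh.hN j)] with z hz
    by_cases hz0 : z ∈ posTime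
    · simpa [hz0] using (hz hz0).trans (le_abs_self _)
    · simp [hz0]; positivity
  have := ae_eq_zero_of_integral_contDiff_smul_eq_zero hloc fun g hg hgc => by
    have := key g ⟨hg, hgc⟩; rw [← integral_indicator measurableSet_posTime] at this; rw [← this]
    refine integral_ext fun z => ?_; by_cases hz0 : z ∈ posTime <;> simp [hz0, mul_comm]
  rw [ae_restrict_iff' measurableSet_posTime]; filter_upwards [this] with z hz hz0
  rwa [indicator_of_mem hz0] at hz

end heatUnique

/-- Fields that are divergence free at almost every time are orthogonal to gradients. -/
lemma sum_integral_gradient_eq_zero {u : E4 → E3} {g : E4 → ℝ} (hg : TF g)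
    (hi : ∀ c : Fin 3, Integrable (fun z => u z c * dd (0, ei c) g z) μ₊)
    (hu : ∀ᵐ t ∂(volume.restrict (Ioi (0 : ℝ))), WeaklyDivFree fun x => u (t, x)) :
    ∑ c : Fin 3, ∫ z in posTime, u z c * dd (0, ei c) g z = 0 := by
  have hs := integrable_finsetSum Finset.univ fun c _ => hi c
  rw [← integral_finsetSum _ fun c _ => hi c, volume_restrict_posTime, integral_prod _
    (by rwa [volume_restrict_posTime] at hs)]
  refine integral_eq_zero_of_ae ?_; filter_upwards [hu] with t ht; simp
  refine Eq.trans (integral_congr_ae (ae_of_all _ fun x => ?_))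
    (ht (fun x => g (t, x)) (hg.smooth.comp (by fun_prop)) (hg.slice_compact t))
  rw [fderiv_apply_eq_sum]; refine sum_congr rfl fun c _ => ?_
  rw [(hg.hasFDerivAt_slice t x).fderiv]; simp [dd]

/-- A vector test field from its components. -/
lemma isTestField_toLp (h : ∀ c, TF (φ c)) : IsTestField fun z => WithLp.toLp 2 fun c => φ c z := by
  refine ⟨contDiff_euclidean.2 fun c => (h c).smooth, ?_⟩
  refine HasCompactSupport.intro (isCompact_iUnion fun c => (h c).compact.isCompact) fun z hz => ?_
  ext c; simp at hz; change φ c z = 0; exact image_eq_zero_of_notMem_tsupport (hz c)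

/-- A weak solution plus its Duhamel term solves the heat equation. -/
lemma solution_add_bil (d : IsData η ε U V w₀) (b : IsBdd η A w)
    (hdiv : ∀ᵐ t ∂(volume.restrict (Ioi (0 : ℝ))), WeaklyDivFree fun x => w (t, x))
    (hmom : ∀ φ : E4 → E3, IsTestField φ → (∀ t x, divergence (fun y => φ (t, y)) x = 0) →
      - ∫ z in posTime, momentumDensity U V (fun t x => w (t, x)) φ z = ∫ x, ⟪w₀ x, φ (0, x)⟫) :
    (∃ N : ℝ, 0 ≤ N ∧ ∀ c, ∀ᵐ z ∂μ₊, |w z c + bil U V w c z| ≤ N * ‖z.2‖ ^ (-1 : ℝ)) ∧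
    (∀ g, TF g → ∑ c : Fin 3, ∫ z in posTime, (w z c + bil U V w c z) * dd (0, ei c) g z = 0) ∧
    (∀ φ : Fin 3 → E4 → ℝ, (∀ c, TF (φ c)) → (∀ z, ∑ c : Fin 3, dd (0, ei c) (φ c) z = 0) →
      ∑ c : Fin 3, ∫ z in posTime, (w z c + bil U V w c z) * Lop (φ c) z
        = -∫ x, ⟪w₀ x, WithLp.toLp 2 fun c => φ c (0, x)⟫) := by
  have hsplit : ∀ c, ∀ g, TF g → ∫ z in posTime, (w z c + bil U V w c z) * g z
      = (∫ z in posTime, w z c * g z) + ∫ z in posTime, bil U V w c z * g z := fun c g hg => by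
    simp_rw [add_mul]; exact integral_add (d.integrable_coord_mul b c hg) (d.integral_bil_mul b c hg).1
  refine ⟨?_, fun g hg => ?_, fun φ hφ hφd => ?_⟩
  · obtain ⟨K, hK, H⟩ := exists_bil_sub_bound d.hη0 d.hη1
    have hA := b.hA; have hε := d.hε
    refine ⟨A + K * ((A + 0 + 2 * ε) * A), by positivity, fun c => ?_⟩
    filter_upwards [ae_posTime, d.abs_coord_le b c] with z hz hzw
    have h1 := (single_le_sum (f := fun c => |bil U V w c z - bil U V (fun _ => 0) c z|)
      (fun _ _ => abs_nonneg _) (Finset.mem_univ c)).trans (H d b ⟨le_rfl, measurable_const,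
        ae_of_all _ fun z => by simp⟩ hA (by simpa using b.hw) z.1 hz.1 z.2 hz.2)
    simp only [bil_zero, sub_zero] at h1; rw [add_mul]
    refine (abs_add_le _ _).trans (add_le_add hzw (h1.trans ?_))
    gcongr; exact wt_le_rpow d.hη0 d.hη1 _ _
  · simp_rw [hsplit _ _ (hg.dd _), fun c => (d.integral_bil_mul b c (hg.dd (0, ei c))).2]
    rw [sum_add_distrib, sum_integral_gradient_eq_zero hg (fun c => d.integrable_coord_mul b c (hg.dd _)) hdiv,
      zero_add, sum_comm]
    refine sum_eq_zero fun i _ => ?_; rw [sum_comm]; refine sum_eq_zero fun j _ => ?_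
    have hi := fun c => d.integrable_duh_mul b i j c (hg.dd (0, ei c))
    have hs := integrable_finsetSum Finset.univ fun c _ => hi c
    rw [← integral_finsetSum _ fun c _ => hi c, volume_restrict_posTime, integral_prod _
      (by rwa [volume_restrict_posTime] at hs)]
    refine integral_eq_zero_of_ae ?_; filter_upwards [ae_restrict_mem measurableSet_Ioi] with t ht
    have hM := d.const_nonneg b
    have := sum_integral_duh_gradient d.hη0 d.hη1 hM (d.mFq b i j) (d.hFq b i j) hg i j ht; simp
    exact Eq.trans (integral_finsetSum _ fun c _ => integrable_duh_mul (isKer_oseenK 0 (ei i) (ei j) (ei c))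
      d.hη0 d.hη1 hM (d.mFq b i j) (d.hFq b i j) ((hg.dd _).slice_continuous t) ((hg.dd _).slice_compact t) ht) this
  · simp_rw [hsplit _ _ (hφ _).Lop]
    have hT := isTestField_toLp hφ
    have h1 := hmom _ hT fun t x => by rw [hT.divergence_slice]; exact hφd _
    rw [(integral_momentumDensity hT (fun c => d.integrable_coord_mul b c (hφ c).Lop)
      fun i j => d.integrable_Fq_mul b i j ((hφ j).dd (0, ei i))).2] at h1
    have hr := d.tendsto_bil b hφ
    rw [funext hφd] at hr; simp only [pair, mul_zero, integral_zero, Finset.sum_const_zero] at hr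
    have := tendsto_nhds_unique hr tendsto_const_nhds
    rw [← h1, neg_neg, sum_add_distrib]; congr 1; linarith

/-- Small solutions in the weighted class are unique. -/
lemma exists_uniqueness (hη0 : 0 < η) (hη1 : η < 1) :
    ∃ K : ℝ, 0 < K ∧ ∀ (ε A A' : ℝ) (U V w₀ : E3 → E3) (w : E4 → E3) (w' : ℝ → E3 → E3),
    IsMild η ε A U V w₀ w → WeaklyDivFree w₀ → 0 ≤ A' → K * (A + A' + 2 * ε) ≤ 1 →
    IsSolution U V w₀ w' → PointwiseBound η A' w' →
    ∀ᵐ z ∂μ₊, w' z.1 z.2 = w z := by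
  obtain ⟨K, hK, HK⟩ := exists_bil_sub_bound hη0 hη1
  refine ⟨2 * K, by positivity, fun ε A A' U V w₀ w w' hw hdiv hA' hsmall hs hb => ?_⟩
  -- a measurable representative of the second solution
  set u := hs.aesm.mk; have mu := hs.aesm.stronglyMeasurable_mk.measurable
  have hu : ∀ᵐ z ∂μ₊, w' z.1 z.2 = u z := hs.aesm.ae_eq_mk
  have hub : ∀ᵐ z ∂μ₊, ‖u z‖ ≤ A' * wt η z.1 z.2 := by
    filter_upwards [hu, ae_posTime] with z hz hz0; rw [← hz]
    calc ‖w' z.1 z.2‖ = ((‖z.2‖ + √z.1) ^ (1 - η) * ‖z.2‖ ^ η * ‖w' z.1 z.2‖) * wt η z.1 z.2 := by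
          linear_combination -‖w' z.1 z.2‖ * mul_wt (η := η) z.1 hz0.2
      _ ≤ _ := mul_le_mul_of_nonneg_right (hb z.1 hz0.1 z.2) (wt_nonneg _ _ _)
  have hudiv : ∀ᵐ t ∂(volume.restrict (Ioi (0 : ℝ))), WeaklyDivFree fun x => u (t, x) := by
    have h1 := hu; rw [volume_restrict_posTime] at h1
    filter_upwards [hs.divFree, Measure.ae_ae_of_ae_prod h1] with t ht ht2 ψ hψ hc
    rw [← ht ψ hψ hc]; refine integral_congr_ae ?_; filter_upwards [ht2] with x hx; rw [← hx]
  have humom : ∀ φ : E4 → E3, IsTestField φ → (∀ t x, divergence (fun y => φ (t, y)) x = 0) →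
      - ∫ z in posTime, momentumDensity U V (fun t x => u (t, x)) φ z = ∫ x, ⟪w₀ x, φ (0, x)⟫ := fun φ hφ hφd => by
    rw [← hs.momentum φ hφ hφd]; congr 1; refine integral_congr_ae ?_; filter_upwards [hu] with z hz
    simp only [momentumDensity]; rw [hz]
  have hsw := hw.isSolution hdiv; have d := hw.toIsData; have bu : IsBdd η A' u := ⟨hA', mu, hub⟩
  obtain ⟨⟨N, hN0, hN⟩, d1, m1⟩ := solution_add_bil d bu hudiv humom
  obtain ⟨⟨N', hN0', hN'⟩, d2, m2⟩ := solution_add_bil d hw.bdd hsw.divFree hsw.momentum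
  have mk : ∀ (v : E4 → E3), Measurable v → ∀ c, Measurable fun z => v z c + bil U V v c z :=
    fun v hv c => (measurable_coord hv c).add (measurable_bil hw.mU hw.mV hv c)
  have ik := fun c g (hg : TF g) => integrable_mul_TF (by simp) (mk u mu c) (hN c) hg
  have ik' := fun c g (hg : TF g) => integrable_mul_TF (by simp) (mk w hw.mw c) (hN' c) hg
  have hsub : ∀ c g, TF g → ∫ z in posTime, ((u z c + bil U V u c z) - (w z c + bil U V w c z)) * g z
      = (∫ z in posTime, (u z c + bil U V u c z) * g z)
        - ∫ z in posTime, (w z c + bil U V w c z) * g z := fun c g hg => by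
    simp_rw [sub_mul]; exact integral_sub (ik c g hg) (ik' c g hg)
  -- the difference of the two fields is a null solution of the heat equation with a pressure
  have hzero := fun j => ae_eq_zero_of_heat (N := N + N')
    (h := fun c z => (u z c + bil U V u c z) - (w z c + bil U V w c z))
    { hm := fun c => (mk u mu c).sub (mk w hw.mw c)
      hN0 := by positivity
      hN := fun c => by
        filter_upwards [hN c, hN' c] with z h1 h2; rw [add_mul]
        exact (abs_sub _ _).trans (by gcongr)
      hdiv := fun g hg => by simp_rw [hsub _ _ (hg.dd _)]; rw [sum_sub_distrib, d1 g hg, d2 g hg, sub_zero]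
      hheat := fun φ hφ hφd => by
        simp_rw [hsub _ _ (hφ _).Lop]; rw [sum_sub_distrib, m1 φ hφ hφd, m2 φ hφ hφd, sub_self] } j
  -- the contraction estimate halves any weighted bound on the difference
  have hhalf : ∀ n, ∀ᵐ z ∂μ₊, ‖u z - w z‖ ≤ (A' + A) * (1 / 2) ^ n * wt η z.1 z.2 := fun n => by
    induction n with
    | zero =>
      filter_upwards [hub] with z hz; have := norm_sub_le (u z) (w z); have h2 := hw.hw z; simp
      linarith
    | succ n ih =>
      have hAA := add_nonneg hA' hw.hA; filter_upwards [ae_posTime, ae_all_iff.2 hzero] with z hz h0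
      have hk := HK (D := (A' + A) * (1 / 2) ^ n) d bu hw.bdd (by positivity) ih z.1 hz.1 z.2 hz.2
      have hc : ∀ c, |(u z - w z) c| = |bil U V u c z - bil U V w c z| := fun c => by
        have : (u z - w z) c = -(bil U V u c z - bil U V w c z) := by
          rw [PiLp.sub_apply]
          linear_combination h0 c
        rw [this, abs_neg]
      refine (norm_le_sum_coord _).trans ?_; simp_rw [hc]
      refine hk.trans (mul_le_mul_of_nonneg_right ?_ (wt_nonneg _ _ _))
      have h4 : 0 ≤ (A' + A) * (1 / 2) ^ n := by positivity
      rw [pow_succ]; nlinarith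
  filter_upwards [hu, ae_all_iff.2 hhalf] with z hz hzn; rw [hz, ← sub_eq_zero, ← norm_le_zero_iff]
  exact ge_of_tendsto (tendsto_half_pow_mul _ _) (.of_forall hzn)

/-! ### Singular integrals: weak type bounds -/

/-- Convolution on `ℝ³` with a bounded kernel. -/
noncomputable def cv (k f : E3 → ℝ) (x : E3) : ℝ := ∫ y, k (x - y) * f y

/-- A (regularized) Calderón–Zygmund kernel of constant `D`: size and smoothness bounds, and
boundedness on `L²` with norm at most `1`. The a priori bound `bounded` is only qualitative; it makes
all convolutions absolutely convergent. -/
structure IsCZ (D : ℝ) (k : E3 → ℝ) : Prop where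
  pos : 0 < D
  continuous : Continuous k
  bounded : ∃ B, 0 ≤ B ∧ ∀ z, |k z| ≤ B
  size : ∀ z, z ≠ 0 → |k z| ≤ D * ‖z‖ ^ (-3 : ℝ)
  smooth : ∀ z h, z ≠ 0 → 2 * ‖h‖ ≤ ‖z‖ → |k (z + h) - k z| ≤ D * ‖h‖ * ‖z‖ ^ (-4 : ℝ)
  l2 : ∀ (f : E3 → ℝ) (M R : ℝ), Measurable f → (∀ y, |f y| ≤ M) → (∀ y, R < ‖y‖ → f y = 0) →
    ∫⁻ x, ofReal (cv k f x ^ 2) ≤ ∫⁻ x, ofReal (f x ^ 2)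

lemma volume_closedBall_eq (x : E3) (hr : 0 ≤ r) :
    volume (closedBall x r) = ofReal (Real.pi * 4 / 3 * r ^ 3) := by
  rw [EuclideanSpace.volume_closedBall_fin_three, ← ofReal_pow hr,
    ← ofReal_mul (by positivity), mul_comm]

lemma integrable_of_bdd_support (mf : Measurable f) (hM : ∀ y, |f y| ≤ M)
    (hR : ∀ y, R < ‖y‖ → f y = 0) : Integrable f := by
  have h1 : IntegrableOn f (closedBall 0 R) :=
    Measure.integrableOn_of_bounded (isCompact_closedBall _ _).measure_lt_top.ne
      mf.aestronglyMeasurable (ae_of_all _ hM)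
  rw [integrableOn_iff_integrable_of_support_subset] at h1
  · exact h1
  · intro y hy
    by_contra h; exact hy (hR y (by simpa using h))

/-- Chebyshev's inequality for square functions. -/
lemma meas_lt_abs_le (hu : Measurable u) {V : ℝ} (hl : 0 < l)
    (hV : ∫⁻ x, ofReal (u x ^ 2) ≤ ofReal V) :
    volume {x | l < |u x|} ≤ ofReal (V / l ^ 2) := by
  have h1 := mul_meas_ge_le_lintegral₀ (μ := (volume : Measure E3))
    (f := fun x => ofReal (u x ^ 2)) (by fun_prop) (ofReal (l ^ 2))
  have hl2 : 0 < l ^ 2 := by positivity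
  have h2 : {x | l < |u x|} ⊆ {x | ofReal (l ^ 2) ≤ ofReal (u x ^ 2)} := fun x hx => by
    refine ofReal_le_ofReal ?_; rw [← sq_abs (u x)]; exact pow_le_pow_left₀ hl.le hx.le 2
  rw [ENNReal.ofReal_div_of_pos hl2, ENNReal.le_div_iff_mul_le (Or.inl (by simpa using hl2.ne'))
    (Or.inl ofReal_ne_top), mul_comm]
  exact (mul_le_mul_right (measure_mono h2) _).trans (h1.trans hV)

/-- Vitali's selection of balls on which the mean square of `u` equals a fraction of `l²`, maximally
so: the five times larger balls cover `{l < |u|}`, and the mean square on them is smaller. -/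
lemma exists_stopping_balls (hu : Continuous u) {V : ℝ} (hV0 : 0 ≤ V) (hl : 0 < l)
    (hV : ∫⁻ x, ofReal (u x ^ 2) ≤ ofReal V) :
    ∃ (s : Set E3) (r : E3 → ℝ), s.Countable ∧ (∀ b ∈ s, 0 < r b) ∧
    {x | l < |u x|} ⊆ ⋃ b ∈ s, closedBall b (5 * r b) ∧
    ∑' b : s, ofReal (r b ^ 3) ≤ ofReal (16 * V / l ^ 2) ∧
    ∀ b ∈ s, ∫⁻ x in closedBall b (5 * r b), ofReal (u x ^ 2)
    ≤ ofReal (l ^ 2 / 16 * (Real.pi * 4 / 3 * (5 * r b) ^ 3)) := by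
  set κ := Real.pi * 4 / 3; have hκ : 1 ≤ κ := by have := Real.pi_gt_three; simp only [κ]; linarith
  set S := fun x => {r | 0 < r ∧ ofReal (l ^ 2 / 16 * (κ * r ^ 3)) ≤
    ∫⁻ x in closedBall x r, ofReal (u x ^ 2)}
  set R0 := 16 * V / l ^ 2 + 1
  have hR0 : 1 ≤ R0 := by simp only [R0]; have : 0 ≤ 16 * V / l ^ 2 := by positivity
                          linarith
  have hcube : ∀ x, ∀ r ∈ S x, r ^ 3 ≤ 16 * V / l ^ 2 := by
    rintro x r ⟨hr, h⟩; have h1 := h.trans ((setLIntegral_le_lintegral _ _).trans hV)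
    rw [ENNReal.ofReal_le_ofReal_iff hV0] at h1; rw [le_div_iff₀ (by positivity)]
    have := mul_le_mul_of_nonneg_left hκ (by positivity); nlinarith
  have hSb : ∀ x, ∀ r ∈ S x, r ≤ R0 := fun x r hr => by
    by_contra hlt; push Not at hlt; have h1 : r ≤ r ^ 3 := le_self_pow₀ (hR0.trans hlt.le) (by simp)
    have h2 := hcube x r hr; linarith
  have hex : ∀ x, l < |u x| → ∃ r ∈ S x, ∀ r' ∈ S x, r' < 2 * r := fun x hx => by
    have hne : (S x).Nonempty := by
      obtain ⟨r, hr, hsub⟩ := Metric.nhds_basis_closedBall.mem_iff.1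
        ((isOpen_lt continuous_const hu.abs).mem_nhds (show l / 4 < |u x| by linarith))
      refine ⟨r, hr, ?_⟩
      rw [ofReal_mul (by positivity), ← volume_closedBall_eq x hr.le, ← setLIntegral_const]
      refine setLIntegral_mono (by fun_prop) fun y hy => ofReal_le_ofReal ?_
      have h1 : l / 4 < |u y| := hsub hy; rw [← sq_abs (u y)]; nlinarith
    have hbd : BddAbove (S x) := ⟨R0, fun r hr => hSb x r hr⟩
    obtain ⟨r, hr, hrs⟩ := exists_lt_of_lt_csSup hne (show sSup (S x) / 2 < sSup (S x) by
      obtain ⟨r1, hr1⟩ := hne; have := le_csSup hbd hr1; have := hr1.1; linarith)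
    exact ⟨r, hr, fun r' hr' => by have := le_csSup hbd hr'; linarith⟩
  choose! r hrS hrmax using hex
  obtain ⟨s, hs, hdisj, hcov⟩ := Vitali.exists_disjoint_subfamily_covering_enlargement_closedBall
    {x | l < |u x|} id r R0 (fun x hx => hSb x _ (hrS x hx)) 5 (by norm_num)
  have hpos := fun b hb => (hrS b (hs hb)).1
  have hcount : s.Countable := by
    refine hdisj.countable_of_nonempty_interior fun b hb => ?_
    refine ⟨b, mem_interior_iff_mem_nhds.2 (Metric.closedBall_mem_nhds _ (hpos b hb))⟩
  refine ⟨s, r, hcount, hpos, ?_, ?_, ?_⟩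
  · intro x hx
    obtain ⟨b, hb, hsub⟩ := hcov x hx
    exact mem_iUnion₂.2 ⟨b, hb, hsub (Metric.mem_closedBall_self (hrS x hx).1.le)⟩
  · have h1 : ∑' b : s, ∫⁻ x in closedBall (b : E3) (r b), ofReal (u x ^ 2) ≤ ofReal V := by
      rw [← lintegral_biUnion (s := fun b => closedBall b (r b)) hcount
        (fun b _ => measurableSet_closedBall) hdisj]
      exact (setLIntegral_le_lintegral _ _).trans hV
    have h2 : ∀ b : s, ofReal (l ^ 2 / 16) * ofReal (r b ^ 3) ≤
        ∫⁻ x in closedBall (b : E3) (r b), ofReal (u x ^ 2) := fun b => by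
      refine le_trans ?_ (hrS b (hs b.2)).2; rw [← ofReal_mul (by positivity)]; gcongr
      have := hpos b b.2; exact le_mul_of_one_le_left (by positivity) hκ
    have h3 := (tsum_le_tsum h2).trans h1; rw [ENNReal.tsum_mul_left] at h3
    have hl2 : 0 < l ^ 2 / 16 := by positivity
    rw [show 16 * V / l ^ 2 = V / (l ^ 2 / 16) by field_simp, ENNReal.ofReal_div_of_pos hl2,
      ENNReal.le_div_iff_mul_le (Or.inl (by simpa using hl2))
      (Or.inl ofReal_ne_top), mul_comm]
    exact h3
  · intro b hb
    have hb0 := hpos b hb; by_contra hlt; push Not at hlt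
    have := hrmax b (hs hb) (5 * r b) ⟨by positivity, hlt.le⟩; linarith

namespace IsCZ
variable {D : ℝ} {k f : E3 → ℝ}

lemma integrable (h : IsCZ D k) (hf : Integrable f) (x : E3) : Integrable fun y => k (x - y) * f y := by
  obtain ⟨B, hB0, hB⟩ := h.bounded
  exact hf.bdd_mul ((h.continuous.comp (by fun_prop)).aestronglyMeasurable) (ae_of_all _ fun y => hB _)

lemma continuous_cv (h : IsCZ D k) (hf : Integrable f) : Continuous (cv k f) := by
  obtain ⟨B, hB0, hB⟩ := h.bounded
  refine continuous_of_dominated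
    (fun x => (h.integrable hf x).aestronglyMeasurable) (fun x => ae_of_all _ fun y => ?_)
    (hf.norm.const_mul B) (ae_of_all _ fun y => ?_)
  · rw [norm_mul]; gcongr; exact hB _
  · exact (h.continuous.comp (by fun_prop)).mul continuous_const

lemma cv_add (x : E3) (hf : Integrable fun y => k (x - y) * f y)
    (hg : Integrable fun y => k (x - y) * g y) : cv k (fun y => f y + g y) x = cv k f x + cv k g x := by
  unfold cv; rw [← integral_add hf hg]; simp_rw [mul_add]

lemma lintegral_sq_le (h : IsCZ D k) {b : E3} (mf : Measurable f) (hM : ∀ y, |f y| ≤ M)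
    (hR0 : 0 ≤ R) (hR : ∀ y, y ∉ closedBall b R → f y = 0) :
    ∫⁻ x, ofReal (cv k f x ^ 2) ≤ ofReal (M ^ 2 * (Real.pi * 4 / 3 * R ^ 3)) := by
  have hs : ∀ y, ‖b‖ + R < ‖y‖ → f y = 0 := fun y hy => by
    refine hR y fun hm => ?_; have h1 : ‖y - b‖ ≤ R := by simpa [dist_eq_norm] using hm
    have := norm_le_norm_add_norm_sub' y b; linarith
  refine (h.l2 f M _ mf hM hs).trans ?_
  rw [ofReal_mul (by positivity), ← volume_closedBall_eq b hR0, ← setLIntegral_const,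
    ← lintegral_indicator measurableSet_closedBall]
  refine lintegral_mono fun y => ?_
  by_cases hy : y ∈ closedBall b R
  · rw [indicator_of_mem hy]
    refine ofReal_le_ofReal ?_; rw [← sq_abs]; exact pow_le_pow_left₀ (abs_nonneg _) (hM y) 2
  · rw [hR y hy]; simp

/-- Far from the support, the convolution with a bounded function has bounded oscillation. -/
lemma exists_oscillation : ∃ C : ℝ, 0 < C ∧ ∀ {D : ℝ} {k f : E3 → ℝ}, IsCZ D k → Measurable f →
    (∀ y, |f y| ≤ 1) → Integrable f → ∀ (b : E3) (r : ℝ), 0 < r →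
    (∀ y ∈ ball b (10 * r), f y = 0) → ∀ x ∈ closedBall b (5 * r),
      |cv k f x - cv k f b| ≤ D * C := by
  obtain ⟨C, hC, H⟩ := exists_lintegral_compl_ball_rpow (b := 4) (by norm_num)
  refine ⟨C / 2, by positivity, fun {D k f} h mf hf1 hf b r hr hz x hx => ?_⟩
  have hx' : ‖x - b‖ ≤ 5 * r := by simpa [dist_eq_norm] using hx
  have hae : ∀ᵐ y, |k (x - y) * f y - k (b - y) * f y| ≤ D * (5 * r) *
      ({z : E3 | 10 * r ≤ ‖z‖}.indicator (fun z => ‖z‖ ^ (-4 : ℝ)) (b - y)) := by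
    refine ae_of_all _ fun y => ?_
    by_cases hy : 10 * r ≤ ‖b - y‖
    · rw [indicator_of_mem (show b - y ∈ {z : E3 | 10 * r ≤ ‖z‖} from hy), ← sub_mul, abs_mul]
      have h1 := h.smooth (b - y) (x - b) (norm_pos_iff.1 (by linarith)) (by linarith)
      rw [show b - y + (x - b) = x - y by abel] at h1
      calc _ ≤ |k (x - y) - k (b - y)| * 1 := by gcongr; exact hf1 y
        _ ≤ D * ‖x - b‖ * ‖b - y‖ ^ (-4 : ℝ) := by rw [mul_one]; exact h1
        _ ≤ _ := by have := h.pos; gcongr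
    · have := hz y (by rw [Metric.mem_ball, dist_comm, dist_eq_norm]; linarith)
      rw [this, indicator_of_notMem (show b - y ∉ {z : E3 | 10 * r ≤ ‖z‖} from hy)]; simp
  have hl : ∫⁻ y, ofReal ({z : E3 | 10 * r ≤ ‖z‖}.indicator (fun z => ‖z‖ ^ (-4 : ℝ)) (b - y))
      ≤ ofReal (C * (10 * r) ^ (3 - 4 : ℝ)) := by
    rw [lintegral_sub_left_eq_self
      (fun z => ofReal ({z : E3 | 10 * r ≤ ‖z‖}.indicator (fun z => ‖z‖ ^ (-4 : ℝ)) z)) b]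
    refine le_trans (le_of_eq ?_) (H (10 * r) (by positivity))
    rw [← lintegral_indicator (measurableSet_le measurable_const measurable_norm)]
    refine lintegral_congr fun z => ?_
    by_cases hz : z ∈ {z : E3 | 10 * r ≤ ‖z‖}
    · rw [indicator_of_mem hz, indicator_of_mem hz]
    · rw [indicator_of_notMem hz, indicator_of_notMem hz]; simp
  have h1 := h.integrable hf x; have h2 := h.integrable hf b
  have h3 := (integrable_of_lintegral_le (h1.sub h2).aestronglyMeasurable
    (by have := h.pos; positivity) (by positivity) hae hl).2
  unfold cv; rw [← integral_sub h1 h2]; refine (abs_integral_le_integral_abs).trans (h3.trans_eq ?_)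
  rw [show (3 - 4 : ℝ) = -1 by norm_num, rpow_neg_one]; field

/-- A bounded function with bounded support is mapped to weak `L⁴`. Beyond the `L²` bound this uses
that on each stopping ball only the part of `f` near the ball matters, for which the `L²` bound gains
another factor `l⁻²`. -/
lemma exists_weak_four (hD : 0 < D) : ∃ C : ℝ, 0 < C ∧ ∀ {k f : E3 → ℝ}, IsCZ D k →
    Measurable f → (∀ y, |f y| ≤ 1) → ∀ R : ℝ, 0 < R → (∀ y, R < ‖y‖ → f y = 0) → ∀ l : ℝ, 0 < l →
    volume {x | l < |cv k f x|} ≤ ofReal (C * R ^ 3 / l ^ 4) := by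
  obtain ⟨C1, hC1, hosc⟩ := exists_oscillation; set κ := Real.pi * 4 / 3 with hκ
  have hκ0 : 0 < κ := by positivity
  -- the threshold above which the stopping argument applies
  set L := 8 * (D * C1) + 20 with hL; have hDC : 0 < D * C1 := by positivity
  refine ⟨κ * (L ^ 2 + 256000 * κ), by positivity, fun {k f} h mf hf1 R hR hsupp l hl => ?_⟩
  have hsupp' : ∀ y, y ∉ closedBall (0 : E3) R → f y = 0 := fun y hy => hsupp y (by simpa using hy)
  have hfi := integrable_of_bdd_support mf hf1 hsupp
  have hV := h.lintegral_sq_le mf hf1 hR.le hsupp'; rw [one_pow, one_mul] at hV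
  have hc := h.continuous_cv hfi; rcases le_or_gt l L with hlL | hlL
  · refine (meas_lt_abs_le hc.measurable hl hV).trans (ofReal_le_ofReal ?_)
    rw [div_le_div_iff₀ (by positivity) (by positivity)]
    have h2 := mul_le_mul_of_nonneg_left (pow_le_pow_left₀ hl.le hlL 2) (show 0 ≤ κ * R ^ 3 * l ^ 2 by positivity)
    have h3 : 0 ≤ κ * (256000 * κ) * R ^ 3 * l ^ 2 := by positivity
    rw [← hκ]; linarith
  -- above the threshold, the level set is covered by the enlarged stopping balls
  obtain ⟨s, r, hs, hr, hcov, hsum, hmean⟩ := exists_stopping_balls hc (by positivity) hl hV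
  -- the measure of the level set in one ball
  have hball : ∀ b ∈ s, volume ({x | l < |cv k f x|} ∩ closedBall b (5 * r b))
      ≤ ofReal (16000 * κ / l ^ 2) * ofReal (r b ^ 3) := fun b hb => by
    have hr0 := hr b hb; set ρ := r b; set f1 := (closedBall b (10 * ρ)).indicator f with hf1d
    set f2 := (closedBall b (10 * ρ))ᶜ.indicator f with hf2d
    have m1 : Measurable f1 := mf.indicator measurableSet_closedBall
    have m2 : Measurable f2 := mf.indicator measurableSet_closedBall.compl
    have i1 : Integrable f1 := hfi.indicator measurableSet_closedBall
    have i2 : Integrable f2 := hfi.indicator measurableSet_closedBall.compl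
    have hadd : ∀ x, cv k f x = cv k f1 x + cv k f2 x := fun x => by
      rw [← cv_add x (h.integrable i1 x) (h.integrable i2 x)]; congr 1
      funext y
      exact (congrFun (indicator_self_add_compl (closedBall b (10 * ρ)) f) y).symm
    have hE := h.lintegral_sq_le m1 (fun y => (norm_indicator_le_norm_self f y).trans (hf1 y)) (by positivity)
      fun y hy => indicator_of_notMem hy _
    rw [one_pow, one_mul] at hE
    have ho :=
      hosc h m2 (fun y => (norm_indicator_le_norm_self f y).trans (hf1 y)) i2 b ρ hr0 fun y hy =>
        indicator_of_notMem (notMem_compl_iff.2 (Metric.ball_subset_closedBall hy)) _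
    set H := cv k f2 b
    -- the far part is bounded by half of `l` on the ball
    have hH : |H| ≤ l / 2 := by
      have hpt : ∀ x ∈ closedBall b (5 * ρ), ofReal (H ^ 2) ≤ ofReal 3 * ofReal (cv k f x ^ 2)
          + (ofReal 3 * ofReal (cv k f1 x ^ 2) + ofReal (3 * (D * C1) ^ 2)) := fun x hx => by
        rw [← ofReal_mul (by simp), ← ofReal_mul (by simp),
          ← ofReal_add (by positivity) (by positivity),
          ← ofReal_add (by positivity) (by positivity)]
        gcongr; have h2 := sq_le_sq' (by linarith [(abs_le.1 (ho x hx)).1]) (abs_le.1 (ho x hx)).2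
        have h4 : H = cv k f x - cv k f1 x - (cv k f2 x - H) := by rw [(hadd x)]; ring
        have h5 : ∀ a b c : ℝ, (a - b - c) ^ 2 ≤ 3 * a ^ 2 + 3 * b ^ 2 + 3 * c ^ 2 := fun a b c => by
          linarith [sq_nonneg (a + b), sq_nonneg (a + c), sq_nonneg (b - c)]
        have h6 := h5 (cv k f x) (cv k f1 x) (cv k f2 x - H); rw [← h4] at h6; linarith
      have h5 := setLIntegral_mono (μ := (volume : Measure E3)) (by
        have := hc.measurable; have := (h.continuous_cv i1).measurable; fun_prop) hpt
      rw [setLIntegral_const, volume_closedBall_eq b (by positivity), lintegral_add_left (by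
        have := hc.measurable; fun_prop), lintegral_add_right _ measurable_const, setLIntegral_const,
        lintegral_const_mul' _ _ ofReal_ne_top, lintegral_const_mul' _ _ ofReal_ne_top,
        volume_closedBall_eq b (by positivity)] at h5
      have h6 := h5.trans (add_le_add (mul_le_mul_right (hmean b hb) _) (add_le_add
        (mul_le_mul_right ((setLIntegral_le_lintegral _ _).trans hE) _) le_rfl))
      rw [← ofReal_mul (by positivity), ← ofReal_mul (by positivity),
        ← ofReal_mul (by positivity), ← ofReal_mul (by positivity),
        ← ofReal_add (by positivity) (by positivity),
        ← ofReal_add (by positivity) (by positivity),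
        ENNReal.ofReal_le_ofReal_iff (by positivity)] at h6
      have h8 : H ^ 2 ≤ 3 * (l ^ 2 / 16) + (24 + 3 * (D * C1) ^ 2) := by
        refine le_of_mul_le_mul_right (h6.trans_eq ?_) (by positivity); ring
      have h9 : 24 + 3 * (D * C1) ^ 2 ≤ l ^ 2 / 16 := by
        have := pow_le_pow_left₀ (by positivity) hlL.le 2; rw [hL] at this; nlinarith
      refine abs_le_of_sq_le_sq ?_ (by positivity); linarith
    have hsub : {x | l < |cv k f x|} ∩ closedBall b (5 * ρ) ⊆ {x | l / 4 < |cv k f1 x|} := by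
      rintro x ⟨hx, hxb⟩; have h1 : l < |cv k f x| := hx; rw [hadd x] at h1
      have h2 := abs_add_le (cv k f1 x) (cv k f2 x); have h3 := abs_add_le (cv k f2 x - H) H
      rw [sub_add_cancel] at h3; have h4 := ho x hxb
      have h5 : D * C1 ≤ l / 4 := by rw [hL] at hlL; linarith
      have h6 : |cv k f1 x| > l / 4 := by linarith
      exact h6
    refine (measure_mono hsub).trans ((meas_lt_abs_le (h.continuous_cv i1).measurable
      (by positivity) hE).trans ?_)
    rw [← ofReal_mul (by positivity)]; refine ofReal_le_ofReal (le_of_eq ?_); field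
  calc volume {x | l < |cv k f x|}
      ≤ volume (⋃ b ∈ s, ({x | l < |cv k f x|} ∩ closedBall b (5 * r b))) := by
        refine measure_mono fun x hx => ?_; obtain ⟨b, hb, hxb⟩ := mem_iUnion₂.1 (hcov hx)
        exact mem_iUnion₂.2 ⟨b, hb, hx, hxb⟩
    _ ≤ ∑' b : s, volume ({x | l < |cv k f x|} ∩ closedBall (b : E3) (5 * r b)) :=
      measure_biUnion_le _ hs _
    _ ≤ ∑' b : s, ofReal (16000 * κ / l ^ 2) * ofReal (r b ^ 3) := tsum_le_tsum fun b => hball b b.2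
    _ ≤ ofReal (16000 * κ / l ^ 2) * ofReal (16 * (κ * R ^ 3) / l ^ 2) := by
      rw [ENNReal.tsum_mul_left]; gcongr
    _ ≤ _ := by
      rw [← ofReal_mul (by positivity)]; gcongr
      rw [div_mul_div_comm, div_le_div_iff₀ (by positivity) (by positivity)]
      have : 0 ≤ κ * L ^ 2 * R ^ 3 * l ^ 4 := by positivity
      linarith

end IsCZ

/-! ### Singular integrals: decaying functions -/

lemma measurable_cv {k : E3 → ℝ} (hk : Measurable k) (hf : Measurable f) : Measurable (cv k f) := by
  refine StronglyMeasurable.measurable (StronglyMeasurable.integral_prod_right ?_)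
  apply Measurable.stronglyMeasurable; exact (hk.comp (by fun_prop)).mul (hf.comp measurable_snd)

/-- Integrals of functions bounded by one power near the origin and another one far from it. -/
lemma exists_integral_two_rpow : ∃ C : ℝ, 0 < C ∧ ∀ (r A B : ℝ) (F : E3 → ℝ), 0 < r → 0 ≤ A → 0 ≤ B →
    AEStronglyMeasurable F → (∀ y, ‖y‖ < r → |F y| ≤ A * ‖y‖ ^ (-(5 / 2) : ℝ)) →
    (∀ y, r ≤ ‖y‖ → |F y| ≤ B * ‖y‖ ^ (-4 : ℝ)) →
    Integrable F ∧ ∫ y, |F y| ≤ C * (A * r ^ (1 / 2 : ℝ) + B * r ^ (-1 : ℝ)) := by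
  obtain ⟨C1, h1, H1⟩ := exists_lintegral_ball_rpow (b := 5 / 2) (by norm_num)
  obtain ⟨C2, h2, H2⟩ := exists_lintegral_compl_ball_rpow (b := 4) (by norm_num)
  refine ⟨C1 + C2, by positivity, fun r A B F hr hA hB mF hin hout => ?_⟩; set b := ball (0 : E3) r
  have hb : MeasurableSet b := Metric.isOpen_ball.measurableSet
  have hco : bᶜ = {y : E3 | r ≤ ‖y‖} := by ext; simp [b]
  have key := integrable_of_lintegral_le
    (B := A * (C1 * r ^ (3 - 5 / 2 : ℝ)) + B * (C2 * r ^ (3 - 4 : ℝ)))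
    (g := fun y => b.indicator (fun y => A * ‖y‖ ^ (-(5 / 2) : ℝ)) y
      + bᶜ.indicator (fun y => B * ‖y‖ ^ (-4 : ℝ)) y) mF zero_le_one (by positivity) ?_ ?_
  · refine ⟨key.1, key.2.trans ?_⟩
    rw [one_mul, show (3 - 5 / 2 : ℝ) = 1 / 2 by norm_num, show (3 - 4 : ℝ) = -1 by norm_num]
    have e1 : 0 ≤ A * r ^ (1 / 2 : ℝ) := by positivity
    have e2 : 0 ≤ B * r ^ (-1 : ℝ) := by positivity
    nlinarith
  · refine ae_of_all _ fun y => ?_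
    rw [one_mul]
    by_cases hy : y ∈ b
    · rw [indicator_of_mem hy, indicator_of_notMem (notMem_compl_iff.2 hy), add_zero]
      exact hin y (by simpa [b] using hy)
    · rw [indicator_of_notMem hy, indicator_of_mem (mem_compl hy), zero_add]
      exact hout y (by simpa [b] using hy)
  · have hind : ∀ (s : Set E3) (g : E3 → ℝ), (fun y => ofReal (s.indicator g y))
      = s.indicator fun y => ofReal (g y) := fun s g => by
      funext y
      by_cases hy : y ∈ s
      · simp [hy]
      · simp [hy]
    have hnn : ∀ y, 0 ≤ b.indicator (fun y => A * ‖y‖ ^ (-(5 / 2) : ℝ)) y := fun y =>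
      indicator_nonneg (fun y _ => by positivity) y
    have hnn2 : ∀ y, 0 ≤ bᶜ.indicator (fun y => B * ‖y‖ ^ (-4 : ℝ)) y := fun y =>
      indicator_nonneg (fun y _ => by positivity) y
    simp_rw [fun y => ofReal_add (hnn y) (hnn2 y)]
    have mm : Measurable fun y => ofReal (b.indicator (fun y => A * ‖y‖ ^ (-(5 / 2) : ℝ)) y) :=
      (Measurable.indicator (by fun_prop) hb).ennreal_ofReal
    rw [lintegral_add_left mm, hind, hind, lintegral_indicator hb, lintegral_indicator hb.compl,
      ofReal_add (by positivity) (by positivity), ofReal_mul hA, ofReal_mul hB]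
    simp_rw [ofReal_mul hA, ofReal_mul hB]
    rw [lintegral_const_mul' _ _ ofReal_ne_top, lintegral_const_mul' _ _ ofReal_ne_top, hco]
    exact add_le_add (mul_le_mul_right (H1 r hr) _) (mul_le_mul_right (H2 r hr) _)

lemma rpow_neg_le_inside (ha0 : 0 < a) (ha : a ≤ 5 / 2) (hy : ‖y‖ ≤ r) :
    ‖y‖ ^ (-a) ≤ r ^ (5 / 2 - a) * ‖y‖ ^ (-(5 / 2) : ℝ) := by
  rcases eq_or_ne y 0 with rfl | h0
  · rw [norm_zero, zero_rpow (by linarith), zero_rpow (by simp), mul_zero]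
  · have h := norm_pos_iff.2 h0
    calc ‖y‖ ^ (-a) = ‖y‖ ^ (5 / 2 - a) * ‖y‖ ^ (-(5 / 2) : ℝ) := by rw [← rpow_add h]; ring_nf
      _ ≤ _ := by gcongr

lemma rpow_neg_le_outside (ha : 1 ≤ a) (hr : 0 < r) (hy : r ≤ ‖y‖) :
    ‖y‖ ^ (-3 : ℝ) * ‖y‖ ^ (-a) ≤ r ^ (1 - a) * ‖y‖ ^ (-4 : ℝ) := by
  have h := hr.trans_le hy
  calc ‖y‖ ^ (-3 : ℝ) * ‖y‖ ^ (-a) = ‖y‖ ^ (1 - a) * ‖y‖ ^ (-4 : ℝ) := by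
        rw [← rpow_add h, ← rpow_add h]; ring_nf
    _ ≤ _ := mul_le_mul_of_nonneg_right (rpow_le_rpow_of_nonpos hr hy (by linarith)) (by positivity)

namespace IsCZ
variable {D : ℝ} {k f : E3 → ℝ}

lemma abs_le_of_half_le (h : IsCZ D k) (hr : 0 < r) (hz : r / 2 ≤ ‖z‖) :
    |k z| ≤ 8 * D * r ^ (-3 : ℝ) := by
  refine (h.size z (norm_pos_iff.1 ((half_pos hr).trans_le hz))).trans ?_
  have h1 : ‖z‖ ^ (-3 : ℝ) ≤ (r / 2) ^ (-3 : ℝ) :=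
    rpow_le_rpow_of_nonpos (by positivity) hz (by simp)
  have h2 : (r / 2) ^ (-3 : ℝ) = 8 * r ^ (-3 : ℝ) := by
    rw [div_rpow hr.le (by simp), show ((2 : ℝ) ^ (-3 : ℝ)) = 1 / 8 by
      rw [show (-3 : ℝ) = ((-3 : ℤ) : ℝ) by simp, Real.rpow_intCast]; norm_num]
    ring
  have := h.pos
  calc D * ‖z‖ ^ (-3 : ℝ) ≤ D * (8 * r ^ (-3 : ℝ)) := by rw [← h2]; gcongr
    _ = _ := by ring

lemma abs_le_of_two_mul_le (h : IsCZ D k) (hy : y ≠ 0) (hxy : 2 * ‖x‖ ≤ ‖y‖) :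
    |k (x - y)| ≤ 8 * D * ‖y‖ ^ (-3 : ℝ) := by
  refine h.abs_le_of_half_le (norm_pos_iff.2 hy) ?_; have := norm_sub_norm_le y x
  rw [norm_sub_rev] at this; linarith

/-- Absolute convergence, locally uniformly in `x`; the constant depends on the kernel. -/
lemma exists_integral_abs_le (h : IsCZ D k) (hR : 0 ≤ R) (ha : 1 ≤ a) (ha2 : a ≤ 5 / 2) :
    ∃ C : ℝ, 0 ≤ C ∧ ∀ (M : ℝ) (f : E3 → ℝ), 0 ≤ M → Measurable f → (∀ y, |f y| ≤ M * ‖y‖ ^ (-a)) →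
    ∀ x, ‖x‖ ≤ R → Integrable (fun y => k (x - y) * f y) ∧ ∫ y, |k (x - y) * f y| ≤ C * M := by
  obtain ⟨C, hC, H⟩ := exists_integral_two_rpow; obtain ⟨B, hB0, hB⟩ := h.bounded
  set r := 2 * R + 1; have hr : 0 < r := by positivity
  have hD := h.pos
  refine ⟨C * (B * r ^ (5 / 2 - a) * r ^ (1 / 2 : ℝ) + 8 * D * r ^ (1 - a) * r ^ (-1 : ℝ)),
    by positivity, fun M f hM mf hf x hx => ?_⟩
  have := H r (B * M * r ^ (5 / 2 - a)) (8 * D * M * r ^ (1 - a)) (fun y => k (x - y) * f y) hr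
    (by positivity) (by positivity)
    ((h.continuous.comp (by fun_prop)).measurable.mul mf).aestronglyMeasurable (fun y hy => ?_)
    fun y hy => ?_
  · refine ⟨this.1, this.2.trans_eq ?_⟩
    ring
  · rw [abs_mul]
    calc _ ≤ B * (M * (r ^ (5 / 2 - a) * ‖y‖ ^ (-(5 / 2) : ℝ))) := mul_le_mul (hB _) ((hf y).trans
        (by gcongr; exact rpow_neg_le_inside (by linarith) ha2 hy.le)) (abs_nonneg _) hB0
      _ = _ := by ring
  · rw [abs_mul]
    have h1 := h.abs_le_of_two_mul_le (x := x) (norm_pos_iff.1 (hr.trans_le hy))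
      (by simp only [r] at hy; linarith)
    calc _ ≤ 8 * D * ‖y‖ ^ (-3 : ℝ) * (M * ‖y‖ ^ (-a)) :=
        by gcongr; exact hf y
      _ = 8 * D * M * (‖y‖ ^ (-3 : ℝ) * ‖y‖ ^ (-a)) := by ring
      _ ≤ 8 * D * M * (r ^ (1 - a) * ‖y‖ ^ (-4 : ℝ)) :=
        mul_le_mul_of_nonneg_left (rpow_neg_le_outside ha hr hy) (by positivity)
      _ = _ := by ring

/-- The part of `f` living at distances from the origin incomparable to `‖x‖`. -/
lemma exists_far_bound : ∃ C : ℝ, 0 < C ∧ ∀ {D : ℝ} {k : E3 → ℝ}, IsCZ D k → ∀ (a M : ℝ) (f : E3 → ℝ),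
    1 ≤ a → a ≤ 5 / 2 → 0 ≤ M → Measurable f → (∀ y, |f y| ≤ M * ‖y‖ ^ (-a)) → ∀ x, x ≠ 0 →
    (∀ y, ‖x‖ / 2 ≤ ‖y‖ → ‖y‖ ≤ 2 * ‖x‖ → f y = 0) →
    |cv k f x| ≤ D * C * (M * ‖x‖ ^ (-a)) := by
  obtain ⟨C, hC, H⟩ := exists_integral_two_rpow
  refine ⟨16 * C, by positivity, fun {D k} h a M f ha ha2 hM mf hf x hx hz => ?_⟩; have hD := h.pos
  set r := ‖x‖; have hr : 0 < r := norm_pos_iff.2 hx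
  have := H r (8 * D * M * (r ^ (-3 : ℝ) * r ^ (5 / 2 - a))) (8 * D * M * r ^ (1 - a))
    (fun y => k (x - y) * f y) hr (by positivity) (by positivity)
    ((h.continuous.comp (by fun_prop)).measurable.mul mf).aestronglyMeasurable (fun y hy => ?_)
    fun y hy => ?_
  · refine abs_integral_le_integral_abs.trans (this.2.trans_eq ?_)
    have e1 : r ^ (-3 : ℝ) * r ^ (5 / 2 - a) * r ^ (1 / 2 : ℝ) = r ^ (-a) := by
      rw [← rpow_add hr, ← rpow_add hr]; ring_nf
    have e2 : r ^ (1 - a) * r ^ (-1 : ℝ) = r ^ (-a) := by rw [← rpow_add hr]; ring_nf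
    linear_combination C * (8 * D * M) * e1 + C * (8 * D * M) * e2
  · rcases le_or_gt (r / 2) ‖y‖ with h1 | h1
    · rw [hz y h1 (by linarith), mul_zero, abs_zero]
      positivity
    rw [abs_mul]
    have h2 : |k (x - y)| ≤ 8 * D * r ^ (-3 : ℝ) := by
      refine h.abs_le_of_half_le hr ?_; have := norm_sub_norm_le x y; linarith
    calc _ ≤ 8 * D * r ^ (-3 : ℝ) * (M * (r ^ (5 / 2 - a) * ‖y‖ ^ (-(5 / 2) : ℝ))) := mul_le_mul h2 ((hf y).trans
        (by gcongr; exact rpow_neg_le_inside (by linarith) ha2 hy.le)) (abs_nonneg _) (by positivity)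
      _ = _ := by ring
  · rcases le_or_gt ‖y‖ (2 * r) with h1 | h1
    · rw [hz y (by linarith) h1, mul_zero, abs_zero]
      positivity
    rw [abs_mul]; have h2 := h.abs_le_of_two_mul_le (norm_pos_iff.1 (hr.trans_le hy)) h1.le
    calc _ ≤ 8 * D * ‖y‖ ^ (-3 : ℝ) * (M * ‖y‖ ^ (-a)) :=
        by gcongr; exact hf y
      _ = 8 * D * M * (‖y‖ ^ (-3 : ℝ) * ‖y‖ ^ (-a)) := by ring
      _ ≤ 8 * D * M * (r ^ (1 - a) * ‖y‖ ^ (-4 : ℝ)) :=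
        mul_le_mul_of_nonneg_left (rpow_neg_le_outside ha hr hy) (by positivity)
      _ = _ := by ring

lemma exists_weak_four_scaled (hD : 0 < D) : ∃ C : ℝ, 0 < C ∧ ∀ {k f : E3 → ℝ}, IsCZ D k →
    Measurable f → ∀ M R l : ℝ, 0 < M → (∀ y, |f y| ≤ M) → 0 < R → (∀ y, R < ‖y‖ → f y = 0) → 0 < l →
    volume {x | l < |cv k f x|} ≤ ofReal (C * M ^ 4 * R ^ 3 / l ^ 4) := by
  obtain ⟨C, hC, H⟩ := exists_weak_four hD
  refine ⟨C, hC, fun {k f} h mf M R l hM hfM hR hsupp hl => ?_⟩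
  have h1 := H h (mf.const_mul _) (fun y => by
    rw [abs_mul, abs_of_pos (inv_pos.2 hM)]
    calc M⁻¹ * |f y| ≤ M⁻¹ * M := by have := hfM y; gcongr
      _ = 1 := by field_simp) R hR (fun y hy => by simp [hsupp y hy]) (M⁻¹ * l) (by positivity)
  have e : ∀ x, cv k (fun y => M⁻¹ * f y) x = M⁻¹ * cv k f x := fun x => by
    unfold cv; rw [← integral_const_mul]; congr 1; funext y; ring
  simp_rw [e, abs_mul, abs_of_pos (inv_pos.2 hM), mul_lt_mul_iff_right₀ (inv_pos.2 hM)] at h1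
  refine h1.trans_eq ?_; congr 1; field_simp

/-- Weak type bound for data bounded by `|y|^(-a)`, from a dyadic decomposition in `‖x‖`. -/
lemma exists_weak_bound (hD : 0 < D) : ∃ C : ℝ, 1 ≤ C ∧ ∀ {k f : E3 → ℝ}, IsCZ D k →
    Measurable f → ∀ a M l : ℝ, 1 ≤ a → a ≤ 5 / 2 → 0 < M → (∀ y, |f y| ≤ M * ‖y‖ ^ (-a)) → 0 < l →
    volume {x | l < |cv k f x|} ≤ ofReal (C * (M / l) ^ (3 / a)) := by
  obtain ⟨C4, hC4, H4⟩ := exists_weak_four_scaled hD; obtain ⟨Cf, hCf, Hf⟩ := exists_far_bound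
  set c1 := max 1 (2 * (D * Cf)); have hc1 : 1 ≤ c1 := le_max_left _ _
  have hc2 : 2 * (D * Cf) ≤ c1 := le_max_right _ _; set κ := Real.pi * 4 / 3
  have hκ0 : 0 < κ := by positivity
  set A := C4 * (6 ^ 4 * 64 * 16) with hA
  refine ⟨max 1 ((κ + 2 * A) * c1 ^ 3), le_max_left _ _, fun {k f} h mf a M l ha ha2 hM hf hl => ?_⟩
  -- outside the ball of radius `ρ` the far part of `f` contributes at most `l / 2`
  set ρ := (c1 * M / l) ^ (1 / a) with hρ; have hq : 0 < c1 * M / l := by positivity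
  have hρ0 : 0 < ρ := Real.rpow_pos_of_pos hq _
  have hρa : ρ ^ (-a) = l / (c1 * M) := by
    rw [hρ, ← rpow_mul hq.le, show 1 / a * -a = -1 by field_simp, rpow_neg_one, inv_div]
  have hρ3 : ρ ^ 3 ≤ c1 ^ 3 * (M / l) ^ (3 / a) := by
    rw [hρ, ← rpow_natCast, ← rpow_mul hq.le, mul_div_assoc,
      mul_rpow (by positivity) (by positivity), show 1 / a * ((3 : ℕ) : ℝ) = 3 / a by push_cast; ring]
    gcongr; rw [← rpow_natCast]; exact rpow_le_rpow_of_exponent_le hc1 (div_le_self (by simp) ha)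
  -- enlarged dyadic shells; on the `n`-th one `f` is `O(2⁻ⁿ l)` and the weak `L⁴` bounds are summable
  set N : ℕ → Set E3 := fun n => {y | 2 ^ n * ρ / 2 ≤ ‖y‖ ∧ ‖y‖ ≤ 4 * (2 ^ n * ρ)}
  have hN : ∀ n, MeasurableSet (N n) := fun n =>
    (measurableSet_le measurable_const measurable_norm).inter
      (measurableSet_le measurable_norm measurable_const)
  have hdecay : ∀ n, (2 ^ n * ρ) ^ (-a) ≤ (1 / 2) ^ n * (l / (c1 * M)) := fun n => by
    rw [mul_rpow (by positivity) hρ0.le, hρa]; gcongr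
    rw [← rpow_natCast 2 n, ← rpow_mul (by simp), one_div, inv_pow, ← rpow_natCast,
      ← rpow_neg (by simp)]
    refine rpow_le_rpow_of_exponent_le (by simp) ?_; nlinarith
  have hnear : ∀ n, ∀ y, |(N n).indicator f y| ≤ 6 * l * (1 / 2) ^ n := fun n y => by
    by_cases hy : y ∈ N n
    · rw [indicator_of_mem hy]
      have h1 : ‖y‖ ^ (-a) ≤ (2 ^ n * ρ / 2) ^ (-a) :=
        rpow_le_rpow_of_nonpos (by positivity) hy.1 (by linarith)
      have h2 : (2 ^ n * ρ / 2) ^ (-a) ≤ 6 * (2 ^ n * ρ) ^ (-a) := by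
        rw [div_rpow (by positivity) (by simp), div_eq_mul_inv, mul_comm,
          ← rpow_neg (by simp), neg_neg]
        gcongr
        calc (2 : ℝ) ^ a ≤ 2 ^ (5 / 2 : ℝ) := rpow_le_rpow_of_exponent_le (by simp) ha2
          _ ≤ 6 := by
            rw [show (5 / 2 : ℝ) = 5 * (1 / 2) by norm_num, rpow_mul (by simp),
              ← sqrt_eq_rpow, Real.sqrt_le_left (by simp)]
            norm_num
      calc |f y| ≤ M * (6 * ((1 / 2) ^ n * (l / (c1 * M)))) :=
          (hf y).trans (mul_le_mul_of_nonneg_left (h1.trans (h2.trans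
            (mul_le_mul_of_nonneg_left (hdecay n) (by simp)))) hM.le)
        _ = 6 * l * (1 / 2) ^ n / c1 := by field_simp
        _ ≤ _ := div_le_self (by positivity) hc1
    · rw [indicator_of_notMem hy, abs_zero]; positivity
  have hint : ∀ x, ∀ g, Measurable g → (∀ y, |g y| ≤ M * ‖y‖ ^ (-a)) →
      Integrable fun y => k (x - y) * g y := fun x g mg hg => by
    obtain ⟨C, -, HC⟩ := h.exists_integral_abs_le (norm_nonneg x) ha ha2
    exact (HC M g hM.le mg hg x le_rfl).1
  have hle : ∀ (s : Set E3) y, |s.indicator f y| ≤ M * ‖y‖ ^ (-a) := fun s y =>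
    (norm_indicator_le_norm_self f y).trans (hf y)
  have hsub : {x | l < |cv k f x|} ⊆ closedBall 0 ρ ∪
      ⋃ n, {x | l / 2 < |cv k ((N n).indicator f) x|} := fun x hx => by
    rcases le_or_gt ‖x‖ ρ with h1 | h1
    · exact Or.inl (by simpa using h1)
    right
    obtain ⟨n, hn1, hn2⟩ := exists_nat_pow_near (y := 2) ((one_le_div hρ0).2 h1.le) (by simp)
    rw [le_div_iff₀ hρ0] at hn1; rw [div_lt_iff₀ hρ0, pow_succ] at hn2; refine mem_iUnion.2 ⟨n, ?_⟩
    have hfar := Hf h a M ((N n)ᶜ.indicator f) ha ha2 hM.le (mf.indicator (hN n).compl) (hle _) x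
        (norm_pos_iff.1 (hρ0.trans h1))
      (fun y hy1 hy2 => indicator_of_notMem (notMem_compl_iff.2
        (show y ∈ N n from ⟨by linarith, by linarith⟩)) _)
    have hadd : cv k f x = cv k ((N n).indicator f) x + cv k ((N n)ᶜ.indicator f) x := by
      rw [← cv_add x (hint x _ (mf.indicator (hN n)) (hle _)) (hint x _ (mf.indicator (hN n).compl) (hle _))]
      congr 1
      funext y
      exact (congrFun (indicator_self_add_compl (N n) f) y).symm
    have hfar2 : D * Cf * (M * ‖x‖ ^ (-a)) ≤ l / 2 := by
      have h2 : ‖x‖ ^ (-a) ≤ ρ ^ (-a) := rpow_le_rpow_of_nonpos hρ0 h1.le (by linarith)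
      calc _ ≤ D * Cf * (M * (l / (c1 * M))) := by rw [← hρa]; gcongr
        _ = D * Cf / c1 * l := by field_simp
        _ ≤ 1 / 2 * l := by
          refine mul_le_mul_of_nonneg_right ?_ hl.le; rw [div_le_div_iff₀ (by positivity) (by simp)]
          linarith
        _ = _ := by ring
    have h3 : l < |cv k f x| := hx; rw [hadd] at h3
    have h4 := abs_add_le (cv k ((N n).indicator f) x) (cv k ((N n)ᶜ.indicator f) x)
    change l / 2 < _; linarith
  have hn : ∀ n, volume {x | l / 2 < |cv k ((N n).indicator f) x|}
      ≤ ofReal (A * ρ ^ 3) * ofReal (1 / 2) ^ n := fun n => by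
    refine (H4 h (mf.indicator (hN n)) (6 * l * (1 / 2) ^ n) (4 * (2 ^ n * ρ)) (l / 2) (by positivity)
      (hnear n) (by positivity) (fun y hy => indicator_of_notMem (fun hy' => by
        have := hy'.2; linarith) _) (by positivity)).trans ?_
    rw [← ofReal_pow (by simp), ← ofReal_mul (by positivity)]; gcongr
    have e : ((1 / 2 : ℝ) ^ n) * 2 ^ n = 1 := by rw [← mul_pow]; norm_num
    have e3 : ((1 / 2 : ℝ) ^ n) ^ 4 * (2 ^ n) ^ 3 = (1 / 2) ^ n := by
      calc _ = (1 / 2 : ℝ) ^ n * ((1 / 2 : ℝ) ^ n * 2 ^ n) ^ 3 := by ring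
        _ = _ := by rw [e]; ring
    rw [hA]
    generalize (1 / 2 : ℝ) ^ n = p at *
    generalize (2 : ℝ) ^ n = q at *
    field_simp
    linear_combination 1024 * e3
  calc volume {x | l < |cv k f x|}
      ≤ volume (closedBall (0 : E3) ρ) + ∑' n, volume {x | l / 2 < |cv k ((N n).indicator f) x|} :=
        (measure_mono hsub).trans ((measure_union_le _ _).trans (by gcongr; exact measure_iUnion_le _))
    _ ≤ ofReal (κ * ρ ^ 3) + ∑' n, ofReal (A * ρ ^ 3) * ofReal (1 / 2) ^ n := by
      rw [volume_closedBall_eq _ hρ0.le]; exact add_le_add le_rfl (tsum_le_tsum hn)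
    _ = ofReal ((κ + 2 * A) * ρ ^ 3) := by
      rw [ENNReal.tsum_mul_left, ENNReal.tsum_geometric,
        show (1 : ℝ≥0∞) - ofReal (1 / 2) = ofReal (1 / 2) by
          rw [← ofReal_one, ← ENNReal.ofReal_sub _ (by simp)]; norm_num,
        ← ENNReal.ofReal_inv_of_pos (by simp), ← ofReal_mul (by positivity),
        ← ofReal_add (by positivity) (by positivity)]
      congr 1; ring
    _ ≤ _ := by
      refine ofReal_le_ofReal ?_
      calc (κ + 2 * A) * ρ ^ 3 ≤ (κ + 2 * A) * (c1 ^ 3 * (M / l) ^ (3 / a)) := by gcongr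
        _ = (κ + 2 * A) * c1 ^ 3 * (M / l) ^ (3 / a) := by ring
        _ ≤ _ := by gcongr; exact le_max_right _ _

end IsCZ

/-! ### The Riesz kernels are Calderón–Zygmund -/

lemma integrable_exp_neg_norm : Integrable fun x : E3 => exp (-‖x‖) := by
  refine (integrable_one_add_norm (r := 4) (by norm_num)).const_mul (24 * exp 1) |>.mono'
    (by fun_prop) (ae_of_all _ fun x => ?_)
  have h1 := Real.pow_div_factorial_le_exp (1 + ‖x‖) (by positivity) 4; rw [Real.exp_add] at h1
  rw [norm_eq_abs, Real.abs_exp, rpow_neg (by positivity), exp_neg, ← div_eq_mul_inv,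
    inv_eq_one_div, div_le_div_iff₀ (exp_pos _) (by positivity),
    show (4 : ℝ) = ((4 : ℕ) : ℝ) by simp, rpow_natCast]
  rw [div_le_iff₀ (by positivity)] at h1; norm_num [Nat.factorial] at h1; linarith

/-- The weak type bounds integrate to an `L¹` bound against the weight `exp(-|x|)`. -/
lemma IsCZ.exists_lintegral_exp_le (hD : 0 < D) : ∃ C : ℝ, 0 < C ∧ ∀ {k f : E3 → ℝ}, IsCZ D k →
    Measurable f → ∀ a M : ℝ, 1 ≤ a → a ≤ 5 / 2 → 0 < M → (∀ y, |f y| ≤ M * ‖y‖ ^ (-a)) →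
    ∫⁻ x, ofReal (|cv k f x| * exp (-‖x‖)) ≤ ofReal (C * M) := by
  obtain ⟨C, hC, H⟩ := IsCZ.exists_weak_bound hD; set E := ∫ x : E3, exp (-‖x‖)
  have hE : 0 ≤ E := integral_nonneg fun x => (exp_pos _).le
  refine ⟨E + C + 5 * C, by positivity, fun {k f} h mf a M ha ha2 hM hf => ?_⟩
  have mg := measurable_cv h.continuous.measurable mf; set g := cv k f; set S := {x | M < |g x|}
  have h1 : ∫⁻ x in Sᶜ, ofReal (|g x| * exp (-‖x‖)) ≤ ofReal (M * E) := by
    rw [← integral_const_mul, ofReal_integral_eq_lintegral_ofReal (integrable_exp_neg_norm.const_mul M)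
      (ae_of_all _ fun x => by positivity)]
    refine (setLIntegral_mono (by fun_prop) fun x hx => ofReal_le_ofReal ?_).trans
      (setLIntegral_le_lintegral _ _)
    gcongr; exact not_lt.1 hx
  have h2 : ∫⁻ x in S, ofReal (|g x| * exp (-‖x‖)) ≤ ofReal (C * M) + ofReal (5 * C * M) := by
    calc _ ≤ ∫⁻ x in S, ofReal |g x| := lintegral_mono fun x => ofReal_le_ofReal
              (mul_le_of_le_one_right (abs_nonneg _) (Real.exp_le_one_iff.2 (by simp)))
      _ = ∫⁻ t in Ioi 0, (volume.restrict S) {x | t < |g x|} :=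
        lintegral_eq_lintegral_meas_lt _ (ae_of_all _ fun x => abs_nonneg _) (by fun_prop)
      _ = (∫⁻ t in Ioc 0 M, (volume.restrict S) {x | t < |g x|})
        + ∫⁻ t in Ioi M, (volume.restrict S) {x | t < |g x|} := by
        rw [← lintegral_union measurableSet_Ioi Ioc_disjoint_Ioi_same, Ioc_union_Ioi_eq_Ioi hM.le]
      _ ≤ _ := by
        gcongr
        · calc _ ≤ ∫⁻ t in Ioc 0 M, ofReal C := by
                refine lintegral_mono fun t => (measure_mono (subset_univ _)).trans ?_
                rw [Measure.restrict_apply_univ]; have := H h mf a M M ha ha2 hM hf hM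
                rwa [div_self hM.ne', one_rpow, mul_one] at this
            _ = _ := by rw [setLIntegral_const, Real.volume_Ioc, sub_zero, ofReal_mul (by linarith)]
        · calc _ ≤ ∫⁻ t in Ioi M, ofReal (C * M ^ (6 / 5 : ℝ) * t ^ (-(6 / 5) : ℝ)) := by
                refine setLIntegral_mono (by fun_prop) fun t ht => ?_; have ht0 := hM.trans ht
                refine (Measure.restrict_apply_le _ _).trans ((H h mf a M t ha ha2 hM hf ht0).trans
                  (ofReal_le_ofReal ?_))
                rw [mul_assoc, rpow_neg ht0.le, ← div_eq_mul_inv, ← div_rpow hM.le ht0.le]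
                gcongr C * ?_
                refine Real.rpow_le_rpow_of_exponent_ge (by positivity) ((div_le_one ht0).2 ht.le) ?_
                rw [div_le_div_iff₀ (by simp) (by linarith)]; linarith
            _ = _ := by
                have hi := (integrableOn_Ioi_rpow_of_lt (a := -(6 / 5)) (by norm_num) hM).const_mul
                  (C * M ^ (6 / 5 : ℝ))
                rw [← ofReal_integral_eq_lintegral_ofReal hi, integral_const_mul,
                  integral_Ioi_rpow_of_lt (by norm_num) hM]
                · congr 1
                  have e : M ^ (6 / 5 : ℝ) * M ^ (-(6 / 5) + 1 : ℝ) = M := by rw [← rpow_add hM]; norm_num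
                  linear_combination 5 * C * e
                · filter_upwards [ae_restrict_mem measurableSet_Ioi] with t ht
                  have ht0 := hM.trans ht; positivity
  rw [← lintegral_add_compl _ (measurableSet_lt measurable_const mg.abs)]
  refine (add_le_add h2 h1).trans_eq ?_
  rw [← ofReal_add (by positivity) (by positivity), ← ofReal_add (by positivity) (by positivity)]
  congr 1; ring

lemma norm_clm_le (L : E3 →L[ℝ] ℝ) : ‖L‖ ≤ ∑ c : Fin 3, |L (ei c)| := by
  refine L.opNorm_le_bound (sum_nonneg fun c _ => abs_nonneg _) fun v => ?_
  have hv : v = ∑ c, v c • ei c := by ext k; simp [Pi.single_apply]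
  conv_lhs => rw [hv]
  rw [map_sum, sum_mul]; refine (norm_sum_le _ _).trans (sum_le_sum fun c _ => ?_)
  rw [map_smul, norm_smul, mul_comm]
  exact mul_le_mul_of_nonneg_left (abs_coord_le v c) (norm_nonneg _)

lemma IsKer.exists_fderiv_le (hK : IsKer (n + 1) m K) :
    ∃ C : ℝ, 0 ≤ C ∧ ∀ τ z, ‖fderiv ℝ (K τ) z‖ ≤ C * pk (m + 1) τ z := by
  choose C hC H using fun c => (hK.dk (ei c)).bound
  refine ⟨∑ c, C c, sum_nonneg fun c _ => hC c, fun τ z => (norm_clm_le _).trans ?_⟩; rw [sum_mul]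
  exact sum_le_sum fun c _ => H c τ z

/-- Differentiation under the integral in `cnv`. -/
lemma IsKer.hasFDerivAt_cnv (hK : IsKer (n + 2) m K) (hm : 0 ≤ m)
    (hf : Integrable f) (hτ : 0 < τ) (x : E3) :
    HasFDerivAt (cnv K f τ) (∫ y, f y • fderiv ℝ (K τ) (x - y)) x := by
  obtain ⟨C, hC, H⟩ := hK.exists_fderiv_le; obtain ⟨C', hC', H'⟩ := hK.bound
  have hcf := (hK.contDiff τ).continuous_fderiv (by simp)
  have hs : ∀ x, AEStronglyMeasurable (fun y => K τ (x - y)) :=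
    fun x => (hK.measurable_sub τ x).aestronglyMeasurable
  refine hasFDerivAt_integral_of_dominated_of_fderiv_le
    (F' := fun x y => f y • fderiv ℝ (K τ) (x - y))
    (bound := fun y => |f y| * (C * √τ ^ (-(m + 1)))) univ_mem
    (.of_forall fun x => (hs x).mul hf.1) ?_
    (hf.1.smul (hcf.comp (by fun_prop)).aestronglyMeasurable) ?_ (hf.norm.mul_const _) ?_
  · refine hf.bdd_mul (c := C' * √τ ^ (-m)) (hs x) (ae_of_all _ fun y => (H' τ _).trans ?_)
    gcongr; exact pk_le_rpow hm hτ le_rfl _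
  · refine ae_of_all _ fun y x _ => ?_
    rw [norm_smul]; refine mul_le_mul_of_nonneg_left ((H τ _).trans ?_) (abs_nonneg _)
    gcongr; exact pk_le_rpow (by linarith) hτ le_rfl _
  · refine ae_of_all _ fun y x _ => ?_
    have h1 := IsKer.hasFDerivAt_sub hK τ x y; exact h1.mul_const (f y)

lemma IsKer.fderiv_cnv (hK : IsKer (n + 2) m K) (hm : 0 ≤ m)
    (hf : Integrable f) (hτ : 0 < τ) (x v : E3) :
    fderiv ℝ (cnv K f τ) x v = cnv (dk v K) f τ x := by
  obtain ⟨C, hC, H⟩ := hK.exists_fderiv_le; have hcf := (hK.contDiff τ).continuous_fderiv (by simp)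
  rw [(hK.hasFDerivAt_cnv hm hf hτ x).fderiv, integral_apply]
  · refine integral_ext fun y => ?_
    simp [dk, mul_comm]
  · refine (hf.norm.mul_const (C * √τ ^ (-(m + 1)))).mono'
      (hf.1.smul (hcf.comp (by fun_prop)).aestronglyMeasurable) (ae_of_all _ fun y => ?_)
    rw [norm_smul]; refine mul_le_mul_of_nonneg_left ((H τ _).trans ?_) (norm_nonneg _)
    gcongr; exact pk_le_rpow (by linarith) hτ le_rfl _

lemma IsKer.exists_cnv_decay (hK : IsKer n m K) (hm : 0 ≤ m)
    (hf : Integrable f) (hR0 : 0 ≤ R) (hR : ∀ y, R < ‖y‖ → f y = 0) (hτ : 0 < τ) :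
    ∃ C : ℝ, 0 ≤ C ∧ ∀ x, |cnv K f τ x| ≤ C * (1 + ‖x‖) ^ (-m) := by
  obtain ⟨C, hC, H⟩ := hK.bound; have hsq := Real.sqrt_pos.2 hτ; set c := (1 + R) / √τ + 1
  have hc : 0 < c := by positivity
  refine ⟨C * c ^ m * ∫ y, |f y|, by positivity, fun x => ?_⟩
  calc |∫ y, K τ (x - y) * f y| ≤ ∫ y, C * c ^ m * (1 + ‖x‖) ^ (-m) * |f y| := by
        change ‖∫ y, K τ (x - y) * f y‖ ≤ _
        refine norm_integral_le_of_norm_le (hf.abs.const_mul _) (ae_of_all _ fun y => ?_)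
        rw [norm_mul, norm_eq_abs, norm_eq_abs]; rcases lt_or_ge R ‖y‖ with h | h
        · rw [hR y h]; simp
        refine mul_le_mul_of_nonneg_right ((H τ _).trans ?_) (abs_nonneg _); rw [mul_assoc]; gcongr
        rw [pk, if_pos hτ]
        have h1 : 1 + ‖x‖ ≤ c * (‖x - y‖ + √τ) := by
          have h2 := norm_le_norm_add_norm_sub' x y
          have h3 : c * √τ = 1 + R + √τ := by simp only [c]; field_simp
          have h4 : 0 ≤ (1 + R) / √τ * ‖x - y‖ := by positivity
          have h5 : c * ‖x - y‖ = (1 + R) / √τ * ‖x - y‖ + ‖x - y‖ := by simp only [c]; ring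
          rw [mul_add, h3, h5]; linarith
        calc (‖x - y‖ + √τ) ^ (-m) = c ^ m * (c * (‖x - y‖ + √τ)) ^ (-m) := by
              rw [mul_rpow hc.le (by positivity), ← mul_assoc, ← rpow_add hc]; simp
          _ ≤ _ := mul_le_mul_of_nonneg_left
              (rpow_le_rpow_of_nonpos (by positivity) h1 (by linarith)) (by positivity)
    _ = _ := by rw [integral_const_mul]; ring

lemma integrable_mul_of_decay {C' : ℝ} (hg : Continuous g) (hh : Continuous h)
    (hC : 0 ≤ C) (hgb : ∀ x, |g x| ≤ C * (1 + ‖x‖) ^ (-m)) (hhb : ∀ x, |h x| ≤ C' * (1 + ‖x‖) ^ (-m'))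
    (hm : 3 < m + m') : Integrable fun x => g x * h x := by
  refine (integrable_one_add_norm (by simpa using hm)).const_mul (C * C') |>.mono'
    (hg.mul hh).aestronglyMeasurable (ae_of_all _ fun x => ?_)
  rw [norm_mul]; refine (mul_le_mul (hgb x) (hhb x) (abs_nonneg _) (by positivity)).trans_eq ?_
  rw [neg_add, rpow_add (by positivity)]; ring

/-- The `L²` bound for the regularized second derivatives of the Newtonian potential: integrating by
parts twice, `∫ (∂ᵢ∂ⱼu)² = ∫ ∂ᵢ∂ᵢu ∂ⱼ∂ⱼu`. -/
lemma lintegral_cnv_rieszK_sq_le (mf : Measurable f) (hM : ∀ y, |f y| ≤ M)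
    (hR : ∀ y, R < ‖y‖ → f y = 0) (i j : Fin 3) (hτ : 0 < τ) :
    ∫⁻ x, ofReal (cnv (rieszK (ei i) (ei j)) f τ x ^ 2)
    ≤ ∫⁻ x, ofReal (cnv heatK f τ x ^ 2) := by
  have hf := integrable_of_bdd_support mf hM hR
  have hR' : ∀ y, max R 0 < ‖y‖ → f y = 0 := fun y hy => hR y ((le_max_left _ _).trans_lt hy)
  have hR0 : 0 ≤ max R 0 := le_max_right _ _; set u := fun b => cnv (dk (ei b) newtK) f τ
  set U := fun a b => cnv (rieszK (ei a) (ei b)) f τ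
  have k1 := fun b => by have := (isKer_newtK 5).dk (ei b); norm_num at this; exact this
  have du : ∀ b, Differentiable ℝ (u b) := fun b x =>
    ((k1 b).hasFDerivAt_cnv (by simp) hf hτ x).differentiableAt
  have dU : ∀ a b, Differentiable ℝ (U a b) := fun a b x =>
    ((isKer_rieszK 4 (ei a) (ei b)).hasFDerivAt_cnv (by simp) hf hτ x).differentiableAt
  have fu : ∀ a b x, fderiv ℝ (u b) x (ei a) = U a b x := fun a b x =>
    (k1 b).fderiv_cnv (by simp) hf hτ x (ei a)
  have fU : ∀ a b c x, fderiv ℝ (U a b) x (ei c) = cnv (dk (ei c) (rieszK (ei a) (ei b))) f τ x :=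
    fun a b c x => (isKer_rieszK 4 (ei a) (ei b)).fderiv_cnv (by simp) hf hτ x (ei c)
  choose Cu hCu bu using fun b => (k1 b).exists_cnv_decay (by simp) hf hR0 hR' hτ
  choose CU hCU bU using fun a b => (isKer_rieszK 4 (ei a) (ei b)).exists_cnv_decay (by simp) hf hR0 hR' hτ
  choose CV hCV bV using fun a b c => ((isKer_rieszK 4 (ei a) (ei b)).dk (ei c)).exists_cnv_decay
    (by norm_num) hf hR0 hR' hτ
  have cV := fun a b c =>
    continuous_iff_continuousAt.2 fun x =>
      (((isKer_rieszK 4 (ei a) (ei b)).dk (ei c)).hasFDerivAt_cnv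
        (by norm_num) hf hτ x).continuousAt
  have iUU := fun a b c d =>
    integrable_mul_of_decay (dU a b).continuous (dU c d).continuous (hCU a b) (bU a b) (bU c d) (by simp)
  have iuU := fun b c d =>
    integrable_mul_of_decay (du b).continuous (dU c d).continuous (hCu b) (bu b) (bU c d) (by simp)
  have iuV :=
    fun b c d e => integrable_mul_of_decay (du b).continuous (cV c d e) (hCu b) (bu b) (bV c d e) (by norm_num)
  have ibp : ∀ a b c d, ∫ x, U a b x * U c d x
      = -∫ x, u b x * cnv (dk (ei a) (rieszK (ei c) (ei d))) f τ x := fun a b c d => by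
    have h := integral_mul_fderiv_eq_neg_fderiv_mul_of_integrable
      (v := ei a) (by simp_rw [fu]; exact iUU a b c d)
      (by simp_rw [fU]; exact iuV b c d a) (iuU b c d) (fun x _ => du b x) (fun x _ => dU c d x)
    simp_rw [fu, fU] at h; rw [h, neg_neg]
  have key : ∀ a b, ∫ x, U a b x ^ 2 = ∫ x, U a a x * U b b x := fun a b => by
    have e : dk (ei a) (rieszK (ei a) (ei b)) = dk (ei b) (rieszK (ei a) (ei a)) := by
      rw [rieszK, rieszK, dk_comm (isKer_newtK 3) (ei a) (ei b), dk_comm ((k1 a).of_succ) (ei a) (ei b)]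
    simp_rw [sq]; rw [ibp a b a b, e, ← (ibp b b a a)]; exact integral_ext fun x => mul_comm _ _
  have hsum : ∀ x, ∑ a, U a a x = -cnv heatK f τ x := fun x => by
    have hb : ∀ a, Integrable fun y => rieszK (ei a) (ei a) τ (x - y) * f y := fun a => by
      obtain ⟨C, hC, H⟩ := (isKer_rieszK 0 (ei a) (ei a)).bound
      exact hf.bdd_mul ((isKer_rieszK 0 _ _).measurable_sub τ x).aestronglyMeasurable
        (ae_of_all _ fun y => (H τ _).trans
          (mul_le_mul_of_nonneg_left (pk_le_rpow (by simp) hτ le_rfl _) hC))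
    simp only [U, cnv]; rw [← integral_finsetSum _ fun a _ => hb a, ← integral_neg]
    refine integral_ext fun y => ?_; rw [← sum_mul]; have := sum_rieszK hτ (x - y)
    rw [this, neg_mul]
  have hsq : ∀ x, cnv heatK f τ x ^ 2 = ∑ a, ∑ b, U a a x * U b b x := fun x => by
    rw [← neg_sq, ← hsum, sq, Finset.sum_mul_sum]
  have iH : Integrable fun x => cnv heatK f τ x ^ 2 := by
    simp_rw [hsq]
    exact integrable_finsetSum _ fun a _ => integrable_finsetSum _ fun b _ => iUU a a b b
  have i2 : ∀ a b, Integrable fun x => U a b x ^ 2 := fun a b => by simp_rw [sq]; exact iUU a b a b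
  rw [← ofReal_integral_eq_lintegral_ofReal (i2 i j) (ae_of_all _ fun x => sq_nonneg _),
    ← ofReal_integral_eq_lintegral_ofReal iH (ae_of_all _ fun x => sq_nonneg _)]
  refine ofReal_le_ofReal ?_; simp_rw [hsq]
  rw [integral_finsetSum _ fun a _ => integrable_finsetSum _ fun b _ => iUU a a b b]
  simp_rw [fun a => integral_finsetSum Finset.univ fun b _ => iUU a a b b, ← key]
  have hnn : ∀ a b, 0 ≤ ∫ x, U a b x ^ 2 := fun a b => integral_nonneg fun x => sq_nonneg _
  exact (single_le_sum (fun b _ => hnn i b) (Finset.mem_univ j)).trans (single_le_sum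
      (fun a _ => sum_nonneg fun b _ => hnn a b) (Finset.mem_univ i))

/-- The heat semigroup is a contraction of `L²`. -/
lemma lintegral_cnv_heatK_sq_le (mf : Measurable f) (hM : ∀ y, |f y| ≤ M) (hτ : 0 < τ) :
    ∫⁻ x, ofReal (cnv heatK f τ x ^ 2) ≤ ∫⁻ x, ofReal (f x ^ 2) := by
  have mK := (isKer_heatK 0).measurable.comp (f := fun q : E3 × E3 => (τ, q.1 - q.2)) (by fun_prop)
  have hG : ∀ x, Integrable fun y => heatK τ (x - y) := fun x => (integrable_heatK hτ).comp_sub_left x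
  have hG1 : ∀ x, ∫ y, heatK τ (x - y) = 1 := fun x => by
    rw [integral_sub_left_eq_self (fun z => heatK τ z) volume x, integral_heatK hτ]
  have hpt : ∀ x, ofReal (cnv heatK f τ x ^ 2)
      ≤ ∫⁻ y, ofReal (heatK τ (x - y)) * ofReal (f y ^ 2) := fun x => by
    have i1 := (hG x).mul_bdd mf.aestronglyMeasurable (ae_of_all _ hM)
    have i2 : Integrable fun y => heatK τ (x - y) * f y ^ 2 :=
      (hG x).mul_bdd (by fun_prop) (ae_of_all _ fun y => by
        rw [norm_pow]; exact pow_le_pow_left₀ (norm_nonneg _) (hM y) 2)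
    set m := cnv heatK f τ x with hm
    have h1 : 0 ≤ ∫ y, heatK τ (x - y) * (f y - m) ^ 2 :=
      integral_nonneg fun y => mul_nonneg (heatK_nonneg _ _) (sq_nonneg _)
    have h2 : ∫ y, heatK τ (x - y) * (f y - m) ^ 2 = (∫ y, heatK τ (x - y) * f y ^ 2) - m ^ 2 := by
      have e : ∀ y, heatK τ (x - y) * (f y - m) ^ 2
          = (heatK τ (x - y) * f y ^ 2 - 2 * m * (heatK τ (x - y) * f y)) + m ^ 2 * heatK τ (x - y) :=
        fun y => by ring
      have i3 : Integrable fun y => heatK τ (x - y) * f y ^ 2 - 2 * m * (heatK τ (x - y) * f y) :=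
        i2.sub (i1.const_mul (2 * m))
      simp_rw [e]
      rw [integral_add i3 ((hG x).const_mul (m ^ 2)), integral_sub i2 (i1.const_mul (2 * m)),
        integral_const_mul, integral_const_mul, hG1, show ∫ y, heatK τ (x - y) * f y = m from rfl]
      ring
    simp_rw [← ofReal_mul (heatK_nonneg _ _)]
    rw [← ofReal_integral_eq_lintegral_ofReal i2
      (ae_of_all _ fun y => mul_nonneg (heatK_nonneg _ _) (sq_nonneg _))]
    gcongr; linarith
  refine (lintegral_mono hpt).trans ?_; rw [lintegral_lintegral_swap]
  · refine lintegral_mono fun y => ?_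
    rw [lintegral_mul_const' _ _ ofReal_ne_top,
      ← ofReal_integral_eq_lintegral_ofReal ((integrable_heatK hτ).comp_sub_right y)
        (ae_of_all _ fun _ => heatK_nonneg _ _),
      integral_sub_right_eq_self (fun z => heatK τ z) y, integral_heatK hτ]
    simp
  · exact (mK.ennreal_ofReal.mul ((mf.comp measurable_snd).pow_const 2).ennreal_ofReal).aemeasurable

/-- Uniformly in the regularization, the second derivatives of the Newtonian potential are
Calderón–Zygmund kernels. -/
lemma exists_isCZ_rieszK : ∃ D : ℝ, 0 < D ∧ ∀ τ : ℝ, 0 < τ → ∀ i j : Fin 3,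
    IsCZ D (rieszK (ei i) (ei j) τ) := by
  choose C hC H using fun q : Fin 3 × Fin 3 => (isKer_rieszK 0 (ei q.1) (ei q.2)).bound
  choose C' hC' H' using fun q : Fin 3 × Fin 3 => (isKer_rieszK 1 (ei q.1) (ei q.2)).exists_fderiv_le
  set D := 1 + ∑ q, C q + 16 * ∑ q, C' q; have s1 : 0 ≤ ∑ q, C q := sum_nonneg fun q _ => hC q
  have s2 : 0 ≤ ∑ q, C' q := sum_nonneg fun q _ => hC' q
  have pk_le : ∀ {m τ : ℝ} {z : E3}, 0 ≤ m → 0 < τ → z ≠ 0 → pk m τ z ≤ ‖z‖ ^ (-m) := by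
    intro m τ z hm hτ hz; rw [pk, if_pos hτ]
    exact rpow_le_rpow_of_nonpos (norm_pos_iff.2 hz) (by bound) (by linarith)
  refine ⟨D, by positivity, fun τ hτ i j => ?_⟩
  have hCi : C (i, j) ≤ ∑ q, C q := single_le_sum (fun q _ => hC q) (Finset.mem_univ _)
  have hCi' : C' (i, j) ≤ ∑ q, C' q := single_le_sum (fun q _ => hC' q) (Finset.mem_univ _)
  refine ⟨by positivity, (isKer_rieszK 1 _ _).continuous τ,
    ⟨C (i, j) * √τ ^ (-3 : ℝ), mul_nonneg (hC _) (by positivity), fun z => (H (i, j) τ z).trans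
      (mul_le_mul_of_nonneg_left (pk_le_rpow (by simp) hτ le_rfl _) (hC _))⟩,
    fun z hz => ?_, fun z h hz hh => ?_, fun f M R mf hM hR =>
      (lintegral_cnv_rieszK_sq_le mf hM hR i j hτ).trans (lintegral_cnv_heatK_sq_le mf hM hτ)⟩
  · refine (H (i, j) τ z).trans (mul_le_mul ?_ (pk_le (by simp) hτ hz) (pk_nonneg _ _ _) (by positivity))
    simp only [D]; linarith
  · have hz0 := norm_pos_iff.2 hz
    have hseg : ∀ y ∈ segment ℝ z (z + h), ‖fderiv ℝ (rieszK (ei i) (ei j) τ) y‖ ≤ D * ‖z‖ ^ (-4 : ℝ) := fun y hy => by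
      rw [segment_eq_image'] at hy; obtain ⟨θ, hθ, rfl⟩ := hy
      have h1 : ‖z‖ / 2 ≤ ‖z + θ • (z + h - z)‖ := by
        have e : ‖θ • (z + h - z)‖ ≤ ‖h‖ := by
          rw [add_sub_cancel_left, norm_smul, norm_eq_abs, abs_of_nonneg hθ.1]
          exact mul_le_of_le_one_left (norm_nonneg _) hθ.2
        have e2 := norm_sub_le (z + θ • (z + h - z)) (θ • (z + h - z))
        rw [add_sub_cancel_right] at e2; linarith
      set y := z + θ • (z + h - z)
      have h2 : ‖y‖ ^ (-4 : ℝ) ≤ 16 * ‖z‖ ^ (-4 : ℝ) := by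
        refine (rpow_le_rpow_of_nonpos (by positivity) h1 (by simp)).trans_eq ?_
        rw [div_rpow hz0.le (by simp), show ((2 : ℝ) ^ (-4 : ℝ)) = 1 / 16 by
          rw [show (-4 : ℝ) = ((-4 : ℤ) : ℝ) by simp, Real.rpow_intCast]; norm_num]
        ring
      have h3 := H' (i, j) τ y; rw [show (3 + 1 : ℝ) = 4 by norm_num] at h3
      calc _ ≤ C' (i, j) * (16 * ‖z‖ ^ (-4 : ℝ)) :=
          h3.trans (mul_le_mul_of_nonneg_left ((pk_le (by simp) hτ
            (norm_pos_iff.1 (by linarith))).trans h2) (hC' _))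
        _ = 16 * C' (i, j) * ‖z‖ ^ (-4 : ℝ) := by ring
        _ ≤ _ := by gcongr; simp only [D]; linarith
    have := (convex_segment z (z + h)).norm_image_sub_le_of_norm_fderiv_le
      (fun y _ => (isKer_rieszK 1 (ei i) (ei j)).differentiable τ y) hseg (left_mem_segment ℝ z (z + h))
      (right_mem_segment ℝ z (z + h))
    rw [add_sub_cancel_left] at this; refine this.trans_eq ?_; ring

/-! ### Singular integrals: removing the regularization -/

/-- A derivative of the kernel moves to the function. -/
lemma cv_fderiv {k ψ : E3 → ℝ} (hk : ContDiff ℝ 1 k) (hψ : ContDiff ℝ ∞ ψ) (hc : HasCompactSupport ψ)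
    (v x : E3) : cv (fun z => fderiv ℝ k z v) ψ x = cv k (fun y => fderiv ℝ ψ y v) x := by
  have := integral_fderiv_mul (k := fun y => k (x - y)) (hk.comp (by fun_prop)) (hψ.of_le (by simp)) hc v
  have hf : ∀ y, fderiv ℝ (fun y => k (x - y)) y v = -(fderiv ℝ k (x - y) v) := fun y => by
    have : HasFDerivAt (fun y => k (x - y)) _ y := (hk.differentiable one_ne_zero (x - y)).hasFDerivAt.comp y ((hasFDerivAt_id y).const_sub x)
    simpa using DFunLike.congr_fun this.fderiv v
  simp only [hf, neg_mul, integral_neg, neg_inj] at this; exact this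

/-- `newtK` decreases in time at the rate of the heat kernel, which has mass one. -/
lemma lintegral_newtK_sub_le {τ' : ℝ} (hτ : 0 < τ) (h : τ ≤ τ') :
    ∫⁻ z, ofReal |newtK τ z - newtK τ' z| ≤ ofReal (τ' - τ) := by
  have hpt : ∀ z, ofReal |newtK τ z - newtK τ' z| ≤ ∫⁻ s in Ioc τ τ', ofReal (heatK s z) := fun z => by
    have hi := (integrableOn_ek (k := 3 / 2) (by norm_num) hτ z)
    have e : newtK τ z - newtK τ' z = ∫ s in Ioc τ τ', heatK s z := by
      unfold newtK gk heatK
      rw [if_pos hτ, if_pos (hτ.trans_le h), integral_const_mul, ← mul_sub, ← Ioc_union_Ioi_eq_Ioi h,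
        setIntegral_union Ioc_disjoint_Ioi_same measurableSet_Ioi (hi.mono_set Ioc_subset_Ioi_self)
          (hi.mono_set (Ioi_subset_Ioi h))]
      ring
    rw [e, abs_of_nonneg (integral_nonneg fun s => heatK_nonneg _ _),
      ofReal_integral_eq_lintegral_ofReal _ (ae_of_all _ fun s => heatK_nonneg _ _)]
    exact (hi.mono_set Ioc_subset_Ioi_self).const_mul c0
  refine (lintegral_mono hpt).trans ?_; rw [lintegral_lintegral_swap]
  · calc _ = ∫⁻ s in Ioc τ τ', 1 := by
          refine setLIntegral_congr_fun measurableSet_Ioc fun s hs => ?_; have hs0 := hτ.trans hs.1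
          rw [← ofReal_integral_eq_lintegral_ofReal (integrable_heatK hs0)
            (ae_of_all _ fun _ => heatK_nonneg _ _), integral_heatK hs0, ofReal_one]
      _ ≤ _ := by simp
  · have := (isKer_heatK 0).measurable
    exact (this.comp measurable_swap).ennreal_ofReal.aemeasurable

/-- On smooth functions the regularized operators converge uniformly. -/
lemma exists_cnv_rieszK_sub_le {ψ : E3 → ℝ} (hψ : ContDiff ℝ ∞ ψ) (hc : HasCompactSupport ψ)
    (i j : Fin 3) : ∃ B : ℝ, 0 ≤ B ∧ ∀ τ τ' : ℝ, 0 < τ → τ ≤ τ' → ∀ x,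
      |cnv (rieszK (ei i) (ei j)) ψ τ x - cnv (rieszK (ei i) (ei j)) ψ τ' x| ≤ B * (τ' - τ) := by
  set θ1 := fun y => fderiv ℝ ψ y (ei i)
  have h1 : ContDiff ℝ ∞ θ1 := (hψ.fderiv_right (by simp)).clm_apply contDiff_const
  have c1 : HasCompactSupport θ1 := hc.fderiv_apply ℝ _; set θ := fun y => fderiv ℝ θ1 y (ei j)
  have h2 : ContDiff ℝ ∞ θ := (h1.fderiv_right (by simp)).clm_apply contDiff_const
  have c2 : HasCompactSupport θ := c1.fderiv_apply ℝ _
  obtain ⟨B, hB⟩ := c2.exists_bound_of_continuous h2.continuous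
  have hB0 := (norm_nonneg _).trans (hB 0)
  have e : ∀ τ x, cnv (rieszK (ei i) (ei j)) ψ τ x = cv (newtK τ) θ x := fun τ x => by
    have s1 := cv_fderiv (((isKer_newtK 3).dk (ei j)).contDiff τ |>.of_le (by simp)) hψ hc (ei i) x
    exact s1.trans (cv_fderiv ((isKer_newtK 2).contDiff τ) h1 c1 (ei j) x)
  refine ⟨B, hB0, fun τ τ' hτ h x => ?_⟩
  have hcont : ∀ τ, Continuous fun y => newtK τ (x - y) := fun τ =>
    ((isKer_newtK 1).continuous τ).comp (by fun_prop)
  have hi : ∀ τ, Integrable fun y => newtK τ (x - y) * θ y := fun τ =>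
    ((hcont τ).mul h2.continuous).integrable_of_hasCompactSupport c2.mul_left
  have hl := lintegral_newtK_sub_le hτ h
  rw [← lintegral_sub_left_eq_self (fun z => ofReal |newtK τ z - newtK τ' z|) x] at hl
  have := (integrable_of_lintegral_le (F := fun y => newtK τ (x - y) * θ y - newtK τ' (x - y) * θ y)
    ((hi τ).sub (hi τ')).aestronglyMeasurable hB0 (by linarith) (ae_of_all _ fun y => by
      rw [← sub_mul, abs_mul, mul_comm]; gcongr; exact hB y) hl).2
  rw [e, e]; unfold cv; rw [← integral_sub (hi τ) (hi τ')]
  exact abs_integral_le_integral_abs.trans this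

/-- For bounded, compactly supported functions the `L²` bound controls the weighted `L¹` norm. -/
lemma IsCZ.lintegral_exp_le_of_sq {k : E3 → ℝ} (hk : IsCZ D k) (mh : Measurable h)
    (hM : ∀ y, |h y| ≤ M) (hR : ∀ y, R < ‖y‖ → h y = 0) (hκ : 0 < κ)
    (hh : ∫⁻ x, ofReal (h x ^ 2) ≤ ofReal (κ ^ 2)) :
    ∫⁻ x, ofReal (|cv k h x| * exp (-‖x‖))
    ≤ ofReal (κ * (1 + ∫ x : E3, exp (-‖x‖))) := by
  have mg := measurable_cv hk.continuous.measurable mh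
  calc _ ≤ ∫⁻ x, (ofReal κ⁻¹ * ofReal (cv k h x ^ 2)
      + ofReal κ * ofReal (exp (-‖x‖))) := by
        refine lintegral_mono fun x => ?_
        rw [← ofReal_mul (by positivity), ← ofReal_mul (by positivity),
          ← ofReal_add (by positivity) (by positivity)]
        gcongr; set E := exp (-‖x‖); have hE1 : E ≤ 1 := Real.exp_le_one_iff.2 (by simp)
        have hE0 : 0 < E := exp_pos _
        have h1 : |cv k h x| ≤ κ⁻¹ * cv k h x ^ 2 + κ := by
          rw [← sq_abs, inv_mul_eq_div, div_add' _ _ _ hκ.ne', le_div_iff₀ hκ]; nlinarith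
        have h2 : 0 ≤ κ⁻¹ * cv k h x ^ 2 := by positivity
        nlinarith
    _ ≤ ofReal κ⁻¹ * ofReal (κ ^ 2) + ofReal κ * ofReal (∫ x, exp (-‖x‖)) := by
      rw [lintegral_add_left (by fun_prop), lintegral_const_mul' _ _ ofReal_ne_top,
        lintegral_const_mul' _ _ ofReal_ne_top,
        ofReal_integral_eq_lintegral_ofReal integrable_exp_neg_norm
          (ae_of_all _ fun x => (exp_pos _).le)]
      exact add_le_add (mul_le_mul_right ((hk.l2 h M R mh hM hR).trans hh) _) le_rfl
    _ = _ := by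
      rw [← ofReal_mul (by positivity), ← ofReal_mul (by positivity),
        ← ofReal_add (by positivity) (by positivity)]
      congr 1; field_simp

lemma lintegral_exp_add_le (hu : Measurable u) : ∫⁻ x, ofReal (|u x + v x| * exp (-‖x‖))
    ≤ (∫⁻ x, ofReal (|u x| * exp (-‖x‖)))
    + ∫⁻ x, ofReal (|v x| * exp (-‖x‖)) := by
  rw [← lintegral_add_left (by fun_prop)]; refine lintegral_mono fun x => ?_
  rw [← ofReal_add (by positivity) (by positivity), ← add_mul]
  exact ofReal_le_ofReal (by gcongr; exact abs_add_le _ _)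

/-- The regularized operators are Cauchy as the regularization is removed, in `L¹(exp(-|x|))`. -/
lemma exists_lintegral_cnv_rieszK_sub_le (mf : Measurable f) (hM : 0 < M)
    (hf : ∀ y, |f y| ≤ M * ‖y‖ ^ (-2 : ℝ)) (i j : Fin 3) (hκ : 0 < κ) :
    ∃ δ : ℝ, 0 < δ ∧ ∀ τ τ' : ℝ, 0 < τ → τ < δ → 0 < τ' → τ' < δ →
    ∫⁻ x, ofReal (|cnv (rieszK (ei i) (ei j)) f τ x - cnv (rieszK (ei i) (ei j)) f τ' x|
    * exp (-‖x‖)) ≤ ofReal κ := by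
  obtain ⟨D, hD, hcz⟩ := exists_isCZ_rieszK; obtain ⟨C, hC, HC⟩ := IsCZ.exists_lintegral_exp_le hD
  set E := ∫ x : E3, exp (-‖x‖); have hE : 0 ≤ E := integral_nonneg fun x => (exp_pos _).le
  -- a truncation parameter, so large that the inner and outer parts are negligible
  obtain ⟨N, hN1, hN⟩ : ∃ N, 1 ≤ N ∧ C * (M * N ^ (-(1 / 2) : ℝ)) ≤ κ / 9 := by
    have : Tendsto (fun N => C * (M * N ^ (-(1 / 2) : ℝ))) atTop (𝓝 (C * (M * 0))) :=
      ((tendsto_rpow_neg_atTop (by simp)).const_mul _).const_mul _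
    rw [mul_zero, mul_zero] at this
    obtain ⟨N, h1, h2⟩ := ((eventually_ge_atTop (1 : ℝ)).and
      (this.eventually_le_const (show 0 < κ / 9 by positivity))).exists
    exact ⟨N, h1, h2⟩
  have hN0 : 0 < N := by linarith
  set S1 : Set E3 := {y | ‖y‖ < N⁻¹}; set S2 : Set E3 := {y | N < ‖y‖}
  set S0 : Set E3 := (S1 ∪ S2)ᶜ
  have mS1 : MeasurableSet S1 := measurableSet_lt measurable_norm measurable_const
  have mS2 : MeasurableSet S2 := measurableSet_lt measurable_const measurable_norm
  have mf0 := mf.indicator (mS1.union mS2).compl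
  have hdec : ∀ y, f y = S0.indicator f y + (S1.indicator f y + S2.indicator f y) := fun y => by
    have hd : Disjoint S1 S2 := disjoint_left.2 fun y (h1 : ‖y‖ < N⁻¹) (h2 : N < ‖y‖) => by
      linarith [inv_le_one_of_one_le₀ hN1]
    exact (indicator_compl_add_self_apply (S1 ∪ S2) f y).symm.trans
      (congrArg _ (congrFun (indicator_union_of_disjoint hd f) y))
  -- both tails are small in a neighbouring class `O(|y|^(-a))`
  have b1 : ∀ y, |S1.indicator f y| ≤ M * N ^ (-(1 / 2) : ℝ) * ‖y‖ ^ (-(5 / 2) : ℝ) := fun y => by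
    refine abs_indicator_le (by positivity) fun hy => (hf y).trans ?_; rw [mul_assoc]; gcongr
    refine (rpow_neg_le_inside (by simp) (by norm_num) hy.le).trans_eq ?_
    rw [Real.inv_rpow hN0.le, ← rpow_neg hN0.le]; norm_num
  have b2 : ∀ y, |S2.indicator f y| ≤ M * N ^ (-(1 / 2) : ℝ) * ‖y‖ ^ (-(3 / 2) : ℝ) := fun y => by
    refine abs_indicator_le (by positivity) fun hy => (hf y).trans ?_
    rw [mul_assoc, show (-2 : ℝ) = -(1 / 2) + -(3 / 2) by norm_num, rpow_add (hN0.trans hy)]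
    exact mul_le_mul_of_nonneg_left (mul_le_mul_of_nonneg_right
      (rpow_le_rpow_of_nonpos hN0 hy.le (by simp)) (by positivity)) hM.le
  have b0 : ∀ y, |S0.indicator f y| ≤ M * N ^ (2 : ℝ) := fun y => by
    refine abs_indicator_le (by positivity) fun hy => (hf y).trans (mul_le_mul_of_nonneg_left ?_ hM.le)
    refine (rpow_le_rpow_of_nonpos (inv_pos.2 hN0) (not_lt.1 fun h => hy (.inl h)) (by simp)).trans_eq ?_
    rw [Real.inv_rpow hN0.le, ← rpow_neg hN0.le, neg_neg]
  have s0 : ∀ y, N < ‖y‖ → S0.indicator f y = 0 := fun y hy =>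
    indicator_of_notMem (not_not.2 (.inr hy)) _
  -- a smooth approximation of the middle part
  set κ' := κ / (9 * (1 + E)); have hκ' : 0 < κ' := by positivity
  have mem0 : MemLp (S0.indicator f) 2 := by
    rw [memLp_two_iff_integrable_sq mf0.aestronglyMeasurable]
    refine integrable_of_bdd_support (M := (M * N ^ (2 : ℝ)) ^ 2) (mf0.pow_const 2)
      (fun y => ?_) fun y hy => by rw [s0 y hy]; norm_num
    rw [abs_pow]; exact pow_le_pow_left₀ (abs_nonneg _) (b0 y) 2
  obtain ⟨ψ, hψc, hψs, hψ⟩ := mem0.exist_eLpNorm_sub_le (by simp) (by simp) hκ'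
  obtain ⟨B, hB0, hB⟩ := exists_cnv_rieszK_sub_le hψs hψc i j
  have iψ : Integrable ψ := hψs.continuous.integrable_of_hasCompactSupport hψc
  set h := fun y => S0.indicator f y - ψ y; have mh := mf0.sub hψs.continuous.measurable
  have ih : Integrable h := (integrable_of_bdd_support mf0 b0 s0).sub iψ
  obtain ⟨P, hP⟩ := hψc.exists_bound_of_continuous hψs.continuous
  obtain ⟨Q, hQ⟩ := hψc.isCompact.isBounded.exists_norm_le
  have hhb := fun y => (abs_sub _ _).trans (add_le_add (b0 y) (hP y))
  have hhs : ∀ y, max N Q < ‖y‖ → h y = 0 := fun y hy => by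
    have := image_eq_zero_of_notMem_tsupport fun hm =>
      absurd (hQ y hm) (not_le.2 ((le_max_right _ _).trans_lt hy))
    simp only [h]; rw [s0 y ((le_max_left _ _).trans_lt hy), this, sub_zero]
  have hsq : ∫⁻ x, ofReal (h x ^ 2) ≤ ofReal (κ' ^ 2) := by
    have h1 := eLpNorm_nnreal_pow_eq_lintegral (p := 2) (f := S0.indicator f - ψ)
      (μ := (volume : Measure E3)) (by simp)
    have h2 : ∫⁻ x, ofReal (h x ^ 2) = ∫⁻ x, ‖(S0.indicator f - ψ) x‖ₑ ^ ((2 : ℝ≥0) : ℝ) := by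
      refine lintegral_congr fun x => ?_
      rw [Real.enorm_eq_ofReal_abs, ENNReal.ofReal_rpow_of_nonneg (abs_nonneg _) (by simp)]; congr 1
      norm_num [h]
    rw [h2, ← h1]; refine (ENNReal.rpow_le_rpow hψ (by simp)).trans_eq ?_
    rw [ENNReal.ofReal_rpow_of_nonneg hκ'.le (by simp)]; norm_num
  set g1 := S1.indicator f; set g2 := S2.indicator f; have mg1 := mf.indicator mS1
  have mg2 := mf.indicator mS2; set T := fun τ f => cnv (rieszK (ei i) (ei j)) f τ
  set I : (E3 → ℝ) → ℝ≥0∞ := fun u => ∫⁻ x, ofReal (|u x| * exp (-‖x‖))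
  have mT : ∀ τ, 0 < τ → ∀ g, Measurable g → Measurable (T τ g) := fun τ hτ g hg =>
    measurable_cv (hcz τ hτ i j).continuous.measurable hg
  have hlin : ∀ τ, 0 < τ → ∀ x, T τ f x - T τ ψ x = T τ h x + (T τ g1 x + T τ g2 x) := fun τ hτ x => by
    have hk := hcz τ hτ i j
    obtain ⟨_, -, H1⟩ := hk.exists_integral_abs_le (norm_nonneg x) (by norm_num) le_rfl
    obtain ⟨_, -, H2⟩ := hk.exists_integral_abs_le (norm_nonneg x) (a := 3 / 2) (by norm_num) (by norm_num)
    have j1 := (H1 _ g1 (by positivity) mg1 b1 x le_rfl).1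
    have j2 := (H2 _ g2 (by positivity) mg2 b2 x le_rfl).1; have jh := hk.integrable ih x
    have e : T τ f x = T τ ψ x + (T τ h x + (T τ g1 x + T τ g2 x)) :=
      (integral_ext fun y => by rw [hdec y]; simp only [Pi.add_apply]; ring).trans
        ((integral_add (hk.integrable iψ x) (jh.add (j1.add j2))).trans
        (congrArg _ ((integral_add jh (j1.add j2)).trans (congrArg _ (integral_add j1 j2)))))
    rw [e]; ring
  have I1 := fun τ hτ =>
    (HC (hcz τ hτ i j) mg1 (5 / 2) _ (by norm_num) le_rfl (by positivity) b1).trans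
      (ofReal_le_ofReal hN)
  have I2 := fun τ hτ =>
    (HC (hcz τ hτ i j) mg2 (3 / 2) _ (by norm_num) (by norm_num) (by positivity) b2).trans
      (ofReal_le_ofReal hN)
  have Ih : ∀ τ, 0 < τ → I (T τ h) ≤ ofReal (κ / 9) := fun τ hτ =>
    ((hcz τ hτ i j).lintegral_exp_le_of_sq mh hhb hhs hκ' hsq).trans_eq (by
      congr 1; simp only [κ']; change _ * (1 + E) = _; field_simp)
  have hneg : ∀ u, I (fun x => -u x) = I u := fun u => by simp only [I, abs_neg]
  refine ⟨κ / (9 * (1 + B) * (1 + E)), by positivity, fun τ τ' hτ hτδ hτ' hτδ' => ?_⟩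
  have Iψ : I (fun x => T τ ψ x - T τ' ψ x) ≤ ofReal (κ / 9) := by
    have hd : ∀ x, |T τ ψ x - T τ' ψ x| ≤ B * (κ / (9 * (1 + B) * (1 + E))) := fun x => by
      rcases le_total τ τ' with hle | hle
      · exact (hB τ τ' hτ hle x).trans (by gcongr; linarith)
      · rw [abs_sub_comm]
        exact (hB τ' τ hτ' hle x).trans (by gcongr; linarith)
    calc I (fun x => T τ ψ x - T τ' ψ x)
        ≤ ∫⁻ x, ofReal (B * (κ / (9 * (1 + B) * (1 + E))) * exp (-‖x‖)) :=
          lintegral_mono fun x => ofReal_le_ofReal (by gcongr; exact hd x)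
      _ = ofReal (B * (κ / (9 * (1 + B) * (1 + E))) * E) := by
        rw [← ofReal_integral_eq_lintegral_ofReal (integrable_exp_neg_norm.const_mul _)
          (ae_of_all _ fun x => by positivity), integral_const_mul]
      _ ≤ _ := by
        gcongr
        have e : κ / 9 - B * (κ / (9 * (1 + B) * (1 + E))) * E
          = κ / 9 * ((1 + B + E) / ((1 + B) * (1 + E))) := by field
        have : 0 ≤ κ / 9 * ((1 + B + E) / ((1 + B) * (1 + E))) := by positivity
        linarith
  have hadd : ∀ (u v : E3 → ℝ) (a b : ℝ), Measurable u → 0 ≤ a → 0 ≤ b → I u ≤ ofReal a →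
      I v ≤ ofReal b → I (fun x => u x + v x) ≤ ofReal (a + b) := fun u v a b mu ha hb hu hv => by
    rw [ofReal_add ha hb]; exact (lintegral_exp_add_le mu).trans (by gcongr)
  have k0 : 0 ≤ κ / 9 := by positivity
  have mψ := hψs.continuous.measurable
  have J : ∀ τ, 0 < τ → I (fun x => T τ f x - T τ ψ x) ≤ ofReal (κ / 9 + (κ / 9 + κ / 9)) := fun τ hτ => by
    simp_rw [hlin τ hτ]
    exact hadd _ _ _ _ (mT τ hτ h mh) k0 (by positivity) (Ih τ hτ)
      (hadd _ _ _ _ (mT τ hτ g1 mg1) k0 k0 (I1 τ hτ) (I2 τ hτ))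
  have q := hadd _ _ _ _ ((mT τ hτ ψ mψ).sub (mT τ' hτ' ψ mψ)) k0 (by positivity) Iψ
    (hadd _ (fun x => -(T τ' f x - T τ' ψ x)) _ _ ((mT τ hτ f mf).sub (mT τ hτ ψ mψ)) (by positivity)
      (by positivity) (J τ hτ) ((hneg _).trans_le (J τ' hτ')))
  refine Eq.trans_le (congrArg I (funext fun x => ?_)) (q.trans (by gcongr; linarith))
  simp only [Pi.sub_apply]; ring

/-! ### Singular integrals: the limit operators -/

/-- A Cauchy sequence in `L¹` converges in `L¹`, and almost everywhere along a subsequence. -/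
lemma exists_limit_of_cauchy {α : Type*} [MeasurableSpace α] {μ : Measure α} {H : ℕ → α → ℝ}
    (hi : ∀ n, Integrable (H n) μ)
    (hc : Tendsto (fun p : ℕ × ℕ => ∫⁻ z, ‖H p.1 z - H p.2 z‖ₑ ∂μ) atTop (𝓝 0)) :
    ∃ G : α → ℝ, Measurable G ∧ Integrable G μ ∧ Tendsto (fun n => ∫⁻ z, ‖H n z - G z‖ₑ ∂μ) atTop (𝓝 0) ∧
      ∃ ns : ℕ → ℕ, StrictMono ns ∧ ∀ᵐ z ∂μ, Tendsto (fun k => H (ns k) z) atTop (𝓝 (G z)) := by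
  have hcs : CauchySeq fun n => (hi n).toL1 (H n) := by
    rw [EMetric.cauchySeq_iff]; intro ε hε
    obtain ⟨N, hN⟩ := eventually_atTop_prod_self'.1 (hc.eventually_lt_const hε)
    refine ⟨N, fun m hm n hn => ?_⟩; rw [Integrable.edist_toL1_toL1]; exact hN m hm n hn
  obtain ⟨F, hF⟩ := cauchySeq_tendsto_of_complete hcs; have hFm := (Lp.aestronglyMeasurable F)
  set G := hFm.mk; have hG := hFm.ae_eq_mk; have hGi := (L1.integrable_coeFn F).congr hG
  have hlim : Tendsto (fun n => ∫⁻ z, ‖H n z - G z‖ₑ ∂μ) atTop (𝓝 0) := by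
    rw [tendsto_iff_edist_tendsto_0] at hF; refine hF.congr fun n => ?_
    have : F = hGi.toL1 G := Lp.ext (hG.trans hGi.coeFn_toL1.symm)
    rw [this, Integrable.edist_toL1_toL1]; simp_rw [edist_eq_enorm_sub]
  refine ⟨G, hFm.stronglyMeasurable_mk.measurable, hGi, hlim, ?_⟩
  have hm : TendstoInMeasure μ H atTop G := by
    refine tendstoInMeasure_of_tendsto_eLpNorm one_ne_zero (fun n => (hi n).1) hGi.1 (hlim.congr fun n => ?_)
    rw [eLpNorm_one_eq_lintegral_enorm]; rfl
  exact hm.exists_seq_tendsto_ae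

/-- Bounds on superlevel sets pass to almost everywhere limits. -/
lemma meas_lt_abs_le_of_tendsto {u : ℕ → E3 → ℝ} {A : ℝ≥0∞}
    (h : ∀ᵐ x, Tendsto (fun k => u k x) atTop (𝓝 (g x))) (hu : ∀ k, volume {x | l < |u k x|} ≤ A) :
    volume {x | l < |g x|} ≤ A := by
  set S := fun m => ⋂ k ≥ m, {x | l < |u k x|}
  have hS : Monotone S := fun m n hmn x hx => mem_iInter₂.2 fun k hk => mem_iInter₂.1 hx k (hmn.trans hk)
  have hsub : {x | l < |g x|} ≤ᵐ[volume] ⋃ m, S m := by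
    filter_upwards [h] with x hx hlx
    obtain ⟨m, hm⟩ := eventually_atTop.1 ((hx.abs).eventually_const_lt hlx)
    exact mem_iUnion.2 ⟨m, mem_iInter₂.2 fun k hk => hm k hk⟩
  refine (measure_mono_ae hsub).trans ?_; rw [hS.measure_iUnion]
  exact iSup_le fun m => (measure_mono (iInter₂_subset m le_rfl)).trans (hu m)

/-- Pairing with the regularized operator is the pairing with the regularized dual kernel. -/
lemma integral_mul_pair_rieszK {f : E4 → ℝ} (mf : Measurable f) (hM : 0 ≤ M)
    (hf : ∀ z, |f z| ≤ M * ‖z.2‖ ^ (-2 : ℝ)) (i j : Fin 3) (hχ : TF χ) (hε : 0 < ε) :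
    ∫ z in posTime, f z * pair (rieszK (ei i) (ei j)) χ ε z.1 z.2
    = ∫ z in posTime, cnv (rieszK (ei i) (ei j)) (fun y => f (z.1, y)) ε z.2 * χ (z.1 + ε, z.2) := by
  obtain ⟨D, hD, hcz⟩ := exists_isCZ_rieszK; have hk := hcz ε hε i j
  obtain ⟨R, hR, hRs⟩ := hχ.exists_radius
  obtain ⟨C, hC, HC⟩ := hk.exists_integral_abs_le hR.le (a := 2) (by simp) (by norm_num)
  set k := rieszK (ei i) (ei j) ε; have mk := hk.continuous.measurable
  -- the shifted test function
  have iχ : Integrable fun z : E4 => χ (z.1 + ε, z.2) := by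
    have h1 := (hχ.continuous.comp (Homeomorph.addLeft ((ε, 0) : E4)).continuous).integrable_of_hasCompactSupport
      (μ := volume) (hχ.compact.comp_homeomorph (Homeomorph.addLeft ((ε, 0) : E4)))
    exact h1.congr (ae_of_all _ fun z => by simp [Prod.add_def, add_comm])
  have hin : ∀ s, ∀ x, Integrable (fun y => k (x - y) * f (s, y) * χ (s + ε, x)) ∧
      ∫ y, ‖k (x - y) * f (s, y) * χ (s + ε, x)‖ ≤ C * M * |χ (s + ε, x)| := fun s x => by
    rcases le_or_gt R ‖x‖ with h | h
    · rw [hRs _ x (Or.inr h)]; simp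
    obtain ⟨h1, h2⟩ := HC M (fun y => f (s, y)) hM ((fun s => mf.comp (by fun_prop)) s) (fun y => hf (s, y)) x h.le
    refine ⟨h1.mul_const _, ?_⟩; simp_rw [norm_mul _ (χ _)]; rw [integral_mul_const]
    exact mul_le_mul_of_nonneg_right h2 (abs_nonneg _)
  have hΨ : Integrable (fun q : E4 × E3 => k (q.1.2 - q.2) * f (q.1.1, q.2) * χ (q.1.1 + ε, q.1.2))
      (μ₊.prod volume) := by
    have mΨ : Measurable fun q : E4 × E3 => k (q.1.2 - q.2) * f (q.1.1, q.2) * χ (q.1.1 + ε, q.1.2) :=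
      ((mk.comp (by fun_prop)).mul (mf.comp (by fun_prop))).mul (hχ.continuous.measurable.comp (by fun_prop))
    rw [integrable_prod_iff mΨ.aestronglyMeasurable]
    refine ⟨ae_of_all _ fun z => (hin z.1 z.2).1, (iχ.abs.const_mul (C * M)).restrict.mono'
      mΨ.norm.stronglyMeasurable.integral_prod_right.aestronglyMeasurable (ae_of_all _ fun z => ?_)⟩
    rw [norm_eq_abs, abs_of_nonneg (integral_nonneg fun _ => norm_nonneg _)]; exact (hin z.1 z.2).2
  -- reorder the variables
  set e : E4 × E3 ≃ᵐ E4 × E3 :=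
    (MeasurableEquiv.prodAssoc.trans ((MeasurableEquiv.refl ℝ).prodCongr MeasurableEquiv.prodComm)).trans
      MeasurableEquiv.prodAssoc.symm
  have he : MeasurePreserving e (μ₊.prod volume) (μ₊.prod volume) := by
    rw [volume_restrict_posTime]
    exact ((measurePreserving_prodAssoc _ _ _).trans
      ((MeasurePreserving.id _).prod (Measure.measurePreserving_swap))).trans
      (measurePreserving_prodAssoc _ _ _).symm
  have h3 := he.integral_comp e.measurableEmbedding
    (fun q : E4 × E3 => k (q.1.2 - q.2) * f (q.1.1, q.2) * χ (q.1.1 + ε, q.1.2))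
  calc _ = ∫ z in posTime, ∫ x, k (x - z.2) * f (z.1, z.2) * χ (z.1 + ε, x) := by
        refine integral_ext fun z => ?_; simp only [pair]
        rw [← integral_const_mul]; refine integral_ext fun x => ?_; ring
    _ = ∫ z in posTime, ∫ y, k (z.2 - y) * f (z.1, y) * χ (z.1 + ε, z.2) :=
      (integral_prod _ (he.integrable_comp_of_integrable hΨ)).symm.trans (h3.trans (integral_prod _ hΨ))
    _ = _ := by refine integral_ext fun z => ?_; simp only [cnv]; rw [← integral_mul_const]

/-- `L¹` convergence tested against bounded, almost everywhere convergent functions. -/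
lemma tendsto_integral_mul_of_bounded {α : Type*} [MeasurableSpace α] {μ : Measure α} {H ψn : ℕ → α → ℝ}
    {G ψ : α → ℝ} (iH : ∀ n, Integrable (H n) μ) (iG : Integrable G μ)
    (hG : Tendsto (fun n => ∫⁻ z, ‖H n z - G z‖ₑ ∂μ) atTop (𝓝 0)) (mψ : ∀ n, AEStronglyMeasurable (ψn n) μ)
    (hB : ∀ n, ∀ᵐ z ∂μ, |ψn n z| ≤ B) (hψ : ∀ᵐ z ∂μ, Tendsto (fun n => ψn n z) atTop (𝓝 (ψ z))) :
    Tendsto (fun n => ∫ z, H n z * ψn n z ∂μ) atTop (𝓝 (∫ z, G z * ψ z ∂μ)) := by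
  have h1 : Tendsto (fun n => ∫ z, G z * ψn n z ∂μ) atTop (𝓝 (∫ z, G z * ψ z ∂μ)) := by
    refine tendsto_integral_of_dominated_convergence (fun z => |G z| * B) (fun n => iG.1.mul (mψ n))
      (iG.abs.mul_const B) (fun n => ?_) (hψ.mono fun z hz => hz.const_mul _)
    filter_upwards [hB n] with z hz; rw [norm_mul, norm_eq_abs, norm_eq_abs]; gcongr
  have i2 : ∀ n, Integrable (fun z => (H n z - G z) * ψn n z) μ := fun n =>
    ((iH n).sub iG).mul_bdd (mψ n) (hB n)
  have h2 : Tendsto (fun n => ∫ z, (H n z - G z) * ψn n z ∂μ) atTop (𝓝 (∫ z, (0 : ℝ) ∂μ)) := by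
    refine tendsto_integral_of_L1 _ aestronglyMeasurable_const (.of_forall i2) ?_
    have h3 : Tendsto (fun n => (∫⁻ z, ‖H n z - G z‖ₑ ∂μ) * ofReal B) atTop (𝓝 0) := by
      have := ENNReal.Tendsto.mul_const (b := ofReal B) hG (Or.inr ofReal_ne_top)
      rwa [zero_mul] at this
    refine tendsto_of_tendsto_of_tendsto_of_le_of_le tendsto_const_nhds h3 (fun _ => zero_le) fun n => ?_
    rw [← lintegral_mul_const' _ _ ofReal_ne_top]; refine lintegral_mono_ae ?_
    filter_upwards [hB n] with z hz; rw [sub_zero, enorm_mul]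
    exact mul_le_mul_right (by rw [Real.enorm_eq_ofReal_abs]; gcongr) _
  have h4 := h2.add h1; rw [integral_zero, zero_add] at h4; refine h4.congr fun n => ?_
  rw [← integral_add (i2 n) ((fun n => iG.mul_bdd (mψ n) (hB n)) n)]
  refine integral_ext fun z => ?_; ring

/-- The Riesz-type operators `∂ᵢ∂ⱼ(-Δ)⁻¹`, applied at each time to a field that decays like `|x|⁻²`.
They are `L¹` limits, with an exponential weight, of the regularized operators. -/
lemma exists_riesz_limit : ∃ C : ℝ, 1 ≤ C ∧ ∀ (f : E4 → ℝ) (M : ℝ), 0 < M → Measurable f →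
    (∀ z, |f z| ≤ M * ‖z.2‖ ^ (-2 : ℝ)) → ∀ i j : Fin 3, ∃ g : E4 → ℝ, Measurable g ∧
      (∀ t a M' l : ℝ, 0 < t → 1 ≤ a → a ≤ 5 / 2 → 0 < M' → (∀ y, |f (t, y)| ≤ M' * ‖y‖ ^ (-a)) → 0 < l →
        volume {x | l < |g (t, x)|} ≤ ofReal (C * (M' / l) ^ (3 / a))) ∧
      Integrable (fun z => g z * (exp (-z.1) * exp (-‖z.2‖))) μ₊ ∧
      ∀ χ : E4 → ℝ, TF χ → Tendsto (fun n : ℕ => ∫ z in posTime,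
        f z * pair (rieszK (ei i) (ei j)) χ (1 / ((n : ℝ) + 1)) z.1 z.2) atTop (𝓝 (∫ z in posTime, g z * χ z)) := by
  obtain ⟨D, hD, hcz⟩ := exists_isCZ_rieszK; obtain ⟨C, hC, HC⟩ := IsCZ.exists_weak_bound hD
  obtain ⟨C2, hC2, HC2⟩ := IsCZ.exists_lintegral_exp_le hD
  refine ⟨C, hC, fun f M hM mf hf i j => ?_⟩; set εn : ℕ → ℝ := fun n => 1 / ((n : ℝ) + 1)
  have hεn : ∀ n, 0 < εn n := fun n => by positivity
  have hεl : Tendsto εn atTop (𝓝 0) := tendsto_one_div_add_atTop_nhds_zero_nat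
  set u : ℕ → E4 → ℝ := fun n z => cnv (rieszK (ei i) (ei j)) (fun y => f (z.1, y)) (εn n) z.2
  have mu := fun n =>
    measurable_cnv (isKer_rieszK 0 (ei i) (ei j)) (f := fun t y => f (t, y)) mf (fun _ => εn n) measurable_const
  have mfs : ∀ s, Measurable fun y => f (s, y) := fun s => mf.comp (by fun_prop)
  set H := fun n z => u n z * (exp (-z.1) * exp (-‖z.2‖))
  have mH : ∀ n, Measurable (H n) := fun n => (mu n).mul (by fun_prop)
  have enorm_eq : ∀ (a : ℝ) (z : E4), ‖a * (exp (-z.1) * exp (-‖z.2‖))‖ₑ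
      = ofReal (exp (-z.1)) * ofReal (|a| * exp (-‖z.2‖)) := fun a z => by
    rw [← ofReal_mul (exp_pos _).le, Real.enorm_eq_ofReal_abs, abs_mul,
      abs_of_pos (by positivity : 0 < exp (-z.1) * exp (-‖z.2‖))]
    congr 1; ring
  have slice : ∀ G : E4 → ℝ, Measurable G → ∫⁻ z in posTime, ‖G z * (exp (-z.1) * exp (-‖z.2‖))‖ₑ
        = ∫⁻ t in Ioi (0 : ℝ), ofReal (exp (-t)) *
          ∫⁻ x, ofReal (|G (t, x)| * exp (-‖x‖)) := fun G mG => by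
    rw [volume_restrict_posTime, lintegral_prod _ (by fun_prop)]; refine lintegral_congr fun t => ?_
    rw [← lintegral_const_mul _ (by fun_prop)]; exact lintegral_congr fun x => enorm_eq _ _
  have ub : ∀ n t, ∫⁻ x, ofReal (|u n (t, x)| * exp (-‖x‖)) ≤ ofReal (C2 * M) :=
    fun n t => HC2 (hcz _ (hεn n) i j) (mfs t) 2 M (by simp) (by norm_num) hM fun y => hf (t, y)
  have iexp : ∫⁻ t in Ioi (0 : ℝ), ofReal (exp (-t)) ≠ ⊤ := by
    have h1 := (integrableOn_exp_neg_Ioi 0).hasFiniteIntegral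
    rw [hasFiniteIntegral_iff_ofReal (ae_of_all _ fun _ => (exp_pos _).le)] at h1; exact h1.ne
  have mexp : Measurable fun t => ofReal (exp (-t)) := by fun_prop
  have iH : ∀ n, Integrable (H n) μ₊ := fun n => by
    refine ⟨(mH n).aestronglyMeasurable, ?_⟩; rw [hasFiniteIntegral_iff_enorm, slice _ (mu n)]
    refine (lintegral_mono fun t => mul_le_mul_right (ub n t) _).trans_lt ?_
    rw [lintegral_mul_const _ mexp]; exact ENNReal.mul_lt_top iexp.lt_top ENNReal.ofReal_lt_top
  have hc : Tendsto (fun p : ℕ × ℕ => ∫⁻ z in posTime, ‖H p.1 z - H p.2 z‖ₑ) atTop (𝓝 0) := by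
    have h1 : ∀ p : ℕ × ℕ, ∫⁻ z in posTime, ‖H p.1 z - H p.2 z‖ₑ = ∫⁻ t in Ioi (0 : ℝ),
        ofReal (exp (-t)) * ∫⁻ x, ofReal (|u p.1 (t, x) - u p.2 (t, x)| * exp (-‖x‖)) := fun p => by
      rw [← slice (fun z => u p.1 z - u p.2 z) ((mu _).sub (mu _))]; simp only [H, sub_mul]
    simp_rw [h1]; have h0 : ∫⁻ t in Ioi (0 : ℝ), (0 : ℝ≥0∞) = 0 := by simp
    rw [← h0]
    -- dominated convergence in `t`: each time slice is Cauchy, with a uniform bound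
    refine tendsto_lintegral_filter_of_dominated_convergence
      (fun t => ofReal (exp (-t)) * (ofReal (C2 * M) + ofReal (C2 * M))) ?_ ?_ ?_ ?_
    · refine .of_forall fun p => ?_
      exact mexp.mul (Measurable.lintegral_prod_right' (f := fun q =>
        ofReal (|u p.1 q - u p.2 q| * exp (-‖q.2‖))) (by fun_prop))
    · refine .of_forall fun p => ae_of_all _ fun t => mul_le_mul_right ?_ _
      refine le_trans ?_ (add_le_add (ub p.1 t) (ub p.2 t)); rw [← lintegral_add_left (by fun_prop)]
      refine lintegral_mono fun x => ?_
      rw [← ofReal_add (by positivity) (by positivity), ← add_mul]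
      exact ofReal_le_ofReal (by gcongr; exact abs_sub _ _)
    · rw [lintegral_mul_const _ mexp]
      exact ENNReal.mul_ne_top iexp (by finiteness)
    · refine ae_of_all _ fun t => ?_
      rw [show (0 : ℝ≥0∞) = ofReal (exp (-t)) * 0 by simp]
      refine ENNReal.Tendsto.const_mul ?_ (Or.inr ofReal_ne_top); rw [ENNReal.tendsto_nhds_zero]
      intro κ hκ
      obtain ⟨κ', hκ', hκ1⟩ : ∃ κ' : ℝ, 0 < κ' ∧ ofReal κ' ≤ κ := by
        rcases eq_or_ne κ ⊤ with rfl | h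
        · exact ⟨1, one_pos, le_top⟩
        · exact ⟨κ.toReal, ENNReal.toReal_pos hκ.ne' h, ENNReal.ofReal_toReal_le⟩
      obtain ⟨δ, hδ, Hδ⟩ := exists_lintegral_cnv_rieszK_sub_le (mfs t) hM (fun y => hf (t, y)) i j hκ'
      obtain ⟨N, hN⟩ := eventually_atTop.1 (hεl.eventually_lt_const hδ)
      filter_upwards [eventually_ge_atTop (N, N)] with p hp
      exact (Hδ _ _ (hεn _) (hN _ hp.1) (hεn _) (hN _ hp.2)).trans hκ1
  obtain ⟨G, mG, iG, hG, ns, hns, hae⟩ := exists_limit_of_cauchy iH hc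
  -- undo the exponential weight, off the null set of times without almost everywhere convergence
  have hae' : ∀ᵐ t ∂(volume.restrict (Ioi (0 : ℝ))), ∀ᵐ x, Tendsto (fun k => H (ns k) (t, x)) atTop (𝓝 (G (t, x))) := by
    rw [volume_restrict_posTime] at hae; exact Measure.ae_ae_of_ae_prod hae
  obtain ⟨S, hS, mS, vS⟩ := exists_measurable_superset_of_null hae'
  set g := (Sᶜ ×ˢ univ).indicator fun z => G z * (exp z.1 * exp ‖z.2‖)
  have mg : Measurable g := Measurable.indicator (by fun_prop) (mS.compl.prod MeasurableSet.univ)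
  have hexp : ∀ z : E4, (exp z.1 * exp ‖z.2‖) * (exp (-z.1) * exp (-‖z.2‖)) = 1 := by
    intro z; rw [exp_neg, exp_neg]; field_simp
  have hgG : ∀ᵐ z ∂μ₊, g z * (exp (-z.1) * exp (-‖z.2‖)) = G z := by
    have : ∀ᵐ z ∂μ₊, z.1 ∈ Sᶜ := by
      rw [volume_restrict_posTime]
      exact Measure.quasiMeasurePreserving_fst.ae (compl_mem_ae_iff.2 vS)
    filter_upwards [this] with z hz; simp only [g]
    rw [indicator_of_mem (show z ∈ Sᶜ ×ˢ (univ : Set E3) from ⟨hz, mem_univ _⟩), mul_assoc, hexp, mul_one]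
  refine ⟨g, mg, ?_, iG.congr (hgG.mono fun z hz => hz.symm), ?_⟩
  · intro t a M' l ht ha ha2 hM' hf' hl
    by_cases hts : t ∈ S
    · have : {x : E3 | l < |g (t, x)|} = ∅ := by
        refine eq_empty_of_forall_notMem fun x hx => ?_; simp only [g, mem_ofPred_eq] at hx
        rw [indicator_of_notMem (fun h => h.1 hts), abs_zero] at hx; exact hx.not_gt hl
      rw [this]; simp
    · have h1 : ∀ᵐ x, Tendsto (fun k => H (ns k) (t, x)) atTop (𝓝 (G (t, x))) := by
        by_contra h; exact hts (hS h)
      refine meas_lt_abs_le_of_tendsto (u := fun k x => u (ns k) (t, x)) ?_ fun k =>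
        HC (hcz _ (hεn (ns k)) i j) (mfs t) a M' l ha ha2 hM' hf' hl
      filter_upwards [h1] with x hx
      have h3 : g (t, x) = G (t, x) * (exp t * exp ‖x‖) := indicator_of_mem (show (t, x) ∈ Sᶜ ×ˢ (univ : Set E3) from ⟨hts, mem_univ _⟩) _
      rw [h3]; refine (hx.mul_const (exp t * exp ‖x‖)).congr fun k => ?_; have := hexp (t, x)
      rw [mul_assoc, mul_comm (exp (-t) * _), this, mul_one]
  · intro χ hχ
    obtain ⟨B, hB, HB⟩ := hχ.exists_bound; obtain ⟨R, hR, HR⟩ := hχ.exists_radius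
    set ψ : ℝ → E4 → ℝ := fun ε z => χ (z.1 + ε, z.2) * (exp z.1 * exp ‖z.2‖)
    have h1 := tendsto_integral_mul_of_bounded (B := B * (exp R * exp R)) (ψn := fun n => ψ (εn n))
      (ψ := ψ 0) iH iG hG (fun n => by
        apply Measurable.aestronglyMeasurable
        exact (hχ.continuous.measurable.comp (by fun_prop)).mul (by fun_prop)) (fun n => ?_) (ae_of_all _ fun z => ?_)
    · have e1 : ∀ n, ∫ z in posTime, H n z * ψ (εn n) z = ∫ z in posTime,
        f z * pair (rieszK (ei i) (ei j)) χ (1 / ((n : ℝ) + 1)) z.1 z.2 := fun n => by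
        rw [integral_mul_pair_rieszK mf hM.le hf i j hχ (hεn n)]
        refine integral_congr_ae (ae_of_all _ fun z => ?_); have := hexp z
        calc _ = u n z * χ (z.1 + εn n, z.2) * ((exp z.1 * exp ‖z.2‖) *
            (exp (-z.1) * exp (-‖z.2‖))) := by simp; ring
          _ = _ := by rw [this, mul_one]
      have e2 : ∫ z in posTime, G z * ψ 0 z = ∫ z in posTime, g z * χ z := by
        refine integral_congr_ae (hgG.mono fun z hz => ?_); have := hexp z
        calc G z * ψ 0 z = g z * χ z * ((exp z.1 * exp ‖z.2‖) *
            (exp (-z.1) * exp (-‖z.2‖))) := by rw [← hz]; simp only [ψ, add_zero]; ring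
          _ = _ := by rw [this, mul_one]
      rw [e2] at h1; exact h1.congr e1
    · filter_upwards [ae_posTime] with z hz
      simp only [ψ]
      by_cases hc : R ≤ |z.1 + εn n| ∨ R ≤ ‖z.2‖
      · rw [HR _ _ hc]; simp; positivity
      push Not at hc; rw [abs_mul, abs_of_pos (by positivity : 0 < exp z.1 * exp ‖z.2‖)]
      have := hεn n; have h5 : z.1 ≤ R := by have := le_abs_self (z.1 + εn n); linarith
      have h6 := hc.2.le; gcongr; exact HB _
    · have : Tendsto (fun n => (z.1 + εn n, z.2)) atTop (𝓝 (z.1 + 0, z.2)) :=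
        (tendsto_const_nhds.add hεl).prodMk_nhds tendsto_const_nhds
      exact ((hχ.continuous.tendsto _).comp this).mul_const _

/-! ### The pressure -/

/-- The source of the pressure interpolates between powers of `t` and of `|x|`. -/
lemma wtF_le_time_rpow_mul (ha : 1 + η ≤ a) (ha2 : a ≤ 2) (hη : -1 < η) (ht : 0 < t) (x : E3) :
    wtF η t x ≤ t ^ ((a - 2) / 2) * ‖x‖ ^ (-a) := by
  unfold wtF; rcases eq_or_ne x 0 with rfl | hx
  · rw [norm_zero, zero_rpow (by linarith), mul_zero]
    positivity
  have hx0 := norm_pos_iff.2 hx; have hs := Real.sqrt_pos.2 ht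
  have e1 : (‖x‖ + √t) ^ (-1 + η) = (‖x‖ + √t) ^ (a - 2) * (‖x‖ + √t) ^ (1 + η - a) := by
    rw [← rpow_add (by positivity)]; congr 1; ring
  have e2 : t ^ ((a - 2) / 2) = √t ^ (a - 2) := by rw [sqrt_eq_rpow, ← rpow_mul ht.le]; congr 1; ring
  have e3 : ‖x‖ ^ (-a) = ‖x‖ ^ (1 + η - a) * ‖x‖ ^ (-(1 + η)) := by rw [← rpow_add hx0]; congr 1; ring
  rw [e1, e2, e3, mul_assoc]
  have h1 : (‖x‖ + √t) ^ (a - 2) ≤ √t ^ (a - 2) :=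
    rpow_le_rpow_of_nonpos hs (by linarith) (by linarith)
  have h2 : (‖x‖ + √t) ^ (1 + η - a) ≤ ‖x‖ ^ (1 + η - a) :=
    rpow_le_rpow_of_nonpos hx0 (by linarith) (by linarith)
  exact mul_le_mul h1 (by rw [← neg_add']; gcongr) (by positivity) (by positivity)

/-- A crude quasi-triangle inequality, by splitting the level `l` evenly. -/
lemma weakLpNorm_sum_le {ι : Type*} [Fintype ι] [Nonempty ι] {g : ι → E3 → ℝ} (hs : 1 ≤ s) (hC : 1 ≤ C)
    (hM : 0 ≤ M) (h : ∀ q l, 0 < l → volume {x | l < |g q x|} ≤ ofReal (C * (M / l) ^ s)) :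
    weakLpNorm s (fun x => ∑ q, g q x) ≤ ofReal ((Fintype.card ι : ℝ) ^ 2 * C * M) := by
  set N := (Fintype.card ι : ℝ); refine iSup_le fun l => ?_; rcases eq_or_ne l 0 with rfl | hl0
  · simp
  have hsub : {x | (l : ℝ) < |∑ q, g q x|} ⊆ ⋃ q, {x | l / N < |g q x|} := fun x hx => by
    by_contra hcon; simp at hcon
    have h1 : |∑ q, g q x| ≤ ∑ q : ι, l / N :=
      (abs_sum_le_sum_abs _ _).trans (sum_le_sum fun q _ => hcon q)
    rw [sum_const, card_univ, nsmul_eq_mul, mul_div_cancel₀ _ (by positivity)] at h1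
    exact (show (l : ℝ) < |∑ q, g q x| from hx).not_ge h1
  have h1 : volume {x | (l : ℝ) < |∑ q, g q x|} ≤ ofReal (N * (C * (M / (l / N)) ^ s)) := by
    refine (measure_mono hsub).trans ((measure_iUnion_fintype_le _ _).trans ?_)
    refine (sum_le_sum fun q _ => h q (l / N) (by positivity)).trans ?_
    rw [sum_const, card_univ, nsmul_eq_mul, ofReal_mul (p := N) (by positivity),
      (by simp [N] : ofReal N = ((Fintype.card ι : ℕ) : ℝ≥0∞))]
  have hs0 : 0 < s := by linarith
  have h2 : (N * (C * (M / (l / N)) ^ s)) ^ (1 / s) ≤ N * C * (M / (l / N)) := by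
    rw [← mul_assoc, mul_rpow (by positivity) (by positivity), ← rpow_mul (by positivity),
      mul_one_div_cancel hs0.ne', rpow_one]
    gcongr
    calc (N * C) ^ (1 / s) ≤ (N * C) ^ (1 : ℝ) :=
        rpow_le_rpow_of_exponent_le (one_le_mul_of_one_le_of_one_le
          (Nat.one_le_cast.2 (Nat.one_le_iff_ne_zero.2 Fintype.card_ne_zero)) hC) (by rw [div_le_one hs0]; exact hs)
      _ = N * C := rpow_one _
  calc (l : ℝ≥0∞) * volume {x | (l : ℝ) < |∑ q, g q x|} ^ (1 / s)
      ≤ ofReal l * ofReal (N * C * (M / (l / N))) := by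
        rw [ENNReal.ofReal_coe_nnreal]; gcongr
        refine (ENNReal.rpow_le_rpow h1 (by positivity)).trans ?_
        rw [ENNReal.ofReal_rpow_of_nonneg (by positivity) (by positivity)]; gcongr
    _ = ofReal (N ^ 2 * C * M) := by
      rw [← ofReal_mul (NNReal.coe_pos.2 (pos_iff_ne_zero.2 hl0)).le]; congr 1; field_simp

lemma locallyIntegrableOn_of_integrable_mul_exp {g : E4 → ℝ}
    (ig : Integrable (fun z => g z * (exp (-z.1) * exp (-‖z.2‖))) μ₊) :
    LocallyIntegrable g μ₊ := by
  rw [locallyIntegrable_iff]; intro K hK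
  have h1 := (ig.integrableOn).mul_continuousOn (g' := fun z => exp z.1 * exp ‖z.2‖)
    (by fun_prop) hK
  refine h1.congr_fun (fun z _ => ?_) hK.measurableSet; simp only; rw [mul_assoc, exp_neg, exp_neg]
  field_simp

lemma integrable_mul_TF_of_locallyIntegrable {μ : Measure E4} {g : E4 → ℝ}
    (hg : LocallyIntegrable g μ) (hχ : TF χ) : Integrable (fun z => g z * χ z) μ := by
  have := hg.integrable_smul_right_of_hasCompactSupport hχ.continuous hχ.compact
  simpa [mul_comm] using this

/-- The pressure `∂ᵢ∂ⱼ(-Δ)⁻¹ Fᵢⱼ` of a mild solution, with its weak Lebesgue bounds. -/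
lemma exists_pressure : ∃ C : ℝ, 0 < C ∧ ∀ {η ε A : ℝ} {U V w₀ : E3 → E3} {w : E4 → E3},
    IsMild η ε A U V w₀ w → ∃ p : E4 → ℝ, Measurable p ∧
      IsPressure U V (fun t x => w (t, x)) (fun t x => p (t, x)) ∧
      ∀ t : ℝ, 0 < t → ∀ s : ℝ, 3 / 2 ≤ s → s ≤ 3 / (1 + η) →
        weakLpNorm s (fun x => p (t, x)) ≤ ofReal (C * ((A + 2 * ε) * A) * t ^ (-1 + 3 / (2 * s))) := by
  obtain ⟨C, hC, HC⟩ := exists_riesz_limit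
  refine ⟨81 * C, by positivity, fun {η ε A U V w₀ w} h => ?_⟩; set M := (A + 2 * ε) * A
  have hM := h.const_nonneg h.bdd; have hη0 := h.hη0
  have key : ∀ q : Fin 3 × Fin 3, ∃ g : E4 → ℝ, Measurable g ∧
      (∀ t a l, 0 < t → 1 + η ≤ a → a ≤ 2 → 0 < l →
        volume {x | l < |g (t, x)|} ≤ ofReal (C * (M * t ^ ((a - 2) / 2) / l) ^ (3 / a))) ∧
      Integrable (fun z => g z * (exp (-z.1) * exp (-‖z.2‖))) μ₊ ∧
      ∀ χ : E4 → ℝ, TF χ → Tendsto (fun n : ℕ => ∫ z in posTime, Fq U V w q.1 q.2 z *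
        pair (rieszK (ei q.1) (ei q.2)) χ (1 / ((n : ℝ) + 1)) z.1 z.2) atTop (𝓝 (∫ z in posTime, g z * χ z)) := by
    rintro ⟨i, j⟩; rcases hM.eq_or_lt with h0 | h0
    · have hF := fun z => by
        have := h.abs_Fq_le i j z; rw [show (A + 2 * ε) * A = 0 from h0.symm, zero_mul] at this
        exact abs_eq_zero.1 (this.antisymm (abs_nonneg _))
      refine ⟨fun _ => 0, measurable_const, fun t a l ht ha ha2 hl => ?_, by simp, fun χ _ => by simp [hF]⟩
      simp [hl.not_gt]
    · obtain ⟨g, mg, hw, ig, hl⟩ := HC (Fq U V w i j) M h0 (h.mFq h.bdd i j) (fun z => (h.abs_Fq_le i j z).trans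
        (mul_le_mul_of_nonneg_left (wtF_le_rpow hη0 h.hη1 _ _) hM)) i j
      refine ⟨g, mg, fun t a l ht ha ha2 hl => hw t a _ l ht (by linarith) (by linarith) (by positivity)
        (fun y => ?_) hl, ig, hl⟩
      rw [mul_assoc]
      exact (h.abs_Fq_le i j _).trans (mul_le_mul_of_nonneg_left
        (wtF_le_time_rpow_mul ha ha2 (by linarith) ht y) hM)
  choose g mg hw ig hl using key
  have lg := fun q => locallyIntegrableOn_of_integrable_mul_exp (ig q)
  have hp : LocallyIntegrable (fun z => ∑ q, g q z) μ₊ :=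
    locallyIntegrable_finsetSum _ fun q _ => lg q
  refine ⟨fun z => ∑ q, g q z, by fun_prop, ⟨?_, ?_⟩, ?_⟩
  · exact locallyIntegrableOn_of_locallyIntegrable_restrict hp
  · intro φ hφ hsupp
    set χ := fun z => ∑ c, dd (0, ei c) (fun z => φ z c) z
    have hχ : TF χ := TF.sum fun c _ => (hφ.TF c).dd _
    have hdiv : ∀ z, divergence (fun y => φ (z.1, y)) z.2 = χ z := fun z => hφ.divergence_slice z.1 z.2
    obtain ⟨im, em⟩ := integral_momentumDensity hφ (fun c => h.integrable_coord_mul h.bdd c (hφ.TF c).Lop)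
      fun i j => h.integrable_Fq_mul h.bdd i j ((hφ.TF j).dd (0, ei i))
    simp_rw [hdiv]; refine (integral_add im (integrable_mul_TF_of_locallyIntegrable hp hχ)).trans ?_
    have hseq : Tendsto (fun n : ℕ => 1 / ((n : ℝ) + 1)) atTop (𝓝[>] 0) :=
      tendsto_nhdsWithin_iff.2 ⟨tendsto_one_div_add_atTop_nhds_zero_nat,
        .of_forall fun n => by simp; positivity⟩
    have h2 := tendsto_finsetSum (Finset.univ : Finset (Fin 3)) fun i _ =>
      tendsto_finsetSum (Finset.univ : Finset (Fin 3)) fun j _ => hl (i, j) χ hχ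
    have h0 : ∀ x, φ (0, x) = 0 := fun x => by
      by_contra hne; exact lt_irrefl (0 : ℝ) (hsupp (subset_tsupport _ hne)).1
    have h4 : ∫ z in posTime, (∑ q, g q z) * χ z = ∑ i, ∑ j, ∫ z in posTime, g (i, j) z * χ z := by
      simp_rw [sum_mul]
      rw [integral_finsetSum _ fun q _ => integrable_mul_TF_of_locallyIntegrable (lg q) hχ,
        Fintype.sum_prod_type]
    rw [em, h4, ← (tendsto_nhds_unique ((h.tendsto_weak hφ.TF).comp hseq) h2)]; simp [h0]
  · intro t ht s hs1 hs2
    have hs : 0 < s := by linarith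
    have ha : 1 + η ≤ 3 / s := by rw [le_div_iff₀ hs]; rw [le_div_iff₀ (by linarith)] at hs2; linarith
    have h1 := weakLpNorm_sum_le (s := s) (M := M * t ^ ((3 / s - 2) / 2))
      (by linarith) hC (by positivity) fun q l hl' => by
        have := hw q t (3 / s) l ht ha (by rw [div_le_iff₀ hs]; linarith) hl'
        rwa [div_div_cancel₀ (by simp)] at this
    refine h1.trans_eq ?_; have e1 : (3 / s - 2) / 2 = -1 + 3 / (2 * s) := by field
    rw [e1]; simp; congr 1; ring

/-! ### Lipschitz representatives -/

open scoped Convolution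

/-- The mollification of a field. -/
noncomputable def moll (φ : ContDiffBump (0 : E3)) (U : E3 → E3) (x : E3) : E3 :=
  ∫ y, φ.normed volume (x - y) • U y

lemma moll_eq (φ : ContDiffBump (0 : E3)) (U : E3 → E3) :
    moll φ U = φ.normed volume ⋆[lsmul ℝ ℝ, volume] U := by
  ext1 x
  rw [convolution_eq_swap]; rfl

lemma norm_moll_le (φ : ContDiffBump (0 : E3)) {f : E3 → E3}
    (h : ∀ y, ‖z - y‖ < φ.rOut → ‖f y‖ ≤ B) : ‖∫ y, φ.normed volume (z - y) • f y‖ ≤ B := by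
  have h1 : ∫ y, φ.normed volume (z - y) * B = B := by
    rw [integral_mul_const, integral_sub_left_eq_self (fun y => φ.normed volume y), φ.integral_normed, one_mul]
  rw [← h1]
  refine norm_integral_le_of_norm_le ((φ.integrable_normed.comp_sub_left z).mul_const B) (ae_of_all _ fun y => ?_)
  rw [norm_smul, norm_eq_abs, abs_of_nonneg (φ.nonneg_normed _)]
  by_cases hy : ‖z - y‖ < φ.rOut
  · exact mul_le_mul_of_nonneg_left (h y hy) (φ.nonneg_normed _)
  · have : φ.normed volume (z - y) = 0 := by
      by_contra hne; have := φ.support_normed_eq (μ := volume) ▸ Function.mem_support.2 hne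
      exact hy (by simpa using this)
    rw [this]; simp

lemma hasFDerivAt_moll (φ : ContDiffBump (0 : E3)) (hU : LocallyIntegrable U) (x : E3) :
    DifferentiableAt ℝ (moll φ U) x ∧
    ∀ e, fderiv ℝ (moll φ U) x e = ∫ y, (fderiv ℝ (φ.normed volume) (x - y) e) • U y := by
  have h1 := φ.hasCompactSupport_normed (μ := volume) |>.hasFDerivAt_convolution_left
    (lsmul ℝ ℝ) (φ.contDiff_normed) hU x
  rw [← moll_eq] at h1; refine ⟨h1.differentiableAt, fun e => ?_⟩
  have h2 := (((φ.hasCompactSupport_normed (μ := volume)).fderiv ℝ).convolutionExists_left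
    ((lsmul ℝ ℝ).precompL E3)
    ((φ.contDiff_normed).continuous_fderiv one_ne_zero) hU x).integrable_swap
  rw [h1.fderiv, convolution_eq_swap, integral_apply h2]
  rfl

/-- Mollification moves the gradient to the field, whose weak gradient is bounded near `z`. -/
lemma norm_fderiv_moll_le (φ : ContDiffBump (0 : E3))
    (h : IsWeakGradient U DU) (hB0 : 0 ≤ B) (hB : ∀ y, ‖z - y‖ < φ.rOut → ‖DU y‖ ≤ B) :
    ‖fderiv ℝ (moll φ U) z‖ ≤ B := by
  refine opNorm_le_bound _ hB0 fun e => ?_; rw [(hasFDerivAt_moll φ h.locInt z).2 e]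
  have hs : ContDiff ℝ ∞ fun y => φ.normed volume (z - y) := φ.contDiff_normed.comp (contDiff_const.sub contDiff_id)
  have hc : HasCompactSupport fun y => φ.normed volume (z - y) :=
    (φ.hasCompactSupport_normed).comp_homeomorph (Homeomorph.subLeft z)
  have h1 := h.eq _ hs hc e
  have h2 : ∀ y, fderiv ℝ (fun y => φ.normed volume (z - y)) y e = -(fderiv ℝ (φ.normed volume) (z - y) e) := fun y => by
    have h3 := ((φ.contDiff_normed (μ := volume)).differentiable one_ne_zero (z - y)).hasFDerivAt.comp y
      ((hasFDerivAt_const z y).sub (hasFDerivAt_id y))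
    have h4 := h3.fderiv; simp at h4
    erw [h4]
    simp
  simp_rw [h2, neg_smul, integral_neg, neg_inj] at h1; rw [h1]
  exact norm_moll_le φ fun y hy => ((DU y).le_opNorm e).trans (by gcongr; exact hB y hy)

/-- A field whose weak gradient is `O(|x|⁻²)` has a representative that is locally Lipschitz off the origin. -/
lemma exists_lipschitz_rep (hε : 0 ≤ ε)
    (hU : ∀ x, ‖U x‖ ≤ ε * ‖x‖ ^ (-1 : ℝ)) (h : IsWeakGradient U DU) (hD : ∀ x, ‖x‖ ^ 2 * ‖DU x‖ ≤ ε) :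
    ∃ U' : E3 → E3, Measurable U' ∧ U' =ᵐ[volume] U ∧ (∀ x, ‖U' x‖ ≤ ε * ‖x‖ ^ (-1 : ℝ)) ∧
    ∀ x y, ‖x - y‖ ≤ ‖x‖ / 2 → ‖U' x - U' y‖ ≤ 16 * ε * ‖x - y‖ * ‖x‖ ^ (-2 : ℝ) := by
  set φ : ℕ → ContDiffBump (0 : E3) := fun n =>
    ⟨1 / ((n : ℝ) + 1), 2 * (1 / ((n : ℝ) + 1)), by positivity, by
      have : 0 < 1 / ((n : ℝ) + 1) := by positivity
      linarith⟩
  have hr : Tendsto (fun n => (φ n).rOut) atTop (𝓝 0) := by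
    have := (tendsto_one_div_add_atTop_nhds_zero_nat (𝕜 := ℝ)).const_mul 2; rwa [mul_zero] at this
  set Un := fun n => moll (φ n) U
  have hae : ∀ᵐ x, Tendsto (fun n => Un n x) atTop (𝓝 (U x)) := by
    filter_upwards [ContDiffBump.ae_convolution_tendsto_right_of_locallyIntegrable hr
      (.of_forall fun n => le_rfl) h.locInt] with x hx
    refine hx.congr fun n => ?_; rw [← moll_eq]
  have hlip : ∀ x, x ≠ 0 → ∀ n, (φ n).rOut < ‖x‖ / 4 → ∀ y z, ‖x - y‖ ≤ ‖x‖ / 2 → ‖x - z‖ ≤ ‖x‖ / 2 →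
      ‖Un n y - Un n z‖ ≤ 16 * ε * ‖x‖ ^ (-2 : ℝ) * ‖y - z‖ := fun x hx n hn y z hy hz => by
    refine (convex_closedBall x (‖x‖ / 2)).norm_image_sub_le_of_norm_fderiv_le
      (fun u _ => (hasFDerivAt_moll (φ n) h.locInt u).1) (fun u hu => ?_)
      (by simpa [dist_eq_norm, norm_sub_rev] using hz) (by simpa [dist_eq_norm, norm_sub_rev] using hy)
    refine norm_fderiv_moll_le (φ n) h (by positivity) fun v hv => ?_
    have hu' : ‖x - u‖ ≤ ‖x‖ / 2 := by simpa [dist_eq_norm, norm_sub_rev] using hu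
    have h1 : ‖x‖ / 4 ≤ ‖v‖ := by
      have h2 : ‖x‖ ≤ ‖x - u‖ + ‖u - v‖ + ‖v‖ := by calc ‖x‖ = ‖(x - u) + (u - v) + v‖ := by congr 1; abel
        _ ≤ _ := norm_add₃_le
      linarith
    have h3 : (‖x‖ / 4) ^ 2 * ‖DU v‖ ≤ ε := (mul_le_mul_of_nonneg_right (by gcongr) (norm_nonneg _)).trans (hD v)
    rw [rpow_neg (norm_pos_iff.2 hx).le, Real.rpow_two, ← div_eq_mul_inv, le_div_iff₀ (by positivity)]
    nlinarith
  have hconv : ∀ x, ∃ u, x ≠ 0 → Tendsto (fun n => Un n x) atTop (𝓝 u) := fun x => by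
    by_cases hx : x = 0
    · exact ⟨0, fun h => (h hx).elim⟩
    have hx0 := norm_pos_iff.2 hx
    suffices hc : CauchySeq fun n => Un n x by
      obtain ⟨u, hu⟩ := cauchySeq_tendsto_of_complete hc; exact ⟨u, fun _ => hu⟩
    rw [Metric.cauchySeq_iff]; intro κ hκ; set L := 16 * ε * ‖x‖ ^ (-2 : ℝ)
    have hL : 0 ≤ L := by positivity
    have hd := Measure.dense_of_ae hae
    obtain ⟨y, hy, hyx⟩ := hd.exists_dist_lt x (ε := min (‖x‖ / 2) (κ / (3 * (L + 1)))) (by positivity)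
    have hy1 : ‖x - y‖ ≤ ‖x‖ / 2 := by rw [← dist_eq_norm]; exact hyx.le.trans (min_le_left _ _)
    have hy2 : L * ‖x - y‖ < κ / 3 := by
      have h2 : ‖x - y‖ ≤ κ / (3 * (L + 1)) := by rw [← dist_eq_norm]; exact hyx.le.trans (min_le_right _ _)
      calc L * ‖x - y‖ ≤ L * (κ / (3 * (L + 1))) := by gcongr
        _ < (L + 1) * (κ / (3 * (L + 1))) := by gcongr; linarith
        _ = κ / 3 := by field_simp
    obtain ⟨N, hN⟩ := Metric.cauchySeq_iff.1 (Tendsto.cauchySeq hy) (κ / 3) (by positivity)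
    obtain ⟨N', hN'⟩ := eventually_atTop.1 (hr.eventually_lt_const (show 0 < ‖x‖ / 4 by positivity))
    refine ⟨max N N', fun m hm n hn => ?_⟩
    have e1 := hlip x hx m (hN' m ((le_max_right _ _).trans hm)) x y (by simp; positivity) hy1
    have e2 := hlip x hx n (hN' n ((le_max_right _ _).trans hn)) x y (by simp; positivity) hy1
    have e3 := hN m ((le_max_left _ _).trans hm) n ((le_max_left _ _).trans hn)
    rw [dist_eq_norm] at e3 ⊢
    calc ‖Un m x - Un n x‖ = ‖(Un m x - Un m y) + (Un m y - Un n y) + -(Un n x - Un n y)‖ := by congr 1; abel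
      _ ≤ ‖Un m x - Un m y‖ + ‖Un m y - Un n y‖ + ‖-(Un n x - Un n y)‖ := norm_add₃_le
      _ < κ := by rw [norm_neg]; linarith
  choose V hV using hconv
  set U' := ({0}ᶜ : Set E3).indicator V
  have hU' : ∀ x, x ≠ 0 → Tendsto (fun n => Un n x) atTop (𝓝 (U' x)) := fun x hx => by
    simp only [U']; rw [indicator_of_mem (by simpa using hx)]; exact hV x hx
  have hz : U' 0 = 0 := by simp [U']
  refine ⟨U', ?_, ?_, ?_, ?_⟩
  · refine measurable_of_tendsto_metrizable (f := fun n => ({0}ᶜ : Set E3).indicator (Un n)) (fun n => ?_) ?_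
    · refine Measurable.indicator ?_ (measurableSet_singleton _).compl
      have : Differentiable ℝ (Un n) := fun x => (hasFDerivAt_moll (φ n) h.locInt x).1
      exact this.continuous.measurable
    · rw [tendsto_pi_nhds]
      intro x
      by_cases hx : x = 0
      · subst hx; simp [U']
      · refine (hU' x hx).congr fun n => ?_
        rw [indicator_of_mem (by simpa using hx)]
  · filter_upwards [hae, ae_ne_zero] with x hx hx0 using tendsto_nhds_unique (hU' x hx0) hx
  · intro x
    by_cases hx : x = 0
    · subst hx; rw [hz]; simp
    have h1 : Tendsto (fun n => ε * (‖x‖ - (φ n).rOut) ^ (-1 : ℝ)) atTop (𝓝 (ε * (‖x‖ - 0) ^ (-1 : ℝ))) :=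
      ((tendsto_const_nhds.sub hr).rpow_const (Or.inl (by simpa using hx))).const_mul _
    rw [sub_zero] at h1; refine le_of_tendsto_of_tendsto (hU' x hx).norm h1 ?_
    filter_upwards [hr.eventually_lt_const (norm_pos_iff.2 hx)] with n hn
    refine norm_moll_le (φ n) fun y hy => (hU y).trans ?_
    have : ‖x‖ - (φ n).rOut ≤ ‖y‖ := by have := norm_le_norm_add_norm_sub' x y; linarith
    exact mul_le_mul_of_nonneg_left (rpow_le_rpow_of_nonpos (by linarith) this (by simp)) hε
  · intro x y hxy
    by_cases hx : x = 0
    · subst hx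
      have : y = 0 := by simpa using hxy
      subst this; simp
    have hx0 := norm_pos_iff.2 hx; have hy : y ≠ 0 := by rintro rfl; rw [sub_zero] at hxy; linarith
    refine le_of_tendsto ((hU' x hx).sub (hU' y hy)).norm ?_
    filter_upwards [hr.eventually_lt_const (show 0 < ‖x‖ / 4 by positivity)] with n hn
    refine (hlip x hx n hn x y (by simp; positivity) hxy).trans_eq (by ring)

/-! ### Cancellation in differentiated kernels -/

lemma exists_cutoff : ∃ (χ : E3 → ℝ) (B : ℝ), 0 ≤ B ∧ ContDiff ℝ ∞ χ ∧ HasCompactSupport χ ∧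
    (∀ z, 0 ≤ χ z ∧ χ z ≤ 1) ∧ (∀ z, ‖z‖ ≤ 1 / 4 → χ z = 1) ∧
    (∀ z, 1 / 2 ≤ ‖z‖ → χ z = 0 ∧ fderiv ℝ χ z = 0) ∧ ∀ z, ‖fderiv ℝ χ z‖ ≤ B := by
  set χ : ContDiffBump (0 : E3) := ⟨1 / 4, 1 / 2, by simp, by norm_num⟩
  have hs : ContDiff ℝ ∞ (χ : E3 → ℝ) := χ.contDiff
  obtain ⟨B, hB⟩ := (χ.hasCompactSupport.fderiv ℝ).exists_bound_of_continuous (hs.continuous_fderiv (by simp))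
  refine ⟨χ, B, (norm_nonneg _).trans (hB 0), hs, χ.hasCompactSupport, fun z => ⟨χ.nonneg, χ.le_one⟩,
    fun z hz => χ.one_of_mem_closedBall (by rw [mem_closedBall_zero_iff]; exact hz), fun z hz => ?_, hB⟩
  have h0 := χ.zero_of_le_dist (by rw [dist_zero_right]; exact hz)
  refine ⟨h0, IsLocalMin.fderiv_eq_zero (.of_forall fun y => ?_)⟩; rw [h0]; exact χ.nonneg

lemma pk_add_eq (a : ℝ) (hτ : 0 < τ) (z : E3) : pk k τ z = (‖z‖ + √τ) ^ a * pk (k + a) τ z := by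
  have : 0 < ‖z‖ + √τ := by positivity
  rw [pk, pk, if_pos hτ, if_pos hτ, ← rpow_add this]; congr 1; ring

lemma pk_of_pos (hτ : 0 < τ) (z : E3) : pk k τ z = (‖z‖ + √τ) ^ (-k) := if_pos hτ

lemma pk_add_one_le (hτ : 0 < τ) (z : E3) : pk (k + 1) τ z ≤ (√τ)⁻¹ * pk k τ z := by
  rw [(pk_add_eq (k := k) 1 hτ z), rpow_one, ← mul_assoc]
  refine le_mul_of_one_le_left (pk_nonneg _ _ _) ?_
  rw [← div_eq_inv_mul, one_le_div (Real.sqrt_pos.2 hτ)]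
  bound

/-- Cancellation estimate: since the derivative of a kernel has mean zero, its singularity is
weakened on Hölder continuous functions. The weight `A` dominates both the function and its
Hölder constant relative to the distance from the origin. -/
lemma IsKer.exists_abs_cnv_dk_le (hK : IsKer 2 m K) {α : ℝ} (hα : 0 ≤ α) :
    ∃ C : ℝ, 0 ≤ C ∧ ∀ (v : E3) (τ : ℝ) (x : E3) (f A : E3 → ℝ), 0 < τ → x ≠ 0 → Measurable f → (∀ y, |f y| ≤ A y) →
    (∀ y, ‖x - y‖ ≤ ‖x‖ / 2 → |f x| ≤ A y ∧ |f y - f x| ≤ A y * (‖x - y‖ / ‖x‖) ^ α) →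
    Integrable (fun y => pk (m + 1 - α) τ (x - y) * A y) → Integrable (fun y => pk m τ (x - y) * A y) →
    |cnv (PerturbedNS.dk v K) f τ x| ≤ C * ‖v‖ * (‖x‖ ^ (-α) * (∫ y, pk (m + 1 - α) τ (x - y) * A y)
    + ‖x‖ ^ (-1 : ℝ) * ∫ y, pk m τ (x - y) * A y) := by
  obtain ⟨χ, B, hB0, hχ, hχc, hχ01, hχ1, hχ0, hB⟩ := exists_cutoff; obtain ⟨C1, hC1, H1⟩ := hK.bound
  obtain ⟨C2, hC2, H2⟩ := hK.exists_fderiv_le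
  refine ⟨4 * C2 + C1 * B, by positivity, fun v τ x f A hτ hx mf hfA hf i1 i2 => ?_⟩; set r := ‖x‖
  have hr := norm_pos_iff.2 hx; set χr := fun z => χ (r⁻¹ • z)
  have hχr : ContDiff ℝ ∞ χr := hχ.comp (contDiff_const_smul _)
  have hχrc := hχc.comp_homeomorph (Homeomorph.smulOfNeZero r⁻¹ (inv_ne_zero hr.ne'))
  have dχr : ∀ z, fderiv ℝ χr z v = r⁻¹ * fderiv ℝ χ (r⁻¹ • z) v := fun z => by
    have h1 := (hχ.differentiable (by simp) (r⁻¹ • z)).hasFDerivAt.comp z ((hasFDerivAt_id z).const_smul r⁻¹)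
    have h2 : fderiv ℝ χr z = _ := h1.fderiv; rw [h2]; simp
  have nrm : ∀ z : E3, ‖r⁻¹ • z‖ = ‖z‖ / r := fun z => by
    rw [norm_smul, norm_inv, norm_of_nonneg hr.le, div_eq_inv_mul]
  set k := K τ; set dkv := PerturbedNS.dk v K τ
  have hdkv : ∀ z, dkv z = fderiv ℝ k z v := fun z => rfl
  have ck : ContDiff ℝ 1 k := by have := hK.contDiff τ; exact_mod_cast this
  have cdk : Continuous dkv := (ck.continuous_fderiv one_ne_zero).clm_apply continuous_const
  have cdχ : Continuous fun z => fderiv ℝ χr z v := (hχr.continuous_fderiv (by simp)).clm_apply continuous_const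
  have bdk : ∀ z, |dkv z| ≤ C2 * ‖v‖ * pk (m + 1) τ z := fun z => by
    calc |dkv z| ≤ ‖fderiv ℝ k z‖ * ‖v‖ := (fderiv ℝ k z).le_opNorm v
      _ ≤ C2 * pk (m + 1) τ z * ‖v‖ := by gcongr; exact H2 τ z
      _ = _ := by ring
  have j1 : Integrable fun z => dkv z * χr z :=
    (cdk.mul hχr.continuous).integrable_of_hasCompactSupport hχrc.mul_left
  have j2 : Integrable fun z => k z * fderiv ℝ χr z v :=
    (ck.continuous.mul cdχ).integrable_of_hasCompactSupport ((hχrc.fderiv_apply ℝ v).mul_left)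
  have ibp : ∫ z, (dkv z * χr z + k z * fderiv ℝ χr z v) = 0 := by
    rw [integral_add j1 j2, integral_mul_fderiv_eq_neg_fderiv_mul_of_integrable j1 j2
      ((ck.continuous.mul hχr.continuous).integrable_of_hasCompactSupport hχrc.mul_left)
      (fun z _ => ck.differentiable one_ne_zero z) (fun z _ => hχr.differentiable (by simp) z)]
    exact add_neg_cancel _
  have jf : Integrable fun y => dkv (x - y) * f y := by
    refine (i2.const_mul (C2 * ‖v‖ * (√τ)⁻¹)).mono'
      ((cdk.comp (by fun_prop)).measurable.mul mf).aestronglyMeasurable (ae_of_all _ fun y => ?_)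
    rw [norm_mul]
    calc |dkv (x - y)| * |f y| ≤ (C2 * ‖v‖ * ((√τ)⁻¹ * pk m τ (x - y))) * A y :=
        mul_le_mul ((bdk _).trans (by gcongr; exact pk_add_one_le hτ _)) (hfA y)
          (abs_nonneg _) (by have := pk_nonneg m τ (x - y); positivity)
      _ = _ := by ring
  set g := fun y => dkv (x - y) * χr (x - y) * (f y - f x) - k (x - y) * fderiv ℝ χr (x - y) v * f x
    + dkv (x - y) * (1 - χr (x - y)) * f y
  have j3 : Integrable fun y => f x * (dkv (x - y) * χr (x - y) + k (x - y) * fderiv ℝ χr (x - y) v) :=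
    ((j1.add j2).comp_sub_left x).const_mul (f x)
  have eg : g = fun y => dkv (x - y) * f y
    - f x * (dkv (x - y) * χr (x - y) + k (x - y) * fderiv ℝ χr (x - y) v) := by ext y; ring
  have e1 : cnv (PerturbedNS.dk v K) f τ x = ∫ y, g y := by
    rw [eg, integral_sub jf j3, integral_const_mul, integral_sub_left_eq_self
      (fun z => dkv z * χr z + k z * fderiv ℝ χr z v), ibp, mul_zero, sub_zero]
    rfl
  rw [e1]
  have bound : ∀ y, |g y| ≤ (4 * C2 + C1 * B) * ‖v‖ * (r ^ (-α) * (pk (m + 1 - α) τ (x - y) * A y)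
      + r ^ (-1 : ℝ) * (pk m τ (x - y) * A y)) := fun y => by
    have p0 := pk_nonneg m τ (x - y); have p1 := pk_nonneg (m + 1) τ (x - y)
    have pα := pk_nonneg (m + 1 - α) τ (x - y); have a0 := (fun y => (abs_nonneg _).trans (hfA y)) y
    have hz : 0 < ‖x - y‖ + √τ := by positivity
    have rinv := rpow_neg_one r; obtain ⟨c0, c1⟩ := hχ01 (r⁻¹ • (x - y))
    -- the cancellation near `x`
    have t1 : |dkv (x - y) * χr (x - y) * (f y - f x)| ≤ C2 * ‖v‖ * (r ^ (-α) * (pk (m + 1 - α) τ (x - y) * A y)) := by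
      by_cases hy : ‖x - y‖ ≤ r / 2
      · have h3 : pk (m + 1) τ (x - y) * ‖x - y‖ ^ α ≤ pk (m + 1 - α) τ (x - y) := by
          rw [pk_add_eq (k := m + 1 - α) α hτ, sub_add_cancel, mul_comm]
          exact mul_le_mul_of_nonneg_right (rpow_le_rpow (norm_nonneg _) (by bound) hα) p1
        rw [abs_mul, abs_mul, abs_of_nonneg c0]
        calc |dkv (x - y)| * χr (x - y) * |f y - f x|
            ≤ (C2 * ‖v‖ * pk (m + 1) τ (x - y)) * 1 * (A y * (‖x - y‖ / r) ^ α) := by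
              gcongr
              · exact bdk _
              · exact (hf y hy).2
          _ = C2 * ‖v‖ * (r ^ (-α) * ((pk (m + 1) τ (x - y) * ‖x - y‖ ^ α) * A y)) := by
            rw [div_rpow (norm_nonneg _) hr.le, rpow_neg hr.le]; ring
          _ ≤ _ := by gcongr
      · have : χr (x - y) = 0 := (hχ0 _ (by rw [nrm, div_le_div_iff₀ (by simp) hr]; push Not at hy; linarith)).1
        rw [this]; simp; positivity
    have t2 : |k (x - y) * fderiv ℝ χr (x - y) v * f x| ≤ C1 * B * ‖v‖ * (r ^ (-1 : ℝ) * (pk m τ (x - y) * A y)) := by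
      rw [dχr]
      by_cases hy : ‖x - y‖ ≤ r / 2
      · rw [abs_mul, abs_mul, abs_mul, abs_of_pos (inv_pos.2 hr)]
        calc |k (x - y)| * (r⁻¹ * |fderiv ℝ χ (r⁻¹ • (x - y)) v|) * |f x|
            ≤ (C1 * pk m τ (x - y)) * (r⁻¹ * (B * ‖v‖)) * A y := by
              gcongr
              · exact H1 τ _
              · exact ((fderiv ℝ χ _).le_opNorm v).trans (by gcongr; exact hB _)
              · exact (hf y hy).1
          _ = _ := by rw [rinv]; ring
      · have : fderiv ℝ χ (r⁻¹ • (x - y)) = 0 :=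
          (hχ0 _ (by rw [nrm, div_le_div_iff₀ (by simp) hr]; push Not at hy; linarith)).2
        rw [this]; simp; positivity
    have t3 : |dkv (x - y) * (1 - χr (x - y)) * f y| ≤ 4 * C2 * ‖v‖ * (r ^ (-1 : ℝ) * (pk m τ (x - y) * A y)) := by
      by_cases hy : ‖x - y‖ ≤ r / 4
      · have : χr (x - y) = 1 := hχ1 _ (by rw [nrm, div_le_div_iff₀ hr (by simp)]; linarith)
        rw [this]; simp; positivity
      · push Not at hy
        have h3 : pk (m + 1) τ (x - y) ≤ 4 * (r⁻¹ * pk m τ (x - y)) := by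
          have h4 : (1 : ℝ) ≤ 4 * r⁻¹ * (‖x - y‖ + √τ) := by
            rw [mul_comm 4, mul_assoc, ← div_eq_inv_mul, one_le_div hr]; linarith [sqrt_nonneg τ]
          rw [pk_add_eq (k := m) 1 hτ, rpow_one]
          calc pk (m + 1) τ (x - y) ≤ (4 * r⁻¹ * (‖x - y‖ + √τ)) * pk (m + 1) τ (x - y) :=
              le_mul_of_one_le_left p1 h4
            _ = _ := by ring
        rw [abs_mul, abs_mul, abs_of_nonneg (sub_nonneg.2 c1)]
        calc |dkv (x - y)| * (1 - χr (x - y)) * |f y|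
            ≤ (C2 * ‖v‖ * (4 * (r⁻¹ * pk m τ (x - y)))) * 1 * A y := by
              gcongr
              · exact (bdk _).trans (by gcongr)
              · linarith
              · exact hfA y
          _ = _ := by rw [rinv]; ring
    have q1 : 0 ≤ r ^ (-α) * (pk (m + 1 - α) τ (x - y) * A y) := by positivity
    have q2 : 0 ≤ r ^ (-1 : ℝ) * (pk m τ (x - y) * A y) := by positivity
    have q3 : 0 ≤ (3 * C2 + C1 * B) * ‖v‖ * (r ^ (-α) * (pk (m + 1 - α) τ (x - y) * A y)) := by positivity
    refine (abs_add_le _ _).trans ((add_le_add_left (abs_sub _ _) _).trans ?_)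
    linear_combination t1 + t2 + t3 + q3
  have i3 : Integrable fun y => r ^ (-α) * (pk (m + 1 - α) τ (x - y) * A y) + r ^ (-1 : ℝ) * (pk m τ (x - y) * A y) :=
    (i1.const_mul _).add (i2.const_mul _)
  refine (norm_integral_le_of_norm_le (f := g) (i3.const_mul _) (ae_of_all _ bound)).trans_eq ?_
  rw [integral_const_mul, integral_add (i1.const_mul _) (i2.const_mul _), integral_const_mul, integral_const_mul]

/-- Kernels are Hölder continuous of exponent `1/2` in space, at the cost of half an order of decay. -/
lemma IsKer.exists_abs_sub_le (hK : IsKer 1 m K) (hm : 0 ≤ m) :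
    ∃ C : ℝ, 0 ≤ C ∧ ∀ τ z z', |K τ z - K τ z'| ≤
    C * ‖z - z'‖ ^ (1 / 2 : ℝ) * (pk (m + 1 / 2) τ z + pk (m + 1 / 2) τ z') := by
  obtain ⟨C1, hC1, H1⟩ := hK.bound; obtain ⟨C2, hC2, H2⟩ := hK.exists_fderiv_le
  set c := (2 : ℝ) ^ (m + 1); have hc : 0 < c := by positivity
  refine ⟨2 * C1 + c * C2, by positivity, fun τ z z' => ?_⟩; rcases le_or_gt τ 0 with hτ | hτ
  · rw [hK.eq_zero hτ, hK.eq_zero hτ]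
    have := pk_nonneg (m + 1 / 2) τ z; have := pk_nonneg (m + 1 / 2) τ z'
    simp only [sub_zero, abs_zero]; positivity
  have hs := Real.sqrt_pos.2 hτ; have p1 := pk_nonneg (m + 1 / 2) τ z
  have p2 := pk_nonneg (m + 1 / 2) τ z'; set d := ‖z - z'‖; have hd : 0 ≤ d := norm_nonneg _
  set R := ‖z‖ + √τ; have hR : 0 < R := by positivity
  rcases le_or_gt d (R / 2) with h | h
  · -- the mean value inequality on the which stays away from the origin
    have h1 : |K τ z - K τ z'| ≤ C2 * (c * R ^ (-(m + 1))) * d := by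
      refine (convex_segment z z').norm_image_sub_le_of_norm_fderiv_le
        (fun u _ => hK.differentiable τ u) (fun u hu => ?_) (right_mem_segment ℝ z z') (left_mem_segment ℝ z z')
      refine (H2 τ u).trans (mul_le_mul_of_nonneg_left ?_ hC2); rw [pk_of_pos hτ]
      have hzu : ‖z - u‖ ≤ d := by
        obtain ⟨a, b, ha, hb, hab, rfl⟩ := hu
        have : z - (a • z + b • z') = b • (z - z') := by
          have : a = 1 - b := by linarith
          subst this; module
        rw [this, norm_smul, norm_of_nonneg hb]; exact mul_le_of_le_one_left hd (by linarith)
      have hu2 : R / 2 ≤ ‖u‖ + √τ := by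
        have := norm_le_norm_add_norm_sub' z u; simp only [R] at h ⊢; linarith
      calc (‖u‖ + √τ) ^ (-(m + 1)) ≤ (R / 2) ^ (-(m + 1)) :=
          rpow_le_rpow_of_nonpos (by positivity) hu2 (by linarith)
        _ = _ := div_rpow_neg hR.le two_pos _
    have h2 : R ^ (-(m + 1)) * d ≤ d ^ (1 / 2 : ℝ) * pk (m + 1 / 2) τ z := by
      rw [pk_of_pos hτ]
      have e1 : R ^ (-(m + 1)) = R ^ (-(1 / 2) : ℝ) * R ^ (-(m + 1 / 2)) := by
        rw [← rpow_add hR]; congr 1; ring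
      have e2 : d = d ^ (1 / 2 : ℝ) * d ^ (1 / 2 : ℝ) := by
        rw [← Real.rpow_add_of_nonneg hd (by simp) (by simp)]; norm_num
      have e3 : R ^ (-(1 / 2) : ℝ) * d ^ (1 / 2 : ℝ) ≤ 1 := by
        rw [rpow_neg hR.le, ← div_eq_inv_mul, div_le_one (by positivity)]
        exact rpow_le_rpow hd (by linarith) (by simp)
      calc R ^ (-(m + 1)) * d = (R ^ (-(1 / 2) : ℝ) * d ^ (1 / 2 : ℝ)) * (d ^ (1 / 2 : ℝ) * R ^ (-(m + 1 / 2))) := by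
            rw [e1]; nth_rewrite 1 [e2]; ring
        _ ≤ _ := mul_le_of_le_one_left (by positivity) e3
    calc |K τ z - K τ z'| ≤ c * C2 * (R ^ (-(m + 1)) * d) := h1.trans_eq (by ring)
      _ ≤ c * C2 * (d ^ (1 / 2 : ℝ) * pk (m + 1 / 2) τ z) := by gcongr
      _ ≤ (2 * C1 + c * C2) * (d ^ (1 / 2 : ℝ) * (pk (m + 1 / 2) τ z + pk (m + 1 / 2) τ z')) := by
        gcongr
        · linarith
        · linarith
      _ = _ := by ring
  · -- both kernel values are small compared to the distance
    have key : ∀ u, ‖u‖ + √τ ≤ 4 * d → |K τ u| ≤ 2 * C1 * (d ^ (1 / 2 : ℝ) * pk (m + 1 / 2) τ u) := fun u hu => by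
      have h3 : (‖u‖ + √τ) ^ (1 / 2 : ℝ) ≤ 2 * d ^ (1 / 2 : ℝ) := by
        refine (rpow_le_rpow (by positivity) hu (by simp)).trans_eq ?_
        rw [mul_rpow (by simp) hd, ← sqrt_eq_rpow 4, show (4 : ℝ) = 2 ^ 2 by norm_num,
          Real.sqrt_sq (by simp)]
      refine (H1 τ u).trans ?_; rw [pk_add_eq (1 / 2) hτ]; have := pk_nonneg (m + 1 / 2) τ u
      calc C1 * ((‖u‖ + √τ) ^ (1 / 2 : ℝ) * pk (m + 1 / 2) τ u)
          ≤ C1 * ((2 * d ^ (1 / 2 : ℝ)) * pk (m + 1 / 2) τ u) := by gcongr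
        _ = _ := by ring
    have hz' : ‖z'‖ + √τ ≤ 4 * d := by have := norm_le_norm_add_norm_sub z z'; linarith
    have h6 : 0 ≤ c * C2 * (d ^ (1 / 2 : ℝ) * (pk (m + 1 / 2) τ z + pk (m + 1 / 2) τ z')) := by positivity
    refine (abs_sub _ _).trans ?_
    linear_combination (key z (by simp only [R] at h; linarith)) + (key z' hz') + h6

/-- Differentiation under the integral in `cnv`, for functions that need not be integrable. -/
lemma IsKer.hasFDerivAt_cnv_of_integrable_mul (hK : IsKer 2 m K) (hm : 0 ≤ m)
    (mf : Measurable f) (hτ : 0 < τ) (x : E3)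
    (hi : Integrable fun y => pk m τ (x - y) * |f y|) :
    HasFDerivAt (cnv K f τ) (∑ c : Fin 3, cnv (PerturbedNS.dk (ei c) K) f τ x • EuclideanSpace.proj (𝕜 := ℝ) c) x := by
  obtain ⟨C, hC, H⟩ := hK.exists_fderiv_le; obtain ⟨C', hC', H'⟩ := hK.bound
  have hcf := (hK.contDiff τ).continuous_fderiv (by simp); have hs := Real.sqrt_pos.2 hτ
  have ms : ∀ x, Measurable (fun y => K τ (x - y)) := fun x => hK.measurable_sub τ x
  set c := 1 + (√τ)⁻¹; have hc : 0 < c := by positivity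
  have hpk : ∀ u, u ∈ ball x 1 → ∀ y, pk (m + 1) τ (u - y) ≤ c ^ (m + 1) * ((√τ)⁻¹ * pk m τ (x - y)) := fun u hu y => by
    have hu' : ‖x - u‖ < 1 := by rw [← dist_eq_norm, dist_comm]; exact hu
    have h1 : ‖x - y‖ + √τ ≤ c * (‖u - y‖ + √τ) := by
      have h2 : ‖x - y‖ ≤ ‖x - u‖ + ‖u - y‖ := norm_sub_le_norm_sub_add_norm_sub _ _ _
      have h3 : c * (‖u - y‖ + √τ) = ‖u - y‖ + √τ + 1 + (√τ)⁻¹ * ‖u - y‖ := by simp only [c]; field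
      have h4 : 0 ≤ (√τ)⁻¹ * ‖u - y‖ := by positivity
      linarith
    calc pk (m + 1) τ (u - y) = c ^ (m + 1) * (c * (‖u - y‖ + √τ)) ^ (-(m + 1)) := by
          rw [pk_of_pos hτ, mul_rpow hc.le (by positivity), ← mul_assoc, ← rpow_add hc]; simp
      _ ≤ c ^ (m + 1) * pk (m + 1) τ (x - y) := by
          rw [pk_of_pos hτ]
          exact mul_le_mul_of_nonneg_left
              (rpow_le_rpow_of_nonpos (by positivity) h1 (by linarith)) (by positivity)
      _ ≤ _ := by gcongr; exact pk_add_one_le hτ _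
  have hF : HasFDerivAt (cnv K f τ) (∫ y, f y • fderiv ℝ (K τ) (x - y)) x := by
    refine hasFDerivAt_integral_of_dominated_of_fderiv_le
      (F' := fun x y => f y • fderiv ℝ (K τ) (x - y))
      (bound := fun y => C * c ^ (m + 1) * (√τ)⁻¹ * (pk m τ (x - y) * |f y|)) (ball_mem_nhds x one_pos)
      (.of_forall fun x => ((ms x).mul mf).aestronglyMeasurable) ?_
      (mf.aestronglyMeasurable.smul (hcf.comp (by fun_prop)).aestronglyMeasurable) ?_ (hi.const_mul _) ?_
    · refine (hi.const_mul C').mono' ((ms x).mul mf).aestronglyMeasurable (ae_of_all _ fun y => ?_)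
      rw [norm_mul, ← mul_assoc]; exact mul_le_mul_of_nonneg_right (H' τ _) (abs_nonneg _)
    · refine ae_of_all _ fun y u hu => ?_
      rw [norm_smul]
      calc |f y| * ‖fderiv ℝ (K τ) (u - y)‖ ≤ |f y| * (C * (c ^ (m + 1) * ((√τ)⁻¹ * pk m τ (x - y)))) := by
            gcongr; exact (H τ _).trans (by gcongr; exact hpk u hu y)
        _ = _ := by ring
    · refine ae_of_all _ fun y u _ => ?_
      exact (hK.hasFDerivAt_sub τ u y).mul_const (f y)
  convert hF using 1
  have hi' : Integrable fun y => f y • fderiv ℝ (K τ) (x - y) := by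
    refine (hi.const_mul (C * c ^ (m + 1) * (√τ)⁻¹)).mono'
      (mf.aestronglyMeasurable.smul (hcf.comp (by fun_prop)).aestronglyMeasurable) (ae_of_all _ fun y => ?_)
    rw [norm_smul]
    calc |f y| * ‖fderiv ℝ (K τ) (x - y)‖ ≤ |f y| * (C * (c ^ (m + 1) * ((√τ)⁻¹ * pk m τ (x - y)))) := by
          gcongr; exact (H τ _).trans (by gcongr; exact hpk x (Metric.mem_ball_self one_pos) y)
      _ = _ := by ring
  refine ContinuousLinearMap.ext fun v => ?_
  have hv : v = ∑ c, v c • ei c := by ext k; simp [Pi.single_apply]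
  have hcoef : ∀ c, (∫ y, f y • fderiv ℝ (K τ) (x - y)) (ei c) = cnv (PerturbedNS.dk (ei c) K) f τ x := fun c => by
    rw [integral_apply hi']; refine integral_ext fun y => ?_; simp [PerturbedNS.dk, mul_comm]
  conv_rhs => rw [hv]
  rw [map_sum]; simp only [map_smul, hcoef]; simp [mul_comm]

/-! ### The heat flow and Hölder continuity -/

lemma isKer_pk (k : ℝ) : IsKer 0 k (pk k) :=
  ⟨measurable_pk k, 1, zero_le_one, fun τ z => by rw [abs_of_nonneg (pk_nonneg _ _ _), one_mul]⟩

lemma rpow_neg_le_of_half_le (ha : 0 < a) (h : a / 2 ≤ b) (hk : 0 ≤ k) : b ^ (-k) ≤ 2 ^ k * a ^ (-k) := by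
  rw [← div_rpow_neg ha.le two_pos]; exact rpow_le_rpow_of_nonpos (by positivity) h (by linarith)

lemma half_le_add_sqrt (h : ‖x‖ / 2 ≤ ‖y‖) : (‖x‖ + √t) / 2 ≤ ‖y‖ + √t := by linarith [sqrt_nonneg t]

lemma wt_le_two_mul (hη0 : 0 < η) (hη1 : η < 1) (hx : x ≠ 0) (h : ‖x‖ / 2 ≤ ‖y‖) :
    wt η t y ≤ 2 * wt η t x := by
  have h1 := rpow_neg_le_of_half_le (by positivity) (half_le_add_sqrt (t := t) h) (k := 1 - η) (by linarith)
  have h2 := rpow_neg_le_of_half_le (norm_pos_iff.2 hx) h hη0.le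
  rw [show -(1 - η) = -1 + η by ring] at h1; unfold wt
  calc _ ≤ (2 ^ (1 - η) * (‖x‖ + √t) ^ (-1 + η)) * (2 ^ η * ‖x‖ ^ (-η)) := by gcongr
    _ = (2 ^ (1 - η) * 2 ^ η) * ((‖x‖ + √t) ^ (-1 + η) * ‖x‖ ^ (-η)) := by ring
    _ = _ := by rw [← rpow_add two_pos]; norm_num

lemma wtF_le_four_mul (hη0 : 0 < η) (hη1 : η < 1) (hx : x ≠ 0) (h : ‖x‖ / 2 ≤ ‖y‖) :
    wtF η t y ≤ 4 * wtF η t x := by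
  have h1 := wt_le_two_mul hη0 hη1 (t := t) hx h
  have h2 := rpow_neg_le_of_half_le (norm_pos_iff.2 hx) h zero_le_one; rw [rpow_one] at h2
  rw [← wt_mul_rpow hη0, ← wt_mul_rpow hη0]; have := wt_nonneg η t x
  calc _ ≤ (2 * wt η t x) * (2 * ‖x‖ ^ (-1 : ℝ)) := by gcongr
    _ = _ := by ring

lemma wtF_mul_norm (hη0 : 0 < η) (hx : x ≠ 0) : wtF η t x * ‖x‖ = wt η t x := by
  rw [← wt_mul_rpow hη0, mul_assoc, rpow_neg_one, inv_mul_cancel₀ (norm_pos_iff.2 hx).ne', mul_one]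

/-- `|g(x) - g(y)| ≤ W(x) (|x - y| / |x|)^(1/2)` whenever `|x - y| ≤ |x| / 2`: Hölder continuity
of exponent `1/2` at the scale of the distance from the origin. -/
def HolderHalf (W g : E3 → ℝ) : Prop :=
  ∀ x y : E3, x ≠ 0 → ‖x - y‖ ≤ ‖x‖ / 2 → |g x - g y| ≤ W x * (‖x - y‖ / ‖x‖) ^ (1 / 2 : ℝ)

lemma le_rpow_half {q : ℝ} (h0 : 0 ≤ q) (h1 : q ≤ 1) : q ≤ q ^ (1 / 2 : ℝ) := by
  rw [← sqrt_eq_rpow]; exact Real.le_sqrt_of_sq_le (by nlinarith)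

lemma div_norm_le_one (h : ‖x - y‖ ≤ ‖x‖ / 2) : ‖x - y‖ / ‖x‖ ≤ 1 :=
  div_le_one_of_le₀ (h.trans (by linarith [norm_nonneg x])) (norm_nonneg _)

lemma half_norm_le (h : ‖x - y‖ ≤ ‖x‖ / 2) : ‖x‖ / 2 ≤ ‖y‖ := by
  have := norm_le_norm_add_norm_sub' x y; linarith

lemma norm_half_le (h : ‖x - y‖ ≤ ‖x‖ / 2) : ‖y‖ / 2 ≤ ‖x‖ := by
  have := norm_le_norm_add_norm_sub x y; linarith [norm_nonneg x]

lemma ne_zero_of_half (hx : x ≠ 0) (h : ‖x - y‖ ≤ ‖x‖ / 2) : y ≠ 0 := by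
  have := half_norm_le h; have := norm_pos_iff.2 hx; exact norm_pos_iff.1 (by linarith)

/-- A gradient bound with weight `wtF` implies the Hölder bound with weight `wt`. -/
lemma holderHalf_of_fderiv (hη0 : 0 < η) (hη1 : η < 1) {N : ℝ} (hN : 0 ≤ N)
    (h : ∀ x : E3, x ≠ 0 → DifferentiableAt ℝ g x ∧ ‖fderiv ℝ g x‖ ≤ N * wtF η t x) :
    HolderHalf (fun x => 4 * N * wt η t x) g := fun x y hx hxy => by
  have hmem : ∀ u ∈ closedBall x (‖x‖ / 2), ‖x - u‖ ≤ ‖x‖ / 2 := fun u hu => by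
    rw [← dist_eq_norm, dist_comm]; exact hu
  have h1 : ‖g x - g y‖ ≤ N * (4 * wtF η t x) * ‖x - y‖ :=
    (convex_closedBall x (‖x‖ / 2)).norm_image_sub_le_of_norm_fderiv_le
      (fun u hu => (h u (ne_zero_of_half hx (hmem u hu))).1) (fun u hu =>
        (h u (ne_zero_of_half hx (hmem u hu))).2.trans (mul_le_mul_of_nonneg_left
      (wtF_le_four_mul hη0 hη1 hx (half_norm_le (hmem u hu))) hN))
      (by rw [Metric.mem_closedBall, dist_comm, dist_eq_norm]; exact hxy) (Metric.mem_closedBall_self (by positivity))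
  refine h1.trans ?_
  calc N * (4 * wtF η t x) * ‖x - y‖ = 4 * N * (wtF η t x * ‖x‖) * (‖x - y‖ / ‖x‖) := by field_simp
    _ = 4 * N * wt η t x * (‖x - y‖ / ‖x‖) := by rw [wtF_mul_norm hη0 hx]
    _ ≤ _ := by
      have := wt_nonneg η t x; gcongr; exact le_rpow_half (by positivity) (div_norm_le_one hxy)

lemma norm_sum_smul_proj_le (a : Fin 3 → ℝ) :
    ‖∑ c : Fin 3, a c • (EuclideanSpace.proj c : E3 →L[ℝ] ℝ)‖ ≤ ∑ c : Fin 3, |a c| := by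
  refine (norm_sum_le _ _).trans (sum_le_sum fun c _ => ?_); rw [norm_smul]
  exact mul_le_of_le_one_right (norm_nonneg _)
    (opNorm_le_bound _ zero_le_one fun v => by rw [one_mul]; exact abs_coord_le v c)

/-- Gradient bound for the heat flow of data that are Lipschitz at the scale of the distance from the origin. -/
lemma exists_heat_fderiv_bound (hη0 : 0 < η) : ∃ C : ℝ, 0 ≤ C ∧ ∀ (L : ℝ) (v : E3 → ℝ),
    0 ≤ L → Measurable v → (∀ y, |v y| ≤ L * ‖y‖ ^ (-1 : ℝ)) →
    (∀ x y, ‖x - y‖ ≤ ‖x‖ / 2 → |v x - v y| ≤ L * ‖x - y‖ * ‖x‖ ^ (-2 : ℝ)) →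
    ∀ t : ℝ, 0 < t → ∀ x : E3, x ≠ 0 → DifferentiableAt ℝ (cnv heatK v t) x ∧
    ‖fderiv ℝ (cnv heatK v t) x‖ ≤ C * L * wtF η t x := by
  obtain ⟨C1, hC1, H1⟩ := (isKer_ek_two 2).exists_abs_cnv_dk_le zero_le_one
  obtain ⟨C2, hC2, H2⟩ := exists_cnv_bound (isKer_pk 4) (by norm_num) zero_le_one (by simp : (1 : ℝ) < 3)
  refine ⟨12 * C1 * C2, by positivity, fun L v hL mv hv hlip t ht x hx => ?_⟩
  have hx0 := norm_pos_iff.2 hx; have hst := Real.sqrt_pos.2 ht; set K := fun t z => c0 * ek 2 t z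
  obtain ⟨i1, b1⟩ := H2 (2 * L) (fun y => 2 * L * ‖y‖ ^ (-1 : ℝ)) (by positivity) (by fun_prop)
    (ae_of_all _ fun y => by rw [abs_of_nonneg (by positivity)]) t ht x
  have hvA : ∀ y, |v y| ≤ 2 * L * ‖y‖ ^ (-1 : ℝ) := fun y => (hv y).trans (by
    have : 0 ≤ L * ‖y‖ ^ (-1 : ℝ) := by positivity
    linarith)
  have hi : Integrable fun y => pk 4 t (x - y) * |v y| := by
    refine i1.mono' ((measurable_pk 4).comp (f := fun y => (t, x - y)) (by fun_prop) |>.mul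
      mv.abs).aestronglyMeasurable (ae_of_all _ fun y => ?_)
    rw [norm_mul, norm_of_nonneg (pk_nonneg _ _ _), norm_eq_abs, abs_abs]
    exact mul_le_mul_of_nonneg_left (hvA y) (pk_nonneg _ _ _)
  have hd' := ((isKer_ek_two 2).hasFDerivAt_cnv_of_integrable_mul (by simp) mv ht x hi).const_mul (√t)
  rw [← (funext fun x => cnv_heatK_eq v t x)] at hd'; refine ⟨hd'.differentiableAt, ?_⟩
  rw [hd'.fderiv]
  have hfA : ∀ y, ‖x - y‖ ≤ ‖x‖ / 2 → |v x| ≤ 2 * L * ‖y‖ ^ (-1 : ℝ) ∧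
      |v y - v x| ≤ 2 * L * ‖y‖ ^ (-1 : ℝ) * (‖x - y‖ / ‖x‖) ^ (1 : ℝ) := fun y hy => by
    have h3 := rpow_neg_le_of_half_le (norm_pos_iff.2 (ne_zero_of_half hx hy)) (norm_half_le hy) zero_le_one
    rw [rpow_one] at h3
    refine ⟨(hv x).trans (by calc L * ‖x‖ ^ (-1 : ℝ) ≤ L * (2 * ‖y‖ ^ (-1 : ℝ)) := by gcongr
      _ = _ := by ring), ?_⟩
    rw [abs_sub_comm]; refine (hlip x y hy).trans ?_
    have h4 : ‖x‖ ^ (-2 : ℝ) = ‖x‖ ^ (-1 : ℝ) * ‖x‖⁻¹ := by rw [← rpow_neg_one ‖x‖, ← rpow_add hx0]; norm_num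
    rw [h4, rpow_one]
    calc L * ‖x - y‖ * (‖x‖ ^ (-1 : ℝ) * ‖x‖⁻¹) ≤ L * ‖x - y‖ * ((2 * ‖y‖ ^ (-1 : ℝ)) * ‖x‖⁻¹) := by gcongr
      _ = _ := by ring
  have hI : ∫ y, pk 4 t (x - y) * (2 * L * ‖y‖ ^ (-1 : ℝ))
      ≤ C2 * (2 * L) * (t ^ ((3 - 4) / 2 : ℝ) * (‖x‖ + √t) ^ (-1 : ℝ)) := by
    refine le_trans (integral_mono_of_nonneg (ae_of_all _ fun y => ?_) i1.abs (ae_of_all _ fun y => le_abs_self _)) b1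
    have := pk_nonneg 4 t (x - y); positivity
  set I := ∫ y, pk 4 t (x - y) * (2 * L * ‖y‖ ^ (-1 : ℝ))
  have hc : ∀ c, |cnv (dk (ei c) K) v t x| ≤ C1 * (2 * (‖x‖ ^ (-1 : ℝ) * I)) := fun c => by
    have := H1 (ei c) t x v (fun y => 2 * L * ‖y‖ ^ (-1 : ℝ)) ht hx mv hvA hfA
      (by rw [show (4 : ℝ) + 1 - 1 = 4 by simp]; exact i1) i1
    rw [show (4 : ℝ) + 1 - 1 = 4 by simp] at this; refine this.trans_eq ?_
    simp only [PiLp.norm_single, norm_one]; ring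
  have hsum := (norm_sum_smul_proj_le fun c => cnv (dk (ei c) K) v t x).trans (sum_le_sum fun c _ => hc c)
  rw [norm_smul, norm_of_nonneg hst.le]
  have hw : ‖x‖ ^ (-1 : ℝ) * (‖x‖ + √t) ^ (-1 : ℝ) ≤ wtF η t x := by
    unfold wtF
    have e1 : (‖x‖ + √t) ^ (-1 : ℝ) = (‖x‖ + √t) ^ (-1 + η) * (‖x‖ + √t) ^ (-η) := by
      rw [← rpow_add (by positivity)]; congr 1; ring
    have e2 : ‖x‖ ^ (-1 - η) = ‖x‖ ^ (-1 : ℝ) * ‖x‖ ^ (-η) := by rw [← rpow_add hx0]; congr 1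
    have e3 : (‖x‖ + √t) ^ (-η) ≤ ‖x‖ ^ (-η) :=
      rpow_le_rpow_of_nonpos hx0 (by linarith) (by linarith)
    rw [e1, e2]
    calc _ = (‖x‖ + √t) ^ (-1 + η) * (‖x‖ ^ (-1 : ℝ) * (‖x‖ + √t) ^ (-η)) := by ring
      _ ≤ _ := by gcongr
  have ht1 : √t * t ^ ((3 - 4) / 2 : ℝ) = 1 := by rw [sqrt_eq_rpow, ← rpow_add ht]; norm_num
  calc _ ≤ √t * ∑ c, C1 * (2 * (‖x‖ ^ (-1 : ℝ) *
      (C2 * (2 * L) * (t ^ ((3 - 4) / 2 : ℝ) * (‖x‖ + √t) ^ (-1 : ℝ))))) := by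
        refine mul_le_mul_of_nonneg_left (hsum.trans (sum_le_sum fun c _ => ?_)) hst.le; gcongr
    _ = 12 * C1 * C2 * L * (√t * t ^ ((3 - 4) / 2 : ℝ)) * (‖x‖ ^ (-1 : ℝ) * (‖x‖ + √t) ^ (-1 : ℝ)) := by
      simp; ring
    _ ≤ _ := by rw [ht1, mul_one]; gcongr

/-- The Duhamel term is Hölder continuous of exponent `1/2` off the origin. -/
lemma exists_duh_holder (hη0 : 0 < η) (hη1 : η < 1) (hK : IsKer 1 4 K) :
    ∃ C : ℝ, 0 ≤ C ∧ ∀ (M : ℝ) (f : E4 → ℝ), 0 ≤ M → Measurable f → (∀ z, |f z| ≤ M * wtF η z.1 z.2) →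
    ∀ t : ℝ, 0 < t → HolderHalf (fun x => C * M * wt η t x) (duh K f t) := by
  obtain ⟨C1, hC1, H1⟩ := exists_duh_bound (hK.of_succ) le_rfl (by norm_num) hη0 hη1
  obtain ⟨C2, hC2, H2⟩ := hK.exists_abs_sub_le (by simp)
  obtain ⟨C3, hC3, H3⟩ := exists_duh_bound (isKer_pk (4 + 1 / 2)) (by simp) (by norm_num) hη0 hη1
  refine ⟨C2 * (5 * C3), by positivity, fun M f hM mf hf t ht x y hx hxy => ?_⟩
  have hy := ne_zero_of_half hx hxy; have hx0 := norm_pos_iff.2 hx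
  have hf' : ∀ᵐ z ∂μ₊, |f z| ≤ M * wtF η z.1 z.2 := ae_of_all _ hf
  have ix := (H1 M f hM mf hf' t ht x hx).1; obtain ⟨jx, bx, -⟩ := H3 M f hM mf hf' t ht x hx
  obtain ⟨jy, byy, -⟩ := H3 M f hM mf hf' t ht y hy
  have hpt : ∀ z, |K (t - z.1) (x - z.2) * f z - K (t - z.1) (y - z.2) * f z| ≤
      C2 * ‖x - y‖ ^ (1 / 2 : ℝ) * (|pk (4 + 1 / 2) (t - z.1) (x - z.2) * f z| + |pk (4 + 1 / 2) (t - z.1) (y - z.2) * f z|) := fun z => by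
    have h1 := H2 (t - z.1) (x - z.2) (y - z.2); rw [show x - z.2 - (y - z.2) = x - y by abel] at h1
    rw [← sub_mul, abs_mul, abs_mul, abs_mul, abs_of_nonneg (pk_nonneg _ _ _), abs_of_nonneg (pk_nonneg _ _ _),
      ← add_mul, ← mul_assoc]
    gcongr
  have h2 : |duh K f t x - duh K f t y| ≤ C2 * ‖x - y‖ ^ (1 / 2 : ℝ) *
      ((∫ z in posTime, |pk (4 + 1 / 2) (t - z.1) (x - z.2) * f z|)
        + ∫ z in posTime, |pk (4 + 1 / 2) (t - z.1) (y - z.2) * f z|) := by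
    unfold duh
    rw [← integral_sub ix ((H1 M f hM mf hf' t ht y hy).1), ← integral_add jx.abs jy.abs, ← integral_const_mul]
    exact norm_integral_le_of_norm_le
      (f := fun z => K (t - z.1) (x - z.2) * f z - K (t - z.1) (y - z.2) * f z)
      ((jx.abs.add jy.abs).const_mul _) (ae_of_all _ hpt)
  set p := (‖x‖ + √t) ^ (-1 + η) * ‖x‖ ^ (-η - (4 + 1 / 2 - 4))
  have hp : p = wt η t x * ‖x‖ ^ (-(1 / 2) : ℝ) := by
    unfold wt; rw [mul_assoc, ← rpow_add hx0]; simp only [p]; congr 2; ring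
  have hq : (‖y‖ + √t) ^ (-1 + η) * ‖y‖ ^ (-η - (4 + 1 / 2 - 4)) ≤ 4 * p := by
    have e1 : (‖y‖ + √t) ^ (-1 + η) * ‖y‖ ^ (-η - (4 + 1 / 2 - 4)) = wt η t y * ‖y‖ ^ (-(1 / 2) : ℝ) := by
      unfold wt; rw [mul_assoc, ← rpow_add (norm_pos_iff.2 hy)]; congr 2; ring
    rw [e1, hp]; have h3 := wt_le_two_mul hη0 hη1 (t := t) hx (half_norm_le hxy)
    have h5 : (2 : ℝ) ^ (1 / 2 : ℝ) ≤ 2 := by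
      calc (2 : ℝ) ^ (1 / 2 : ℝ) ≤ 2 ^ (1 : ℝ) := rpow_le_rpow_of_exponent_le (by simp) (by norm_num)
        _ = 2 := rpow_one 2
    have := wt_nonneg η t x
    calc _ ≤ (2 * wt η t x) * (2 * ‖x‖ ^ (-(1 / 2) : ℝ)) := by
          gcongr
          exact (rpow_neg_le_of_half_le hx0 (half_norm_le hxy) (k := 1 / 2) (by simp)).trans (by gcongr)
      _ = _ := by ring
  calc |duh K f t x - duh K f t y| ≤ C2 * ‖x - y‖ ^ (1 / 2 : ℝ) * (C3 * M * p + C3 * M * (4 * p)) := by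
        refine h2.trans ?_; gcongr; exact byy.trans (by gcongr)
    _ = C2 * (5 * C3) * M * wt η t x * (‖x - y‖ / ‖x‖) ^ (1 / 2 : ℝ) := by
      rw [hp, div_rpow (norm_nonneg _) hx0.le, rpow_neg hx0.le]; ring

/-! ### The gradient of the Duhamel term -/

/-- The Duhamel term as an integral over time of convolutions in space. -/
lemma duh_eq_integral_cnv (hK : IsKer n m K) {f : E4 → ℝ}
    (hi : Integrable (fun z => K (t - z.1) (x - z.2) * f z) μ₊) :
    IntegrableOn (fun s => cnv K (fun y => f (s, y)) (t - s) x) (Ioo 0 t) ∧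
    duh K f t x = ∫ s in Ioo 0 t, cnv K (fun y => f (s, y)) (t - s) x := by
  rw [volume_restrict_posTime] at hi
  refine ⟨hi.integral_prod_left.mono_measure (Measure.restrict_mono Ioo_subset_Ioi_self le_rfl), ?_⟩
  unfold duh; rw [volume_restrict_posTime, integral_prod _ hi]
  have h0 : ∀ s ∈ Ioi (0 : ℝ) \ Ioo 0 t, cnv K (fun y => f (s, y)) (t - s) x = 0 := fun s hs => by
    have hs' : t - s ≤ 0 := by by_contra h; exact hs.2 ⟨hs.1, by linarith⟩
    simp [cnv, hK.eq_zero hs']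
  exact (setIntegral_eq_of_subset_of_forall_sdiff_eq_zero measurableSet_Ioi Ioo_subset_Ioi_self h0)

lemma integrableOn_sub_rpow (hp : p < 1) :
    IntegrableOn (fun s : ℝ => (t - s) ^ (-p)) (Ioo 0 t) := by
  have := ((intervalIntegral.intervalIntegrable_rpow' (a := t) (b := 0) (r := -p) (by linarith)).comp_sub_left t).1
  rw [sub_self, sub_zero] at this; exact this.mono_set Ioo_subset_Ioc_self

/-- Gradient bound for the Duhamel term of a source that is Hölder continuous of exponent `1/2`
at the scale of the distance from the origin. -/
lemma exists_duh_fderiv_bound (hη0 : 0 < η) (hη1 : η < 1) (hK : IsKer 2 4 K) :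
    ∃ C : ℝ, 0 ≤ C ∧ ∀ (Q : ℝ) (f : E4 → ℝ), 0 ≤ Q → Measurable f → (∀ z, |f z| ≤ Q * wtF η z.1 z.2) →
    (∀ s : ℝ, 0 < s → ∀ x y : E3, x ≠ 0 → ‖x - y‖ ≤ ‖x‖ / 2 → |f (s, x)| ≤ Q * wtF η s y ∧
    |f (s, y) - f (s, x)| ≤ Q * wtF η s y * (‖x - y‖ / ‖x‖) ^ (1 / 2 : ℝ)) →
    ∀ t : ℝ, 0 < t → ∀ x : E3, x ≠ 0 → DifferentiableAt ℝ (duh K f t) x ∧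
    ‖fderiv ℝ (duh K f t) x‖ ≤ C * Q * wtF η t x := by
  obtain ⟨C1, hC1, H1⟩ := hK.exists_abs_cnv_dk_le (α := 1 / 2) (by simp)
  obtain ⟨D4, hD4, B4⟩ := exists_cnv_bound (isKer_pk 4) (by norm_num) zero_le_two (by norm_num : (2 : ℝ) < 3)
  obtain ⟨D5, hD5, B5⟩ := exists_cnv_bound (isKer_pk (4 + 1 - 1 / 2)) (by norm_num) zero_le_two
    (by norm_num : (2 : ℝ) < 3)
  obtain ⟨C0, hC0, E0⟩ := exists_duh_bound hK.of_succ.of_succ le_rfl (by norm_num) hη0 hη1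
  obtain ⟨C4, hC4, HE4⟩ := exists_duh_bound (isKer_pk 4) le_rfl (by norm_num) hη0 hη1
  obtain ⟨C5, hC5, E5⟩ := exists_duh_bound (isKer_pk (4 + 1 - 1 / 2)) (by norm_num) (by norm_num) hη0 hη1
  refine ⟨3 * C1 * (C5 + C4), by positivity, fun Q f hQ mf hf hfH t ht x hx => ?_⟩
  have hx0 := norm_pos_iff.2 hx; set A : E4 → ℝ := fun z => Q * wtF η z.1 z.2
  have mA : Measurable A := by fun_prop
  have hA0 : ∀ z, 0 ≤ A z := fun z => mul_nonneg hQ (wtF_nonneg _ _ _)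
  have absA := fun z => abs_of_nonneg (hA0 z)
  have mfs : ∀ s, Measurable fun y => f (s, y) := fun s => mf.comp (by fun_prop)
  have mAs : ∀ s, Measurable fun y => A (s, y) := fun s => mA.comp (by fun_prop)
  have hA2 : ∀ s, ∀ᵐ y, |A (s, y)| ≤ Q * ‖y‖ ^ (-2 : ℝ) := fun s => ae_of_all _ fun y => by
    rw [absA]; exact mul_le_mul_of_nonneg_left (wtF_le_rpow hη0 hη1 _ _) hQ
  -- the orders `4` and `9/2` occur in the cancellation estimate; both are integrable in time
  set I := fun k s u => ∫ y, pk k (t - s) (u - y) * A (s, y)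
  have hpA : ∀ k s (u y : E3), 0 ≤ pk k (t - s) (u - y) * A (s, y) := fun k s u y =>
    mul_nonneg (pk_nonneg _ _ _) (hA0 _)
  -- fixed times
  have i4 : ∀ s < t, ∀ u, Integrable fun y => pk 4 (t - s) (u - y) * A (s, y) := fun s hs u =>
    (B4 Q _ hQ (mAs s) (hA2 s) (t - s) (by linarith) u).1
  have i5 : ∀ s < t, ∀ u, Integrable fun y => pk (4 + 1 - 1 / 2) (t - s) (u - y) * A (s, y) := fun s hs u =>
    (B5 Q _ hQ (mAs s) (hA2 s) (t - s) (by linarith) u).1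
  have neg2 : ∀ {s : ℝ} {u : E3}, u ≠ 0 → (‖u‖ + √(t - s)) ^ (-2 : ℝ) ≤ ‖u‖ ^ (-2 : ℝ) := fun {s u} hu =>
    rpow_le_rpow_of_nonpos (norm_pos_iff.2 hu) (by bound) (by simp)
  have b4 : ∀ s < t, ∀ u, u ≠ 0 → I 4 s u ≤ D4 * Q * ((t - s) ^ (-(1 / 2) : ℝ) * ‖u‖ ^ (-2 : ℝ)) := fun s hs u hu => by
    have h1 := (B4 Q _ hQ (mAs s) (hA2 s) (t - s) (by linarith) u).2
    simp_rw [abs_of_nonneg (hpA _ _ _ _)] at h1; have hts : 0 < t - s := by linarith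
    refine h1.trans ?_; rw [show ((3 : ℝ) - 4) / 2 = -(1 / 2) by norm_num]; have := neg2 (s := s) hu
    gcongr
  have b5 : ∀ s < t, ∀ u, u ≠ 0 →
      I (4 + 1 - 1 / 2) s u ≤ D5 * Q * ((t - s) ^ (-(3 / 4) : ℝ) * ‖u‖ ^ (-2 : ℝ)) := fun s hs u hu => by
    have h1 := (B5 Q _ hQ (mAs s) (hA2 s) (t - s) (by linarith) u).2
    simp_rw [abs_of_nonneg (hpA _ _ _ _)] at h1; have hts : 0 < t - s := by linarith
    refine h1.trans ?_; rw [show ((3 : ℝ) - (4 + 1 - 1 / 2)) / 2 = -(3 / 4) by norm_num]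
    have := neg2 (s := s) hu; gcongr
  set G := fun s u c => cnv (dk (ei c) K) (fun y => f (s, y)) (t - s) u
  have hG : ∀ s, 0 < s → s < t → ∀ u, u ≠ 0 → ∀ c,
      |G s u c| ≤ C1 * (‖u‖ ^ (-(1 / 2) : ℝ) * I (4 + 1 - 1 / 2) s u + ‖u‖ ^ (-1 : ℝ) * I 4 s u) := fun s hs hst u hu c => by
    refine (H1 (ei c) (t - s) u (fun y => f (s, y)) (fun y => A (s, y)) (by linarith) hu (mfs s)
      (fun y => hf (s, y)) (fun y hy => hfH s hs u y hu hy) (i5 s hst u) (i4 s hst u)).trans_eq ?_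
    simp only [PiLp.norm_single, norm_one, mul_one, I]
  have hGs : ∀ s, 0 < s → s < t → ∀ u, u ≠ 0 →
      ‖∑ c, G s u c • (EuclideanSpace.proj c : E3 →L[ℝ] ℝ)‖ ≤
        3 * C1 * (‖u‖ ^ (-(1 / 2) : ℝ) * I (4 + 1 - 1 / 2) s u + ‖u‖ ^ (-1 : ℝ) * I 4 s u) := fun s hs hst u hu => by
    refine ((norm_sum_smul_proj_le _).trans (sum_le_sum fun c _ => hG s hs hst u hu c)).trans_eq ?_
    simp; ring
  have hdiff : ∀ s, 0 < s → s < t → ∀ u, HasFDerivAt (cnv K (fun y => f (s, y)) (t - s))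
      (∑ c, G s u c • (EuclideanSpace.proj c : E3 →L[ℝ] ℝ)) u := fun s hs hst u => by
    refine hK.hasFDerivAt_cnv_of_integrable_mul (by simp) (mfs s) (by linarith) u ?_
    refine (i4 s hst u).mono' ((measurable_pk 4).comp (f := fun y => (t - s, u - y)) (by fun_prop) |>.mul
      (mfs s).abs).aestronglyMeasurable (ae_of_all _ fun y => ?_)
    rw [norm_mul, norm_of_nonneg (pk_nonneg _ _ _), norm_eq_abs, abs_abs]
    exact mul_le_mul_of_nonneg_left (hf (s, y)) (pk_nonneg _ _ _)
  -- integration in time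
  have hduh : ∀ u, u ≠ 0 → IntegrableOn (fun s => cnv K (fun y => f (s, y)) (t - s) u) (Ioo 0 t) ∧
      duh K f t u = ∫ s in Ioo 0 t, cnv K (fun y => f (s, y)) (t - s) u := fun u hu =>
    duh_eq_integral_cnv hK (E0 Q f hQ mf (ae_of_all _ hf) t ht u hu).1
  have mG := fun c =>
    (measurable_cnv ((hK.of_succ).dk (ei c)) (f := fun s y => f (s, y)) mf (fun s => t - s) (by fun_prop)).comp
      (f := fun s => (s, x)) (by fun_prop)
  have mG' : AEStronglyMeasurable (fun s => ∑ c, G s x c • (EuclideanSpace.proj c : E3 →L[ℝ] ℝ))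
      (volume.restrict (Ioo 0 t)) :=
    Finset.aestronglyMeasurable_fun_sum _ fun c _ => (mG c).aestronglyMeasurable.smul_const _
  set r := ‖x‖ / 2; have hr : 0 < r := by positivity
  have hball := fun u hu => by
    have h1 : ‖x - u‖ < r := by rw [← dist_eq_norm, dist_comm]; exact hu
    exact half_norm_le h1.le
  have hfd : HasFDerivAt (fun u => ∫ s in Ioo 0 t, cnv K (fun y => f (s, y)) (t - s) u)
      (∫ s in Ioo 0 t, ∑ c, G s x c • (EuclideanSpace.proj c : E3 →L[ℝ] ℝ)) x := by
    refine hasFDerivAt_integral_of_dominated_of_fderiv_le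

      (F' := fun u s => ∑ c, G s u c • (EuclideanSpace.proj c : E3 →L[ℝ] ℝ))
      (bound := fun s => 3 * C1 * (r ^ (-(1 / 2) : ℝ) * (D5 * Q * ((t - s) ^ (-(3 / 4) : ℝ) * r ^ (-2 : ℝ)))
        + r ^ (-1 : ℝ) * (D4 * Q * ((t - s) ^ (-(1 / 2) : ℝ) * r ^ (-2 : ℝ))))) (ball_mem_nhds x hr)
      (.of_forall fun u => ?_) (hduh x hx).1 mG' ?_ ?_ ?_
    · exact ((measurable_cnv hK (f := fun s y => f (s, y)) mf (fun s => t - s) (by fun_prop)).comp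
        (f := fun s => (s, u)) (by fun_prop)).aestronglyMeasurable
    · refine (ae_restrict_iff' measurableSet_Ioo).2 (ae_of_all _ fun s hs u hu => ?_)
      have hru := hball u hu; have hu0 := norm_pos_iff.1 (hr.trans_le hru)
      have hts : 0 < t - s := by linarith [hs.2]
      have n1 : ∀ k : ℝ, 0 ≤ k → ‖u‖ ^ (-k) ≤ r ^ (-k) := fun k hk =>
        rpow_le_rpow_of_nonpos hr hru (by linarith)
      have I5 : 0 ≤ I (4 + 1 - 1 / 2) s u := integral_nonneg fun y => hpA _ _ _ _
      have I4 : 0 ≤ I 4 s u := integral_nonneg fun y => hpA _ _ _ _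
      refine (hGs s hs.1 hs.2 u hu0).trans ?_; gcongr 3 * C1 * (?_ * ?_ + ?_ * ?_)
      · exact n1 _ (by simp)
      · exact (b5 s hs.2 u hu0).trans (by gcongr ?_ * (?_ * ?_); exact n1 2 (by simp))
      · exact n1 _ (by simp)
      · exact (b4 s hs.2 u hu0).trans (by gcongr ?_ * (?_ * ?_); exact n1 2 (by simp))
    · have j1 := integrableOn_sub_rpow (p := 3 / 4) (t := t) (by norm_num)
      have j2 := integrableOn_sub_rpow (p := 1 / 2) (t := t) (by norm_num)
      exact ((((j1.mul_const _).const_mul _).const_mul _).add (((j2.mul_const _).const_mul _).const_mul _)).const_mul _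
    · exact (ae_restrict_iff' measurableSet_Ioo).2 (ae_of_all _ fun s hs u _ => hdiff s hs.1 hs.2 u)
  have hev : duh K f t =ᶠ[𝓝 x] fun u => ∫ s in Ioo 0 t, cnv K (fun y => f (s, y)) (t - s) u := by
    filter_upwards [isOpen_ne.mem_nhds hx] with u hu using (hduh u hu).2
  have hfd' := hfd.congr_of_eventuallyEq hev; refine ⟨hfd'.differentiableAt, ?_⟩; rw [hfd'.fderiv]
  -- the size of the derivative
  have e5 := E5 Q A hQ mA (ae_of_all _ fun z => (absA z).le) t ht x hx
  have e4 := HE4 Q A hQ mA (ae_of_all _ fun z => (absA z).le) t ht x hx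
  have time : ∀ k b, Integrable (fun z => pk k (t - z.1) (x - z.2) * A z) μ₊ →
      ∫ z in posTime, |pk k (t - z.1) (x - z.2) * A z| ≤ b →
      IntegrableOn (fun s => I k s x) (Ioo 0 t) ∧ ∫ s in Ioo 0 t, I k s x ≤ b := fun k b hi hb => by
    obtain ⟨h1, h2⟩ := duh_eq_integral_cnv (isKer_pk k) hi; refine ⟨h1, ?_⟩
    have h3 : ∫ s in Ioo 0 t, I k s x = duh (pk k) A t x := h2.symm; rw [h3]
    exact le_trans (le_of_eq (integral_ext fun z => (abs_of_nonneg (mul_nonneg (pk_nonneg _ _ _) (hA0 z))).symm)) hb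
  obtain ⟨k5, l5⟩ := time _ _ e5.1 e5.2.1; obtain ⟨k4, l4⟩ := time _ _ e4.1 e4.2.1
  have kk : IntegrableOn (fun s => 3 * C1 * (‖x‖ ^ (-(1 / 2) : ℝ) * I (4 + 1 - 1 / 2) s x + ‖x‖ ^ (-1 : ℝ) * I 4 s x))
    (Ioo 0 t) := ((k5.const_mul _).add (k4.const_mul _)).const_mul _
  refine (norm_integral_le_of_norm_le kk ((ae_restrict_iff' measurableSet_Ioo).2
    (ae_of_all _ fun s hs => hGs s hs.1 hs.2 x hx))).trans ?_
  rw [integral_const_mul, integral_add (k5.const_mul _) (k4.const_mul _), integral_const_mul, integral_const_mul]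
  have w5 : ‖x‖ ^ (-(1 / 2) : ℝ) * ((‖x‖ + √t) ^ (-1 + η) * ‖x‖ ^ (-η - (4 + 1 - 1 / 2 - 4))) = wtF η t x := by
    rw [mul_left_comm, ← rpow_add hx0]; congr 2; ring
  have w4 : ‖x‖ ^ (-1 : ℝ) * ((‖x‖ + √t) ^ (-1 + η) * ‖x‖ ^ (-η - (4 - 4))) = wtF η t x := by
    rw [mul_left_comm, ← rpow_add hx0]; congr 2; ring
  calc _ ≤ 3 * C1 * (‖x‖ ^ (-(1 / 2) : ℝ) * (C5 * Q * ((‖x‖ + √t) ^ (-1 + η) * ‖x‖ ^ (-η - (4 + 1 - 1 / 2 - 4))))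
      + ‖x‖ ^ (-1 : ℝ) * (C4 * Q * ((‖x‖ + √t) ^ (-1 + η) * ‖x‖ ^ (-η - (4 - 4))))) := by gcongr
    _ = 3 * C1 * (C5 * Q * (‖x‖ ^ (-(1 / 2) : ℝ) * ((‖x‖ + √t) ^ (-1 + η) * ‖x‖ ^ (-η - (4 + 1 - 1 / 2 - 4))))
      + C4 * Q * (‖x‖ ^ (-1 : ℝ) * ((‖x‖ + √t) ^ (-1 + η) * ‖x‖ ^ (-η - (4 - 4))))) := by ring
    _ = _ := by rw [w5, w4]; ring

/-! ### The gradient of the solution -/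

lemma abs_mul_sub_mul_le {a' b' h : ℝ} (ha' : |a'| ≤ A) (hb : |b| ≤ B)
    (hda : |a - a'| ≤ A * h) (hdb : |b - b'| ≤ B * h) : |a * b - a' * b'| ≤ 2 * (A * B) * h := by
  have h1 : a * b - a' * b' = (a - a') * b + a' * (b - b') := by ring
  rw [h1]; refine (abs_add_le _ _).trans ?_; rw [abs_mul, abs_mul]
  have h2 := mul_le_mul hda hb (abs_nonneg _) ((abs_nonneg _).trans hda)
  have h3 := mul_le_mul ha' hdb (abs_nonneg _) ((abs_nonneg _).trans ha'); linarith

/-- The quadratic term inherits boundedness and Hölder continuity from its factors. -/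
lemma Fq_holder {h : ℝ} (hη0 : 0 < η) (hη1 : η < 1) (hp : 0 ≤ p) (h0 : 0 ≤ h)
    (hwx : ‖w (s, x)‖ ≤ p * wt η s y) (hwy : ‖w (s, y)‖ ≤ p * wt η s y)
    (hwd : ∀ c, |w (s, y) c - w (s, x) c| ≤ p * wt η s y * h)
    (hUx : ‖U x‖ ≤ p * ‖y‖ ^ (-1 : ℝ)) (hUy : ‖U y‖ ≤ p * ‖y‖ ^ (-1 : ℝ)) (hUd : ‖U y - U x‖ ≤ p * ‖y‖ ^ (-1 : ℝ) * h)
    (hVx : ‖V x‖ ≤ p * ‖y‖ ^ (-1 : ℝ)) (hVy : ‖V y‖ ≤ p * ‖y‖ ^ (-1 : ℝ)) (hVd : ‖V y - V x‖ ≤ p * ‖y‖ ^ (-1 : ℝ) * h)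
    (i j : Fin 3) :
    |Fq U V w i j (s, x)| ≤ 6 * p ^ 2 * wtF η s y ∧
    |Fq U V w i j (s, y) - Fq U V w i j (s, x)| ≤ 6 * p ^ 2 * wtF η s y * h := by
  set a := wt η s y; set b := ‖y‖ ^ (-1 : ℝ); have ha : 0 ≤ a := wt_nonneg _ _ _
  have hb : 0 ≤ b := by positivity
  have hab : a * b = wtF η s y := wt_mul_rpow hη0 _ _
  have haa : a * a ≤ wtF η s y := wt_mul_wt_le hη0 hη1 _ _; have hW := wtF_nonneg η s y
  have wx : ∀ c, |w (s, x) c| ≤ p * a := fun c => (abs_coord_le _ _).trans hwx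
  have wy : ∀ c, |w (s, y) c| ≤ p * a := fun c => (abs_coord_le _ _).trans hwy
  have Ux : |U x i| ≤ p * b := (abs_coord_le _ _).trans hUx
  have Uy : |U y i| ≤ p * b := (abs_coord_le _ _).trans hUy
  have Ud : |U y i - U x i| ≤ p * b * h := (abs_coord_le (U y - U x) i).trans hUd
  have Vx : |V x j| ≤ p * b := (abs_coord_le _ _).trans hVx
  have Vy : |V y j| ≤ p * b := (abs_coord_le _ _).trans hVy
  have Vd : |V y j - V x j| ≤ p * b * h := (abs_coord_le (V y - V x) j).trans hVd
  have hp2 : p ^ 2 * (a * a) ≤ p ^ 2 * wtF η s y := by gcongr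
  constructor
  · unfold Fq
    refine (abs_add_three _ _ _).trans ?_; simp
    have t1 := mul_le_mul (wx i) (wx j) (abs_nonneg _) (by positivity)
    have t2 := mul_le_mul Ux (wx j) (abs_nonneg _) (by positivity)
    have t4 : 0 ≤ p ^ 2 * wtF η s y := by positivity
    rw [← hab] at *
    linear_combination t1 + t2 + (mul_le_mul (wx i) Vx (abs_nonneg _) (by positivity)) + hp2 + 3 * t4
  · have t1 := abs_mul_sub_mul_le (wx i) (wy j) (hwd i) (hwd j)
    have t2 := abs_mul_sub_mul_le Ux (wy j) Ud (hwd j)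
    have e : Fq U V w i j (s, y) - Fq U V w i j (s, x) = (w (s, y) i * w (s, y) j - w (s, x) i * w (s, x) j)
        + (U y i * w (s, y) j - U x i * w (s, x) j) + (w (s, y) i * V y j - w (s, x) i * V x j) := by
      unfold Fq; ring
    rw [e]; refine (abs_add_three _ _ _).trans ?_; rw [← hab] at *
    linear_combination t1 + t2 + (abs_mul_sub_mul_le (wx i) Vy (hwd i) Vd) + 2 * (mul_le_mul_of_nonneg_right hp2 h0)

/-- The gradient bound for mild solutions with data that are Lipschitz at the scale of the
distance from the origin; `16` is the constant of `exists_lipschitz_rep`. -/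
lemma exists_gradient_bound (hη0 : 0 < η) (hη1 : η < 1) (hκ : 0 ≤ κ) : ∃ C : ℝ, 0 ≤ C ∧
    ∀ {ε : ℝ} {U V w₀ : E3 → E3} {w : E4 → E3}, ε ≤ 1 → IsMild η ε (κ * ε) U V w₀ w →
    (∀ x y, ‖x - y‖ ≤ ‖x‖ / 2 → ‖U x - U y‖ ≤ 16 * ε * ‖x - y‖ * ‖x‖ ^ (-2 : ℝ)) →
    (∀ x y, ‖x - y‖ ≤ ‖x‖ / 2 → ‖V x - V y‖ ≤ 16 * ε * ‖x - y‖ * ‖x‖ ^ (-2 : ℝ)) →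
    (∀ x y, ‖x - y‖ ≤ ‖x‖ / 2 → ‖w₀ x - w₀ y‖ ≤ 16 * ε * ‖x - y‖ * ‖x‖ ^ (-2 : ℝ)) →
    ∀ t : ℝ, 0 < t → ∀ x : E3, x ≠ 0 → DifferentiableAt ℝ (fun x => w (t, x)) x ∧
    ‖fderiv ℝ (fun x => w (t, x)) x‖ ≤ C * ε * wtF η t x := by
  obtain ⟨C1, hC1, H1⟩ := exists_heat_fderiv_bound hη0
  choose D hD HD using fun q : Fin 3 × Fin 3 × Fin 3 =>
    exists_duh_holder hη0 hη1 (isKer_oseenK 1 (ei q.1) (ei q.2.1) (ei q.2.2))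
  choose G hG HG using fun q : Fin 3 × Fin 3 × Fin 3 =>
    exists_duh_fderiv_bound hη0 hη1 (isKer_oseenK 2 (ei q.1) (ei q.2.1) (ei q.2.2))
  set D' := ∑ q, D q; set G' := ∑ q, G q; have hD' : 0 ≤ D' := sum_nonneg fun q _ => hD q
  have hG' : 0 ≤ G' := sum_nonneg fun q _ => hG q; set N := 64 * C1 + 9 * D' * ((κ + 2) * κ)
  have hN : 0 ≤ N := by positivity
  set P := 2 * κ + 2 * N + 34
  refine ⟨3 * (16 * C1 + 9 * G' * (6 * P ^ 2)), by positivity, fun {ε U V w₀ w} hε1 h lU lV lw t ht x hx => ?_⟩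
  have hε := h.hε; have hε2 := mul_le_of_le_one_left hε hε1
  have hM : (κ * ε + 2 * ε) * (κ * ε) ≤ (κ + 2) * κ * ε := by calc _ = (κ + 2) * κ * (ε * ε) := by ring
    _ ≤ _ := by gcongr
  -- the heat flow
  have heat : ∀ c, ∀ t, 0 < t → ∀ x, x ≠ 0 → DifferentiableAt ℝ (cnv heatK (fun y => w₀ y c) t) x ∧
      ‖fderiv ℝ (cnv heatK (fun y => w₀ y c) t) x‖ ≤ C1 * (16 * ε) * wtF η t x := fun c =>
    H1 (16 * ε) (fun y => w₀ y c) (by positivity) (measurable_coord h.mw₀ c)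
      (fun y => ((abs_coord_le _ _).trans (h.hw₀ y)).trans (by
        have : 0 ≤ ε * ‖y‖ ^ (-1 : ℝ) := by positivity
        linarith)) fun x y hxy => (abs_coord_le (w₀ x - w₀ y) c).trans (lw x y hxy)
  have duhH : ∀ i j c, ∀ t, 0 < t →
      HolderHalf (fun x => D (i, j, c) * ((κ * ε + 2 * ε) * (κ * ε)) * wt η t x)
        (duh (oseenK (ei i) (ei j) (ei c)) (Fq U V w i j) t) := fun i j c =>
    HD (i, j, c) _ _ (h.const_nonneg h.bdd) (h.mFq h.bdd i j) (h.abs_Fq_le i j)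
  -- Hölder continuity of the solution
  have hold : ∀ c, ∀ s, 0 < s → HolderHalf (fun x => N * ε * wt η s x) fun x => w (s, x) c := fun c s hs x y hx hxy => by
    have hy := ne_zero_of_half hx hxy; set q := (‖x - y‖ / ‖x‖) ^ (1 / 2 : ℝ)
    have hq : 0 ≤ q := by positivity
    have hW := wt_nonneg η s x; simp only; rw [h.coord_eq ⟨hs, hx⟩, h.coord_eq ⟨hs, hy⟩]
    have h1 := holderHalf_of_fderiv hη0 hη1 (by positivity) (heat c s hs) x y hx hxy
    have h2 : |bil U V w c (s, x) - bil U V w c (s, y)| ≤ 9 * (D' * ((κ + 2) * κ * ε) * wt η s x * q) := by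
      unfold bil; rw [← sum_sub_distrib]; refine (abs_sum_le_sum_abs _ _).trans ?_
      have h3 : ∀ i ∈ (Finset.univ : Finset (Fin 3)), |(∑ j, duh (oseenK (ei i) (ei j) (ei c)) (Fq U V w i j) s x)
          - ∑ j, duh (oseenK (ei i) (ei j) (ei c)) (Fq U V w i j) s y|
          ≤ ∑ j : Fin 3, D' * ((κ + 2) * κ * ε) * wt η s x * q := fun i _ => by
        rw [← sum_sub_distrib]
        refine (abs_sum_le_sum_abs _ _).trans (sum_le_sum fun j _ => (duhH i j c s hs x y hx hxy).trans ?_)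
        have := h.const_nonneg h.bdd; simp only; gcongr
        exact (fun q => single_le_sum (fun q _ => hD q) (Finset.mem_univ q)) _
      refine (sum_le_sum h3).trans_eq ?_; simp; ring
    have e : cnv heatK (fun y => w₀ y c) s x - bil U V w c (s, x) - (cnv heatK (fun y => w₀ y c) s y - bil U V w c (s, y))
      = (cnv heatK (fun y => w₀ y c) s x - cnv heatK (fun y => w₀ y c) s y)
        - (bil U V w c (s, x) - bil U V w c (s, y)) := by ring
    rw [e]; refine (abs_sub _ _).trans ((add_le_add h1 h2).trans_eq ?_); simp only [N]; ring
  -- Hölder continuity of the quadratic term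
  have hF : ∀ i j, ∀ s, 0 < s → ∀ x y, x ≠ 0 → ‖x - y‖ ≤ ‖x‖ / 2 →
      |Fq U V w i j (s, x)| ≤ 6 * (P * ε) ^ 2 * wtF η s y ∧
      |Fq U V w i j (s, y) - Fq U V w i j (s, x)| ≤ 6 * (P * ε) ^ 2 * wtF η s y * (‖x - y‖ / ‖x‖) ^ (1 / 2 : ℝ) := fun i j s hs x y hx hxy => by
    have hy := ne_zero_of_half hx hxy; have hx0 := norm_pos_iff.2 hx
    set q := (‖x - y‖ / ‖x‖) ^ (1 / 2 : ℝ); have hq : 0 ≤ q := by positivity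
    have hqq := le_rpow_half (by positivity) (div_norm_le_one hxy); have hW := wt_nonneg η s y
    have hWx : wt η s x ≤ 2 * wt η s y := wt_le_two_mul hη0 hη1 hy (norm_half_le hxy)
    have hrx : ‖x‖ ^ (-1 : ℝ) ≤ 2 * ‖y‖ ^ (-1 : ℝ) := by
      have := rpow_neg_le_of_half_le (norm_pos_iff.2 hy) (norm_half_le hxy) zero_le_one
      rwa [rpow_one] at this
    have hry : 0 ≤ ‖y‖ ^ (-1 : ℝ) := by positivity
    have x2 : ‖x‖ ^ (-2 : ℝ) = ‖x‖ ^ (-1 : ℝ) * ‖x‖⁻¹ := by rw [← rpow_neg_one ‖x‖, ← rpow_add hx0]; norm_num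
    have dx : ∀ {T : E3 → E3}, (∀ x, ‖T x‖ ≤ ε * ‖x‖ ^ (-1 : ℝ)) → ‖T x‖ ≤ P * ε * ‖y‖ ^ (-1 : ℝ) := fun {T} hT =>
      calc ‖T x‖ ≤ ε * (2 * ‖y‖ ^ (-1 : ℝ)) := (hT x).trans (by gcongr)
        _ = 2 * ε * ‖y‖ ^ (-1 : ℝ) := by ring
        _ ≤ _ := by gcongr; linarith
    have dy : ∀ {T : E3 → E3}, (∀ x, ‖T x‖ ≤ ε * ‖x‖ ^ (-1 : ℝ)) → ‖T y‖ ≤ P * ε * ‖y‖ ^ (-1 : ℝ) := fun {T} hT =>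
      (hT y).trans (by gcongr; exact le_mul_of_one_le_left hε (by simp only [P]; linarith))
    have dd : ∀ {T : E3 → E3}, (∀ x y, ‖x - y‖ ≤ ‖x‖ / 2 → ‖T x - T y‖ ≤ 16 * ε * ‖x - y‖ * ‖x‖ ^ (-2 : ℝ)) →
        ‖T y - T x‖ ≤ P * ε * ‖y‖ ^ (-1 : ℝ) * q := fun {T} hT => by
      rw [norm_sub_rev]
      calc ‖T x - T y‖ ≤ 16 * ε * ‖x - y‖ * (‖x‖ ^ (-1 : ℝ) * ‖x‖⁻¹) := by rw [← x2]; exact hT x y hxy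
        _ = 16 * ε * ‖x‖ ^ (-1 : ℝ) * (‖x - y‖ / ‖x‖) := by ring
        _ ≤ 16 * ε * (2 * ‖y‖ ^ (-1 : ℝ)) * q := by gcongr
        _ = 32 * ε * ‖y‖ ^ (-1 : ℝ) * q := by ring
        _ ≤ _ := by gcongr; linarith
    refine Fq_holder hη0 hη1 (by positivity) hq ?_ ?_ (fun c => ?_) (dx h.hU) (dy h.hU) (dd lU) (dx h.hV) (dy h.hV) (dd lV) i j
    · calc ‖w (s, x)‖ ≤ κ * ε * (2 * wt η s y) := (h.hw (s, x)).trans (by gcongr)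
        _ = 2 * κ * ε * wt η s y := by ring
        _ ≤ _ := by gcongr; linarith
    · exact (h.hw (s, y)).trans (by gcongr; linarith)
    · rw [abs_sub_comm]
      calc |w (s, x) c - w (s, y) c| ≤ N * ε * (2 * wt η s y) * q := (hold c s hs x y hx hxy).trans (by
        simp only; gcongr)
        _ = 2 * N * ε * wt η s y * q := by ring
        _ ≤ _ := by gcongr; linarith
  have hFb : ∀ i j, ∀ z, |Fq U V w i j z| ≤ 6 * (P * ε) ^ 2 * wtF η z.1 z.2 := fun i j z => by
    refine (h.abs_Fq_le i j z).trans (mul_le_mul_of_nonneg_right ?_ (wtF_nonneg _ _ _))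
    have : (κ + 2) * κ ≤ P * P := by refine mul_le_mul ?_ ?_ hκ (by positivity) <;> · simp only [P]; linarith
    calc (κ * ε + 2 * ε) * (κ * ε) = (κ + 2) * κ * (ε * ε) := by ring
      _ ≤ P * P * (ε * ε) := by gcongr
      _ ≤ _ := by
        have : 0 ≤ P * P * (ε * ε) := by positivity
        linarith
  have hQ : 6 * (P * ε) ^ 2 ≤ 6 * P ^ 2 * ε := by calc _ = 6 * P ^ 2 * (ε * ε) := by ring
    _ ≤ _ := by gcongr
  have hW := wtF_nonneg η t x
  -- the components
  have comp : ∀ c, DifferentiableAt ℝ (fun x => w (t, x) c) x ∧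
      ‖fderiv ℝ (fun x => w (t, x) c) x‖ ≤ (16 * C1 + 9 * G' * (6 * P ^ 2)) * ε * wtF η t x := fun c => by
    have hev : (fun x => w (t, x) c) =ᶠ[𝓝 x] fun x => cnv heatK (fun y => w₀ y c) t x
        - ∑ i, ∑ j, duh (oseenK (ei i) (ei j) (ei c)) (Fq U V w i j) t x := by
      filter_upwards [isOpen_ne.mem_nhds hx] with u hu using h.coord_eq ⟨ht, hu⟩ c
    have hd := fun i j => HG (i, j, c) (6 * (P * ε) ^ 2) (Fq U V w i j) (by positivity) (h.mFq h.bdd i j) (hFb i j)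
      (fun s hs x y hx hxy => hF i j s hs x y hx hxy) t ht x hx
    have hfd := ((heat c t ht x hx).1.hasFDerivAt.fun_sub (HasFDerivAt.fun_sum fun i _ =>
      HasFDerivAt.fun_sum fun j _ => (hd i j).1.hasFDerivAt)).congr_of_eventuallyEq hev
    refine ⟨hfd.differentiableAt, ?_⟩; rw [hfd.fderiv]
    have hs : ‖∑ i, ∑ j, fderiv ℝ (duh (oseenK (ei i) (ei j) (ei c)) (Fq U V w i j) t) x‖
        ≤ ∑ i : Fin 3, ∑ j : Fin 3, G' * (6 * P ^ 2 * ε) * wtF η t x := by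
      refine (norm_sum_le _ _).trans (sum_le_sum fun i _ => (norm_sum_le _ _).trans
        (sum_le_sum fun j _ => (hd i j).2.trans ?_))
      gcongr; exact (fun q => single_le_sum (fun q _ => hG q) (Finset.mem_univ q)) _
    refine (norm_sub_le _ _).trans ((add_le_add (heat c t ht x hx).2 hs).trans_eq ?_); simp; ring
  have hdw := differentiableAt_euclidean.2 fun c => (comp c).1
  refine ⟨hdw, opNorm_le_bound _ (by positivity) fun v => (norm_le_sum_coord _).trans ?_⟩
  have hc : ∀ c ∈ (Finset.univ : Finset (Fin 3)), |fderiv ℝ (fun x => w (t, x)) x v c|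
      ≤ (16 * C1 + 9 * G' * (6 * P ^ 2)) * ε * wtF η t x * ‖v‖ := fun c _ => by
    rw [fderiv_apply_coord hdw v c]
    exact ((fderiv ℝ (fun x => w (t, x) c) x).le_opNorm v).trans (by gcongr; exact (comp c).2)
  refine (sum_le_sum hc).trans_eq ?_; simp; ring

/-! ### Changing the data on null sets -/

/-- A field with `|x| |U(x)| ≤ ε` has a measurable representative with the same bound. -/
lemma exists_measurable_rep (hε : 0 ≤ ε) (hU : AEStronglyMeasurable U) (hb : ∀ x, ‖x‖ * ‖U x‖ ≤ ε) :
    ∃ U' : E3 → E3, Measurable U' ∧ U' =ᵐ[volume] U ∧ ∀ x, ‖U' x‖ ≤ ε * ‖x‖ ^ (-1 : ℝ) := by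
  have mV := hU.stronglyMeasurable_mk.measurable
  refine ⟨{x | ‖hU.mk U x‖ ≤ ε * ‖x‖ ^ (-1 : ℝ)}.indicator (hU.mk U),
    mV.indicator (measurableSet_le mV.norm (by fun_prop)), ?_, fun x => ?_⟩
  · filter_upwards [hU.ae_eq_mk, ae_ne_zero] with x hx hx0
    rw [indicator_of_mem, hx]; show ‖hU.mk U x‖ ≤ ε * ‖x‖ ^ (-1 : ℝ)
    rw [← hx, rpow_neg_one, ← div_eq_mul_inv, le_div_iff₀ (norm_pos_iff.2 hx0), mul_comm]
    exact hb x
  · by_cases hx : x ∈ {x | ‖hU.mk U x‖ ≤ ε * ‖x‖ ^ (-1 : ℝ)}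
    · rw [indicator_of_mem hx]; exact hx
    · rw [indicator_of_notMem hx, norm_zero]; positivity

section congr
variable {U U' V V' w₀ w₀' : E3 → E3}

lemma ae_posTime_snd {P : E3 → Prop} (h : ∀ᵐ x, P x) : ∀ᵐ z ∂μ₊, P z.2 :=
  ae_restrict_of_ae (Measure.quasiMeasurePreserving_snd.ae h)

lemma WeaklyDivFree.congr (h : WeaklyDivFree w₀) (hw : w₀ =ᵐ[volume] w₀') : WeaklyDivFree w₀' := fun ψ h1 h2 => by
  rw [← h ψ h1 h2]
  exact integral_congr_ae (hw.mono fun x hx => by simp only [hx])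

lemma IsWeakGradient.congr (h : IsWeakGradient U DU) (hU : U =ᵐ[volume] U') :
    IsWeakGradient U' DU where
  locInt := h.locInt.congr hU
  locInt_grad := h.locInt_grad
  eq ψ h1 h2 e := by
    rw [← h.eq ψ h1 h2 e]; exact integral_congr_ae (hU.mono fun x hx => by simp only [hx])

lemma momentumDensity_congr (hU : U =ᵐ[volume] U') (hV : V =ᵐ[volume] V') (w : ℝ → E3 → E3) (φ : E4 → E3) :
    momentumDensity U V w φ =ᵐ[μ₊] momentumDensity U' V' w φ := by
  filter_upwards [ae_posTime_snd hU, ae_posTime_snd hV] with z h1 h2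
  simp only [momentumDensity, h1, h2]

lemma IsSolution.congr {w : ℝ → E3 → E3} (h : IsSolution U V w₀ w) (hU : U =ᵐ[volume] U') (hV : V =ᵐ[volume] V')
    (hw : w₀ =ᵐ[volume] w₀') : IsSolution U' V' w₀' w where
  aesm := h.aesm
  locSq := h.locSq
  divFree := h.divFree
  momentum φ h1 h2 := by
    rw [← integral_congr_ae (momentumDensity_congr hU hV w φ), h.momentum φ h1 h2]
    exact integral_congr_ae (hw.mono fun x hx => by simp only [hx])

lemma IsPressure.congr {w : ℝ → E3 → E3} {p : ℝ → E3 → ℝ} (h : IsPressure U V w p) (hU : U =ᵐ[volume] U')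
    (hV : V =ᵐ[volume] V') : IsPressure U' V' w p where
  locInt := h.locInt
  momentum φ h1 h2 := by
    rw [← h.momentum φ h1 h2]
    exact integral_congr_ae ((momentumDensity_congr hU hV w φ).symm.mono fun z hz => by simp only [hz])

lemma IsMild.congr (h : IsMild η ε A U V w₀ w) (hU : U =ᵐ[volume] U')
    (hV : V =ᵐ[volume] V') (hw : w₀ =ᵐ[volume] w₀') (d : IsData η ε U' V' w₀') : IsMild η ε A U' V' w₀' w :=
  { d with
    hA := h.hA
    mw := h.mw
    hw := h.hw
    eq := fun p => by
      rw [← h.eq p]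
      have h1 : ∀ i j, Fq U V w i j =ᵐ[μ₊] Fq U' V' w i j := fun i j => by
        filter_upwards [ae_posTime_snd hU, ae_posTime_snd hV] with z h1 h2
        simp only [Fq, h1, h2]
      have h2 : ∀ c, bil U' V' w c p = bil U V w c p := fun c =>
        sum_congr rfl fun i _ => sum_congr rfl fun j _ =>
          integral_congr_ae ((h1 i j).mono fun z hz => by simp only [hz])
      have h3 : ∀ c, cnv heatK (fun y => w₀' y c) p.1 p.2 = cnv heatK (fun y => w₀ y c) p.1 p.2 := fun c =>
        integral_congr_ae (hw.mono fun z hz => by simp only [hz])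
      simp only [mildMap, h2, h3] }

end congr

/-- `wtF` is the reciprocal of the weight in the gradient bound. -/
lemma mul_wtF_eq (hx : x ≠ 0) : (‖x‖ + √t) ^ (1 - η) * ‖x‖ ^ (1 + η) * wtF η t x = 1 := by
  unfold wtF; rw [mul_mul_mul_comm, ← rpow_add (by positivity), ← rpow_add (norm_pos_iff.2 hx)]
  norm_num

end PerturbedNS

theorem proposition4 (η : ℝ) (hη0 : 0 < η) (hη1 : η < 1) : ∃ ε₀ : ℝ, 0 < ε₀ ∧ ∃ C : ℝ, 0 < C ∧
      ∀ (ε : ℝ) (U V w₀ : PerturbedNS.E3 → PerturbedNS.E3), ε ≤ ε₀ →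
        AEStronglyMeasurable U → AEStronglyMeasurable V → AEStronglyMeasurable w₀ →
        (∀ x, ‖x‖ * (‖U x‖ + ‖V x‖ + ‖w₀ x‖) ≤ ε) →
        PerturbedNS.WeaklyDivFree w₀ →
        ∃ (w : ℝ → PerturbedNS.E3 → PerturbedNS.E3) (p : ℝ → PerturbedNS.E3 → ℝ),
          -- `w` is a solution with the pointwise bound, attaining its initial data weakly-star
          PerturbedNS.IsSolution U V w₀ w ∧
          PerturbedNS.PointwiseBound η (C * ε) w ∧
          (∀ t : ℝ, 0 < t → AEStronglyMeasurable (w t)) ∧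
          (∀ φ : PerturbedNS.E3 → PerturbedNS.E3, Continuous φ → HasCompactSupport φ →
            Tendsto (fun t : ℝ => ∫ x, ⟪w t x, φ x⟫) (𝓝[>] 0) (𝓝 (∫ x, ⟪w₀ x, φ x⟫))) ∧
          -- uniqueness
          (∀ w' : ℝ → PerturbedNS.E3 → PerturbedNS.E3, PerturbedNS.IsSolution U V w₀ w' →
            PerturbedNS.PointwiseBound η (C * ε₀) w' →
            ∀ᵐ z ∂(volume.restrict PerturbedNS.posTime), w' z.1 z.2 = w z.1 z.2) ∧
          -- the pressure
          PerturbedNS.IsPressure U V w p ∧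
          (∀ t : ℝ, 0 < t → AEStronglyMeasurable (p t)) ∧
          (∀ t : ℝ, 0 < t → ∀ s : ℝ, 3 / 2 ≤ s → s ≤ 3 / (1 + η) → PerturbedNS.weakLpNorm s (p t)
              ≤ ENNReal.ofReal (C * ε ^ 2 * t ^ (-1 + 3 / (2 * s)))) ∧
          -- the gradient bound
          (∀ DU DV Dw₀ : PerturbedNS.E3 → PerturbedNS.E3 →L[ℝ] PerturbedNS.E3,
            PerturbedNS.IsWeakGradient U DU → PerturbedNS.IsWeakGradient V DV →
            PerturbedNS.IsWeakGradient w₀ Dw₀ →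
            (∀ x, ‖x‖ ^ 2 * (‖DU x‖ + ‖DV x‖ + ‖Dw₀ x‖) ≤ ε) →
            ∀ t : ℝ, 0 < t → ∀ x : PerturbedNS.E3, x ≠ 0 → DifferentiableAt ℝ (w t) x ∧
              (‖x‖ + √t) ^ (1 - η) * ‖x‖ ^ (1 + η) * ‖fderiv ℝ (w t) x‖ ≤ C * ε) := by
  obtain ⟨K, hK, HK⟩ := PerturbedNS.exists_mild hη0 hη1
  obtain ⟨K', hK', HK'⟩ := PerturbedNS.exists_uniqueness hη0 hη1
  obtain ⟨C₁, hC₁, H₁⟩ := PerturbedNS.exists_pressure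
  obtain ⟨C₂, hC₂, H₂⟩ := PerturbedNS.exists_gradient_bound hη0 hη1 hK.le
  set C := K + C₁ * ((K + 2) * K) + C₂
  have hCK : K ≤ C := by
    have : 0 ≤ C₁ * ((K + 2) * K) := by positivity
    simp only [C]; linarith
  have hCp : C₁ * ((K + 2) * K) ≤ C := by simp only [C]; linarith
  have hCg : C₂ ≤ C := by
    have : 0 ≤ C₁ * ((K + 2) * K) := by positivity
    simp only [C]; linarith
  -- `ε₀` is chosen after `C`, so that uniqueness holds in the class with constant `C * ε₀`
  set S := 1 + K + K' * (K + C + 2)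
  have hKS : K ≤ S := by
    have : 0 ≤ K' * (K + C + 2) := by positivity
    simp only [S]; linarith
  have h1S : 1 ≤ S := by
    have : 0 ≤ K' * (K + C + 2) := by positivity
    simp only [S]; linarith
  refine ⟨S⁻¹, by positivity, C, (by positivity), fun ε U V w₀ hε₀ hU hV hw₀ hb hdiv => ?_⟩
  have hε : 0 ≤ ε := by simpa using hb 0
  have small : ∀ a, 0 ≤ a → a ≤ S → a * S⁻¹ ≤ 1 := fun a _ h => by
    rw [← div_eq_mul_inv, div_le_one (by positivity)]; exact h
  have hε1 := hε₀.trans (inv_le_one_of_one_le₀ h1S)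
  -- each of the three terms of a hypothesis on the data separately
  have part : ∀ {a b c d e : ℝ}, 0 ≤ e → 0 ≤ a → 0 ≤ b → 0 ≤ c → e * (a + b + c) ≤ d →
      e * a ≤ d ∧ e * b ≤ d ∧ e * c ≤ d := fun {a b c d e} he ha hb hc h => by
    have := mul_nonneg he ha; have := mul_nonneg he hb; have := mul_nonneg he hc
    refine ⟨?_, ?_, ?_⟩ <;> linarith
  have hb' := fun x => part (norm_nonneg x) (norm_nonneg _) (norm_nonneg _) (norm_nonneg _) (hb x)
  -- the construction is run with measurable representatives, to which all notions are insensitive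
  obtain ⟨U', mU, eU, bU⟩ := PerturbedNS.exists_measurable_rep hε hU fun x => (hb' x).1
  obtain ⟨V', mV, eV, bV⟩ := PerturbedNS.exists_measurable_rep hε hV fun x => (hb' x).2.1
  obtain ⟨w₀', mw₀, ew₀, bw₀⟩ := PerturbedNS.exists_measurable_rep hε hw₀ fun x => (hb' x).2.2
  have hKε := (mul_le_mul_of_nonneg_left hε₀ hK.le).trans (small K hK.le hKS)
  obtain ⟨w, h⟩ := HK ⟨hη0, hη1, hε, mU, mV, mw₀, bU, bV, bw₀⟩ hKε
  have hdiv' := hdiv.congr ew₀.symm; obtain ⟨p, mp, hp, bp⟩ := H₁ h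
  refine ⟨fun t x => w (t, x), fun t x => p (t, x), (h.isSolution hdiv').congr eU eV ew₀, ?_, ?_, ?_, ?_,
    hp.congr eU eV, ?_, ?_, ?_⟩
  · intro t ht x
    exact (h.pointwiseBound t ht x).trans (by gcongr)
  · exact fun t _ => (h.mw.comp (by fun_prop)).aestronglyMeasurable
  · intro φ hφ hc
    rw [← integral_congr_ae (ew₀.mono fun x hx => by simp only [hx] : (fun x => ⟪w₀' x, φ x⟫) =ᵐ[volume] fun x => ⟪w₀ x, φ x⟫)]
    exact h.tendsto_initial hφ hc
  · intro w' hs hbd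
    refine HK' ε (K * ε) (C * S⁻¹) U' V' w₀' w w' h hdiv' (by positivity) ?_ (hs.congr eU.symm eV.symm ew₀.symm) hbd
    calc K' * (K * ε + C * S⁻¹ + 2 * ε) ≤ K' * (K * S⁻¹ + C * S⁻¹ + 2 * S⁻¹) := by gcongr
      _ = K' * (K + C + 2) * S⁻¹ := by ring
      _ ≤ 1 := small _ (by positivity) (by simp only [S]; linarith)
  · exact fun t _ => (mp.comp (by fun_prop)).aestronglyMeasurable
  · intro t ht s hs1 hs2
    refine (bp t ht s hs1 hs2).trans (ENNReal.ofReal_le_ofReal ?_)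
    calc _ = C₁ * ((K + 2) * K) * ε ^ 2 * t ^ (-1 + 3 / (2 * s)) := by ring
      _ ≤ _ := by gcongr
  · intro DU DV Dw₀ gU gV gw₀ hD t ht x hx
    have hD' := fun x => part (sq_nonneg ‖x‖) (norm_nonneg _) (norm_nonneg _) (norm_nonneg _) (hD x)
    obtain ⟨U₁, mU₁, eU₁, bU₁, lU⟩ := PerturbedNS.exists_lipschitz_rep hε bU (gU.congr eU.symm) fun x => (hD' x).1
    obtain ⟨V₁, mV₁, eV₁, bV₁, lV⟩ := PerturbedNS.exists_lipschitz_rep hε bV (gV.congr eV.symm) fun x => (hD' x).2.1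
    obtain ⟨v₁, mv₁, ev₁, bv₁, lv⟩ := PerturbedNS.exists_lipschitz_rep hε bw₀ (gw₀.congr ew₀.symm) fun x => (hD' x).2.2
    obtain ⟨d1, d2⟩ := H₂ hε1 (h.congr eU₁.symm eV₁.symm ev₁.symm
      ⟨hη0, hη1, hε, mU₁, mV₁, mv₁, bU₁, bV₁, bv₁⟩) lU lV lv t ht x hx
    refine ⟨d1, ?_⟩
    calc _ ≤ (‖x‖ + √t) ^ (1 - η) * ‖x‖ ^ (1 + η) * (C₂ * ε * PerturbedNS.wtF η t x) :=
        by gcongr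
      _ = C₂ * ε * ((‖x‖ + √t) ^ (1 - η) * ‖x‖ ^ (1 + η) * PerturbedNS.wtF η t x) := by ring
      _ = C₂ * ε := by rw [PerturbedNS.mul_wtF_eq hx, mul_one]
      _ ≤ C * ε := by gcongr
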